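/- **Setting.** Consider one of the three systems continuous Hahn (cH), Wilson (W), Askey–Wilson (AW, with $0<q<1$), with parameters $\lambda=(\lambda_1,\dots,\lambda_4)\in\mathbb C^4$; put $a_k=\lambda_k$ for cH, W and $a_k=q^{\lambda_k}$ for AW, $b_1=a_1+a_2+a_3+a_4$, $b_4=a_1a_2a_3a_4$. Let $\gamma=1,1,\log q$ and $\eta(x)=x,\ x^2,\ \cos x$ for cH, W, AW respectively, and * $V(x;\lambda)=(a_1+ix)(a_2+ix)$ (cH), $\dfrac{\prod_k(a_k+ix)}{2ix(2ix+1)}$ (W), $\dfrac{\prod_k(1-a_ke^{ix})}{(1-e^{2ix})(1-qe^{2ix})}$ (AW); * $V^*(x;\lambda)=(a_3-ix)(a_4-ix)$ (cH), $V(-x;\lambda)$ (W, AW). If $\lambda_3=\overline{\lambda_1},\lambda_4=\overline{\lambda_2}$ (cH), resp. $\{\overline{\lambda_k}\}=\{\lambda_k\}$ (W, AW), this is $\overline{V(\bar x;\lambda)}$. * $\mathcal E_n=n(n+b_1-1)$ (cH, W), $(q^{-n}-1)(1-b_4q^{n-1})$ (AW), and $P_n(\eta;\lambda)$ is the continuous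 Hahn, Wilson, resp. Askey–Wilson polynomial of degree index $n$, $\check P_n(x)=P_n(\eta(x))$. *Virtual states.* The twist $\mathfrak t^{\rm I}$ is $\lambda\mapsto(1-\lambda_3,\lambda_2,1-\lambda_1,\lambda_4)$ for cH and $(1-\lambda_1,1-\lambda_2,\lambda_3,\lambda_4)$ for W, AW; $\mathfrak t^{\rm II}$ is $\lambda\mapsto(\lambda_1,1-\lambda_4,\lambda_3,1-\lambda_2)$ for cH and $(\lambda_1,\lambda_2,1-\lambda_3,1-\lambda_4)$ for W, AW. Put $\check\xi^{T}_v(x)=\check P_v(x;\mathfrak t^{T}(\lambda))$. The virtual energies of type I are $\tilde{\mathcal E}^{\rm I}_v=-(a_1+a_3-v-1)(a_2+a_4+v)$ (cH), $-(a_1+a_2-v-1)(a_3+a_4+v)$ (W), $-(1-a_1a_2q^{-v-1})(1-a_3a_4q^{v})$ (AW); those of type II, $\tilde{\mathcal E}^{\rm II}_v$, result from the exchange $1\leftrightarrow2$, $3\leftrightarrow4$ of indices (cH), resp. $1\leftrightarrow3$, $2\leftrightarrow4$ (W, AW). *Multi-indexed polynomials.* Let $\mathcal D=(\mathcal D^{\rm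 I},\mathcal D^{\rm II})$ be a pair of finite sets of non-negative integers, $M_{\rm I}=|\mathcal D^{\rm I}|$, $M_{\rm II}=|\mathcal D^{\rm II}|$, $M=M_{\rm I}+M_{\rm II}$. For $n\ge1$ and $1\le j\le n$ let $x^{(n)}_j=x+i(\frac{n+1}2-j)\gamma$. For a type $T$ let $R^T_{n;s,t}(x)=\prod_{k}(a_k-\frac{n-1}2+ix)_s\prod_{k'}(a_{k'}-\frac{n-1}2-ix)_t$ for cH and W, and $\prod_k(a_kq^{-\frac{n-1}2}e^{ix};q)_s\prod_{k'}(a_{k'}q^{-\frac{n-1}2}e^{-ix};q)_t$ for AW, where $k$ and $k'$ both run over $\{1,2\}$ for $T={\rm I}$ and over $\{3,4\}$ for $T={\rm II}$ (W, AW), whereas for cH $k=1,k'=3$ if $T={\rm I}$ and $k=2,k'=4$ if $T={\rm II}$. Let $r^T_{n,j}(x)=\epsilon_{n,j}(x)R^T_{n;\,j-1,\,n-j}(x)$ with $\epsilon_{n,j}(x)=(-1)^{j-1}$ (cH), $1$ (W), $e^{ix(n+1-2j)}q^{(j-1)(n-j)}$ (AW). Let $X_v,Y_v,Z_m$ be the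 columns of height $n$ with entries $r^{\rm II}_{n,j}(x)\check\xi^{\rm I}_v(x^{(n)}_j)$, $r^{\rm I}_{n,j}(x)\check\xi^{\rm II}_v(x^{(n)}_j)$, $r^{\rm I}_{n,j}(x)r^{\rm II}_{n,j}(x)\check P_m(x^{(n)}_j)$ and let $$\Delta_{n;s,t}(x)=\prod_{1\le j<k\le n}\bigl(\eta(x_j^{(n)})-\eta(x_k^{(n)})\bigr)\prod_{j=0}^{s-1}R^{\rm II}_{n;j,j}(x)\prod_{j=0}^{t-1}R^{\rm I}_{n;j,j}(x).$$ The denominator polynomial $\Xi_{\mathcal D}(\eta;\lambda)$ and the multi-indexed polynomial $P_{\mathcal D,m}(\eta;\lambda)$ are the polynomials in $\eta$ with, for all $x\in\mathbb C$, $$\det\bigl[(X_v)_{v\in\mathcal D^{\rm I}},(Y_v)_{v\in\mathcal D^{\rm II}}\bigr]=\Delta_{M;M_{\rm I},M_{\rm II}}(x)\,\Xi_{\mathcal D}(\eta(x)),\qquad \det\bigl[(X_v)_{v\in\mathcal D^{\rm I}},(Y_v)_{v\in\mathcal D^{\rm II}},Z_m\bigr]=\Delta_{M+1;M_{\rm I}+1,M_{\rm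 II}+1}(x)\,P_{\mathcal D,m}(\eta(x))$$ (columns in increasing order of $v$ within each type; $n=M$, resp. $n=M+1$). Write $\check\Xi_{\mathcal D}(x;\lambda)=\Xi_{\mathcal D}(\eta(x);\lambda)$, $\check P_{\mathcal D,m}(x)=P_{\mathcal D,m}(\eta(x))$. *Deformed Hamiltonian.* Let $\delta=(\frac12,\frac12,\frac12,\frac12)$, $\lambda_{\mathcal D}=\lambda+(M_{\rm II}-M_{\rm I})\sigma$ with $\sigma=(\frac12,-\frac12,\frac12,-\frac12)$ for cH and $(\frac12,\frac12,-\frac12,-\frac12)$ for W, AW, and $$\widetilde{\mathcal H}_{\mathcal D}f(x)=V(x;\lambda_{\mathcal D})\frac{\check\Xi_{\mathcal D}(x+\frac{i\gamma}2;\lambda)}{\check\Xi_{\mathcal D}(x-\frac{i\gamma}2;\lambda)}\Bigl(f(x-i\gamma)-\frac{\check\Xi_{\mathcal D}(x-i\gamma;\lambda+\delta)}{\check\Xi_{\mathcal D}(x;\lambda+\delta)}f(x)\Bigr)+V^*(x;\lambda_{\mathcal D})\frac{\check\Xi_{\mathcal D}(x-\frac{i\gamma}2;\lambda)}{\check\Xi_{\mathcal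 D}(x+\frac{i\gamma}2;\lambda)}\Bigl(f(x+i\gamma)-\frac{\check\Xi_{\mathcal D}(x+i\gamma;\lambda+\delta)}{\check\Xi_{\mathcal D}(x;\lambda+\delta)}f(x)\Bigr).$$ **Proposition.** The polynomials $\Xi_{\mathcal D}(\eta;\lambda)$ and $P_{\mathcal D,m}(\eta;\lambda)$ exist and are unique for all $\lambda,\mathcal D,m$. Let $\lambda,\mathcal D$ be such that $\Xi_{\mathcal D}(\cdot;\lambda)\ne0$ and $\Xi_{\mathcal D}(\cdot;\lambda+\delta)\neq0$, let $\mathcal N\ge0$, and let $x_0\in\mathbb C$ be such that $\eta_0=\eta(x_0)$ is a zero of $P_{\mathcal D,\mathcal N}$. Then $$\widetilde{\mathcal H}_{\mathcal D}\check{\mathcal P}(x)\big|_{x=x_0}=\mathcal E^{\mathcal P}\,\mathcal P(\eta_0)$$ in each of the following cases, where for (1)–(3) it is assumed that $\check\Xi_{\mathcal D}(x_0\pm\frac{i\gamma}2;\lambda)\ne0$: * (0) $\mathcal P=P_{\mathcal D,n}$ with $0\le n<\mathcal N$, and $\mathcal E^{\mathcal P}=\mathcal E_n$; * (1) $\mathcal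 P=P_{\mathcal D',\mathcal N}$, where $\mathcal D'$ arises from $\mathcal D$ by replacing some $d\in\mathcal D^{\rm I}$ by some $\epsilon<d$, $\epsilon\in\mathbb Z_{\ge0}\setminus\mathcal D^{\rm I}$ (as type I), and $\mathcal E^{\mathcal P}=\tilde{\mathcal E}^{\rm I}_{d}+\tilde{\mathcal E}^{\rm I}_{\epsilon}-\mathcal E_{\mathcal N}$; * (2) the same with type II in place of type I, and $\mathcal E^{\mathcal P}=\tilde{\mathcal E}^{\rm II}_{d}+\tilde{\mathcal E}^{\rm II}_{\epsilon}-\mathcal E_{\mathcal N}$; * (3) $\mathcal P=P_{\mathcal D',\mathcal N}$, where $\mathcal D'$ arises from $\mathcal D$ by removing some $d\in\mathcal D^{\rm I}$ and some $d'\in\mathcal D^{\rm II}$, and $\mathcal E^{\mathcal P}=\tilde{\mathcal E}^{\rm I}_{d}+\tilde{\mathcal E}^{\rm II}_{d'}-\mathcal E_{\mathcal N}$. Here the value at $x_0$ is the limit of $\widetilde{\mathcal H}_{\mathcal D}\check{\mathcal P}(x)$ as $x\to x_0$, $x\ne x_0$ (removable singularities of the coefficients are allowed); if no denominator in the coefficients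 of $\widetilde{\mathcal H}_{\mathcal D}$ vanishes at $x_0$, it is also the plain value. -/

import Mathlib

open Filter Topology Complex

noncomputable section

namespace MultiIndexed

/-- The three systems: continuous Hahn, Wilson, and Askey-Wilson with base `q`. -/
inductive System where
  | cH : System
  | W : System
  | AW (q : ℝ) : System

/-- `0 < q < 1` in the Askey-Wilson case, no condition otherwise. -/
def System.Valid : System → Prop
  | .AW q => 0 < q ∧ q < 1
  | _ => True

/-- The two types of virtual states. -/
inductive VType where
  | I : VType
  | II : VType

/-- The parameters are `lam = (λ₁, λ₂, λ₃, λ₄)`. For cH and W one has `a_k = λ_k`, for AW one has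
`a_k = q ^ λ_k`. -/
def aw (q : ℝ) (lam : Fin 4 → ℂ) (k : Fin 4) : ℂ := (q : ℂ) ^ lam k

/-- The shift constant `γ`. -/
def gam : System → ℝ
  | .AW q => Real.log q
  | _ => 1

/-- The sinusoidal coordinate. -/
def eta : System → ℂ → ℂ
  | .cH, x => x
  | .W, x => x ^ 2
  | .AW _, x => Complex.cos x

/-- Numerator of the potential function. -/
def potNum : System → (Fin 4 → ℂ) → ℂ → ℂ
  | .cH, lam, x => (lam 0 + I * x) * (lam 1 + I * x)
  | .W, lam, x => ∏ k : Fin 4, (lam k + I * x)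
  | .AW q, lam, x => ∏ k : Fin 4, (1 - aw q lam k * exp (I * x))

/-- Denominator of the potential function. -/
def potDen : System → ℂ → ℂ
  | .cH, _ => 1
  | .W, x => 2 * I * x * (2 * I * x + 1)
  | .AW q, x => (1 - exp (2 * I * x)) * (1 - q * exp (2 * I * x))

/-- The potential function `V(x; λ)`. -/
def pot (S : System) (lam : Fin 4 → ℂ) (x : ℂ) : ℂ := potNum S lam x / potDen S x

/-- The conjugate potential function `V^*(x; λ)`, as an analytic expression in the parameters.
For parameters obeying the reality conditions it is the conjugate of `V` at the conjugate point,
see `potStar_eq_conj_cH`, `potStar_eq_conj_W` and `potStar_eq_conj_AW`. -/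
def potStar : System → (Fin 4 → ℂ) → ℂ → ℂ
  | .cH, lam, x => (lam 2 - I * x) * (lam 3 - I * x)
  | .W, lam, x => pot .W lam (-x)
  | .AW q, lam, x => pot (.AW q) lam (-x)

theorem potStar_eq_conj_cH (lam : Fin 4 → ℂ) (h2 : lam 2 = (starRingEnd ℂ) (lam 0))
    (h3 : lam 3 = (starRingEnd ℂ) (lam 1)) (x : ℂ) :
    potStar .cH lam x = (starRingEnd ℂ) (pot .cH lam ((starRingEnd ℂ) x)) := by
  simp [potStar, pot, potNum, potDen, h2, h3, sub_eq_add_neg]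

theorem prod_conj_of_conj_multiset (lam : Fin 4 → ℂ)
    (h : (Finset.univ.val.map fun k => (starRingEnd ℂ) (lam k)) = Finset.univ.val.map lam)
    (g : ℂ → ℂ) : ∏ k : Fin 4, g ((starRingEnd ℂ) (lam k)) = ∏ k : Fin 4, g (lam k) := by
  have h' := congrArg (fun s => (Multiset.map g s).prod) h
  simpa [Finset.prod, Multiset.map_map, Function.comp_def] using h'

theorem potStar_eq_conj_W (lam : Fin 4 → ℂ)
    (h : (Finset.univ.val.map fun k => (starRingEnd ℂ) (lam k)) = Finset.univ.val.map lam)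
    (x : ℂ) : potStar .W lam x = (starRingEnd ℂ) (pot .W lam ((starRingEnd ℂ) x)) := by
  have h1 := prod_conj_of_conj_multiset lam h (fun z => z + I * (-x))
  simp only [potStar, pot, potNum, potDen, map_div₀, map_prod, map_mul, map_add, conj_I,
    Complex.conj_conj, map_one, map_ofNat]
  rw [← h1]
  congr 1
  · exact Finset.prod_congr rfl fun k _ => by ring
  · ring

theorem potStar_eq_conj_AW (q : ℝ) (hq : 0 < q) (lam : Fin 4 → ℂ)
    (h : (Finset.univ.val.map fun k => (starRingEnd ℂ) (lam k)) = Finset.univ.val.map lam)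
    (x : ℂ) :
    potStar (.AW q) lam x = (starRingEnd ℂ) (pot (.AW q) lam ((starRingEnd ℂ) x)) := by
  have h1 := prod_conj_of_conj_multiset lam h (fun z => 1 - (q : ℂ) ^ z * exp (I * (-x)))
  have hc : ∀ z : ℂ, (starRingEnd ℂ) ((q : ℂ) ^ z) = (q : ℂ) ^ ((starRingEnd ℂ) z) := by
    intro z
    rw [Complex.cpow_conj _ _ (by
      rw [Complex.arg_ofReal_of_nonneg hq.le]; exact Real.pi_ne_zero.symm)]
    simp
  simp only [potStar, pot, potNum, potDen, aw, map_div₀, map_prod, map_mul, map_sub, map_one, hc,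
    ← Complex.exp_conj, conj_I, Complex.conj_conj, map_ofNat, Complex.conj_ofReal]
  rw [← h1]
  simp

/-- The energy eigenvalues `E_n`. -/
def energy : System → (Fin 4 → ℂ) → ℕ → ℂ
  | .AW q, lam, n =>
      ((q : ℂ) ^ (-(n : ℤ)) - 1) * (1 - (∏ k : Fin 4, aw q lam k) * (q : ℂ) ^ ((n : ℤ) - 1))
  | _, lam, n => n * (n + ∑ k : Fin 4, lam k - 1)

/-- The shifted factorial `(a)_n`. -/
def poch (a : ℂ) (n : ℕ) : ℂ := ∏ i ∈ Finset.range n, (a + i)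

/-- The `q`-shifted factorial `(a; q)_n`. -/
def qpoch (q : ℝ) (a : ℂ) (n : ℕ) : ℂ := ∏ i ∈ Finset.range n, (1 - a * (q : ℂ) ^ i)

open Polynomial in
/-- The continuous Hahn, Wilson and Askey-Wilson polynomials `P_n(η; λ)`. The denominators
`(a₁ + a₃)_k` etc. of the terminating hypergeometric series are cancelled against the prefactors
`(a₁ + a₃)_n` etc. -/
def basePoly : System → (Fin 4 → ℂ) → ℕ → ℂ[X]
  | .cH, a, n =>
      C (I ^ n / (n.factorial : ℂ)) * ∑ k ∈ Finset.range (n + 1),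
        C (poch (-(n : ℂ)) k * poch (n + (∑ i : Fin 4, a i) - 1) k / (k.factorial : ℂ)
            * poch (a 0 + a 2 + k) (n - k) * poch (a 0 + a 3 + k) (n - k))
          * ∏ i ∈ Finset.range k, (C (a 0 + i) + C I * X)
  | .W, a, n =>
      ∑ k ∈ Finset.range (n + 1),
        C (poch (-(n : ℂ)) k * poch (n + (∑ i : Fin 4, a i) - 1) k / (k.factorial : ℂ)
            * poch (a 0 + a 1 + k) (n - k) * poch (a 0 + a 2 + k) (n - k)
            * poch (a 0 + a 3 + k) (n - k))
          * ∏ i ∈ Finset.range k, (C ((a 0 + i) ^ 2) + X)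
  | .AW q, lam, n =>
      let a := aw q lam
      C ((a 0)⁻¹ ^ n) * ∑ k ∈ Finset.range (n + 1),
        C (qpoch q ((q : ℂ) ^ (-(n : ℤ))) k
            * qpoch q ((∏ i : Fin 4, a i) * (q : ℂ) ^ ((n : ℤ) - 1)) k / qpoch q q k
            * (q : ℂ) ^ k * qpoch q (a 0 * a 1 * (q : ℂ) ^ k) (n - k)
            * qpoch q (a 0 * a 2 * (q : ℂ) ^ k) (n - k)
            * qpoch q (a 0 * a 3 * (q : ℂ) ^ k) (n - k))
          * ∏ i ∈ Finset.range k,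
              (1 - C (2 * a 0 * (q : ℂ) ^ i) * X + C ((a 0) ^ 2 * (q : ℂ) ^ (2 * i)))

/-- The twist of the parameters that produces the virtual states of the given type. -/
def twist : System → VType → (Fin 4 → ℂ) → (Fin 4 → ℂ)
  | .cH, .I, lam => ![1 - lam 2, lam 1, 1 - lam 0, lam 3]
  | .cH, .II, lam => ![lam 0, 1 - lam 3, lam 2, 1 - lam 1]
  | _, .I, lam => ![1 - lam 0, 1 - lam 1, lam 2, lam 3]
  | _, .II, lam => ![lam 0, lam 1, 1 - lam 2, 1 - lam 3]

/-- The virtual state polynomial `ξ_v` as a function of `x`. -/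
def xiV (S : System) (T : VType) (lam : Fin 4 → ℂ) (v : ℕ) (x : ℂ) : ℂ :=
  (basePoly S (twist S T lam) v).eval (eta S x)

/-- The virtual energies. -/
def virtualEnergy : System → VType → (Fin 4 → ℂ) → ℕ → ℂ
  | .cH, .I, a, v => -(a 0 + a 2 - v - 1) * (a 1 + a 3 + v)
  | .cH, .II, a, v => -(a 1 + a 3 - v - 1) * (a 0 + a 2 + v)
  | .W, .I, a, v => -(a 0 + a 1 - v - 1) * (a 2 + a 3 + v)
  | .W, .II, a, v => -(a 2 + a 3 - v - 1) * (a 0 + a 1 + v)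
  | .AW q, .I, lam, v =>
      -(1 - aw q lam 0 * aw q lam 1 * (q : ℂ) ^ (-(v : ℤ) - 1))
        * (1 - aw q lam 2 * aw q lam 3 * (q : ℂ) ^ v)
  | .AW q, .II, lam, v =>
      -(1 - aw q lam 2 * aw q lam 3 * (q : ℂ) ^ (-(v : ℤ) - 1))
        * (1 - aw q lam 0 * aw q lam 1 * (q : ℂ) ^ v)

/-- The parameter shift `δ`. -/
def delta : Fin 4 → ℂ := fun _ => 1 / 2

/-- The parameter shifts attached to the two types of virtual states. -/
def deltaTilde : System → VType → (Fin 4 → ℂ)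
  | .cH, .I => ![-1 / 2, 1 / 2, -1 / 2, 1 / 2]
  | .cH, .II => ![1 / 2, -1 / 2, 1 / 2, -1 / 2]
  | _, .I => ![-1 / 2, -1 / 2, 1 / 2, 1 / 2]
  | _, .II => ![1 / 2, 1 / 2, -1 / 2, -1 / 2]

/-- The shifted parameters `λ_D` for an index set with `m₁` elements of type I and `m₂` elements
of type II. -/
def lamD (S : System) (lam : Fin 4 → ℂ) (m₁ m₂ : ℕ) : Fin 4 → ℂ :=
  lam + (m₁ : ℂ) • deltaTilde S .I + (m₂ : ℂ) • deltaTilde S .II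

/-- The points `x_j^{(n)} = x + i ((n + 1) / 2 - j) γ` with `j = 1, …, n`, here numbered from 0. -/
def node (S : System) (n : ℕ) (x : ℂ) (j : Fin n) : ℂ :=
  x + I * (((n : ℂ) - 1) / 2 - (j : ℕ)) * gam S

/-- `(μ + i x)_m` for cH and W, and `(q ^ μ e^{i x}; q)_m` for AW. -/
def fac : System → ℂ → ℂ → ℕ → ℂ
  | .AW q, μ, x, m => qpoch q ((q : ℂ) ^ μ * exp (I * x)) m
  | _, μ, x, m => poch (μ + I * x) m

/-- Indices of the parameters of the given type that occur together with `+ i x`. -/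
def plusIdx : System → VType → Finset (Fin 4)
  | .cH, .I => {0}
  | .cH, .II => {1}
  | _, .I => {0, 1}
  | _, .II => {2, 3}

/-- Indices of the parameters of the given type that occur together with `- i x`. -/
def minusIdx : System → VType → Finset (Fin 4)
  | .cH, .I => {2}
  | .cH, .II => {3}
  | _, .I => {0, 1}
  | _, .II => {2, 3}

/-- The product of the factors `(a_k - (n - 1) / 2 + i x)_s` and `(a_k - (n - 1) / 2 - i x)_t`
(or their `q`-analogues) over the parameters of type `T`. -/
def facProd (S : System) (T : VType) (lam : Fin 4 → ℂ) (n s t : ℕ) (x : ℂ) : ℂ :=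
  (∏ k ∈ plusIdx S T, fac S (lam k - ((n : ℂ) - 1) / 2) x s)
    * ∏ k ∈ minusIdx S T, fac S (lam k - ((n : ℂ) - 1) / 2) (-x) t

/-- The parameter independent part of `rowFac`. -/
def phase : System → (n : ℕ) → ℂ → Fin n → ℂ
  | .cH, _, _, j => (-1) ^ (j : ℕ)
  | .W, _, _, _ => 1
  | .AW q, n, x, j =>
      exp (I * x * ((n : ℂ) - 1 - 2 * (j : ℕ))) * (q : ℂ) ^ ((j : ℕ) * (n - 1 - (j : ℕ)))

/-- The factors `r_j(x_j^{(n)})` of the rows of the determinants, as functions of `x`. -/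
def rowFac (S : System) (T : VType) (lam : Fin 4 → ℂ) (n : ℕ) (x : ℂ) (j : Fin n) : ℂ :=
  phase S n x j * facProd S T lam n (j : ℕ) (n - 1 - (j : ℕ)) x

/-- The Vandermonde-type determinant of the points `η(x_j^{(n)})` times the explicit extra factors
that are divided out of a determinant with `n` rows, `m₁` columns of which are multiples of the
type II row factors, and `m₂` columns of which are multiples of the type I row factors. -/
def detDen (S : System) (lam : Fin 4 → ℂ) (n m₁ m₂ : ℕ) (x : ℂ) : ℂ :=
  (∏ j : Fin n, ∏ k ∈ Finset.Ioi j, (eta S (node S n x j) - eta S (node S n x k)))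
    * (∏ j ∈ Finset.range m₁, facProd S .II lam n j j x)
    * ∏ j ∈ Finset.range m₂, facProd S .I lam n j j x

/-- The columns `X_v` (type I virtual states). -/
def colI (S : System) (lam : Fin 4 → ℂ) (n : ℕ) (x : ℂ) (v : ℕ) (j : Fin n) : ℂ :=
  rowFac S .II lam n x j * xiV S .I lam v (node S n x j)

/-- The columns `Y_v` (type II virtual states). -/
def colII (S : System) (lam : Fin 4 → ℂ) (n : ℕ) (x : ℂ) (v : ℕ) (j : Fin n) : ℂ :=
  rowFac S .I lam n x j * xiV S .II lam v (node S n x j)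

/-- The column `Z_m` (eigenstate). -/
def colZ (S : System) (lam : Fin 4 → ℂ) (n : ℕ) (x : ℂ) (m : ℕ) (j : Fin n) : ℂ :=
  rowFac S .II lam n x j * rowFac S .I lam n x j
    * (basePoly S lam m).eval (eta S (node S n x j))

/-- The matrix whose columns are the `X_v` for `v = d₁ 0, d₁ 1, …`, followed by the `Y_v` for
`v = d₂ 0, d₂ 1, …`. -/
def xiMat (S : System) (lam : Fin 4 → ℂ) {m₁ m₂ : ℕ} (d₁ : Fin m₁ → ℕ) (d₂ : Fin m₂ → ℕ) (x : ℂ) :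
    Matrix (Fin (m₁ + m₂)) (Fin (m₁ + m₂)) ℂ :=
  Matrix.of fun j k => Fin.addCases (motive := fun _ => ℂ)
    (fun a => colI S lam (m₁ + m₂) x (d₁ a) j) (fun b => colII S lam (m₁ + m₂) x (d₂ b) j) k

/-- The matrix whose columns are the `X_v` for `v = d₁ 0, d₁ 1, …`, the `Y_v` for
`v = d₂ 0, d₂ 1, …`, and finally `Z_m`. -/
def polyMat (S : System) (lam : Fin 4 → ℂ) {m₁ m₂ : ℕ} (d₁ : Fin m₁ → ℕ) (d₂ : Fin m₂ → ℕ) (m : ℕ)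
    (x : ℂ) : Matrix (Fin (m₁ + m₂ + 1)) (Fin (m₁ + m₂ + 1)) ℂ :=
  Matrix.of fun j k => Fin.lastCases (motive := fun _ => ℂ) (colZ S lam (m₁ + m₂ + 1) x m j)
    (fun k' => Fin.addCases (motive := fun _ => ℂ)
      (fun a => colI S lam (m₁ + m₂ + 1) x (d₁ a) j)
      (fun b => colII S lam (m₁ + m₂ + 1) x (d₂ b) j) k') k

/-- `p` is the polynomial part of the Casorati determinant of the virtual states labelled by the
set `D₁` of type I degrees and the set `D₂` of type II degrees, in the standard order. -/
def IsDenominatorPoly (S : System) (lam : Fin 4 → ℂ) (D₁ D₂ : Finset ℕ) (p : Polynomial ℂ) :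
    Prop :=
  ∀ x : ℂ, (xiMat S lam (D₁.orderEmbOfFin rfl) (D₂.orderEmbOfFin rfl) x).det
    = detDen S lam (D₁.card + D₂.card) D₁.card D₂.card x * p.eval (eta S x)

/-- `p` is the polynomial part of the Casorati determinant of these virtual states and the `m`-th
eigenstate. -/
def IsMultiIndexedPoly (S : System) (lam : Fin 4 → ℂ) (D₁ D₂ : Finset ℕ) (m : ℕ)
    (p : Polynomial ℂ) : Prop :=
  ∀ x : ℂ, (polyMat S lam (D₁.orderEmbOfFin rfl) (D₂.orderEmbOfFin rfl) m x).det
    = detDen S lam (D₁.card + D₂.card + 1) (D₁.card + 1) (D₂.card + 1) x * p.eval (eta S x)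

/-- The denominator polynomial `Ξ_D(η; λ)`. -/
def Xi (S : System) (lam : Fin 4 → ℂ) (D₁ D₂ : Finset ℕ) : Polynomial ℂ :=
  Classical.epsilon (IsDenominatorPoly S lam D₁ D₂)

/-- The multi-indexed polynomial `P_{D,m}(η; λ)`. -/
def MIPoly (S : System) (lam : Fin 4 → ℂ) (D₁ D₂ : Finset ℕ) (m : ℕ) : Polynomial ℂ :=
  Classical.epsilon (IsMultiIndexedPoly S lam D₁ D₂ m)

/-- `Ξ_D(η(x); λ)`. -/
def XiCheck (S : System) (lam : Fin 4 → ℂ) (D₁ D₂ : Finset ℕ) (x : ℂ) : ℂ :=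
  (Xi S lam D₁ D₂).eval (eta S x)

/-- `P_{D,m}(η(x); λ)`. -/
def MICheck (S : System) (lam : Fin 4 → ℂ) (D₁ D₂ : Finset ℕ) (m : ℕ) (x : ℂ) : ℂ :=
  (MIPoly S lam D₁ D₂ m).eval (eta S x)

/-- The similarity transformed deformed Hamiltonian, applied to `f` at `x`. Here
`(e^{± γ p} f)(x) = f(x ∓ i γ)`. -/
def hamD (S : System) (lam : Fin 4 → ℂ) (D₁ D₂ : Finset ℕ) (f : ℂ → ℂ) (x : ℂ) : ℂ :=
  let γ : ℂ := gam S
  let μ := lamD S lam D₁.card D₂.card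
  let ξ := XiCheck S lam D₁ D₂
  let ξ' := XiCheck S (lam + delta) D₁ D₂
  pot S μ x * (ξ (x + I * γ / 2) / ξ (x - I * γ / 2))
      * (f (x - I * γ) - ξ' (x - I * γ) / ξ' x * f x)
    + potStar S μ x * (ξ (x - I * γ / 2) / ξ (x + I * γ / 2))
      * (f (x + I * γ) - ξ' (x + I * γ) / ξ' x * f x)

/-- `Ξ_D(η(x₀ ∓ i γ / 2); λ)` are both nonzero. -/
def NoCommonZero (S : System) (lam : Fin 4 → ℂ) (D₁ D₂ : Finset ℕ) (x₀ : ℂ) : Prop :=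
  XiCheck S lam D₁ D₂ (x₀ - I * gam S / 2) ≠ 0 ∧ XiCheck S lam D₁ D₂ (x₀ + I * gam S / 2) ≠ 0

/-- No denominator in the coefficients of the difference operator `hamD` vanishes at `x₀`. -/
def Regular (S : System) (lam : Fin 4 → ℂ) (D₁ D₂ : Finset ℕ) (x₀ : ℂ) : Prop :=
  potDen S x₀ ≠ 0 ∧ potDen S (-x₀) ≠ 0 ∧ NoCommonZero S lam D₁ D₂ x₀ ∧
    XiCheck S (lam + delta) D₁ D₂ x₀ ≠ 0

/-- The value at `x₀` of the meromorphic function obtained by applying the deformed Hamiltonian to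
`f` is `v`: the function tends to `v` at `x₀` (removable singularities of the coefficients are
allowed), and at a regular point its plain value is `v`. -/
def HamValueAt (S : System) (lam : Fin 4 → ℂ) (D₁ D₂ : Finset ℕ) (f : ℂ → ℂ) (x₀ v : ℂ) : Prop :=
  Tendsto (hamD S lam D₁ D₂ f) (𝓝[≠] x₀) (𝓝 v) ∧
    (Regular S lam D₁ D₂ x₀ → hamD S lam D₁ D₂ f x₀ = v)

end MultiIndexed

end

namespace MultiIndexed

/-! ### Minors of a matrix with a distinguished square block -/

/-! On a lattice `x = b - i k γ` the difference equation becomes a three-term recurrence with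
coefficients `V`, `-(V + V^*)`, `V^*`. It is solved by the polynomials `P_n` and also by the virtual
state polynomials divided by a gauge function: the twist exchanges the two site functions of one
type up to a displacement, so it changes the operator only by a gauge transformation, a constant
factor and an additive constant (`xiV_diffEq`, `psi_eigenAt`). The determinants that define `Ξ_D`
and `P_{D,m}` are, up to explicit nonzero factors, Casorati determinants of such solutions over
windows of consecutive sites (`cas_psi`). The ratios of these factors for adjacent windows turn the
recurrence coefficients at `λ` into the potentials at `λ_D` (`gaugePsi_up` and its companions).

The equation is thereby a statement about Casorati determinants `W`. Summing the recurrence over all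
columns (`cas_eigen`) and using Plücker relations shows that the shift part of the deformed operator
of `F, d` maps `W(F, e, u)` to `(E_d + E_e - E_u + β) W(F, e, u)` plus a correction proportional to
`W(F, d, u)` (`cas_darboux_replace`). Here `β` is a function of `x` that involves neither `e` nor
`u`. For `e = d` this is an eigenvalue equation with eigenvalue `E_u + β`, which is case (0). For `u
= P_N` the correction is a multiple of `P_{D,N}`, so it vanishes at a zero of that polynomial as
long as the denominators `Ξ_D(x₀ ± iγ/2)` do not; these are cases (1) and (2). `cas_darboux_remove`
does the same for the removal of two columns.

It remains to see that `β` is the diagonal term of the Hamiltonian. Take `u = P_0 = 1`, which has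
energy zero. A Casorati determinant with a constant column is a determinant of differences, and by
the shift relations the differences of virtual states are virtual states for `λ + δ`. Hence `W(D,
1)` is a constant multiple of `Ξ_D(λ + δ)`, and the eigenvalue equation expresses `β` through it.
The constant may vanish at special `λ`, but the resulting identity does not contain it and extends
by continuity in `λ` (`deformedOp_shift`).

Existence of the polynomials is a divisibility question in a ring of functions of `x`. Both `α(x) -
β(y)` and `η(x) - η(y)` have a factor depending only on `x + y`, so rows `i` and `j` of a
determinant are congruent modulo an element indexed by `i + j`, and these elements are pairwise
coprime; this yields the Vandermonde factor. The products of row factors divide every term of the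
Leibniz expansion. An auxiliary indeterminate allows both divisors to be extracted together
(`exists_det_rowProdMatrix_eq`), and the symmetry `x ↦ -x` leaves a polynomial in `η`. -/

/-- The determinant of a square block `P` bordered by some of three columns and some of three
rows. -/
noncomputable def borderedDet {m t : ℕ} (P : Matrix (Fin m) (Fin m) ℂ) (U : Matrix (Fin m) (Fin 3) ℂ)
    (V : Matrix (Fin 3) (Fin m) ℂ) (S : Matrix (Fin 3) (Fin 3) ℂ) (g f : Fin t → Fin 3) : ℂ :=
  (Matrix.fromBlocks P (U.submatrix id f) (V.submatrix g id) (S.submatrix g f)).det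

/-- Schur complement: when `P` is invertible, every bordered minor is `det P` times a minor of one
fixed 3×3 matrix, so relations among bordered minors reduce to relations among minors of that
matrix. -/
theorem borderedDet_eq {m t : ℕ} (P : Matrix (Fin m) (Fin m) ℂ) (U : Matrix (Fin m) (Fin 3) ℂ)
    (V : Matrix (Fin 3) (Fin m) ℂ) (S : Matrix (Fin 3) (Fin 3) ℂ) (hP : P.det ≠ 0)
    (g f : Fin t → Fin 3) :
    borderedDet P U V S g f = P.det * ((S - V * P⁻¹ * U).submatrix g f).det := by
  have := Matrix.invertibleOfIsUnitDet P (isUnit_iff_ne_zero.mpr hP)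
  rw [borderedDet, Matrix.det_fromBlocks₁₁, Matrix.invOf_eq_nonsing_inv]
  congr 2

theorem continuous_borderedDet {m t : ℕ} (P : Matrix (Fin m) (Fin m) ℂ)
    (U : Matrix (Fin m) (Fin 3) ℂ) (V : Matrix (Fin 3) (Fin m) ℂ) (S : Matrix (Fin 3) (Fin 3) ℂ)
    (g f : Fin t → Fin 3) :
    Continuous fun z : ℂ => borderedDet (P + z • (1 : Matrix (Fin m) (Fin m) ℂ)) U V S g f := by
  unfold borderedDet
  refine Continuous.matrix_det (Continuous.matrix_fromBlocks ?_ ?_ ?_ ?_) <;> fun_prop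

/-- As a function of `z` the determinant is the characteristic polynomial of `-P`, which has
finitely many roots. This makes identities proved for invertible `P` accessible by perturbation for
every `P`. -/
theorem eventually_det_add_smul_one_ne_zero {m : ℕ} (P : Matrix (Fin m) (Fin m) ℂ) :
    ∀ᶠ z : ℂ in 𝓝[≠] 0, (P + z • (1 : Matrix (Fin m) (Fin m) ℂ)).det ≠ 0 := by
  have h : ∀ z : ℂ, (P + z • (1 : Matrix (Fin m) (Fin m) ℂ)).det = (-P).charpoly.eval z := by
    intro z
    rw [Matrix.eval_charpoly]
    congr 1
    rw [sub_neg_eq_add, add_comm]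
    congr 1
    ext i j
    simp [Matrix.scalar_apply, Matrix.one_apply, Matrix.diagonal_apply]
  simp only [h]
  have hne : (-P).charpoly ≠ 0 := (Matrix.charpoly_monic _).ne_zero
  have hfin : ((-P).charpoly.rootSet ℂ).Finite := Polynomial.rootSet_finite _ _
  have := (hfin.subset (Set.sdiff_subset (t := {0}))).isClosed.isOpen_compl
  have h2 : ∀ᶠ z : ℂ in 𝓝 0, z ∈ ((-P).charpoly.rootSet ℂ \ {0})ᶜ :=
    this.mem_nhds (by simp)
  filter_upwards [h2.filter_mono nhdsWithin_le_nhds, self_mem_nhdsWithin] with z hz hz0 h0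
  exact hz ⟨(Polynomial.mem_rootSet.mpr ⟨hne, by simpa using h0⟩), hz0⟩

theorem eq_zero_of_eventually {F : ℂ → ℂ} (hF : Continuous F) (h : ∀ᶠ z in 𝓝[≠] (0 : ℂ), F z = 0) :
    F 0 = 0 :=
  tendsto_nhds_unique ((hF.tendsto 0).mono_left nhdsWithin_le_nhds)
    (tendsto_const_nhds.congr' (h.mono fun _ hz => hz.symm))

/-- With `K` the Schur complement, this is the difference between the expansions of `det K` along
column 0 and along row 1, in which the common term with `K 1 0` cancels. Singular `P` follow by
continuity. -/
theorem borderedDet_pluecker {m : ℕ} (P : Matrix (Fin m) (Fin m) ℂ) (U : Matrix (Fin m) (Fin 3) ℂ)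
    (V : Matrix (Fin 3) (Fin m) ℂ) (S : Matrix (Fin 3) (Fin 3) ℂ) :
    borderedDet P U V S ![1] ![2] * borderedDet P U V S ![0, 2] ![0, 1]
      - borderedDet P U V S ![1] ![1] * borderedDet P U V S ![0, 2] ![0, 2]
      + borderedDet P U V S ![0] ![0] * borderedDet P U V S ![1, 2] ![1, 2]
      + borderedDet P U V S ![2] ![0] * borderedDet P U V S ![0, 1] ![1, 2] = 0 := by
  have key := @eq_zero_of_eventually (fun z =>
    let Q := P + z • (1 : Matrix (Fin m) (Fin m) ℂ)
    borderedDet Q U V S ![1] ![2] * borderedDet Q U V S ![0, 2] ![0, 1]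
      - borderedDet Q U V S ![1] ![1] * borderedDet Q U V S ![0, 2] ![0, 2]
      + borderedDet Q U V S ![0] ![0] * borderedDet Q U V S ![1, 2] ![1, 2]
      + borderedDet Q U V S ![2] ![0] * borderedDet Q U V S ![0, 1] ![1, 2]) ?_ ?_
  · simpa using key
  · have h := fun (t : ℕ) (g f : Fin t → Fin 3) => continuous_borderedDet P U V S g f
    exact ((((h _ _ _).mul (h _ _ _)).sub ((h _ _ _).mul (h _ _ _))).add
      ((h _ _ _).mul (h _ _ _))).add ((h _ _ _).mul (h _ _ _))
  · filter_upwards [eventually_det_add_smul_one_ne_zero P] with z hz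
    simp only [borderedDet_eq _ U V S hz]
    generalize S - V * (P + z • (1 : Matrix (Fin m) (Fin m) ℂ))⁻¹ * U = K
    simp only [Matrix.det_fin_one, Matrix.det_fin_two, Matrix.submatrix_apply, Matrix.cons_val_zero,
      Matrix.cons_val_one, Matrix.cons_val_fin_one]
    ring

/-- For the Schur complement `K` this is the expansion of `det K` along its last column; singular
`P` follow by continuity. -/
theorem borderedDet_laplace {m : ℕ} (P : Matrix (Fin m) (Fin m) ℂ) (U : Matrix (Fin m) (Fin 3) ℂ)
    (V : Matrix (Fin 3) (Fin m) ℂ) (S : Matrix (Fin 3) (Fin 3) ℂ) :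
    borderedDet P U V S ![0] ![2] * borderedDet P U V S ![1, 2] ![0, 1]
      - borderedDet P U V S ![1] ![2] * borderedDet P U V S ![0, 2] ![0, 1]
      + borderedDet P U V S ![2] ![2] * borderedDet P U V S ![0, 1] ![0, 1]
      - P.det * borderedDet P U V S ![0, 1, 2] ![0, 1, 2] = 0 := by
  have key := @eq_zero_of_eventually (fun z =>
    let Q := P + z • (1 : Matrix (Fin m) (Fin m) ℂ)
    borderedDet Q U V S ![0] ![2] * borderedDet Q U V S ![1, 2] ![0, 1]
      - borderedDet Q U V S ![1] ![2] * borderedDet Q U V S ![0, 2] ![0, 1]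
      + borderedDet Q U V S ![2] ![2] * borderedDet Q U V S ![0, 1] ![0, 1]
      - Q.det * borderedDet Q U V S ![0, 1, 2] ![0, 1, 2]) ?_ ?_
  · simpa using key
  · have h := fun (t : ℕ) (g f : Fin t → Fin 3) => continuous_borderedDet P U V S g f
    have h2 : Continuous fun z : ℂ => (P + z • (1 : Matrix (Fin m) (Fin m) ℂ)).det :=
      Continuous.matrix_det (by fun_prop)
    exact ((((h _ _ _).mul (h _ _ _)).sub ((h _ _ _).mul (h _ _ _))).add
      ((h _ _ _).mul (h _ _ _))).sub (h2.mul (h _ _ _))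
  · filter_upwards [eventually_det_add_smul_one_ne_zero P] with z hz
    simp only [borderedDet_eq _ U V S hz]
    generalize S - V * (P + z • (1 : Matrix (Fin m) (Fin m) ℂ))⁻¹ * U = K
    simp only [Matrix.det_fin_one, Matrix.det_fin_two, Matrix.det_fin_three,
      Matrix.submatrix_apply, Matrix.cons_val_zero, Matrix.cons_val_one, Matrix.cons_val_fin_one,
      Matrix.cons_val]
    ring

/-! ### Casorati determinants -/

section Casorati

variable {ι : Type*}

/-- The determinant of the values of the sequences `ψ (c k)` at the indices `r i`. -/
noncomputable def cas (ψ : ι → ℕ → ℂ) {n : ℕ} (c : Fin n → ι) (r : Fin n → ℕ) : ℂ :=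
  (Matrix.of fun i k => ψ (c k) (r i)).det

/-- Consecutive indices. -/
def win (p n : ℕ) : Fin n → ℕ := fun i => p + i

/-- Casorati determinants that share the columns `c` and the rows `r`, and otherwise draw on three
further columns and rows, are bordered minors of a single matrix. -/
theorem cas_append (ψ : ι → ℕ → ℂ) {m t : ℕ} (c : Fin m → ι) (r : Fin m → ℕ) (x : Fin 3 → ι)
    (a : Fin 3 → ℕ) (g f : Fin t → Fin 3) :
    cas ψ (Fin.append c (x ∘ f)) (Fin.append r (a ∘ g)) =
      borderedDet (Matrix.of fun i k => ψ (c k) (r i)) (Matrix.of fun i k => ψ (x k) (r i))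
        (Matrix.of fun i k => ψ (c k) (a i)) (Matrix.of fun i k => ψ (x k) (a i)) g f := by
  rw [cas, borderedDet, ← Matrix.det_submatrix_equiv_self finSumFinEquiv]
  congr 1
  ext i k
  rcases i with i | i <;> rcases k with k | k <;> simp

theorem append_one {α : Type*} {m : ℕ} (c : Fin m → α) (x : Fin 3 → α) (i : Fin 3) :
    (Fin.append c (x ∘ ![i]) : Fin (m + 1) → α) = Fin.snoc (α := fun _ => α) c (x i) := by
  ext k
  refine Fin.lastCases ?_ (fun k => ?_) k
  · simp only [Fin.snoc_last]
    exact Fin.append_right c (x ∘ ![i]) 0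
  · simp only [Fin.snoc_castSucc]
    exact Fin.append_left c (x ∘ ![i]) k

theorem append_two {α : Type*} {m : ℕ} (c : Fin m → α) (x : Fin 3 → α) (i j : Fin 3) :
    (Fin.append c (x ∘ ![i, j]) : Fin (m + 2) → α) =
      Fin.snoc (α := fun _ => α) (Fin.snoc (α := fun _ => α) c (x i)) (x j) := by
  ext k
  refine Fin.lastCases ?_ (fun k => Fin.lastCases ?_ (fun k => ?_) k) k
  · simp only [Fin.snoc_last]
    exact Fin.append_right c (x ∘ ![i, j]) 1
  · simp only [Fin.snoc_castSucc, Fin.snoc_last]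
    exact Fin.append_right c (x ∘ ![i, j]) 0
  · simp only [Fin.snoc_castSucc]
    exact Fin.append_left c (x ∘ ![i, j]) k

theorem append_three {α : Type*} {m : ℕ} (c : Fin m → α) (x : Fin 3 → α) (i j l : Fin 3) :
    (Fin.append c (x ∘ ![i, j, l]) : Fin (m + 3) → α) =
      Fin.snoc (α := fun _ => α)
        (Fin.snoc (α := fun _ => α) (Fin.snoc (α := fun _ => α) c (x i)) (x j)) (x l) := by
  ext k
  refine Fin.lastCases ?_ (fun k => Fin.lastCases ?_ (fun k => Fin.lastCases ?_ (fun k => ?_) k) k) k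
  · simp only [Fin.snoc_last]
    exact Fin.append_right c (x ∘ ![i, j, l]) 2
  · simp only [Fin.snoc_castSucc, Fin.snoc_last]
    exact Fin.append_right c (x ∘ ![i, j, l]) 1
  · simp only [Fin.snoc_castSucc, Fin.snoc_last]
    exact Fin.append_right c (x ∘ ![i, j, l]) 0
  · simp only [Fin.snoc_castSucc]
    exact Fin.append_left c (x ∘ ![i, j, l]) k

/-- Adding an element at the end. -/
abbrev sn {α : Type*} {n : ℕ} (c : Fin n → α) (x : α) : Fin (n + 1) → α :=
  Fin.snoc (α := fun _ => α) c x

/-- Adding an element at the beginning. -/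
abbrev cn {α : Type*} {n : ℕ} (x : α) (c : Fin n → α) : Fin (n + 1) → α :=
  Fin.cons (α := fun _ => α) x c

/-- The sites `b`, `c`, `f` need not be distinct. With `b = c` the last term has a repeated row and
a three-term relation remains; both forms are needed. -/
theorem cas_pluecker (ψ : ι → ℕ → ℂ) {m : ℕ} (F : Fin m → ι) (r : Fin m → ℕ) (d e u : ι)
    (b c f : ℕ) :
    cas ψ (sn F u) (sn r c) * cas ψ (sn (sn F d) e) (sn (sn r b) f)
      - cas ψ (sn F e) (sn r c) * cas ψ (sn (sn F d) u) (sn (sn r b) f)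
      + cas ψ (sn F d) (sn r b) * cas ψ (sn (sn F e) u) (sn (sn r c) f)
      + cas ψ (sn F d) (sn r f) * cas ψ (sn (sn F e) u) (sn (sn r b) c) = 0 := by
  have h := borderedDet_pluecker (Matrix.of fun i k => ψ (F k) (r i))
    (Matrix.of fun i k => ψ (![d, e, u] k) (r i)) (Matrix.of fun i k => ψ (F k) (![b, c, f] i))
    (Matrix.of fun i k => ψ (![d, e, u] k) (![b, c, f] i))
  simp only [← cas_append, append_one, append_two] at h
  simpa using h

theorem cas_laplace (ψ : ι → ℕ → ℂ) {m : ℕ} (F : Fin m → ι) (r : Fin m → ℕ) (x y u : ι)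
    (a b c : ℕ) :
    cas ψ (sn F u) (sn r a) * cas ψ (sn (sn F x) y) (sn (sn r b) c)
      - cas ψ (sn F u) (sn r b) * cas ψ (sn (sn F x) y) (sn (sn r a) c)
      + cas ψ (sn F u) (sn r c) * cas ψ (sn (sn F x) y) (sn (sn r a) b)
      - cas ψ F r * cas ψ (sn (sn (sn F x) y) u) (sn (sn (sn r a) b) c) = 0 := by
  have h := borderedDet_laplace (Matrix.of fun i k => ψ (F k) (r i))
    (Matrix.of fun i k => ψ (![x, y, u] k) (r i)) (Matrix.of fun i k => ψ (F k) (![a, b, c] i))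
    (Matrix.of fun i k => ψ (![x, y, u] k) (![a, b, c] i))
  simp only [← cas_append, append_one, append_two, append_three] at h
  simpa [cas] using h

theorem cas_comp_perm_row (ψ : ι → ℕ → ℂ) {n : ℕ} (c : Fin n → ι) (r : Fin n → ℕ)
    (σ : Equiv.Perm (Fin n)) : cas ψ c (r ∘ σ) = (Equiv.Perm.sign σ : ℤ) * cas ψ c r :=
  Matrix.det_permute σ (Matrix.of fun i k => ψ (c k) (r i))

theorem cas_snoc_row (ψ : ι → ℕ → ℂ) {m : ℕ} (c : Fin (m + 1) → ι) (r : Fin m → ℕ) (a : ℕ) :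
    cas ψ c (sn r a) = (-1) ^ m * cas ψ c (cn a r) := by
  have : sn r a = cn a r ∘ finRotate (m + 1) := Fin.snoc_eq_cons_rotate r a
  rw [this, cas_comp_perm_row, sign_finRotate]
  simp

theorem cas_cons_row (ψ : ι → ℕ → ℂ) {m : ℕ} (c : Fin (m + 1) → ι) (r : Fin m → ℕ) (a : ℕ) :
    cas ψ c (cn a r) = (-1) ^ m * cas ψ c (sn r a) := by
  rw [cas_snoc_row, ← mul_assoc, ← mul_pow]
  simp

theorem sn_sn_swap {α : Type*} {m : ℕ} (r : Fin m → α) (a b : α) :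
    sn (sn r a) b = sn (sn r b) a ∘ Equiv.swap (Fin.last (m + 1)) (Fin.last m).castSucc := by
  ext k
  refine Fin.lastCases ?_ (fun k => Fin.lastCases ?_ (fun k => ?_) k) k
  · simp
  · simp
  · rw [Function.comp_apply, Equiv.swap_apply_of_ne_of_ne] <;> simp [Fin.ext_iff]
    all_goals omega

theorem cas_swap_row (ψ : ι → ℕ → ℂ) {m : ℕ} (c : Fin (m + 2) → ι) (r : Fin m → ℕ) (a b : ℕ) :
    cas ψ c (sn (sn r a) b) = - cas ψ c (sn (sn r b) a) := by
  rw [sn_sn_swap, cas_comp_perm_row, Equiv.Perm.sign_swap (by simp [Fin.ext_iff])]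
  simp

theorem cn_sn {α : Type*} {m : ℕ} (r : Fin m → α) (a b : α) : cn a (sn r b) = sn (cn a r) b :=
  Fin.cons_snoc_eq_snoc_cons a r b

theorem cas_cons_snoc_row (ψ : ι → ℕ → ℂ) {m : ℕ} (c : Fin (m + 2) → ι) (r : Fin m → ℕ) (a b : ℕ) :
    cas ψ c (cn a (sn r b)) = (-1) ^ m * cas ψ c (sn (sn r a) b) := by
  rw [cas_cons_row, cas_swap_row, pow_succ]
  ring

theorem cas_cons_cons_row (ψ : ι → ℕ → ℂ) {m : ℕ} (c : Fin (m + 2) → ι) (r : Fin m → ℕ) (a b : ℕ) :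
    cas ψ c (cn a (cn b r)) = cas ψ c (sn (sn r a) b) := by
  rw [cas_cons_row, ← cn_sn, cas_cons_snoc_row, cas_swap_row, pow_succ]
  have : ((-1 : ℂ) ^ m) * (-1) ^ m = 1 := by rw [← mul_pow]; simp
  linear_combination (cas ψ c (sn (sn r a) b)) * this

theorem cn_eq_sn_comp {α : Type*} {m : ℕ} (r : Fin m → α) (a : α) :
    cn a r = sn r a ∘ (finRotate (m + 1)).symm := by
  have := Fin.snoc_eq_cons_rotate r a
  ext i
  simp [sn, this]

theorem cas_sn_comp_perm (ψ : ι → ℕ → ℂ) {n : ℕ} (c : Fin (n + 1) → ι) (w : Fin n → ℕ) (x : ℕ)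
    (σ : Equiv.Perm (Fin n)) :
    cas ψ c (sn (w ∘ σ) x) = (Equiv.Perm.sign σ : ℤ) * cas ψ c (sn w x) := by
  have e : ∀ v : Fin n → ℕ, Fin.append v (![x, 0, 0] ∘ ![0]) = sn v x :=
    fun v => append_one v ![x, 0, 0] 0
  have h : sn (w ∘ σ) x
      = sn w x ∘ (finSumFinEquiv (m := n) (n := 1)).permCongr (Equiv.Perm.sumCongr σ 1) := by
    rw [← e, ← e]
    ext k
    refine Fin.addCases (fun k => ?_) (fun k => ?_) k <;> simp [Equiv.permCongr_apply]
  rw [h, cas_comp_perm_row]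
  simp

theorem cas_cons_cons_snoc_row (ψ : ι → ℕ → ℂ) {m : ℕ} (c : Fin (m + 3) → ι) (r : Fin m → ℕ)
    (a b d : ℕ) : cas ψ c (cn a (cn b (sn r d))) = cas ψ c (sn (sn (sn r a) b) d) := by
  rw [cn_sn, cn_sn, cn_eq_sn_comp (cn b r) a, cas_sn_comp_perm, ← cn_sn, cn_eq_sn_comp (sn r a) b,
    cas_sn_comp_perm, ← mul_assoc]
  simp only [Equiv.Perm.sign_symm, sign_finRotate]
  simp [← mul_pow]

theorem cas_cons_snoc_snoc_row (ψ : ι → ℕ → ℂ) {m : ℕ} (c : Fin (m + 3) → ι) (r : Fin m → ℕ)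
    (a b d : ℕ) :
    cas ψ c (cn a (sn (sn r b) d)) = (-1) ^ m * cas ψ c (sn (sn (sn r a) b) d) := by
  have h2 : cas ψ c (sn (sn (sn r b) a) d) = - cas ψ c (sn (sn (sn r a) b) d) := by
    rw [sn_sn_swap r b a, cas_sn_comp_perm, Equiv.Perm.sign_swap (by simp [Fin.ext_iff])]
    simp
  rw [cn_sn, cn_eq_sn_comp (sn r b) a, cas_sn_comp_perm, h2]
  simp [sign_finRotate, pow_succ]

theorem win_succ (p n : ℕ) : win p (n + 1) = sn (win p n) (p + n) := by
  ext k
  refine Fin.lastCases ?_ (fun k => ?_) k <;> simp [win]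

theorem win_succ' (p n : ℕ) : win p (n + 1) = cn p (win (p + 1) n) := by
  ext k
  refine Fin.cases ?_ (fun k => ?_) k <;> simp [win]
  ring

/-- Sequences that solve a three-term recurrence with eigenvalue `E`, at the index `k + 1`. -/
def EigenAt (A B C : ℕ → ℂ) (E : ℂ) (f : ℕ → ℂ) (k : ℕ) : Prop :=
  A (k + 1) * f (k + 2) + B (k + 1) * f (k + 1) + C (k + 1) * f k = E * f (k + 1)

/-- Expanding along the replaced column, respectively row, both sums become the trace of `adjugate N
* X`. -/
theorem sum_det_updateCol_eq_sum_det_updateRow {n : ℕ} (N X : Matrix (Fin n) (Fin n) ℂ) :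
    ∑ k, (N.updateCol k (fun i => X i k)).det = ∑ i, (N.updateRow i (X i)).det := by
  have h1 : ∀ k, (N.updateCol k (fun i => X i k)).det = ∑ i, N.adjugate k i * X i k := by
    intro k
    rw [← Matrix.cramer_apply, Matrix.cramer_eq_adjugate_mulVec]
    rfl
  have h2 : ∀ i, (N.updateRow i (X i)).det = ∑ k, N.adjugate k i * X i k := by
    intro i
    rw [← Matrix.cramer_transpose_apply, Matrix.cramer_eq_adjugate_mulVec, ← Matrix.adjugate_transpose]
    rfl
  simp only [h1, h2]
  exact Finset.sum_comm

/-- Multiply each column by its eigenvalue and apply the trace identity. Column-wise the result is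
the sum of the eigenvalues times the determinant. Row-wise the recurrence replaces a row by its two
neighbours; inside the window this repeats a row, so only the last row moved up and the first row
moved down survive. -/
theorem cas_eigen (ψ : ι → ℕ → ℂ) (A B C : ℕ → ℂ) (E : ι → ℂ) {n : ℕ} (c : Fin (n + 1) → ι) (p : ℕ)
    (h : ∀ k, ∀ i ≤ n, EigenAt A B C (E (c k)) (ψ (c k)) (p + i)) :
    A (p + 1 + n) * cas ψ c (sn (win (p + 1) n) (p + n + 2))
      + (∑ i ∈ Finset.range (n + 1), B (p + 1 + i)) * cas ψ c (win (p + 1) (n + 1))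
      + C (p + 1) * cas ψ c (cn p (win (p + 2) n))
      = (∑ k, E (c k)) * cas ψ c (win (p + 1) (n + 1)) := by
  set N : Matrix (Fin (n + 1)) (Fin (n + 1)) ℂ := Matrix.of fun i k => ψ (c k) (win (p + 1) (n + 1) i)
    with hN
  have hW : cas ψ c (win (p + 1) (n + 1)) = N.det := rfl
  have key := sum_det_updateCol_eq_sum_det_updateRow N (Matrix.of fun i k => E (c k) * N i k)
  have hcol : ∀ k, (N.updateCol k (fun i => (Matrix.of fun i k => E (c k) * N i k) i k)).det
      = E (c k) * N.det := by
    intro k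
    have : (fun i => (Matrix.of fun i k => E (c k) * N i k) i k) = E (c k) • (fun i => N i k) := by
      ext i; simp
    rw [this, Matrix.det_updateCol_smul]
    congr 2
    ext i j
    by_cases hj : j = k
    · subst hj; simp
    · simp [hj]
  have hrow : ∀ i, (N.updateRow i ((Matrix.of fun i k => E (c k) * N i k) i)).det
      = A (p + 1 + i) * (N.updateRow i (fun k => ψ (c k) (p + i + 2))).det
        + B (p + 1 + i) * N.det + C (p + 1 + i) * (N.updateRow i (fun k => ψ (c k) (p + i))).det := by
    intro i
    have : (Matrix.of fun i k => E (c k) * N i k) i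
        = A (p + 1 + i) • (fun k => ψ (c k) (p + i + 2)) + B (p + 1 + i) • (N i)
          + C (p + 1 + i) • (fun k => ψ (c k) (p + i)) := by
      ext k
      have := h k i (by omega)
      simp only [EigenAt] at this
      simp only [hN, Matrix.of_apply, win, Pi.add_apply, Pi.smul_apply, smul_eq_mul]
      rw [show p + 1 + (i : ℕ) = p + i + 1 by ring, ← this]
    rw [this, Matrix.det_updateRow_add, Matrix.det_updateRow_add, Matrix.det_updateRow_smul,
      Matrix.det_updateRow_smul, Matrix.det_updateRow_smul, Matrix.updateRow_eq_self]
  simp only [hcol, hrow, Finset.sum_add_distrib] at key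
  rw [← Finset.sum_mul, ← Finset.sum_mul] at key
  rw [hW, key]
  have hup : ∑ i : Fin (n + 1), A (p + 1 + i) * (N.updateRow i (fun k => ψ (c k) (p + i + 2))).det
      = A (p + 1 + n) * cas ψ c (sn (win (p + 1) n) (p + n + 2)) := by
    rw [Fin.sum_univ_castSucc, Finset.sum_eq_zero, zero_add]
    · congr 1
      unfold cas
      congr 1
      ext i k
      refine Fin.lastCases ?_ (fun i => ?_) i
      · simp
      · simp [Matrix.updateRow_apply, hN, win]
    · intro i _
      rw [Matrix.det_zero_of_row_eq (i := i.castSucc) (j := i.succ), mul_zero]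
      · simp [Fin.ext_iff]
      · ext k
        rw [Matrix.updateRow_self, Matrix.updateRow_ne (by simp [Fin.ext_iff])]
        simp only [hN, Matrix.of_apply, win, Fin.val_castSucc, Fin.val_succ]
        congr 1
        ring
  have hdn : ∑ i : Fin (n + 1), C (p + 1 + i) * (N.updateRow i (fun k => ψ (c k) (p + i))).det
      = C (p + 1) * cas ψ c (cn p (win (p + 2) n)) := by
    rw [Fin.sum_univ_succ, Finset.sum_eq_zero, add_zero]
    · congr 1
      unfold cas
      congr 1
      ext i k
      refine Fin.cases ?_ (fun i => ?_) i
      · simp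
      · simp only [Matrix.updateRow_apply, hN, win, Fin.succ_ne_zero, if_false, Matrix.of_apply,
          Fin.val_succ, Fin.cons_succ]
        congr 1
        ring
    · intro i _
      rw [Matrix.det_zero_of_row_eq (i := i.castSucc) (j := i.succ), mul_zero]
      · simp [Fin.ext_iff]
      · ext k
        rw [Matrix.updateRow_self, Matrix.updateRow_ne (by simp [Fin.ext_iff])]
        simp only [hN, Matrix.of_apply, win, Fin.val_castSucc, Fin.val_succ]
        congr 1
        ring
  rw [hup, hdn, Finset.sum_range]

end Casorati

end MultiIndexed

/-! ### Darboux identities for Casorati determinants -/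

namespace MultiIndexed

section Casorati

variable {ι : Type*}

theorem cas_row_self (ψ : ι → ℕ → ℂ) {m : ℕ} (c : Fin (m + 2) → ι) (r : Fin m → ℕ) (a : ℕ) :
    cas ψ c (sn (sn r a) a) = 0 := by
  have := cas_swap_row ψ c r a a
  linear_combination this / 2

theorem sum_sn {n : ℕ} (E : ι → ℂ) (c : Fin n → ι) (x : ι) :
    ∑ k, E (sn c x k) = ∑ k, E (c k) + E x := by
  simp [Fin.sum_univ_castSucc]

/-- The common constant term of the Darboux transformed operator. -/
noncomputable def betaTerm (ψ : ι → ℕ → ℂ) (A B C : ℕ → ℂ) (E : ι → ℂ) {m : ℕ} (D : Fin (m + 1) → ι) :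
    ℂ :=
  ∑ k, E (D k) - ∑ i ∈ Finset.range (m + 2), B (1 + i)
    - A (m + 2) * (cas ψ D (sn (win 2 m) (m + 3)) / cas ψ D (win 2 (m + 1)))
    - C 1 * (cas ψ D (cn 0 (win 2 m)) / cas ψ D (win 1 (m + 1)))

/-- The summed recurrences for `(F, d, e)`, `(F, d, u)` and `(F, e, u)` produce determinants with an
end site moved out of the window; Plücker relations trade these for the determinants of `(F, e, u)`
on shifted windows. The constant `betaTerm` collects what depends on `(F, d)` alone. -/
theorem cas_darboux_replace (ψ : ι → ℕ → ℂ) (A B C : ℕ → ℂ) (E : ι → ℂ) {m : ℕ} (F : Fin m → ι)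
    (d e u : ι) (hF : ∀ k, ∀ i ≤ m + 1, EigenAt A B C (E (F k)) (ψ (F k)) i)
    (hd : ∀ i ≤ m + 1, EigenAt A B C (E d) (ψ d) i) (he : ∀ i ≤ m + 1, EigenAt A B C (E e) (ψ e) i)
    (hu : ∀ i ≤ m + 1, EigenAt A B C (E u) (ψ u) i)
    (h1 : cas ψ (sn F d) (win 1 (m + 1)) ≠ 0) (h2 : cas ψ (sn F d) (win 2 (m + 1)) ≠ 0) :
    A (m + 2) * (cas ψ (sn F d) (win 1 (m + 1)) / cas ψ (sn F d) (win 2 (m + 1)))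
        * cas ψ (sn (sn F e) u) (win 2 (m + 2))
      + C 1 * (cas ψ (sn F d) (win 2 (m + 1)) / cas ψ (sn F d) (win 1 (m + 1)))
        * cas ψ (sn (sn F e) u) (win 0 (m + 2))
      = (E d + E e - E u + betaTerm ψ A B C E (sn F d)) * cas ψ (sn (sn F e) u) (win 1 (m + 2))
        + (E u - E e) * (cas ψ (sn F e) (win 1 (m + 1)) / cas ψ (sn F d) (win 1 (m + 1))
            + cas ψ (sn F e) (win 2 (m + 1)) / cas ψ (sn F d) (win 2 (m + 1)))
          * cas ψ (sn (sn F d) u) (win 1 (m + 2)) := by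
  -- All windows contain the sites `2, …, m + 1`. The recurrence summed over `1, …, m + 2` is
  -- rewritten with rows given by this interior and two additional sites; the common sign `(-1)^m`
  -- cancels.
  have hE : ∀ x y : ι, (∀ i ≤ m + 1, EigenAt A B C (E x) (ψ x) i) →
      (∀ i ≤ m + 1, EigenAt A B C (E y) (ψ y) i) →
      A (m + 2) * cas ψ (sn (sn F x) y) (sn (sn (win 2 m) 1) (m + 3))
        + (∑ i ∈ Finset.range (m + 2), B (1 + i))
          * cas ψ (sn (sn F x) y) (sn (sn (win 2 m) 1) (m + 2))
        + C 1 * cas ψ (sn (sn F x) y) (sn (sn (win 2 m) 0) (m + 2))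
        = (∑ k, E (F k) + E x + E y) * cas ψ (sn (sn F x) y) (sn (sn (win 2 m) 1) (m + 2)) := by
    intro x y hx hy
    have h := cas_eigen ψ A B C E (n := m + 1) (sn (sn F x) y) 0 (by
      intro k
      refine Fin.lastCases ?_ (fun k => Fin.lastCases ?_ (fun k => ?_) k) k
      · simpa using hy
      · simpa using hx
      · simpa using hF k)
    simp only [zero_add, sum_sn] at h
    rw [win_succ' 1 m, win_succ' 1 (m + 1), show 1 + 1 = 2 from rfl, win_succ 2 m, ← cn_sn, cas_cons_snoc_row,
      cas_cons_snoc_row, cas_cons_snoc_row, add_comm 2 m, show 1 + (m + 1) = m + 2 by ring,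
      show m + 1 + 2 = m + 3 by ring] at h
    have hs : ((-1 : ℂ) ^ m) ≠ 0 := by simp
    refine mul_left_cancel₀ hs ?_
    linear_combination h
  have Hde := hE d e hd he
  have Hdu := hE d u hd hu
  have Heu := hE e u he hu
  -- `P1` and `P3` produce the shifted windows of `(F, e, u)`. In the others the site is repeated on
  -- purpose, which leaves three-term relations.
  have P1 := cas_pluecker ψ F (win 2 m) d e u 1 (m + 2) (m + 3)
  have P2 := cas_pluecker ψ F (win 2 m) d e u 1 1 (m + 3)
  have P3 := cas_pluecker ψ F (win 2 m) d e u 0 1 (m + 2)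
  have P4 := cas_pluecker ψ F (win 2 m) d e u (m + 2) (m + 2) 0
  have P5 := cas_pluecker ψ F (win 2 m) d e u 1 1 (m + 2)
  have P6 := cas_pluecker ψ F (win 2 m) d e u (m + 2) (m + 2) 1
  simp only [cas_row_self, mul_zero, add_zero] at P2 P4 P5 P6
  rw [cas_swap_row ψ _ _ (m + 2), cas_swap_row ψ _ _ (m + 2), cas_swap_row ψ _ _ (m + 2)] at P4 P6
  have w1 : ∀ c : Fin (m + 1) → ι, cas ψ c (win 1 (m + 1)) = (-1) ^ m * cas ψ c (sn (win 2 m) 1) := by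
    intro c
    rw [win_succ' 1 m, cas_cons_row]
  have w1' : ∀ c : Fin (m + 1) → ι, cas ψ c (cn 0 (win 2 m)) = (-1) ^ m * cas ψ c (sn (win 2 m) 0) :=
    fun c => cas_cons_row _ _ _ _
  have w2 : ∀ c : Fin (m + 1) → ι, cas ψ c (win 2 (m + 1)) = cas ψ c (sn (win 2 m) (m + 2)) := by
    intro c
    rw [win_succ 2 m, add_comm 2 m]
  have w3 : ∀ c : Fin (m + 2) → ι, cas ψ c (win 1 (m + 2))
      = (-1) ^ m * cas ψ c (sn (sn (win 2 m) 1) (m + 2)) := by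
    intro c
    rw [win_succ' 1 (m + 1), win_succ 2 m, cas_cons_snoc_row, add_comm 2 m]
  have w4 : ∀ c : Fin (m + 2) → ι, cas ψ c (win 0 (m + 2)) = cas ψ c (sn (sn (win 2 m) 0) 1) := by
    intro c
    rw [win_succ' 0 (m + 1), win_succ' (0 + 1) m, cas_cons_cons_row]
  have w5 : ∀ c : Fin (m + 2) → ι, cas ψ c (win 2 (m + 2))
      = cas ψ c (sn (sn (win 2 m) (m + 2)) (m + 3)) := by
    intro c
    rw [win_succ 2 (m + 1), win_succ 2 m, add_comm 2 m, show 2 + (m + 1) = m + 3 by ring]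
  have hs : ((-1 : ℂ) ^ m) = 1 ∨ ((-1 : ℂ) ^ m) = -1 := neg_one_pow_eq_or ℂ m
  simp only [betaTerm, w1, w1', w2, w3, w4, w5, sum_sn] at h1 h2 ⊢
  generalize hB : ∑ i ∈ Finset.range (m + 2), B (1 + i) = SB at *
  generalize ∑ k, E (F k) = EF at *
  generalize ((-1 : ℂ) ^ m) = s at *
  have h1' : cas ψ (sn F d) (sn (win 2 m) 1) ≠ 0 := right_ne_zero_of_mul h1
  clear h1
  generalize cas ψ (sn F d) (sn (win 2 m) 1) = db at *
  generalize cas ψ (sn F d) (sn (win 2 m) (m + 2)) = dc at *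
  generalize cas ψ (sn F d) (sn (win 2 m) (m + 3)) = df at *
  generalize cas ψ (sn F d) (sn (win 2 m) 0) = da at *
  generalize cas ψ (sn F e) (sn (win 2 m) 1) = eb at *
  generalize cas ψ (sn F e) (sn (win 2 m) (m + 2)) = ec at *
  generalize cas ψ (sn F u) (sn (win 2 m) 1) = ub at *
  generalize cas ψ (sn F u) (sn (win 2 m) (m + 2)) = uc at *
  generalize cas ψ (sn (sn F d) e) (sn (sn (win 2 m) 1) (m + 2)) = Xbc at *
  generalize cas ψ (sn (sn F d) e) (sn (sn (win 2 m) 1) (m + 3)) = Xbf at *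
  generalize cas ψ (sn (sn F d) e) (sn (sn (win 2 m) 0) (m + 2)) = Xac at *
  generalize cas ψ (sn (sn F d) u) (sn (sn (win 2 m) 1) (m + 2)) = Wbc at *
  generalize cas ψ (sn (sn F d) u) (sn (sn (win 2 m) 1) (m + 3)) = Wbf at *
  generalize cas ψ (sn (sn F d) u) (sn (sn (win 2 m) 0) (m + 2)) = Wac at *
  generalize cas ψ (sn (sn F e) u) (sn (sn (win 2 m) 1) (m + 2)) = Zbc at *
  generalize cas ψ (sn (sn F e) u) (sn (sn (win 2 m) 1) (m + 3)) = Zbf at *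
  generalize cas ψ (sn (sn F e) u) (sn (sn (win 2 m) 0) (m + 2)) = Zac at *
  generalize cas ψ (sn (sn F e) u) (sn (sn (win 2 m) 0) 1) = Zab at *
  generalize cas ψ (sn (sn F e) u) (sn (sn (win 2 m) (m + 2)) (m + 3)) = Zcf at *
  -- Each determinant is now an independent unknown. After clearing denominators the identity is a
  -- linear combination of the three summed recurrences and the six Plücker relations.
  have key : A (m + 2) * (db / dc) * Zcf + C 1 * (dc / db) * Zab
      = (E d + E e - E u + (EF + E d - SB - A (m + 2) * (df / dc) - C 1 * (da / db))) * Zbc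
        + (E u - E e) * (eb / db + ec / dc) * Wbc := by
    field_simp
    linear_combination (-(uc * db + ub * dc)) * Hde + (ec * db + eb * dc) * Hdu - db * dc * Heu
      + A (m + 2) * db * P1 + A (m + 2) * dc * P2 + C 1 * dc * P3 - C 1 * db * P4
      - (EF + E d + E e - SB) * dc * P5 + (EF + E d + E e - SB) * db * P6
  rcases hs with rfl | rfl
  · simpa using key
  · simp only [neg_mul, one_mul, neg_div, div_neg]
    linear_combination -key

/-- Compared with the replacement identity the roles of `A` and `C` are exchanged, since the
function `(F, u)` now has one column fewer than `(F, d, d')` instead of one more. The summed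
recurrences for `(F, d, d')` on two adjacent windows and for `(F, u)` on the middle one are combined
with two Laplace relations, which create the correction with all of `F, d, d', u`. -/
theorem cas_darboux_remove (ψ : ι → ℕ → ℂ) (A B C : ℕ → ℂ) (E : ι → ℂ) {m : ℕ} (F : Fin m → ι)
    (d d' u : ι) (hF : ∀ k, ∀ i ≤ m + 2, EigenAt A B C (E (F k)) (ψ (F k)) i)
    (hd : ∀ i ≤ m + 2, EigenAt A B C (E d) (ψ d) i)
    (hd' : ∀ i ≤ m + 2, EigenAt A B C (E d') (ψ d') i)
    (hu : ∀ i ≤ m + 2, EigenAt A B C (E u) (ψ u) i)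
    (h1 : cas ψ (sn (sn F d) d') (win 1 (m + 2)) ≠ 0)
    (h2 : cas ψ (sn (sn F d) d') (win 2 (m + 2)) ≠ 0) :
    C 2 * (cas ψ (sn (sn F d) d') (win 1 (m + 2)) / cas ψ (sn (sn F d) d') (win 2 (m + 2)))
        * cas ψ (sn F u) (win 3 (m + 1))
      + A (m + 2) * (cas ψ (sn (sn F d) d') (win 2 (m + 2)) / cas ψ (sn (sn F d) d') (win 1 (m + 2)))
        * cas ψ (sn F u) (win 1 (m + 1))
      = (E d + E d' - E u + betaTerm ψ A B C E (sn (sn F d) d')) * cas ψ (sn F u) (win 2 (m + 1))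
        + (A (m + 2) * (cas ψ F (win 2 m) / cas ψ (sn (sn F d) d') (win 1 (m + 2)))
            + C 2 * (cas ψ F (win 3 m) / cas ψ (sn (sn F d) d') (win 2 (m + 2))))
          * cas ψ (sn (sn (sn F d) d') u) (win 1 (m + 3)) := by
  have hD : ∀ k, ∀ i ≤ m + 2, EigenAt A B C (E (sn (sn F d) d' k)) (ψ (sn (sn F d) d' k)) i := by
    intro k
    refine Fin.lastCases ?_ (fun k => Fin.lastCases ?_ (fun k => ?_) k) k
    · simpa using hd'
    · simpa using hd
    · simpa using hF k
  have hFu : ∀ k, ∀ i ≤ m + 2, EigenAt A B C (E (sn F u k)) (ψ (sn F u k)) i := by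
    intro k
    refine Fin.lastCases ?_ (fun k => ?_) k
    · simpa using hu
    · simpa using hF k
  have H1 := cas_eigen ψ A B C E (n := m + 1) (sn (sn F d) d') 0
    (fun k i hi => hD k (0 + i) (by omega))
  have H2 := cas_eigen ψ A B C E (n := m + 1) (sn (sn F d) d') 1
    (fun k i hi => hD k (1 + i) (by omega))
  have H3 := cas_eigen ψ A B C E (n := m) (sn F u) 1 (fun k i hi => hFu k (1 + i) (by omega))
  have PA := cas_laplace ψ F (win 2 m) d d' u 1 (m + 2) (m + 3)
  have PC := cas_laplace ψ F (win 3 m) d d' u 1 2 (m + 3)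
  simp only [sum_sn, zero_add, show 1 + 1 = 2 from rfl, show 1 + 2 = 3 from rfl,
    show 1 + (m + 1) = m + 2 by ring, show 2 + (m + 1) = m + 3 by ring,
    show 2 + m = m + 2 by ring, show m + 1 + 2 = m + 3 by ring, show m + 1 + 1 = m + 2 by ring,
    show m + 2 + 2 = m + 4 by ring, show 1 + m + 2 = m + 3 by ring] at H1 H2 H3
  have B1 : ∑ i ∈ Finset.range (m + 2), B (1 + i)
      = B 1 + ∑ i ∈ Finset.range (m + 1), B (2 + i) := by
    rw [Finset.sum_range_succ', add_comm]
    congr 1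
    exact Finset.sum_congr rfl fun i _ => by congr 1; ring
  have B3 : ∑ i ∈ Finset.range (m + 2), B (2 + i)
      = ∑ i ∈ Finset.range (m + 1), B (2 + i) + B (m + 3) := by
    rw [Finset.sum_range_succ, show 2 + (m + 1) = m + 3 by ring]
  have B2 : ∑ i ∈ Finset.range (m + 3), B (1 + i)
      = B 1 + ∑ i ∈ Finset.range (m + 1), B (2 + i) + B (m + 3) := by
    rw [Finset.sum_range_succ, B1, show 1 + (m + 2) = m + 3 by ring]
  rw [B1] at H1
  rw [B3] at H2
  simp only [betaTerm, sum_sn, show m + 1 + 2 = m + 3 by ring, show m + 1 + 3 = m + 4 by ring, B2]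
  have hs : ((-1 : ℂ) ^ m) * ((-1 : ℂ) ^ m) = 1 := by rw [← mul_pow]; simp
  -- the windows in terms of their interior
  have a1 : cas ψ (sn (sn F d) d') (win 2 (m + 2))
      = cas ψ (sn (sn F d) d') (sn (sn (win 2 m) (m + 2)) (m + 3)) := by
    rw [win_succ 2 (m + 1), win_succ 2 m, show 2 + (m + 1) = m + 3 by ring, add_comm 2 m]
  have a2 : cas ψ (sn F u) (win 1 (m + 1)) = (-1) ^ m * cas ψ (sn F u) (sn (win 2 m) 1) := by
    rw [win_succ' 1 m, cas_cons_row]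
  have a3 : cas ψ (sn (sn F d) d') (win 1 (m + 2))
      = (-1) ^ m * cas ψ (sn (sn F d) d') (sn (sn (win 2 m) 1) (m + 2)) := by
    rw [win_succ' 1 (m + 1), win_succ 2 m, cas_cons_snoc_row, add_comm 2 m]
  have a4 : cas ψ (sn (sn F d) d') (sn (win 1 (m + 1)) (m + 3))
      = (-1) ^ m * cas ψ (sn (sn F d) d') (sn (sn (win 2 m) 1) (m + 3)) := by
    rw [win_succ' 1 m, ← cn_sn, cas_cons_snoc_row]
  have a5 : cas ψ (sn F u) (win 2 (m + 1)) = cas ψ (sn F u) (sn (win 2 m) (m + 2)) := by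
    rw [win_succ 2 m, add_comm 2 m]
  have a6 : cas ψ (sn (sn (sn F d) d') u) (win 1 (m + 3))
      = (-1) ^ m * cas ψ (sn (sn (sn F d) d') u) (sn (sn (sn (win 2 m) 1) (m + 2)) (m + 3)) := by
    rw [win_succ' 1 (m + 2), win_succ 2 (m + 1), win_succ 2 m, cas_cons_snoc_snoc_row,
      show 2 + (m + 1) = m + 3 by ring, add_comm 2 m]
  -- Laplace relation over the interior `2, …, m + 1` with the additional sites `1`, `m + 2`, `m +
  -- 3`.
  have KA : cas ψ (sn (sn F d) d') (win 2 (m + 2)) * cas ψ (sn F u) (win 1 (m + 1))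
      + cas ψ (sn (sn F d) d') (win 1 (m + 2)) * cas ψ (sn F u) (sn (win 2 m) (m + 3))
      - cas ψ (sn (sn F d) d') (sn (win 1 (m + 1)) (m + 3)) * cas ψ (sn F u) (win 2 (m + 1))
      = cas ψ F (win 2 m) * cas ψ (sn (sn (sn F d) d') u) (win 1 (m + 3)) := by
    rw [a1, a2, a3, a4, a5, a6]
    linear_combination (-1) ^ m * PA
  have c1 : cas ψ (sn (sn F d) d') (win 1 (m + 2))
      = cas ψ (sn (sn F d) d') (sn (sn (win 3 m) 1) 2) := by
    rw [win_succ' 1 (m + 1), win_succ' 2 m, cas_cons_cons_row]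
  have c2 : cas ψ (sn F u) (win 3 (m + 1)) = cas ψ (sn F u) (sn (win 3 m) (m + 3)) := by
    rw [win_succ 3 m, add_comm 3 m]
  have c3 : cas ψ (sn (sn F d) d') (win 2 (m + 2))
      = (-1) ^ m * cas ψ (sn (sn F d) d') (sn (sn (win 3 m) 2) (m + 3)) := by
    rw [win_succ' 2 (m + 1), win_succ 3 m, cas_cons_snoc_row, add_comm 3 m]
  have c4 : cas ψ (sn (sn F d) d') (cn 1 (win 3 (m + 1)))
      = (-1) ^ m * cas ψ (sn (sn F d) d') (sn (sn (win 3 m) 1) (m + 3)) := by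
    rw [win_succ 3 m, cas_cons_snoc_row, add_comm 3 m]
  have c5 : cas ψ (sn F u) (win 2 (m + 1)) = (-1) ^ m * cas ψ (sn F u) (sn (win 3 m) 2) := by
    rw [win_succ' 2 m, cas_cons_row]
  have c6 : cas ψ (sn (sn (sn F d) d') u) (win 1 (m + 3))
      = cas ψ (sn (sn (sn F d) d') u) (sn (sn (sn (win 3 m) 1) 2) (m + 3)) := by
    rw [win_succ' 1 (m + 2), win_succ' 2 (m + 1), win_succ 3 m, cas_cons_cons_snoc_row,
      add_comm 3 m]
  have c7 : cas ψ (sn F u) (cn 1 (win 3 m)) = (-1) ^ m * cas ψ (sn F u) (sn (win 3 m) 1) :=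
    cas_cons_row _ _ _ _
  -- The mirror image: interior `3, …, m + 2` with the additional sites `1`, `2`, `m + 3`.
  have KC : cas ψ (sn (sn F d) d') (win 1 (m + 2)) * cas ψ (sn F u) (win 3 (m + 1))
      + cas ψ (sn (sn F d) d') (win 2 (m + 2)) * cas ψ (sn F u) (cn 1 (win 3 m))
      - cas ψ (sn (sn F d) d') (cn 1 (win 3 (m + 1))) * cas ψ (sn F u) (win 2 (m + 1))
      = cas ψ F (win 3 m) * cas ψ (sn (sn (sn F d) d') u) (win 1 (m + 3)) := by
    rw [c1, c2, c3, c4, c5, c6, c7]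
    linear_combination PC + (cas ψ (sn (sn F d) d') (sn (sn (win 3 m) 2) (m + 3))
      * cas ψ (sn F u) (sn (win 3 m) 1) - cas ψ (sn (sn F d) d') (sn (sn (win 3 m) 1) (m + 3))
      * cas ψ (sn F u) (sn (win 3 m) 2)) * hs
  clear a1 a2 a3 a4 a5 a6 c1 c2 c3 c4 c5 c6 c7 PA PC hD hFu hF hd hd' hu
  generalize cas ψ (sn (sn F d) d') (win 1 (m + 2)) = D1 at *
  generalize cas ψ (sn (sn F d) d') (win 2 (m + 2)) = D2 at *
  generalize cas ψ (sn (sn F d) d') (sn (win 1 (m + 1)) (m + 3)) = D1u at *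
  generalize cas ψ (sn (sn F d) d') (sn (win 2 (m + 1)) (m + 4)) = D2u at *
  generalize cas ψ (sn (sn F d) d') (cn 0 (win 2 (m + 1))) = D1d at *
  generalize cas ψ (sn (sn F d) d') (cn 1 (win 3 (m + 1))) = D2d at *
  generalize cas ψ (sn (sn (sn F d) d') u) (win 1 (m + 3)) = Z at *
  generalize cas ψ (sn F u) (win 1 (m + 1)) = U1 at *
  generalize cas ψ (sn F u) (win 2 (m + 1)) = U2 at *
  generalize cas ψ (sn F u) (win 3 (m + 1)) = U3 at *
  generalize cas ψ (sn F u) (sn (win 2 m) (m + 3)) = U2u at *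
  generalize cas ψ (sn F u) (cn 1 (win 3 m)) = U2d at *
  generalize cas ψ F (win 2 m) = F2 at *
  generalize cas ψ F (win 3 m) = F3 at *
  generalize ∑ k, E (F k) = EF at *
  generalize ∑ i ∈ Finset.range (m + 1), B (2 + i) = SB at *
  field_simp
  linear_combination A (m + 2) * D2 * KA + C 2 * D1 * KC + U2 * D2 * H1 + U2 * D1 * H2
    - D1 * D2 * H3

end Casorati

end MultiIndexed

namespace MultiIndexed

/-! ### Divisibility of Casorati determinants by their explicit factors -/

section Divisibility

variable {R : Type*} [CommRing R]

/-- The factor of the row `j` of a Casorati determinant of size `n`. -/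
def rowProd (a b : ℕ → R) (n j : ℕ) : R :=
  (∏ i ∈ Finset.range j, a i) * ∏ i ∈ Finset.Ico (j + 1) n, b i

/-- The product that `m` columns with the factors `rowProd` contribute to a determinant. -/
def denProd (a b : ℕ → R) (n m : ℕ) : R :=
  ∏ j ∈ Finset.range m, ∏ i ∈ Finset.range j, a i * b (n - 1 - i)

/-- The `k`-th smallest element of `J`, counted from 0, is at least `k`, and `F` increases for
divisibility. The induction removes the largest element. -/
theorem prod_range_dvd_prod_of_dvd_succ (F : ℕ → R) (hF : ∀ j, F j ∣ F (j + 1)) (J : Finset ℕ) :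
    ∏ j ∈ Finset.range J.card, F j ∣ ∏ j ∈ J, F j := by
  have hmono : ∀ i j, i ≤ j → F i ∣ F j := by
    intro i j hij
    induction j, hij using Nat.le_induction with
    | base => exact dvd_rfl
    | succ k _ ih => exact ih.trans (hF k)
  induction J using Finset.induction_on_max with
  | empty => simp
  | insert a J hJ ih =>
    have ha : a ∉ J := fun h => lt_irrefl _ (hJ a h)
    rw [Finset.card_insert_of_notMem ha, Finset.prod_range_succ, Finset.prod_insert ha, mul_comm]
    refine mul_dvd_mul (hmono _ _ ?_) ih
    calc J.card ≤ (Finset.range a).card :=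
          Finset.card_le_card fun x hx => Finset.mem_range.mpr (hJ x hx)
      _ = a := Finset.card_range a

/-- The `a`-part of `rowProd` increases with `j` and the `b`-part increases with `n - 1 - j`. The
previous lemma is applied to `J` and to its reflection. -/
theorem denProd_dvd_prod_rowProd (a b : ℕ → R) (n : ℕ) (J : Finset ℕ) (hJ : ∀ j ∈ J, j < n) :
    denProd a b n J.card ∣ ∏ j ∈ J, rowProd a b n j := by
  have h1 : denProd a b n J.card = (∏ j ∈ Finset.range J.card, ∏ i ∈ Finset.range j, a i)
      * ∏ j ∈ Finset.range J.card, ∏ i ∈ Finset.range j, b (n - 1 - i) := by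
    simp only [denProd, Finset.prod_mul_distrib]
  have hinj : Set.InjOn (fun j => n - 1 - j) (J : Set ℕ) := by
    intro x hx y hy hxy
    have := hJ x hx
    have := hJ y hy
    simp only at hxy
    omega
  have h2 : ∏ j ∈ J, rowProd a b n j = (∏ j ∈ J, ∏ i ∈ Finset.range j, a i)
      * ∏ j ∈ J.image (fun j => n - 1 - j), ∏ i ∈ Finset.range j, b (n - 1 - i) := by
    rw [Finset.prod_image hinj, ← Finset.prod_mul_distrib]
    refine Finset.prod_congr rfl fun j hj => ?_
    rw [rowProd]
    congr 1
    have := hJ j hj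
    refine Finset.prod_bij' (fun i _ => n - 1 - i) (fun i _ => n - 1 - i) ?_ ?_ ?_ ?_ ?_ <;>
      simp only [Finset.mem_Ico, Finset.mem_range] <;> intro i hi
    · omega
    · omega
    · omega
    · omega
    · congr 1
      omega
  rw [h1, h2]
  refine mul_dvd_mul ?_ ?_
  · refine prod_range_dvd_prod_of_dvd_succ (fun j => ∏ i ∈ Finset.range j, a i) (fun j => ?_) J
    exact Dvd.intro _ (Finset.prod_range_succ _ _).symm
  · have := prod_range_dvd_prod_of_dvd_succ (fun j => ∏ i ∈ Finset.range j, b (n - 1 - i))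
      (fun j => Dvd.intro _ (Finset.prod_range_succ _ _).symm) (J.image (fun j => n - 1 - j))
    rwa [Finset.card_image_of_injOn hinj] at this

/-- For each `i ∈ I` subtract row `π i` from row `i` and extract the factor `s`. Since `π i ∉ I`,
the rows being subtracted are never altered, so the operations do not interfere. -/
theorem pow_card_dvd_det {n : ℕ} (s : R) (π : Fin n → Fin n) (I : Finset (Fin n)) :
    ∀ N : Matrix (Fin n) (Fin n) R, (∀ i ∈ I, π i ∉ I) → (∀ i ∈ I, ∀ k, s ∣ N i k - N (π i) k) →
      s ^ I.card ∣ N.det := by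
  classical
  induction I using Finset.induction_on with
  | empty => simp
  | insert i I hi ih =>
    intro N hπ hN
    have hne : i ≠ π i := fun h => hπ i (Finset.mem_insert_self _ _)
      (h ▸ Finset.mem_insert_self _ _)
    choose w hw using hN i (Finset.mem_insert_self _ _)
    have h1 : N.det = s * (N.updateRow i w).det := by
      rw [← Matrix.det_updateRow_smul, ← Matrix.det_updateRow_add_smul_self N hne (-1)]
      congr 2
      ext k
      have := hw k
      simp only [Pi.add_apply, Pi.smul_apply, smul_eq_mul]
      linear_combination this
    rw [h1, Finset.card_insert_of_notMem hi, pow_succ, mul_comm]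
    refine mul_dvd_mul_left s (ih _ (fun j hj h => hπ j (Finset.mem_insert_of_mem hj)
      (Finset.mem_insert_of_mem h)) ?_)
    intro j hj k
    have hji : j ≠ i := fun h => hi (h ▸ hj)
    have hπi : π j ≠ i := fun h => hπ j (Finset.mem_insert_of_mem hj)
      (h ▸ Finset.mem_insert_self _ _)
    rw [Matrix.updateRow_ne hji, Matrix.updateRow_ne hπi]
    exact hN j (Finset.mem_insert_of_mem hj) k

theorem dvd_prod_sub_prod {κ : Type*} (s : R) (I : Finset κ) (f g : κ → R)
    (h : ∀ i ∈ I, s ∣ f i - g i) : s ∣ ∏ i ∈ I, f i - ∏ i ∈ I, g i := by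
  simp only [← Ideal.mem_span_singleton, ← Ideal.Quotient.eq, map_prod] at h ⊢
  exact Finset.prod_congr rfl h

theorem dvd_mul_sub_mul {s a b c d : R} (h1 : s ∣ a - b) (h2 : s ∣ c - d) : s ∣ a * c - b * d := by
  have : a * c - b * d = (a - b) * c + b * (c - d) := by ring
  rw [this]
  exact dvd_add (h1.mul_right _) (h2.mul_left _)

/-- After removal of common factors the two products differ in `b (j+1) ⋯ b k` against `a j ⋯ a
(k-1)`. The pairing `i ↔ j + k - i` keeps the sum of the indices equal to `j + k`, so paired factors
are congruent. -/
theorem dvd_rowProd_sub_rowProd (s : R) (a b : ℕ → R) (n j k : ℕ) (hjk : j < k) (hk : k < n)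
    (h : ∀ i < n, ∀ l < n, i + l = j + k → s ∣ a i - b l) :
    s ∣ rowProd a b n j - rowProd a b n k := by
  have e1 : rowProd a b n j = (∏ i ∈ Finset.range j, a i) * (∏ i ∈ Finset.Ico (k + 1) n, b i)
      * ∏ i ∈ Finset.Ico (j + 1) (k + 1), b i := by
    rw [rowProd, ← Finset.prod_Ico_consecutive b (show j + 1 ≤ k + 1 by omega)
      (show k + 1 ≤ n by omega)]
    ring
  have e2 : rowProd a b n k = (∏ i ∈ Finset.range j, a i) * (∏ i ∈ Finset.Ico (k + 1) n, b i)
      * ∏ i ∈ Finset.Ico j k, a i := by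
    rw [rowProd, Finset.range_eq_Ico, Finset.range_eq_Ico,
      ← Finset.prod_Ico_consecutive a (Nat.zero_le j) hjk.le]
    ring
  have e3 : ∏ i ∈ Finset.Ico (j + 1) (k + 1), b i = ∏ i ∈ Finset.Ico j k, b (j + k - i) := by
    refine Finset.prod_bij' (fun i _ => j + k - i) (fun i _ => j + k - i) ?_ ?_ ?_ ?_ ?_ <;>
      simp only [Finset.mem_Ico] <;> intro i hi
    · omega
    · omega
    · omega
    · omega
    · congr 1
      omega
  rw [e1, e2, e3, ← mul_sub, ← dvd_neg, ← mul_neg, neg_sub]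
  refine Dvd.dvd.mul_left (dvd_prod_sub_prod s _ _ _ fun i hi => ?_) _
  rw [Finset.mem_Ico] at hi
  exact h i (by omega) _ (by omega) (by omega)

/-- Group the pairs of rows by their sum `m`. The pairs in one group are disjoint, so they give a
power of `s m` dividing the determinant; the contributions of different `m` are coprime and
multiply. -/
theorem prod_dvd_of_sum_fibers {n : ℕ} (s : ℕ → R)
    (hs : ∀ m m', m ≠ m' → IsCoprime (s m) (s m')) (N : Matrix (Fin n) (Fin n) R)
    (hN : ∀ i j : Fin n, i < j → ∀ k, s (i + j) ∣ N i k - N j k) :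
    ∏ i : Fin n, ∏ j ∈ Finset.Ioi i, s (i + j) ∣ N.det := by
  classical
  rw [Finset.prod_sigma']
  rw [← Finset.prod_fiberwise_of_maps_to (t := Finset.range (2 * n))
    (g := fun p : (_ : Fin n) × Fin n => (p.1 + p.2 : ℕ))
    (fun p _ => Finset.mem_range.mpr (by have := p.1.2; have := p.2.2; omega))]
  have key : ∀ m, ∏ p ∈ ((Finset.univ : Finset (Fin n)).sigma fun i => Finset.Ioi i).filter
      (fun p => (p.1 + p.2 : ℕ) = m), s (p.1 + p.2 : ℕ) ∣ N.det := by
    intro m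
    rw [Finset.prod_congr rfl (g := fun _ => s m)
      (fun p hp => by rw [(Finset.mem_filter.mp hp).2]), Finset.prod_const]
    rcases Nat.eq_zero_or_pos n with rfl | hn
    · have : (((Finset.univ : Finset (Fin 0)).sigma fun i => Finset.Ioi i).filter
          (fun p => (p.1 + p.2 : ℕ) = m)) = ∅ := Finset.eq_empty_of_forall_notMem fun p => p.1.elim0
      rw [this]
      simp
    -- `I` holds the smaller members of the pairs `{i, m - i}` of actual rows, and `π` sends such an
    -- `i` to its partner. The default value `0` is never met on `I`.
    let π : Fin n → Fin n := fun i => if h : m - i < n then ⟨m - i, h⟩ else ⟨0, hn⟩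
    let I : Finset (Fin n) := Finset.univ.filter fun i => (i : ℕ) < m - i ∧ m - i < n
    have hπ : ∀ i ∈ I, ((π i : Fin n) : ℕ) = m - i := by
      intro i hi
      simp [π, (Finset.mem_filter.mp hi).2.2]
    refine (pow_dvd_pow (s m) ?_).trans (pow_card_dvd_det (s m) π I N ?_ ?_)
    · refine Finset.card_le_card_of_injOn (fun p => p.1) ?_ ?_
      · intro p hp
        obtain ⟨h1, h2⟩ := Finset.mem_filter.mp hp
        have h3 : p.1 < p.2 := by simpa using h1
        have h4 : (p.1 : ℕ) < p.2 := h3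
        have := p.2.2
        simp only [I, Finset.coe_filter, Finset.mem_univ, true_and, Set.mem_ofPred_eq]
        omega
      · intro p hp p' hp' h
        have h1 := (Finset.mem_filter.mp hp).2
        have h2 := (Finset.mem_filter.mp hp').2
        obtain ⟨a, b⟩ := p
        obtain ⟨a', b'⟩ := p'
        simp only at h h1 h2
        subst h
        have : b = b' := Fin.ext (by omega)
        rw [this]
    · intro i hi h
      have h1 := (Finset.mem_filter.mp hi).2
      have h2 := (Finset.mem_filter.mp h).2
      rw [hπ i hi] at h2
      omega
    · intro i hi k
      have h1 := (Finset.mem_filter.mp hi).2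
      have h2 := hπ i hi
      have h3 : (i + π i : ℕ) = m := by omega
      rw [← h3]
      exact hN i (π i) (Fin.lt_def.mpr (by omega)) k
  have key2 : ∀ m, ∏ p ∈ ((Finset.univ : Finset (Fin n)).sigma fun i => Finset.Ioi i).filter
      (fun p => (p.1 + p.2 : ℕ) = m), s (p.1 + p.2 : ℕ) = s m ^ (((Finset.univ :
      Finset (Fin n)).sigma fun i => Finset.Ioi i).filter (fun p => (p.1 + p.2 : ℕ) = m)).card := by
    intro m
    rw [Finset.prod_congr rfl (g := fun _ => s m)
      (fun p hp => by rw [(Finset.mem_filter.mp hp).2]), Finset.prod_const]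
  refine Finset.prod_dvd_of_coprime (fun m _ m' _ hmm => ?_) fun m _ => key m
  simp only [Function.onFun, key2]
  exact (hs m m' hmm).pow

open Polynomial in
-- Modulo `v` the polynomial `D` stays monic, hence is not a zero divisor, even though the quotient
-- ring may have zero divisors.
theorem C_dvd_of_C_dvd_monic_mul (v : R) (D Q : R[X]) (hD : D.Monic) (h : C v ∣ D * Q) :
    C v ∣ Q := by
  have hiff : ∀ P : R[X], C v ∣ P ↔ P.map (Ideal.Quotient.mk (Ideal.span {v})) = 0 := by
    intro P
    rw [C_dvd_iff_dvd_coeff, Polynomial.ext_iff]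
    simp only [coeff_map, coeff_zero, Ideal.Quotient.eq_zero_iff_mem, Ideal.mem_span_singleton]
  rw [hiff] at h ⊢
  rw [Polynomial.map_mul] at h
  have hm := hD.map (Ideal.Quotient.mk (Ideal.span {v}))
  exact (hm.mul_right_eq_zero_iff).mp h

/-- The matrix with the columns `g k`, multiplied by the row factors of the first kind for `k ∈ K₁`
and by those of the second kind for `k ∈ K₂`. -/
def rowProdMatrix (a₁ b₁ a₂ b₂ : ℕ → R) {n : ℕ} (K₁ K₂ : Finset (Fin n)) (g : Fin n → ℕ → R) :
    Matrix (Fin n) (Fin n) R :=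
  Matrix.of fun j k => (if k ∈ K₁ then rowProd a₁ b₁ n j else 1)
    * (if k ∈ K₂ then rowProd a₂ b₂ n j else 1) * g k j

/-- Each Leibniz term already has this divisor: a permutation assigns pairwise different rows to the
columns in `K₁`, and likewise in `K₂`, so the divisibility for sets of rows applies. -/
theorem denProd_mul_denProd_dvd_det (a₁ b₁ a₂ b₂ : ℕ → R) {n : ℕ} (K₁ K₂ : Finset (Fin n))
    (g : Fin n → ℕ → R) :
    denProd a₁ b₁ n K₁.card * denProd a₂ b₂ n K₂.card ∣ (rowProdMatrix a₁ b₁ a₂ b₂ K₁ K₂ g).det := by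
  classical
  rw [Matrix.det_apply]
  refine Finset.dvd_sum fun σ _ => ?_
  rw [Units.smul_def, zsmul_eq_mul]
  refine Dvd.dvd.mul_left ?_ _
  simp only [rowProdMatrix, Matrix.of_apply, Finset.prod_mul_distrib]
  refine Dvd.dvd.mul_right (mul_dvd_mul ?_ ?_) _
  all_goals
    rw [Finset.prod_ite_mem, Finset.univ_inter]
  · have := denProd_dvd_prod_rowProd a₁ b₁ n (K₁.image (Fin.val ∘ σ)) (by simp)
    rwa [Finset.card_image_of_injective _ (Fin.val_injective.comp σ.injective),
      Finset.prod_image (Fin.val_injective.comp σ.injective).injOn] at this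
  · have := denProd_dvd_prod_rowProd a₂ b₂ n (K₂.image (Fin.val ∘ σ)) (by simp)
    rwa [Finset.card_image_of_injective _ (Fin.val_injective.comp σ.injective),
      Finset.prod_image (Fin.val_injective.comp σ.injective).injOn] at this

theorem prod_dvd_det_rowProdMatrix (s a₁ b₁ a₂ b₂ : ℕ → R) {n : ℕ} (K₁ K₂ : Finset (Fin n))
    (g : Fin n → ℕ → R) (hs : ∀ m m', m ≠ m' → IsCoprime (s m) (s m'))
    (h₁ : ∀ i < n, ∀ j < n, s (i + j) ∣ a₁ i - b₁ j) (h₂ : ∀ i < n, ∀ j < n, s (i + j) ∣ a₂ i - b₂ j)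
    (hg : ∀ k, ∀ i < n, ∀ j < n, s (i + j) ∣ g k i - g k j) :
    ∏ i : Fin n, ∏ j ∈ Finset.Ioi i, s (i + j) ∣ (rowProdMatrix a₁ b₁ a₂ b₂ K₁ K₂ g).det := by
  refine prod_dvd_of_sum_fibers s hs _ fun i j hij k => ?_
  simp only [rowProdMatrix, Matrix.of_apply]
  refine dvd_mul_sub_mul (dvd_mul_sub_mul ?_ ?_) (hg k i i.2 j j.2)
  · split_ifs
    · exact dvd_rowProd_sub_rowProd _ a₁ b₁ n i j hij j.2
        fun i' hi l hl h => h ▸ h₁ i' hi l hl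
    · simp
  · split_ifs
    · exact dvd_rowProd_sub_rowProd _ a₂ b₂ n i j hij j.2
        fun i' hi l hl h => h ▸ h₂ i' hi l hl
    · simp

open Polynomial in
theorem monic_denProd (a b : ℕ → R) (n m : ℕ) :
    (denProd (fun i => X + C (a i)) (fun i => X + C (b i)) n m).Monic :=
  monic_prod_of_monic _ _ fun _ _ => monic_prod_of_monic _ _ fun _ _ =>
    (monic_X_add_C _).mul (monic_X_add_C _)

open Polynomial in
-- The Vandermonde part and the row products each divide the determinant but need not be coprime.
-- Adding an indeterminate to all `a` and `b` leaves the congruences between them intact and makes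
-- the row products monic, so they can be cancelled modulo the constant Vandermonde part. Setting
-- the indeterminate to zero returns the original matrix.
theorem exists_det_rowProdMatrix_eq (s a₁ b₁ a₂ b₂ : ℕ → R) {n : ℕ} (K₁ K₂ : Finset (Fin n))
    (g : Fin n → ℕ → R) (hs : ∀ m m', m ≠ m' → IsCoprime (s m) (s m'))
    (h₁ : ∀ i < n, ∀ j < n, s (i + j) ∣ a₁ i - b₁ j) (h₂ : ∀ i < n, ∀ j < n, s (i + j) ∣ a₂ i - b₂ j)
    (hg : ∀ k, ∀ i < n, ∀ j < n, s (i + j) ∣ g k i - g k j) :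
    ∃ Q : R, (rowProdMatrix a₁ b₁ a₂ b₂ K₁ K₂ g).det
      = (∏ i : Fin n, ∏ j ∈ Finset.Ioi i, s (i + j)) * denProd a₁ b₁ n K₁.card
        * denProd a₂ b₂ n K₂.card * Q := by
  set N := rowProdMatrix (fun i => X + C (a₁ i)) (fun i => X + C (b₁ i)) (fun i => X + C (a₂ i))
    (fun i => X + C (b₂ i)) K₁ K₂ (fun k i => C (g k i)) with hN
  obtain ⟨Q, hQ⟩ := denProd_mul_denProd_dvd_det (fun i => X + C (a₁ i)) (fun i => X + C (b₁ i))
    (fun i => X + C (a₂ i)) (fun i => X + C (b₂ i)) K₁ K₂ (fun k i => C (g k i))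
  have hv : C (∏ i : Fin n, ∏ j ∈ Finset.Ioi i, s (i + j)) ∣ N.det := by
    have := prod_dvd_det_rowProdMatrix (fun m => C (s m)) (fun i => X + C (a₁ i))
      (fun i => X + C (b₁ i)) (fun i => X + C (a₂ i)) (fun i => X + C (b₂ i)) K₁ K₂
      (fun k i => C (g k i)) (fun m m' h => (hs m m' h).map C)
      (fun i hi j hj => by
        rw [add_sub_add_left_eq_sub, ← C_sub]; exact _root_.map_dvd C (h₁ i hi j hj))
      (fun i hi j hj => by
        rw [add_sub_add_left_eq_sub, ← C_sub]; exact _root_.map_dvd C (h₂ i hi j hj))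
      (fun k i hi j hj => by rw [← C_sub]; exact _root_.map_dvd C (hg k i hi j hj))
    simpa only [map_prod] using this
  rw [← hN] at hQ
  rw [hQ] at hv
  obtain ⟨Q', rfl⟩ := C_dvd_of_C_dvd_monic_mul _ _ _
    ((monic_denProd a₁ b₁ n _).mul (monic_denProd a₂ b₂ n _)) hv
  refine ⟨Q'.eval 0, ?_⟩
  have h := congrArg (evalRingHom 0) hQ
  have hrow : ∀ (a b : ℕ → R) (j : ℕ),
      eval 0 (rowProd (fun i => X + C (a i)) (fun i => X + C (b i)) n j) = rowProd a b n j := by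
    intro a b j
    simp [rowProd, eval_prod]
  have hden : ∀ (a b : ℕ → R) (m : ℕ),
      eval 0 (denProd (fun i => X + C (a i)) (fun i => X + C (b i)) n m) = denProd a b n m := by
    intro a b j
    simp [denProd, eval_prod]
  have hmat : (evalRingHom 0).mapMatrix N = rowProdMatrix a₁ b₁ a₂ b₂ K₁ K₂ g := by
    ext j k
    simp only [hN, rowProdMatrix, RingHom.mapMatrix_apply, Matrix.map_apply, Matrix.of_apply,
      coe_evalRingHom, eval_mul, eval_C]
    congr 2
    · split_ifs
      · exact hrow _ _ _
      · simp
    · split_ifs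
      · exact hrow _ _ _
      · simp
  rw [RingHom.map_det, hmat] at h
  rw [h]
  simp only [coe_evalRingHom, eval_mul, hden, eval_C]
  ring

end Divisibility

end MultiIndexed

namespace MultiIndexed

/-! ### Elementary factors of the three systems -/

/-- The site functions with `V = α^I α^II / D`, where `D` does not depend on the parameters. -/
noncomputable def al : System → VType → (Fin 4 → ℂ) → ℂ → ℂ
  | .cH, .I, lam, x => -(lam 0 + I * x)
  | .cH, .II, lam, x => -(lam 1 + I * x)
  | .W, .I, lam, x => (lam 0 + I * x) * (lam 1 + I * x)
  | .W, .II, lam, x => (lam 2 + I * x) * (lam 3 + I * x)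
  | .AW q, .I, lam, x => exp (-(Real.log q / 2) - I * x)
      * ((1 - aw q lam 0 * exp (I * x)) * (1 - aw q lam 1 * exp (I * x)))
  | .AW q, .II, lam, x => exp (-(Real.log q / 2) - I * x)
      * ((1 - aw q lam 2 * exp (I * x)) * (1 - aw q lam 3 * exp (I * x)))

/-- The site functions with `V^* = β^I β^II / D^*`. -/
noncomputable def be : System → VType → (Fin 4 → ℂ) → ℂ → ℂ
  | .cH, .I, lam, x => lam 2 - I * x
  | .cH, .II, lam, x => lam 3 - I * x
  | .W, T, lam, x => al .W T lam (-x)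
  | .AW q, T, lam, x => al (.AW q) T lam (-x)

/-- The factor of `η(x) - η(y)` that depends on `x + y`. -/
noncomputable def sg : System → ℂ → ℂ
  | .cH, _ => 1
  | .W, y => y
  | .AW _, y => sin (y / 2)

/-- The factor of `η(x) - η(y)` that depends on `x - y`. -/
noncomputable def cEta : System → ℂ → ℂ
  | .cH, d => d
  | .W, d => d
  | .AW _, d => -2 * sin (d / 2)

theorem eta_sub_eta (S : System) (x y : ℂ) : eta S x - eta S y = cEta S (x - y) * sg S (x + y) := by
  cases S with
  | cH => simp [eta, cEta, sg]
  | W => simp only [eta, cEta, sg]; ring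
  | AW q => simp only [eta, cEta, sg, cos_sub_cos]; ring

/-- The constant in the denominators of the potential functions. -/
noncomputable def kap : System → ℂ
  | .cH => 1
  | .W => -1
  | .AW q => -4 * exp (-(Real.log q / 2))

theorem kap_ne_zero (S : System) : kap S ≠ 0 := by
  cases S <;> simp [kap]

theorem ofReal_cpow_eq_exp {q : ℝ} (hq : 0 < q) (μ : ℂ) : (q : ℂ) ^ μ = exp (Real.log q * μ) := by
  rw [cpow_def_of_ne_zero (by exact_mod_cast hq.ne'), Complex.ofReal_log hq.le]

theorem ofReal_eq_exp {q : ℝ} (hq : 0 < q) : (q : ℂ) = exp (Real.log q) := by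
  rw [← Complex.ofReal_exp, Real.exp_log hq]

/-- The points of a Casorati determinant, numbered by all natural numbers. -/
noncomputable def nodeN (S : System) (n : ℕ) (x : ℂ) (i : ℕ) : ℂ :=
  x + I * (((n : ℂ) - 1) / 2 - i) * gam S

theorem node_eq_nodeN (S : System) (n : ℕ) (x : ℂ) (j : Fin n) : node S n x j = nodeN S n x j := rfl

theorem nodeN_reflect (S : System) {n i : ℕ} (hi : i < n) (x : ℂ) :
    nodeN S n x (n - 1 - i) = -nodeN S n (-x) i := by
  rw [nodeN, nodeN, Nat.sub_sub, Nat.cast_sub (by omega)]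
  push_cast
  ring

/-- The phase of a product of the site functions `al`. -/
noncomputable def alPhase : System → ℕ → ℂ → ℕ → ℂ
  | .cH, _, _, j => (-1) ^ j
  | .W, _, _, _ => 1
  | .AW q, n, x, j => exp (Real.log q * (j * ((n : ℂ) - 1 - j) / 2) - j * (I * x))

/-- The phase of a product of the site functions `be`. -/
noncomputable def bePhase : System → ℕ → ℂ → ℕ → ℂ
  | .cH, _, _, _ => 1
  | .W, _, _, _ => 1
  | .AW q, n, x, j => exp (Real.log q * (j * ((n : ℂ) - 1 - j) / 2) + j * (I * x))

theorem add_I_mul_nodeN (S : System) (hS : gam S = 1) (μ : ℂ) (n : ℕ) (x : ℂ) (i : ℕ) :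
    μ + I * nodeN S n x i = μ - ((n : ℂ) - 1) / 2 + I * x + i := by
  rw [nodeN, hS, ofReal_one]
  linear_combination (((n : ℂ) - 1) / 2 - i) * I_mul_I

theorem aw_mul_exp_nodeN {q : ℝ} (hq : 0 < q) (lam : Fin 4 → ℂ) (k : Fin 4) (n : ℕ) (x : ℂ) (i : ℕ) :
    aw q lam k * exp (I * nodeN (.AW q) n x i)
      = (q : ℂ) ^ (lam k - ((n : ℂ) - 1) / 2) * exp (I * x) * (q : ℂ) ^ i := by
  rw [aw, ofReal_cpow_eq_exp hq, ofReal_cpow_eq_exp hq, ← cpow_natCast, ofReal_cpow_eq_exp hq,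
    ← exp_add, ← exp_add, ← exp_add, nodeN, gam]
  congr 1
  linear_combination (((n : ℂ) - 1) / 2 - i) * (Real.log q : ℂ) * I_mul_I

/-- A step to the next node adds 1 to `μ + i x`, respectively multiplies `q^μ e^{ix}` by `q`, so the
factors form a shifted factorial; the signs and exponentials in `al` make up `alPhase`. -/
theorem prod_al (S : System) (hS : S.Valid) (T : VType) (lam : Fin 4 → ℂ) (n : ℕ) (x : ℂ) (j : ℕ) :
    ∏ i ∈ Finset.range j, al S T lam (nodeN S n x i)
      = alPhase S n x j * ∏ k ∈ plusIdx S T, fac S (lam k - ((n : ℂ) - 1) / 2) x j := by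
  cases S with
  | cH =>
    cases T <;> simp only [al, plusIdx, Finset.prod_singleton, fac, poch, alPhase,
      add_I_mul_nodeN .cH rfl, Finset.prod_neg, Finset.card_range]
  | W =>
    cases T <;> simp only [al, plusIdx, Finset.prod_pair (show (0 : Fin 4) ≠ 1 by decide),
      Finset.prod_pair (show (2 : Fin 4) ≠ 3 by decide), fac, poch, alPhase,
      add_I_mul_nodeN .W rfl, Finset.prod_mul_distrib, one_mul]
  | AW q =>
    have hp : ∏ i ∈ Finset.range j, exp (-(Real.log q / 2 : ℂ) - I * nodeN (.AW q) n x i)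
        = alPhase (.AW q) n x j := by
      simp only [alPhase]
      induction j with
      | zero => simp
      | succ j ih =>
        rw [Finset.prod_range_succ, ih, ← exp_add, nodeN, gam]
        congr 1
        push_cast
        linear_combination -(((n : ℂ) - 1) / 2 - j) * (Real.log q : ℂ) * I_mul_I
    cases T <;> simp only [al, plusIdx, Finset.prod_pair (show (0 : Fin 4) ≠ 1 by decide),
      Finset.prod_pair (show (2 : Fin 4) ≠ 3 by decide), fac, qpoch, aw_mul_exp_nodeN hS.1,
      Finset.prod_mul_distrib, hp]

theorem prod_be (S : System) (hS : S.Valid) (T : VType) (lam : Fin 4 → ℂ) (n : ℕ) (x : ℂ) {j : ℕ}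
    (hj : j ≤ n) :
    ∏ i ∈ Finset.range j, be S T lam (nodeN S n x (n - 1 - i))
      = bePhase S n x j * ∏ k ∈ minusIdx S T, fac S (lam k - ((n : ℂ) - 1) / 2) (-x) j := by
  have h1 : ∏ i ∈ Finset.range j, be S T lam (nodeN S n x (n - 1 - i))
      = ∏ i ∈ Finset.range j, be S T lam (-nodeN S n (-x) i) :=
    Finset.prod_congr rfl fun i hi => by
      rw [nodeN_reflect S (by have := Finset.mem_range.mp hi; omega)]
  rw [h1]
  cases S with
  | cH =>
    cases T <;> simp only [be, minusIdx, Finset.prod_singleton, fac, poch, bePhase, mul_neg I,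
      sub_neg_eq_add, one_mul, add_I_mul_nodeN .cH rfl]
  | W =>
    have := prod_al .W hS T lam n (-x) j
    simp only [be, neg_neg, this]
    cases T <;> rfl
  | AW q =>
    have := prod_al (.AW q) hS T lam n (-x) j
    simp only [be, neg_neg, this, alPhase, bePhase, mul_neg, sub_neg_eq_add]
    cases T <;> rfl

theorem prod_Ico_eq_prod_range_reflect {R : Type*} [CommMonoid R] (f : ℕ → R) {n j : ℕ} :
    ∏ i ∈ Finset.Ico (j + 1) n, f i = ∏ i ∈ Finset.range (n - 1 - j), f (n - 1 - i) := by
  refine Finset.prod_bij' (fun i _ => n - 1 - i) (fun i _ => n - 1 - i) ?_ ?_ ?_ ?_ ?_ <;>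
    simp only [Finset.mem_Ico, Finset.mem_range] <;> intro i hi
  · omega
  · omega
  · omega
  · omega
  · congr 1
    omega

/-- Connects the explicit row factors of the determinants with the abstract products of the
divisibility argument. The phases of the `j` factors `α` and the `n - 1 - j` factors `β` multiply to
`phase`. -/
theorem rowFac_eq_rowProd (S : System) (hS : S.Valid) (T : VType) (lam : Fin 4 → ℂ) (n : ℕ) (x : ℂ)
    (j : Fin n) :
    rowFac S T lam n x j = rowProd (fun i => al S T lam (nodeN S n x i))
      (fun i => be S T lam (nodeN S n x i)) n j := by
  rw [rowProd, prod_Ico_eq_prod_range_reflect, prod_al S hS, prod_be S hS T lam n x (by omega), rowFac,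
    facProd]
  have : phase S n x j = alPhase S n x j * bePhase S n x (n - 1 - j) := by
    have hc : ((n - 1 - (j : ℕ) : ℕ) : ℂ) = (n : ℂ) - 1 - (j : ℕ) := by
      rw [Nat.sub_sub, Nat.cast_sub (by omega)]
      push_cast
      ring
    cases S with
    | cH => simp [phase, alPhase, bePhase]
    | W => simp [phase, alPhase, bePhase]
    | AW q =>
      simp only [phase, alPhase, bePhase]
      rw [← cpow_natCast, ofReal_cpow_eq_exp hS.1, ← exp_add, ← exp_add]
      congr 1
      push_cast
      rw [hc]
      ring
  rw [this]
  ring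

/-- The constant by which `facProd` differs from a product of site functions. -/
noncomputable def facConst (S : System) (n j : ℕ) : ℂ := (alPhase S n 0 j * bePhase S n 0 j)⁻¹

theorem facConst_ne_zero (S : System) (n j : ℕ) : facConst S n j ≠ 0 := by
  cases S <;> simp [facConst, alPhase, bePhase]

/-- With equally many factors `α` and `β` the `x`-dependence of the phases cancels, so only a
nonzero constant separates the two expressions. -/
theorem facProd_eq (S : System) (hS : S.Valid) (T : VType) (lam : Fin 4 → ℂ) (n : ℕ) (x : ℂ) {j : ℕ}
    (hj : j ≤ n) :
    facProd S T lam n j j x = facConst S n j * ∏ i ∈ Finset.range j,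
      al S T lam (nodeN S n x i) * be S T lam (nodeN S n x (n - 1 - i)) := by
  rw [Finset.prod_mul_distrib, prod_al S hS, prod_be S hS T lam n x hj, facProd]
  have h0 : alPhase S n x j * bePhase S n x j = alPhase S n 0 j * bePhase S n 0 j := by
    cases S with
    | cH => rfl
    | W => rfl
    | AW q =>
      simp only [alPhase, bePhase, ← exp_add]
      congr 1
      ring
  have h1 : facConst S n j * (alPhase S n x j * bePhase S n x j) = 1 := by
    rw [h0, facConst]
    refine inv_mul_cancel₀ ?_
    exact fun h => facConst_ne_zero S n j (by rw [facConst, h, inv_zero])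
  linear_combination -(∏ k ∈ plusIdx S T, fac S (lam k - ((n : ℂ) - 1) / 2) x j)
    * (∏ k ∈ minusIdx S T, fac S (lam k - ((n : ℂ) - 1) / 2) (-x) j) * h1

theorem sin_eq_exp_inv (w : ℂ) : sin w = ((exp (I * w))⁻¹ - exp (I * w)) * I / 2 := by
  rw [Complex.sin, ← exp_neg, mul_comm w I, show -w * I = -(I * w) by ring]

/-- For AW the exponential prefactors of the two site functions are exactly what turns the
denominator `(1 - e^{2ix})(1 - q e^{2ix})` into a product of two sines. -/
theorem pot_eq (S : System) (hS : S.Valid) (lam : Fin 4 → ℂ) (x : ℂ) :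
    pot S lam x = al S .I lam x * al S .II lam x / (kap S * sg S (2 * x) * sg S (2 * x - I * gam S)) := by
  cases S with
  | cH =>
    simp only [pot, potNum, potDen, al, kap, sg]
    ring
  | W =>
    simp only [pot, potNum, potDen, al, kap, sg, Fin.prod_univ_four, gam]
    congr 1
    · ring
    · push_cast
      linear_combination (4 * x ^ 2) * I_mul_I
  | AW q =>
    have hL : exp (-(Real.log q / 2 : ℂ)) = (exp (Real.log q / 2 : ℂ))⁻¹ := exp_neg _
    have h1 : exp (-(Real.log q / 2 : ℂ) - I * x) = (exp (Real.log q / 2 : ℂ))⁻¹ * (exp (I * x))⁻¹ := by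
      rw [sub_eq_add_neg, exp_add, exp_neg, exp_neg]
    have h2 : exp (2 * I * x) = exp (I * x) ^ 2 := by
      rw [← exp_nat_mul]
      congr 1
      push_cast
      ring
    have h3 : (q : ℂ) = exp (Real.log q / 2 : ℂ) ^ 2 := by
      rw [← exp_nat_mul, ofReal_eq_exp hS.1]
      congr 1
      push_cast
      ring
    have h4 : exp (I * ((2 * x - I * Real.log q) / 2)) = exp (I * x) * exp (Real.log q / 2 : ℂ) := by
      rw [← exp_add]
      congr 1
      linear_combination (-(Real.log q : ℂ) / 2) * I_mul_I
    have hs : kap (.AW q) * sg (.AW q) (2 * x) * sg (.AW q) (2 * x - I * gam (.AW q))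
        = exp (-(Real.log q / 2) - I * x) * exp (-(Real.log q / 2) - I * x)
          * ((1 - exp (2 * I * x)) * (1 - q * exp (2 * I * x))) := by
      simp only [kap, sg, gam]
      rw [sin_eq_exp_inv, sin_eq_exp_inv, h4, hL, h1, h2, h3, mul_div_cancel_left₀ x two_ne_zero]
      have := exp_ne_zero (I * x)
      have := exp_ne_zero (Real.log q / 2 : ℂ)
      field_simp
      linear_combination (-4 * (exp (I * x) ^ 2 - 1) * (exp (I * x) ^ 2 * exp (Real.log q / 2 : ℂ) ^ 2 - 1)) * I_sq
    have hn : al (.AW q) .I lam x * al (.AW q) .II lam x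
        = exp (-(Real.log q / 2) - I * x) * exp (-(Real.log q / 2) - I * x)
          * ∏ k : Fin 4, (1 - aw q lam k * exp (I * x)) := by
      simp only [al, Fin.prod_univ_four]
      ring
    rw [hs, hn, mul_div_mul_left _ _ (mul_ne_zero (exp_ne_zero _) (exp_ne_zero _))]
    rfl

theorem potStar_eq (S : System) (hS : S.Valid) (lam : Fin 4 → ℂ) (x : ℂ) :
    potStar S lam x = be S .I lam x * be S .II lam x
      / (kap S * sg S (2 * x) * sg S (2 * x + I * gam S)) := by
  cases S with
  | cH => simp [potStar, be, kap, sg]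
  | W =>
    rw [potStar, pot_eq .W hS]
    simp only [be, sg, kap]
    congr 1
    ring
  | AW q =>
    rw [potStar, pot_eq (.AW q) hS]
    simp only [be, sg, kap]
    have h1 : sin (2 * -x / 2) = -sin (2 * x / 2) := by rw [← sin_neg]; congr 1; ring
    have h2 : sin ((2 * -x - I * gam (.AW q)) / 2) = -sin ((2 * x + I * gam (.AW q)) / 2) := by
      rw [← sin_neg]; congr 1; ring
    rw [h1, h2]
    congr 1
    ring

/-- The constant that appears when the parameters are shifted by `δ`. -/
noncomputable def deltaConst : System → ℂ
  | .AW q => exp (Real.log q / 2)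
  | _ => 1

theorem deltaConst_ne_zero (S : System) : deltaConst S ≠ 0 := by
  cases S <;> simp [deltaConst]

theorem aw_add {q : ℝ} (hq : 0 < q) (lam μ : Fin 4 → ℂ) (k : Fin 4) :
    aw q (lam + μ) k = aw q lam k * exp (Real.log q * μ k) := by
  rw [aw, aw, Pi.add_apply, cpow_add _ _ (by exact_mod_cast hq.ne'), ofReal_cpow_eq_exp hq (μ k)]

/-- `α` depends on `a + ix`, so the shift by `δ` acts as a further half step in the same direction.
For `β`, which depends on `a - ix`, it undoes the half step, and the common constant drops out of
quotients. -/
theorem al_add_delta (S : System) (hS : S.Valid) (T : VType) (lam : Fin 4 → ℂ) (x : ℂ) :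
    al S T (lam + delta) (x - I * gam S / 2) = deltaConst S * al S T lam (x - I * gam S) := by
  cases S with
  | cH =>
    cases T <;> simp only [al, delta, deltaConst, gam, Pi.add_apply, ofReal_one] <;>
      linear_combination (-1 / 2 : ℂ) * I_mul_I
  | W =>
    have h : ∀ k, (lam + delta) k + I * (x - I * gam .W / 2) = lam k + I * (x - I * gam .W) := by
      intro k
      simp only [delta, gam, Pi.add_apply, ofReal_one]
      linear_combination (1 / 2 : ℂ) * I_mul_I
    cases T <;> simp only [al, h, deltaConst, one_mul]
  | AW q =>
    have h : ∀ k, aw q (lam + delta) k * exp (I * (x - I * gam (.AW q) / 2))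
        = aw q lam k * exp (I * (x - I * gam (.AW q))) := by
      intro k
      rw [aw_add hS.1, mul_assoc, ← exp_add, delta, gam]
      congr 2
      linear_combination ((Real.log q : ℂ) / 2) * I_mul_I
    have h2 : exp (-(Real.log q / 2 : ℂ) - I * (x - I * gam (.AW q) / 2))
        = deltaConst (.AW q) * exp (-(Real.log q / 2 : ℂ) - I * (x - I * gam (.AW q))) := by
      rw [deltaConst, ← exp_add, gam]
      congr 1
      linear_combination -((Real.log q : ℂ) / 2) * I_mul_I
    cases T <;> simp only [al, h, h2, mul_assoc]

theorem be_add_delta (S : System) (hS : S.Valid) (T : VType) (lam : Fin 4 → ℂ) (x : ℂ) :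
    be S T (lam + delta) (x - I * gam S / 2) = deltaConst S * be S T lam x := by
  cases S with
  | cH =>
    cases T <;> simp only [be, delta, deltaConst, gam, Pi.add_apply, ofReal_one] <;>
      linear_combination (1 / 2 : ℂ) * I_mul_I
  | W =>
    have := al_add_delta .W hS T lam (-x + I * gam .W)
    simp only [be]
    rw [show -(x - I * gam .W / 2) = -x + I * gam .W - I * gam .W / 2 by ring, this]
    simp
  | AW q =>
    have := al_add_delta (.AW q) hS T lam (-x + I * gam (.AW q))
    simp only [be]
    rw [show -(x - I * gam (.AW q) / 2) = -x + I * gam (.AW q) - I * gam (.AW q) / 2 by ring, this]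
    simp

/-- The shift of the parameters of a given type in `lamD`. -/
noncomputable def typeShift (m₁ m₂ : ℕ) : VType → ℂ
  | .I => ((m₂ : ℂ) - m₁) / 2
  | .II => -(((m₂ : ℂ) - m₁) / 2)

/-- The phase of the site functions under a shift of the parameters. -/
noncomputable def shiftPhase : System → ℂ → ℂ
  | .AW q, t => exp (Real.log q * t)
  | _, _ => 1

theorem shiftPhase_mul (S : System) (m₁ m₂ : ℕ) :
    shiftPhase S (typeShift m₁ m₂ .I) * shiftPhase S (typeShift m₁ m₂ .II) = 1 := by
  cases S <;> simp [shiftPhase, typeShift, ← exp_add]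

/-- The type of a parameter. -/
def paramType : System → Fin 4 → VType
  | .cH, k => if k = 0 ∨ k = 2 then .I else .II
  | _, k => if k = 0 ∨ k = 1 then .I else .II

theorem lamD_eq (S : System) (lam : Fin 4 → ℂ) (m₁ m₂ : ℕ) :
    lamD S lam m₁ m₂ = lam + fun k => typeShift m₁ m₂ (paramType S k) := by
  ext k
  cases S <;> fin_cases k <;>
    simp [lamD, deltaTilde, typeShift, paramType, -Matrix.smul_cons] <;> ring

theorem al_lamD (S : System) (hS : S.Valid) (T : VType) (lam : Fin 4 → ℂ) (m₁ m₂ : ℕ) (x : ℂ) :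
    al S T (lamD S lam m₁ m₂) x = shiftPhase S (typeShift m₁ m₂ T)
      * al S T lam (x - I * typeShift m₁ m₂ T * gam S) := by
  have h : ∀ t : ℂ, ∀ k, lam k + t + I * x = lam k + I * (x - I * t) := by
    intro t k
    linear_combination t * I_mul_I
  rw [lamD_eq]
  generalize typeShift m₁ m₂ = t
  cases S with
  | cH => cases T <;> simp [al, paramType, gam, shiftPhase, h]
  | W => cases T <;> simp [al, paramType, gam, shiftPhase, h]
  | AW q =>
    have h : ∀ T k, paramType (.AW q) k = T → aw q (lam + fun k => t (paramType (.AW q) k)) k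
        * exp (I * x) = aw q lam k * exp (I * (x - I * t T * Real.log q)) := by
      intro T k hk
      rw [aw_add hS.1, mul_assoc, ← exp_add, hk]
      congr 2
      linear_combination (t T * (Real.log q : ℂ)) * I_mul_I
    have h2 : exp (-(Real.log q / 2 : ℂ) - I * x) = exp (Real.log q * t T)
        * exp (-(Real.log q / 2 : ℂ) - I * (x - I * t T * Real.log q)) := by
      rw [← exp_add]
      congr 1
      linear_combination -(t T * (Real.log q : ℂ)) * I_mul_I
    cases T <;> simp only [al, gam, shiftPhase] <;> rw [h2]
    · rw [h .I 0 rfl, h .I 1 rfl, mul_assoc]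
    · rw [h .II 2 rfl, h .II 3 rfl, mul_assoc]

theorem be_lamD (S : System) (hS : S.Valid) (T : VType) (lam : Fin 4 → ℂ) (m₁ m₂ : ℕ) (x : ℂ) :
    be S T (lamD S lam m₁ m₂) x = shiftPhase S (typeShift m₁ m₂ T)
      * be S T lam (x + I * typeShift m₁ m₂ T * gam S) := by
  cases S with
  | cH =>
    have h : ∀ t : ℂ, ∀ k, lam k + t - I * x = lam k - I * (x + I * t) := by
      intro t k
      linear_combination t * I_mul_I
    rw [lamD_eq]
    cases T <;> simp [be, paramType, gam, shiftPhase, h]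
  | W =>
    have := al_lamD .W hS T lam m₁ m₂ (-x)
    simp only [be, this]
    congr 2
    ring
  | AW q =>
    have := al_lamD (.AW q) hS T lam m₁ m₂ (-x)
    simp only [be, this]
    congr 2
    ring

/-- The parameters of the two types move by opposite amounts. Each shift is absorbed into the
argument of its site function, and the two resulting phases cancel. -/
theorem pot_lamD (S : System) (hS : S.Valid) (lam : Fin 4 → ℂ) (m₁ m₂ : ℕ) (x : ℂ) :
    pot S (lamD S lam m₁ m₂) x = al S .I lam (x - I * (((m₂ : ℂ) - m₁) / 2) * gam S)
      * al S .II lam (x + I * (((m₂ : ℂ) - m₁) / 2) * gam S)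
      / (kap S * sg S (2 * x) * sg S (2 * x - I * gam S)) := by
  rw [pot_eq S hS, al_lamD S hS, al_lamD S hS]
  congr 1
  have := shiftPhase_mul S m₁ m₂
  have e : x - I * typeShift m₁ m₂ .II * gam S = x + I * (((m₂ : ℂ) - m₁) / 2) * gam S := by
    rw [typeShift]; ring
  rw [e]
  simp only [show typeShift m₁ m₂ .I = ((m₂ : ℂ) - m₁) / 2 from rfl] at this ⊢
  linear_combination al S .I lam (x - I * (((m₂ : ℂ) - m₁) / 2) * gam S)
      * al S .II lam (x + I * (((m₂ : ℂ) - m₁) / 2) * gam S) * this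

theorem potStar_lamD (S : System) (hS : S.Valid) (lam : Fin 4 → ℂ) (m₁ m₂ : ℕ) (x : ℂ) :
    potStar S (lamD S lam m₁ m₂) x = be S .I lam (x + I * (((m₂ : ℂ) - m₁) / 2) * gam S)
      * be S .II lam (x - I * (((m₂ : ℂ) - m₁) / 2) * gam S)
      / (kap S * sg S (2 * x) * sg S (2 * x + I * gam S)) := by
  rw [potStar_eq S hS, be_lamD S hS, be_lamD S hS]
  congr 1
  have := shiftPhase_mul S m₁ m₂
  have e : x + I * typeShift m₁ m₂ .II * gam S = x - I * (((m₂ : ℂ) - m₁) / 2) * gam S := by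
    rw [typeShift]; ring
  rw [e]
  simp only [show typeShift m₁ m₂ .I = ((m₂ : ℂ) - m₁) / 2 from rfl] at this ⊢
  linear_combination be S .I lam (x + I * (((m₂ : ℂ) - m₁) / 2) * gam S)
      * be S .II lam (x - I * (((m₂ : ℂ) - m₁) / 2) * gam S) * this

end MultiIndexed

namespace MultiIndexed

/-! ### Existence and uniqueness of the polynomials -/

/-- The factor of `α(x) - β(y)` that depends on `x - y`. -/
noncomputable def cAl : System → VType → (Fin 4 → ℂ) → ℂ → ℂ
  | .cH, .I, lam, d => -(lam 0 + lam 2) - I * d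
  | .cH, .II, lam, d => -(lam 1 + lam 3) - I * d
  | .W, .I, lam, d => I * (lam 0 + lam 1) - d
  | .W, .II, lam, d => I * (lam 2 + lam 3) - d
  | .AW q, .I, lam, d => exp (-(Real.log q / 2)) * (2 * I)
      * (aw q lam 0 * aw q lam 1 * exp (I * (d / 2)) - exp (-(I * (d / 2))))
  | .AW q, .II, lam, d => exp (-(Real.log q / 2)) * (2 * I)
      * (aw q lam 2 * aw q lam 3 * exp (I * (d / 2)) - exp (-(I * (d / 2))))

theorem exp_sub_exp_neg (x y : ℂ) :
    exp (I * x) - exp (-(I * y)) = 2 * I * exp (I * ((x - y) / 2)) * sin ((x + y) / 2) := by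
  rw [show I * x = I * ((x - y) / 2) + I * ((x + y) / 2) by ring,
    show -(I * y) = I * ((x - y) / 2) + -(I * ((x + y) / 2)) by ring, exp_add, exp_add,
    Complex.sin, mul_comm ((x + y) / 2) I, show -((x + y) / 2) * I = -(I * ((x + y) / 2)) by ring]
  linear_combination (exp (I * ((x - y) / 2)) * (exp (I * ((x + y) / 2)) - exp (-(I * ((x + y) / 2))))) * I_sq

/-- The congruence behind the polynomials: `α(x) - β(y)` contains the same factor of `x + y` as
`η(x) - η(y)`, and the cofactor depends only on `x - y`, which is constant for a pair of nodes. -/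
theorem al_sub_be (S : System) (T : VType) (lam : Fin 4 → ℂ) (x y : ℂ) :
    al S T lam x - be S T lam y = cAl S T lam (x - y) * sg S (x + y) := by
  cases S with
  | cH => cases T <;> simp only [al, be, cAl, sg] <;> ring
  | W =>
    cases T <;> simp only [al, be, cAl, sg] <;> linear_combination (x ^ 2 - y ^ 2) * I_sq
  | AW q =>
    have e : ∀ A B x : ℂ, exp (-(Real.log q / 2 : ℂ) - I * x) * ((1 - A * exp (I * x)) * (1 - B * exp (I * x)))
        = exp (-(Real.log q / 2 : ℂ)) * (exp (-(I * x)) - (A + B) + A * B * exp (I * x)) := by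
      intro A B x
      rw [sub_eq_add_neg, exp_add]
      have : exp (-(I * x)) * exp (I * x) = 1 := by rw [← exp_add]; simp
      linear_combination exp (-(Real.log q / 2 : ℂ)) * (A * B * exp (I * x) - A - B) * this
    have h1 := exp_sub_exp_neg x y
    have h2 := exp_sub_exp_neg y x
    rw [show (y - x) / 2 = -((x - y) / 2) by ring, mul_neg, add_comm y x] at h2
    cases T <;> simp only [al, be, cAl, sg] <;> rw [e, e, mul_neg, neg_neg]
    · linear_combination exp (-(Real.log q / 2 : ℂ)) * (aw q lam 0 * aw q lam 1) * h1
        - exp (-(Real.log q / 2 : ℂ)) * h2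
    · linear_combination exp (-(Real.log q / 2 : ℂ)) * (aw q lam 2 * aw q lam 3) * h1
        - exp (-(Real.log q / 2 : ℂ)) * h2

/-- An odd function whose square is a polynomial in `η`. -/
noncomputable def oddFn : System → ℂ → ℂ
  | .cH, _ => 0
  | .W, x => x
  | .AW _, x => sin x

open Polynomial in
theorem exists_oddFn_sq (S : System) : ∃ G : ℂ[X], ∀ x, oddFn S x * oddFn S x = G.eval (eta S x) := by
  cases S with
  | cH => exact ⟨0, fun x => by simp [oddFn]⟩
  | W => exact ⟨X, fun x => by simp [oddFn, eta, sq]⟩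
  | AW q => exact ⟨1 - X ^ 2, fun x => by simp [oddFn, eta, Complex.cos_sq', ← sq]⟩

open Polynomial in
/-- The polynomial functions of `x` (cH, W), resp. of `exp (± i x)` (AW). -/
noncomputable def polyFun (S : System) : Subalgebra ℂ (ℂ → ℂ) where
  carrier := {f | ∃ p r : ℂ[X], ∀ x, f x = p.eval (eta S x) + oddFn S x * r.eval (eta S x)}
  mul_mem' := by
    rintro f g ⟨p, r, h⟩ ⟨p', r', h'⟩
    obtain ⟨G, hG⟩ := exists_oddFn_sq S
    refine ⟨p * p' + G * (r * r'), p * r' + p' * r, fun x => ?_⟩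
    rw [Pi.mul_apply, h, h']
    simp only [eval_add, eval_mul, ← hG]
    ring
  add_mem' := by
    rintro f g ⟨p, r, h⟩ ⟨p', r', h'⟩
    refine ⟨p + p', r + r', fun x => ?_⟩
    rw [Pi.add_apply, h, h']
    simp only [eval_add]
    ring
  algebraMap_mem' c := ⟨C c, 0, fun x => by simp⟩

theorem polyFun_const (S : System) (c : ℂ) : (fun _ => c) ∈ polyFun S :=
  (polyFun S).algebraMap_mem c

open Polynomial in
theorem polyFun_W (c d : ℂ) : (fun x => c * x + d) ∈ polyFun .W :=
  ⟨C d, C c, fun x => by simp [oddFn]; ring⟩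

open Polynomial in
theorem polyFun_cH (c d : ℂ) : (fun x => c * x + d) ∈ polyFun .cH :=
  ⟨C c * X + C d, 0, fun x => by simp [eta]⟩

open Polynomial in
theorem polyFun_exp (q : ℝ) (c : ℂ) : (fun x => exp (I * x + c)) ∈ polyFun (.AW q) :=
  ⟨C (exp c) * X, C (exp c * I), fun x => by
    simp only [eval_mul, eval_C, eval_X, eta, oddFn]
    rw [exp_add, mul_comm I x, exp_mul_I]
    ring⟩

open Polynomial in
theorem polyFun_exp_neg (q : ℝ) (c : ℂ) : (fun x => exp (-(I * x) + c)) ∈ polyFun (.AW q) :=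
  ⟨C (exp c) * X, C (-(exp c * I)), fun x => by
    simp only [eval_mul, eval_C, eval_X, eta, oddFn]
    rw [exp_add, show -(I * x) = (-x) * I by ring, exp_mul_I, cos_neg, sin_neg]
    ring⟩

theorem polyFun_sin (q : ℝ) (c : ℂ) : (fun x => sin (x + c)) ∈ polyFun (.AW q) := by
  convert (polyFun (.AW q)).smul_mem ((polyFun (.AW q)).sub_mem (polyFun_exp_neg q (-(I * c)))
    (polyFun_exp q (I * c))) (I / 2) using 1
  ext x
  simp only [Pi.smul_apply, Pi.sub_apply, smul_eq_mul, Complex.sin]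
  rw [show -(x + c) * I = -(I * x) + -(I * c) by ring, show (x + c) * I = I * x + I * c by ring]
  ring

theorem polyFun_cos (q : ℝ) (c : ℂ) : (fun x => cos (x + c)) ∈ polyFun (.AW q) := by
  convert polyFun_sin q (c + Real.pi / 2) using 1
  ext x
  rw [← add_assoc, Complex.sin_add_pi_div_two]

theorem polyFun_al (S : System) (T : VType) (lam : Fin 4 → ℂ) (c : ℂ) :
    (fun x => al S T lam (x + c)) ∈ polyFun S := by
  cases S with
  | cH =>
    cases T
    · convert polyFun_cH (-I) (-(lam 0 + I * c)) using 2; simp only [al]; ring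
    · convert polyFun_cH (-I) (-(lam 1 + I * c)) using 2; simp only [al]; ring
  | W =>
    have h : ∀ k, (fun x => lam k + I * (x + c)) ∈ polyFun .W := fun k => by
      convert polyFun_W I (lam k + I * c) using 2; ring
    cases T
    · exact (polyFun .W).mul_mem (h 0) (h 1)
    · exact (polyFun .W).mul_mem (h 2) (h 3)
  | AW q =>
    have h : ∀ k, (fun x => 1 - aw q lam k * exp (I * (x + c))) ∈ polyFun (.AW q) := fun k =>
      (polyFun (.AW q)).sub_mem ((polyFun (.AW q)).one_mem) ((polyFun (.AW q)).mul_mem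
        (polyFun_const _ _) (by convert polyFun_exp q (I * c) using 3; ring))
    have h0 : (fun x => exp (-(Real.log q / 2) - I * (x + c))) ∈ polyFun (.AW q) := by
      convert polyFun_exp_neg q (-(Real.log q / 2) - I * c) using 3; ring
    cases T
    · exact (polyFun (.AW q)).mul_mem h0 ((polyFun (.AW q)).mul_mem (h 0) (h 1))
    · exact (polyFun (.AW q)).mul_mem h0 ((polyFun (.AW q)).mul_mem (h 2) (h 3))

theorem polyFun_be (S : System) (T : VType) (lam : Fin 4 → ℂ) (c : ℂ) :
    (fun x => be S T lam (x + c)) ∈ polyFun S := by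
  cases S with
  | cH =>
    cases T
    · convert polyFun_cH (-I) (lam 2 - I * c) using 2; simp only [be]; ring
    · convert polyFun_cH (-I) (lam 3 - I * c) using 2; simp only [be]; ring
  | W =>
    have h : ∀ k, (fun x => lam k + I * -(x + c)) ∈ polyFun .W := fun k => by
      convert polyFun_W (-I) (lam k - I * c) using 2; ring
    cases T
    · exact (polyFun .W).mul_mem (h 0) (h 1)
    · exact (polyFun .W).mul_mem (h 2) (h 3)
  | AW q =>
    have h : ∀ k, (fun x => 1 - aw q lam k * exp (I * -(x + c))) ∈ polyFun (.AW q) := fun k =>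
      (polyFun (.AW q)).sub_mem ((polyFun (.AW q)).one_mem) ((polyFun (.AW q)).mul_mem
        (polyFun_const _ _) (by convert polyFun_exp_neg q (-(I * c)) using 3; ring))
    have h0 : (fun x => exp (-(Real.log q / 2) - I * -(x + c))) ∈ polyFun (.AW q) := by
      convert polyFun_exp q (-(Real.log q / 2) + I * c) using 3; ring
    cases T
    · exact (polyFun (.AW q)).mul_mem h0 ((polyFun (.AW q)).mul_mem (h 0) (h 1))
    · exact (polyFun (.AW q)).mul_mem h0 ((polyFun (.AW q)).mul_mem (h 2) (h 3))

theorem polyFun_sg (S : System) (c : ℂ) : (fun x => sg S (2 * x + c)) ∈ polyFun S := by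
  cases S with
  | cH => exact polyFun_const _ _
  | W => exact polyFun_W 2 c
  | AW q =>
    convert polyFun_sin q (c / 2) using 2
    simp only [sg]
    congr 1
    ring

theorem polyFun_eta (S : System) (c : ℂ) : (fun x => eta S (x + c)) ∈ polyFun S := by
  cases S with
  | cH => convert polyFun_cH 1 c using 2; simp [eta]
  | W =>
    convert (polyFun .W).mul_mem (polyFun_W 1 c) (polyFun_W 1 c) using 1
    ext x
    simp only [eta, Pi.mul_apply]
    ring
  | AW q => exact polyFun_cos q c

/-- Evaluation of a polynomial function. -/
noncomputable def polyFunEval (S : System) (x : ℂ) : polyFun S →ₐ[ℂ] ℂ :=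
  (Pi.evalAlgHom ℂ (fun _ : ℂ => ℂ) x).comp (polyFun S).val

theorem polyFunEval_mk (S : System) (x : ℂ) (f : ℂ → ℂ) (hf : f ∈ polyFun S) :
    polyFunEval S x ⟨f, hf⟩ = f x := rfl

theorem polyFun_ext {S : System} {f g : polyFun S} (h : ∀ x, polyFunEval S x f = polyFunEval S x g) :
    f = g := Subtype.ext (funext h)

/-- The shifted factors `s` as elements of the ring of polynomial functions. -/
noncomputable def sgElt (S : System) (n m : ℕ) : polyFun S :=
  ⟨_, polyFun_sg S (I * ((n : ℂ) - 1 - m) * gam S)⟩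

theorem nodeN_add_nodeN (S : System) (n : ℕ) (x : ℂ) (i j : ℕ) :
    nodeN S n x i + nodeN S n x j = 2 * x + I * ((n : ℂ) - 1 - (i + j : ℕ)) * gam S := by
  simp only [nodeN]; push_cast; ring

theorem nodeN_sub_nodeN (S : System) (n : ℕ) (x : ℂ) (i j : ℕ) :
    nodeN S n x i - nodeN S n x j = I * ((j : ℂ) - i) * gam S := by
  simp only [nodeN]; ring

theorem gam_ne_zero (S : System) (hS : S.Valid) : (gam S : ℂ) ≠ 0 := by
  cases S with
  | cH => simp [gam]
  | W => simp [gam]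
  | AW q => exact_mod_cast (Real.log_neg hS.1 hS.2).ne

theorem sin_I_mul_ne_zero {t : ℝ} (ht : t ≠ 0) : sin (I * t) ≠ 0 := by
  rw [mul_comm, Complex.sin_mul_I]
  refine mul_ne_zero ?_ I_ne_zero
  rw [← Complex.ofReal_sinh]
  exact_mod_cast fun h => ht (Real.sinh_eq_zero.mp h)

theorem cEta_ne_zero (S : System) (hS : S.Valid) {i j : ℕ} (h : i ≠ j) :
    cEta S (I * ((j : ℂ) - i) * gam S) ≠ 0 := by
  have h1 : (j : ℂ) - i ≠ 0 := sub_ne_zero.mpr (by exact_mod_cast h.symm)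
  have h2 := gam_ne_zero S hS
  cases S with
  | cH => exact mul_ne_zero (mul_ne_zero I_ne_zero h1) h2
  | W => exact mul_ne_zero (mul_ne_zero I_ne_zero h1) h2
  | AW q =>
    simp only [cEta]
    refine mul_ne_zero (by norm_num) ?_
    have := sin_I_mul_ne_zero (t := ((j : ℝ) - i) * Real.log q / 2) (by
      refine div_ne_zero (mul_ne_zero ?_ ?_) two_ne_zero
      · exact_mod_cast h1
      · exact_mod_cast h2)
    convert this using 2
    simp only [gam]
    push_cast
    ring

/-- For W two different elements differ by a nonzero constant. For AW the addition formula for the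
sine gives a Bézout relation whose right-hand side is the sine of a nonzero imaginary number. For cH
the elements are 1. -/
theorem isCoprime_sgElt (S : System) (hS : S.Valid) (n : ℕ) {m m' : ℕ} (h : m ≠ m') :
    IsCoprime (sgElt S n m) (sgElt S n m') := by
  have hc := cEta_ne_zero S hS h
  cases S with
  | cH => exact ⟨1, 0, polyFun_ext fun x => by simp [sgElt, polyFunEval_mk, sg]⟩
  | W =>
    set c := cEta .W (I * ((m' : ℂ) - m) * gam .W) with hcd
    refine ⟨algebraMap ℂ _ c⁻¹, algebraMap ℂ _ (-c⁻¹), polyFun_ext fun x => ?_⟩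
    simp only [map_add, map_mul, map_one, AlgHom.commutes, sgElt, polyFunEval_mk, sg,
      Algebra.algebraMap_self, RingHom.id_apply]
    field_simp
    rw [hcd]
    simp only [cEta]
    ring
  | AW q =>
    set c := cEta (.AW q) (I * ((m' : ℂ) - m) * gam (.AW q)) with hcd
    refine ⟨algebraMap ℂ _ (-2 * c⁻¹) * ⟨_, polyFun_cos q (I * ((n : ℂ) - 1 - m') * gam (.AW q) / 2)⟩,
      algebraMap ℂ _ (2 * c⁻¹) * ⟨_, polyFun_cos q (I * ((n : ℂ) - 1 - m) * gam (.AW q) / 2)⟩,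
      polyFun_ext fun x => ?_⟩
    simp only [map_add, map_mul, map_one, AlgHom.commutes, sgElt, polyFunEval_mk, sg,
      Algebra.algebraMap_self, RingHom.id_apply]
    have h3 := Complex.sin_sub (x + I * ((n : ℂ) - 1 - m) * gam (.AW q) / 2)
      (x + I * ((n : ℂ) - 1 - m') * gam (.AW q) / 2)
    rw [show x + I * ((n : ℂ) - 1 - m) * gam (.AW q) / 2 - (x + I * ((n : ℂ) - 1 - m') * gam (.AW q) / 2)
      = I * ((m' : ℂ) - m) * gam (.AW q) / 2 by ring] at h3
    simp only [cEta] at hcd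
    rw [show (2 * x + I * ((n : ℂ) - 1 - m) * gam (.AW q)) / 2
      = x + I * ((n : ℂ) - 1 - m) * gam (.AW q) / 2 by ring,
      show (2 * x + I * ((n : ℂ) - 1 - m') * gam (.AW q)) / 2
      = x + I * ((n : ℂ) - 1 - m') * gam (.AW q) / 2 by ring]
    linear_combination (2 * c⁻¹) * h3 - c⁻¹ * hcd + mul_inv_cancel₀ hc

end MultiIndexed

/-! ### Families of columns and the polynomial parts of their determinants -/

namespace MultiIndexed

/-- The labels of the columns of the determinants. -/
inductive Col where
  | X : ℕ → Col
  | Y : ℕ → Col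
  | Z : ℕ → Col

/-- Whether a column contains the row factors of the given type. -/
def Col.uses : VType → Col → Bool
  | .I, .X _ => false
  | .I, _ => true
  | .II, .Y _ => false
  | .II, _ => true

/-- The polynomial that generates a column. -/
noncomputable def Col.poly (S : System) (lam : Fin 4 → ℂ) : Col → Polynomial ℂ
  | .X v => basePoly S (twist S .I lam) v
  | .Y v => basePoly S (twist S .II lam) v
  | .Z m => basePoly S lam m

/-- The determinants of arbitrary columns. -/
noncomputable def colMat (S : System) (lam : Fin 4 → ℂ) {n : ℕ} (c : Fin n → Col) (x : ℂ) :
    Matrix (Fin n) (Fin n) ℂ :=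
  Matrix.of fun j k => (if (c k).uses .I then rowFac S .I lam n x j else 1)
    * (if (c k).uses .II then rowFac S .II lam n x j else 1)
    * ((c k).poly S lam).eval (eta S (node S n x j))

/-- The number of columns that contain the row factors of the given type. -/
def usesCard (T : VType) {n : ℕ} (c : Fin n → Col) : ℕ :=
  (Finset.univ.filter fun k => (c k).uses T = true).card

/-- The constant by which `detDen` differs from a product of site functions. -/
noncomputable def detDenConst (S : System) (n m₁ m₂ : ℕ) : ℂ :=
  (∏ i : Fin n, ∏ j ∈ Finset.Ioi i, cEta S (I * (((j : ℕ) : ℂ) - (i : ℕ)) * gam S))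
    * (∏ j ∈ Finset.range m₁, facConst S n j) * ∏ j ∈ Finset.range m₂, facConst S n j

theorem detDenConst_ne_zero (S : System) (hS : S.Valid) (n m₁ m₂ : ℕ) : detDenConst S n m₁ m₂ ≠ 0 := by
  refine mul_ne_zero (mul_ne_zero ?_ ?_) ?_
  · refine Finset.prod_ne_zero_iff.mpr fun i _ => Finset.prod_ne_zero_iff.mpr fun j hj => ?_
    exact cEta_ne_zero S hS fun h => (Finset.mem_Ioi.mp hj).ne (Fin.ext h)
  · exact Finset.prod_ne_zero_iff.mpr fun j _ => facConst_ne_zero S n j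
  · exact Finset.prod_ne_zero_iff.mpr fun j _ => facConst_ne_zero S n j

/-- Up to a nonzero constant, the explicit denominator is the divisor of the abstract argument. The
bound `n + 1` suffices because a product over `m` indices only involves exponents up to `m - 1`. -/
theorem detDen_eq (S : System) (hS : S.Valid) (lam : Fin 4 → ℂ) {n m₁ m₂ : ℕ} (h₁ : m₁ ≤ n + 1)
    (h₂ : m₂ ≤ n + 1) (x : ℂ) :
    detDen S lam n m₁ m₂ x = detDenConst S n m₁ m₂
      * ((∏ i : Fin n, ∏ j ∈ Finset.Ioi i, sg S (nodeN S n x i + nodeN S n x j))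
        * denProd (fun i => al S .II lam (nodeN S n x i)) (fun i => be S .II lam (nodeN S n x i)) n m₁
        * denProd (fun i => al S .I lam (nodeN S n x i)) (fun i => be S .I lam (nodeN S n x i)) n m₂) := by
  have hf : ∀ T, ∀ m ≤ n + 1, ∏ j ∈ Finset.range m, facProd S T lam n j j x
      = (∏ j ∈ Finset.range m, facConst S n j)
        * denProd (fun i => al S T lam (nodeN S n x i)) (fun i => be S T lam (nodeN S n x i)) n m := by
    intro T m hm
    rw [denProd, ← Finset.prod_mul_distrib]
    exact Finset.prod_congr rfl fun j hj => facProd_eq S hS T lam n x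
      (by have := Finset.mem_range.mp hj; omega)
  have hv : ∏ j : Fin n, ∏ k ∈ Finset.Ioi j, (eta S (node S n x j) - eta S (node S n x k))
      = (∏ i : Fin n, ∏ j ∈ Finset.Ioi i, cEta S (I * (((j : ℕ) : ℂ) - (i : ℕ)) * gam S))
        * ∏ i : Fin n, ∏ j ∈ Finset.Ioi i, sg S (nodeN S n x i + nodeN S n x j) := by
    simp only [← Finset.prod_mul_distrib]
    refine Finset.prod_congr rfl fun i _ => Finset.prod_congr rfl fun j _ => ?_
    rw [eta_sub_eta, node_eq_nodeN, node_eq_nodeN, nodeN_sub_nodeN]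
  rw [detDen, hf _ _ h₁, hf _ _ h₂, hv, detDenConst]
  ring

theorem usesCard_le (T : VType) {n : ℕ} (c : Fin n → Col) : usesCard T c ≤ n :=
  (Finset.card_filter_le _ _).trans (by simp)

/-- Applies the abstract divisibility in the ring `polyFun S`. The polynomial of a column takes
congruent values at two nodes because the values of `η` there are congruent. -/
theorem exists_polyFun_det_colMat (S : System) (hS : S.Valid) (lam : Fin 4 → ℂ) {n : ℕ} (c : Fin n → Col) :
    ∃ Q ∈ polyFun S, ∀ x, (colMat S lam c x).det
      = detDen S lam n (usesCard .II c) (usesCard .I c) x * Q x := by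
  let a : VType → ℕ → polyFun S := fun T i => ⟨_, polyFun_al S T lam (I * (((n : ℂ) - 1) / 2 - i) * gam S)⟩
  let b : VType → ℕ → polyFun S := fun T i => ⟨_, polyFun_be S T lam (I * (((n : ℂ) - 1) / 2 - i) * gam S)⟩
  let e : ℕ → polyFun S := fun i => ⟨_, polyFun_eta S (I * (((n : ℂ) - 1) / 2 - i) * gam S)⟩
  have hs : ∀ (i j : ℕ) x, polyFunEval S x (sgElt S n (i + j)) = sg S (nodeN S n x i + nodeN S n x j) := by
    intro i j x
    rw [nodeN_add_nodeN]
    rfl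
  have hdvd : ∀ T, ∀ i < n, ∀ j < n, sgElt S n (i + j) ∣ a T i - b T j := by
    intro T i _ j _
    refine ⟨algebraMap ℂ _ (cAl S T lam (I * ((j : ℂ) - i) * gam S)), polyFun_ext fun x => ?_⟩
    rw [map_sub, map_mul, hs, AlgHom.commutes, ← nodeN_sub_nodeN S n x i j]
    exact (al_sub_be S T lam _ _).trans (mul_comm _ _)
  have heta : ∀ i j, sgElt S n (i + j) ∣ e i - e j := by
    intro i j
    refine ⟨algebraMap ℂ _ (cEta S (I * ((j : ℂ) - i) * gam S)), polyFun_ext fun x => ?_⟩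
    rw [map_sub, map_mul, hs, AlgHom.commutes, ← nodeN_sub_nodeN S n x i j]
    exact (eta_sub_eta S _ _).trans (mul_comm _ _)
  let g : Fin n → ℕ → polyFun S := fun k i => Polynomial.aeval (e i) ((c k).poly S lam)
  have hg : ∀ k, ∀ i < n, ∀ j < n, sgElt S n (i + j) ∣ g k i - g k j := fun k i _ j _ => by
    refine (heta i j).trans ?_
    simp only [g, ← Polynomial.eval_map_algebraMap]
    exact Polynomial.sub_dvd_eval_sub _ _ _
  obtain ⟨Q, hQ⟩ := exists_det_rowProdMatrix_eq (sgElt S n) (a .I) (b .I) (a .II) (b .II)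
    (Finset.univ.filter fun k => (c k).uses .I = true) (Finset.univ.filter fun k => (c k).uses .II = true) g
    (fun m m' h => isCoprime_sgElt S hS n h) (hdvd .I) (hdvd .II) hg
  have hd : ∀ T m x, polyFunEval S x (denProd (a T) (b T) n m)
      = denProd (fun i => al S T lam (nodeN S n x i)) (fun i => be S T lam (nodeN S n x i)) n m := by
    intro T m x
    simp only [denProd, map_prod, map_mul]
    rfl
  have hr : ∀ T j x, polyFunEval S x (rowProd (a T) (b T) n j)
      = rowProd (fun i => al S T lam (nodeN S n x i)) (fun i => be S T lam (nodeN S n x i)) n j := by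
    intro T m x
    simp only [rowProd, map_prod, map_mul]
    rfl
  refine ⟨fun x => (detDenConst S n (usesCard .II c) (usesCard .I c))⁻¹ * polyFunEval S x Q,
    (polyFun S).smul_mem Q.2 _, fun x => ?_⟩
  have hx := congrArg (polyFunEval S x) hQ
  have hM : (polyFunEval S x).mapMatrix (rowProdMatrix (a .I) (b .I) (a .II) (b .II)
      (Finset.univ.filter fun k => (c k).uses .I = true)
      (Finset.univ.filter fun k => (c k).uses .II = true) g) = colMat S lam c x := by
    ext j k
    have hgk : polyFunEval S x (g k j) = ((c k).poly S lam).eval (eta S (node S n x j)) := by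
      simp only [g]
      rw [← Polynomial.aeval_algHom_apply]
      simp only [Polynomial.coe_aeval_eq_eval]
      rfl
    simp only [AlgHom.mapMatrix_apply, Matrix.map_apply, rowProdMatrix, Matrix.of_apply, map_mul,
      apply_ite (polyFunEval S x), map_one, hr, hgk, colMat, rowFac_eq_rowProd S hS,
      Finset.mem_filter, Finset.mem_univ, true_and]
  rw [AlgHom.map_det, hM] at hx
  rw [hx, detDen_eq S hS lam ((usesCard_le _ _).trans n.le_succ) ((usesCard_le _ _).trans n.le_succ)]
  simp only [map_mul, map_prod, hd, hs]
  have := detDenConst_ne_zero S hS n (usesCard .II c) (usesCard .I c)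
  field_simp
  simp only [usesCard]
  ring

theorem facProd_neg {S : System} (hS : S ≠ .cH) (T : VType) (lam : Fin 4 → ℂ) (n s t : ℕ) (x : ℂ) :
    facProd S T lam n s t (-x) = facProd S T lam n t s x := by
  have : minusIdx S T = plusIdx S T := by
    cases S <;> cases T <;> first | rfl | exact absurd rfl hS
  rw [facProd, facProd, this, neg_neg, mul_comm]

theorem eta_neg {S : System} (hS : S ≠ .cH) (x : ℂ) : eta S (-x) = eta S x := by
  cases S with
  | cH => exact absurd rfl hS
  | W => simp [eta]
  | AW q => simp [eta]

theorem node_neg (S : System) (n : ℕ) (x : ℂ) (j : Fin n) : node S n (-x) j = -node S n x (Fin.rev j) := by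
  have := nodeN_reflect S j.2 x
  rw [node_eq_nodeN, node_eq_nodeN, Fin.val_rev, show n - (j + 1) = n - 1 - (j : ℕ) by omega, this, neg_neg]

theorem eta_node_neg {S : System} (hS : S ≠ .cH) (n : ℕ) (x : ℂ) (j : Fin n) :
    eta S (node S n (-x) j) = eta S (node S n x (Fin.rev j)) := by
  rw [node_neg, eta_neg hS]

theorem phase_neg {S : System} (hS : S ≠ .cH) (n : ℕ) (x : ℂ) (j : Fin n) :
    phase S n (-x) j = phase S n x (Fin.rev j) := by
  cases S with
  | cH => exact absurd rfl hS
  | W => rfl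
  | AW q =>
    have h1 : n - (j + 1) = n - 1 - (j : ℕ) := by omega
    have h2 : n - 1 - (n - 1 - (j : ℕ)) = j := by omega
    simp only [phase, Fin.val_rev, h1, h2, mul_comm (n - 1 - (j : ℕ)) (j : ℕ)]
    congr 2
    rw [Nat.sub_sub, Nat.cast_sub (by omega)]
    push_cast
    ring

theorem rowFac_neg {S : System} (hS : S ≠ .cH) (T : VType) (lam : Fin 4 → ℂ) (n : ℕ) (x : ℂ) (j : Fin n) :
    rowFac S T lam n (-x) j = rowFac S T lam n x (Fin.rev j) := by
  have h1 : n - (j + 1) = n - 1 - (j : ℕ) := by omega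
  have h2 : n - 1 - (n - 1 - (j : ℕ)) = j := by omega
  rw [rowFac, rowFac, facProd_neg hS, phase_neg hS, Fin.val_rev, h1, h2]

/-- Replacing `x` by `-x` reverses the order of the nodes and hence of the rows. The denominator
acquires the same sign, so the quotient is even. -/
theorem det_colMat_neg {S : System} (hS : S ≠ .cH) (lam : Fin 4 → ℂ) {n : ℕ} (c : Fin n → Col) (x : ℂ) :
    (colMat S lam c (-x)).det = ((Fin.revPerm (n := n)).sign : ℤ) * (colMat S lam c x).det := by
  rw [← Matrix.det_permute Fin.revPerm]
  congr 1
  ext j k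
  simp [colMat, rowFac_neg hS, eta_node_neg hS]

theorem prod_eta_sub_eq_det (S : System) (n : ℕ) (x : ℂ) :
    ∏ j : Fin n, ∏ k ∈ Finset.Ioi j, (eta S (node S n x j) - eta S (node S n x k))
      = (Matrix.vandermonde fun j => -eta S (node S n x j)).det := by
  rw [Matrix.det_vandermonde]
  exact Finset.prod_congr rfl fun j _ => Finset.prod_congr rfl fun k _ => by ring

theorem detDen_neg {S : System} (hS : S ≠ .cH) (lam : Fin 4 → ℂ) (n m₁ m₂ : ℕ) (x : ℂ) :
    detDen S lam n m₁ m₂ (-x) = ((Fin.revPerm (n := n)).sign : ℤ) * detDen S lam n m₁ m₂ x := by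
  simp only [detDen, facProd_neg hS]
  rw [prod_eta_sub_eq_det, prod_eta_sub_eq_det]
  have := Matrix.det_permute Fin.revPerm (Matrix.vandermonde fun j : Fin n => -eta S (node S n x j))
  rw [← mul_assoc, ← mul_assoc, ← this]
  congr 3
  ext j k
  simp [Matrix.vandermonde, eta_node_neg hS]

/-- Averaging the factorizations at `x` and `-x` removes the odd part of the quotient, leaving a
polynomial in `η`. For cH there is no odd part. -/
theorem exists_poly_det_colMat (S : System) (hS : S.Valid) (lam : Fin 4 → ℂ) {n : ℕ} (c : Fin n → Col) :
    ∃ p : Polynomial ℂ, ∀ x, (colMat S lam c x).det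
      = detDen S lam n (usesCard .II c) (usesCard .I c) x * p.eval (eta S x) := by
  obtain ⟨Q, ⟨p, r, hQ⟩, h⟩ := exists_polyFun_det_colMat S hS lam c
  refine ⟨p, fun x => ?_⟩
  by_cases hc : S = .cH
  · subst hc
    rw [h, hQ, oddFn]
    ring
  · have h1 := h x
    have h2 := h (-x)
    rw [det_colMat_neg hc, detDen_neg hc, mul_assoc] at h2
    have hu : (((Fin.revPerm (n := n)).sign : ℤ) : ℂ) ≠ 0 := by
      exact_mod_cast (Units.ne_zero _)
    have h3 := mul_left_cancel₀ hu h2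
    have ho : oddFn S (-x) = -oddFn S x := by
      cases S with
      | cH => exact absurd rfl hc
      | W => rfl
      | AW q => exact sin_neg x
    rw [hQ, eta_neg hc, ho] at h3
    rw [hQ] at h1
    linear_combination (h1 + h3) / 2

end MultiIndexed

namespace MultiIndexed

/-! ### The difference equations -/

/-- The operator is triangular on the basis `φ`, and the coefficients solve the resulting two-term
recursion. A partial sum then satisfies the eigenvalue equation up to `c k * (e k - e n) * φ k`,
which is zero at `k = n`. -/
theorem sum_eigen_of_triangular {K : Type*} [Field K] {n : ℕ} {c φ φm φp d e : ℕ → K} {V W : K}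
    (h0 : V * (φm 0 - φ 0) + W * (φp 0 - φ 0) = e 0 * φ 0)
    (hs : ∀ k < n, V * (φm (k + 1) - φ (k + 1)) + W * (φp (k + 1) - φ (k + 1))
      = e (k + 1) * φ (k + 1) - d k * φ k)
    (hc : ∀ k < n, c (k + 1) * d k = c k * (e k - e n)) :
    V * ((∑ k ∈ Finset.range (n + 1), c k * φm k) - ∑ k ∈ Finset.range (n + 1), c k * φ k)
      + W * ((∑ k ∈ Finset.range (n + 1), c k * φp k) - ∑ k ∈ Finset.range (n + 1), c k * φ k)
      = e n * ∑ k ∈ Finset.range (n + 1), c k * φ k := by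
  have h : ∀ k ≤ n, (V * ((∑ k ∈ Finset.range (k + 1), c k * φm k) - ∑ k ∈ Finset.range (k + 1), c k * φ k)
      + W * ((∑ k ∈ Finset.range (k + 1), c k * φp k) - ∑ k ∈ Finset.range (k + 1), c k * φ k))
      = e n * (∑ k ∈ Finset.range (k + 1), c k * φ k) + c k * (e k - e n) * φ k := by
    intro k hk
    induction k with
    | zero =>
      simp only [zero_add, Finset.sum_range_one]
      linear_combination c 0 * h0
    | succ k ih =>
      rw [Finset.sum_range_succ _ (k + 1), Finset.sum_range_succ _ (k + 1),
        Finset.sum_range_succ _ (k + 1)]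
      linear_combination ih (by omega) + c (k + 1) * hs k (by omega) - φ k * hc k (by omega)
  rw [h n le_rfl]
  ring

theorem poch_succ (a : ℂ) (n : ℕ) : poch a (n + 1) = poch a n * (a + n) := Finset.prod_range_succ _ _

theorem poch_succ' (a : ℂ) (n : ℕ) : poch a (n + 1) = a * poch (a + 1) n := by
  rw [poch, Finset.prod_range_succ', poch, mul_comm]
  simp [add_assoc, add_comm (1 : ℂ)]

theorem poch_tail (a : ℂ) {k n : ℕ} (hk : k < n) :
    poch (a + k) (n - k) = (a + k) * poch (a + (k + 1 : ℕ)) (n - (k + 1)) := by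
  rw [show n - k = n - (k + 1) + 1 by omega, poch_succ']
  push_cast
  rw [add_assoc]

theorem qpoch_succ (q : ℝ) (a : ℂ) (n : ℕ) : qpoch q a (n + 1) = qpoch q a n * (1 - a * (q : ℂ) ^ n) :=
  Finset.prod_range_succ _ _

theorem qpoch_succ' (q : ℝ) (a : ℂ) (n : ℕ) : qpoch q a (n + 1) = (1 - a) * qpoch q (a * q) n := by
  rw [qpoch, Finset.prod_range_succ', qpoch, mul_comm]
  simp [pow_succ', mul_assoc]

theorem qpoch_tail (q : ℝ) (a : ℂ) {k n : ℕ} (hk : k < n) :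
    qpoch q (a * (q : ℂ) ^ k) (n - k)
      = (1 - a * (q : ℂ) ^ k) * qpoch q (a * (q : ℂ) ^ (k + 1)) (n - (k + 1)) := by
  rw [show n - k = n - (k + 1) + 1 by omega, qpoch_succ', pow_succ, mul_assoc a]

/-- The basis of polynomials in which the difference operators are triangular. -/
noncomputable def basisW (a y : ℂ) (k : ℕ) : ℂ := ∏ i ∈ Finset.range k, ((a + i + y) * (a + i - y))

theorem basisW_succ (a y : ℂ) (k : ℕ) :
    basisW a y (k + 1) = basisW a y k * ((a + k + y) * (a + k - y)) := Finset.prod_range_succ _ _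

theorem basisW_neg (a y : ℂ) (k : ℕ) : basisW a (-y) k = basisW a y k :=
  Finset.prod_congr rfl fun i _ => by ring

/-- A unit step of `y` changes only the end factors of the two shifted factorials. The factor `a +
y`, present in the potential, is kept on the left so that nothing has to be divided by it. -/
theorem basisW_shift (a y : ℂ) (k : ℕ) : (a + y) * basisW a (y + 1) (k + 1)
    = basisW a y k * ((a + y + k) * (a + y + k + 1) * (a - y - 1)) := by
  induction k with
  | zero => simp [basisW]; ring
  | succ k ih =>
    rw [basisW_succ _ _ (k + 1), ← mul_assoc, ih, basisW_succ]
    push_cast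
    ring

/-- With the factor `a ± y` of the potential, the difference of basis elements is a multiple of `1 ±
2y` times the previous basis element. This cancels that factor of the denominator, and a rational
identity in `y` remains. -/
theorem basisW_triangular (a b c d y : ℂ) (k : ℕ) (h0 : y ≠ 0) (h1 : 2 * y + 1 ≠ 0) (h2 : 2 * -y + 1 ≠ 0) :
    (a + y) * (b + y) * (c + y) * (d + y) / (2 * y * (2 * y + 1))
        * (basisW a (y + 1) (k + 1) - basisW a y (k + 1))
      + (a + -y) * (b + -y) * (c + -y) * (d + -y) / (2 * -y * (2 * -y + 1))
        * (basisW a (y - 1) (k + 1) - basisW a y (k + 1))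
      = (k + 1) * (k + 1 + (a + b + c + d) - 1) * basisW a y (k + 1)
        - (k + 1) * ((a + b + k) * (a + c + k) * (a + d + k)) * basisW a y k := by
  have e1 := basisW_shift a y k
  have e2 := basisW_shift a (-y) k
  rw [show -y + 1 = -(y - 1) by ring, basisW_neg, basisW_neg] at e2
  have e3 := basisW_succ a y k
  have f1 : (a + y) * (basisW a (y + 1) (k + 1) - basisW a y (k + 1))
      = -(k + 1) * (2 * y + 1) * (a + y + k) * basisW a y k := by
    linear_combination e1 - (a + y) * e3
  have f2 : (a + -y) * (basisW a (y - 1) (k + 1) - basisW a y (k + 1))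
      = -(k + 1) * (2 * -y + 1) * (a + -y + k) * basisW a y k := by
    linear_combination e2 - (a + -y) * e3
  have g : ∀ w X : ℂ, w ≠ 0 → 2 * w + 1 ≠ 0 →
      (a + w) * X = -(k + 1) * (2 * w + 1) * (a + w + k) * basisW a y k →
      (a + w) * (b + w) * (c + w) * (d + w) / (2 * w * (2 * w + 1)) * X
        = (b + w) * (c + w) * (d + w) / (2 * w) * (-(k + 1) * (a + w + k) * basisW a y k) := by
    intro w X hw hw1 hX
    rw [div_mul_eq_mul_div, div_mul_eq_mul_div, div_eq_div_iff (mul_ne_zero (by simp [hw]) hw1) (by simp [hw])]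
    linear_combination (b + w) * (c + w) * (d + w) * (2 * w) * hX
  rw [g y _ h0 h1 f1, g (-y) _ (neg_ne_zero.mpr h0) h2 f2, e3]
  field_simp
  ring

theorem pot_W (lam : Fin 4 → ℂ) (x : ℂ) : pot .W lam x
    = (lam 0 + I * x) * (lam 1 + I * x) * (lam 2 + I * x) * (lam 3 + I * x)
      / (2 * (I * x) * (2 * (I * x) + 1)) := by
  simp only [pot, potNum, potDen, Fin.prod_univ_four]
  ring

theorem basePoly_W_eval (lam : Fin 4 → ℂ) (n : ℕ) (x : ℂ) : (basePoly .W lam n).eval (eta .W x)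
    = ∑ k ∈ Finset.range (n + 1), (poch (-(n : ℂ)) k * poch (n + (∑ i : Fin 4, lam i) - 1) k / (k.factorial : ℂ)
        * poch (lam 0 + lam 1 + k) (n - k) * poch (lam 0 + lam 2 + k) (n - k)
        * poch (lam 0 + lam 3 + k) (n - k)) * basisW (lam 0) (I * x) k := by
  simp only [basePoly, Polynomial.eval_finsetSum, Polynomial.eval_mul, Polynomial.eval_C,
    Polynomial.eval_prod, Polynomial.eval_add, Polynomial.eval_X, eta, basisW]
  refine Finset.sum_congr rfl fun k _ => ?_
  congr 1
  refine Finset.prod_congr rfl fun i _ => ?_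
  linear_combination x ^ 2 * I_sq

theorem basePoly_W_diffEq (lam : Fin 4 → ℂ) (n : ℕ) (x : ℂ) (h1 : potDen .W x ≠ 0) (h2 : potDen .W (-x) ≠ 0) :
    pot .W lam x * ((basePoly .W lam n).eval (eta .W (x - I * gam .W)) - (basePoly .W lam n).eval (eta .W x))
      + potStar .W lam x * ((basePoly .W lam n).eval (eta .W (x + I * gam .W))
        - (basePoly .W lam n).eval (eta .W x))
      = energy .W lam n * (basePoly .W lam n).eval (eta .W x) := by
  have hy : I * x ≠ 0 := by rintro h; exact h1 (by simp only [potDen]; rw [show 2 * I * x = 2 * (I * x) by ring, h]; simp)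
  have hy1 : 2 * (I * x) + 1 ≠ 0 := by
    intro h; exact h1 (by simp only [potDen]; rw [show 2 * I * x + 1 = 2 * (I * x) + 1 by ring, h]; simp)
  have hy2 : 2 * -(I * x) + 1 ≠ 0 := by
    intro h; exact h2 (by simp only [potDen]; rw [show 2 * I * -x + 1 = 2 * -(I * x) + 1 by ring, h]; simp)
  have em : I * (x - I * gam .W) = I * x + 1 := by
    simp only [gam, ofReal_one]; linear_combination -I_mul_I
  have ep : I * (x + I * gam .W) = I * x - 1 := by
    simp only [gam, ofReal_one]; linear_combination I_mul_I
  simp only [basePoly_W_eval, em, ep, potStar, pot_W, mul_neg I x]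
  generalize I * x = y at *
  refine sum_eigen_of_triangular (e := fun k => energy .W lam k)
    (d := fun k => (k + 1) * ((lam 0 + lam 1 + k) * (lam 0 + lam 2 + k) * (lam 0 + lam 3 + k))) ?_ ?_ ?_
  · simp [basisW, energy]
  · intro k _
    rw [basisW_triangular _ _ _ _ _ _ hy hy1 hy2]
    simp only [energy, Fin.sum_univ_four]
    push_cast
    ring
  · intro k hk
    rw [poch_tail (lam 0 + lam 1) hk, poch_tail (lam 0 + lam 2) hk, poch_tail (lam 0 + lam 3) hk,
      poch_succ, poch_succ, Nat.factorial_succ]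
    simp only [energy]
    have hk1 : (k : ℂ) + 1 ≠ 0 := by exact_mod_cast k.succ_ne_zero
    have hk2 : (k.factorial : ℂ) ≠ 0 := by exact_mod_cast k.factorial_ne_zero
    push_cast
    field_simp
    ring

theorem poch_shift (a : ℂ) (k : ℕ) : a * poch (a + 1) (k + 1) = poch a k * ((a + k) * (a + k + 1)) := by
  rw [← poch_succ', poch_succ, poch_succ]
  push_cast
  ring

theorem basePoly_cH_eval (lam : Fin 4 → ℂ) (n : ℕ) (x : ℂ) : (basePoly .cH lam n).eval (eta .cH x)
    = I ^ n / (n.factorial : ℂ) * ∑ k ∈ Finset.range (n + 1),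
        (poch (-(n : ℂ)) k * poch (n + (∑ i : Fin 4, lam i) - 1) k / (k.factorial : ℂ)
        * poch (lam 0 + lam 2 + k) (n - k) * poch (lam 0 + lam 3 + k) (n - k))
        * poch (lam 0 + I * x) k := by
  simp only [basePoly, Polynomial.eval_finsetSum, Polynomial.eval_mul, Polynomial.eval_C,
    Polynomial.eval_prod, Polynomial.eval_add, Polynomial.eval_X, eta, poch]
  congr 1
  refine Finset.sum_congr rfl fun k _ => ?_
  congr 1
  exact Finset.prod_congr rfl fun i _ => by ring

theorem basePoly_cH_diffEq (lam : Fin 4 → ℂ) (n : ℕ) (x : ℂ) :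
    pot .cH lam x * ((basePoly .cH lam n).eval (eta .cH (x - I * gam .cH)) - (basePoly .cH lam n).eval (eta .cH x))
      + potStar .cH lam x * ((basePoly .cH lam n).eval (eta .cH (x + I * gam .cH))
        - (basePoly .cH lam n).eval (eta .cH x))
      = energy .cH lam n * (basePoly .cH lam n).eval (eta .cH x) := by
  have em : lam 0 + I * (x - I * gam .cH) = lam 0 + I * x + 1 := by
    simp only [gam, ofReal_one]; linear_combination -I_mul_I
  have ep : lam 0 + I * (x + I * gam .cH) = lam 0 + I * x - 1 := by
    simp only [gam, ofReal_one]; linear_combination I_mul_I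
  simp only [basePoly_cH_eval, em, ep, potStar, pot, potNum, potDen, div_one]
  rw [← mul_sub, ← mul_sub, mul_left_comm, mul_left_comm ((lam 2 - I * x) * (lam 3 - I * x)), ← mul_add,
    mul_left_comm (energy .cH lam n)]
  congr 1
  generalize I * x = y at *
  refine sum_eigen_of_triangular (e := fun k => energy .cH lam k)
    (d := fun k => (k + 1) * ((lam 0 + lam 2 + k) * (lam 0 + lam 3 + k))) ?_ ?_ ?_
  · simp [poch, energy]
  · intro k _
    have e1 := poch_shift (lam 0 + y) k
    have e2 := poch_succ' (lam 0 + y - 1) k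
    rw [sub_add_cancel] at e2
    have e3 := poch_succ (lam 0 + y) k
    simp only [energy, Fin.sum_univ_four]
    push_cast
    rw [e2, e3]
    linear_combination (lam 1 + y) * e1
  · intro k hk
    rw [poch_tail (lam 0 + lam 2) hk, poch_tail (lam 0 + lam 3) hk,
      poch_succ, poch_succ, Nat.factorial_succ]
    simp only [energy]
    have hk1 : (k : ℂ) + 1 ≠ 0 := by exact_mod_cast k.succ_ne_zero
    have hk2 : (k.factorial : ℂ) ≠ 0 := by exact_mod_cast k.factorial_ne_zero
    push_cast
    field_simp
    ring

end MultiIndexed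

/-! ### The Askey–Wilson difference equation -/

namespace MultiIndexed

/-- The basis of polynomials in which the Askey-Wilson operator is triangular. -/
noncomputable def basisAW (Q a z : ℂ) (k : ℕ) : ℂ :=
  ∏ i ∈ Finset.range k, ((1 - a * Q ^ i * z) * (1 - a * Q ^ i * z⁻¹))

theorem basisAW_succ (Q a z : ℂ) (k : ℕ) :
    basisAW Q a z (k + 1) = basisAW Q a z k * ((1 - a * Q ^ k * z) * (1 - a * Q ^ k * z⁻¹)) :=
  Finset.prod_range_succ _ _

theorem basisAW_inv (Q a z : ℂ) (k : ℕ) : basisAW Q a z⁻¹ k = basisAW Q a z k :=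
  Finset.prod_congr rfl fun i _ => by rw [inv_inv]; ring

theorem basisAW_shift {Q z : ℂ} (hQ : Q ≠ 0) (hz : z ≠ 0) (a : ℂ) (k : ℕ) :
    (1 - a * z) * basisAW Q a (Q * z) (k + 1)
      = basisAW Q a z k * ((1 - a * Q ^ k * z) * (1 - a * Q ^ k * Q * z) * (1 - a * (Q * z)⁻¹)) := by
  induction k with
  | zero => simp [basisAW]; ring
  | succ k ih =>
    rw [basisAW_succ _ _ _ (k + 1), ← mul_assoc, ih, basisAW_succ, pow_succ Q k]
    field_simp

/-- As for Wilson: the factor `1 - a z` of the potential makes the difference of basis elements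
divisible by `1 - Q z ^ 2`. -/
theorem basisAW_triangular {Q z : ℂ} (hQ : Q ≠ 0) (hz : z ≠ 0) (a b c d : ℂ) (k : ℕ) (h0 : 1 - z ^ 2 ≠ 0)
    (h1 : 1 - Q * z ^ 2 ≠ 0) (h2 : 1 - Q * z⁻¹ ^ 2 ≠ 0) :
    (1 - a * z) * (1 - b * z) * (1 - c * z) * (1 - d * z) / ((1 - z ^ 2) * (1 - Q * z ^ 2))
        * (basisAW Q a (Q * z) (k + 1) - basisAW Q a z (k + 1))
      + (1 - a * z⁻¹) * (1 - b * z⁻¹) * (1 - c * z⁻¹) * (1 - d * z⁻¹) / ((1 - z⁻¹ ^ 2) * (1 - Q * z⁻¹ ^ 2))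
        * (basisAW Q a (Q⁻¹ * z) (k + 1) - basisAW Q a z (k + 1))
      = ((Q ^ (k + 1))⁻¹ - 1) * (1 - a * b * c * d * Q ^ k) * basisAW Q a z (k + 1)
        - (Q ^ (k + 1))⁻¹ * (1 - Q ^ (k + 1))
          * ((1 - a * b * Q ^ k) * (1 - a * c * Q ^ k) * (1 - a * d * Q ^ k)) * basisAW Q a z k := by
  have hz' := inv_ne_zero hz
  have h0' : 1 - z⁻¹ ^ 2 ≠ 0 := by
    intro h; apply h0; field_simp at h; linear_combination -h
  have e3 := basisAW_succ Q a z k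
  -- One half of the operator, in a variable `w`, so that it can be used for both `w = z` and `w =
  -- z⁻¹`; the basis is symmetric under inversion.
  have g : ∀ w Fp : ℂ, w ≠ 0 → 1 - w ^ 2 ≠ 0 → 1 - Q * w ^ 2 ≠ 0 →
      basisAW Q a w (k + 1) = basisAW Q a z (k + 1) → basisAW Q a w k = basisAW Q a z k →
      (1 - a * w) * Fp = basisAW Q a w k * ((1 - a * Q ^ k * w) * (1 - a * Q ^ k * Q * w) * (1 - a * (Q * w)⁻¹)) →
      (1 - a * w) * (1 - b * w) * (1 - c * w) * (1 - d * w) / ((1 - w ^ 2) * (1 - Q * w ^ 2))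
        * (Fp - basisAW Q a z (k + 1))
      = (1 - b * w) * (1 - c * w) * (1 - d * w) / (Q * w * (1 - w ^ 2))
        * (-a * (1 - Q ^ (k + 1)) * (1 - a * Q ^ k * w) * basisAW Q a z k) := by
    intro w Fp hw hw1 hw2 r1 r2 hF
    rw [r2] at hF
    have e4 := basisAW_succ Q a w k
    rw [r1, r2] at e4
    have e5 : (Q * w) * (Q * w)⁻¹ = 1 := mul_inv_cancel₀ (mul_ne_zero hQ hw)
    have e6 : w * w⁻¹ = 1 := mul_inv_cancel₀ hw
    rw [div_mul_eq_mul_div, div_mul_eq_mul_div, div_eq_div_iff (mul_ne_zero hw1 hw2)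
      (mul_ne_zero (mul_ne_zero hQ hw) hw1)]
    have : (1 - a * w) * (Fp - basisAW Q a z (k + 1)) * (Q * w)
        = -a * (1 - Q ^ (k + 1)) * (1 - a * Q ^ k * w) * basisAW Q a z k * (1 - Q * w ^ 2) := by
      rw [mul_sub, hF, e4]
      linear_combination basisAW Q a z k * (1 - a * Q ^ k * w) * (-(1 - a * Q ^ k * Q * w) * a * e5
        + (1 - a * w) * Q * a * Q ^ k * e6)
    linear_combination (1 - b * w) * (1 - c * w) * (1 - d * w) * (1 - w ^ 2) * this
  have s1 := basisAW_shift hQ hz a k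
  have s2 := basisAW_shift hQ hz' a k
  rw [show Q * z⁻¹ = (Q⁻¹ * z)⁻¹ by rw [mul_inv, inv_inv], basisAW_inv _ _ (Q⁻¹ * z),
    show (Q⁻¹ * z)⁻¹ = Q * z⁻¹ by rw [mul_inv, inv_inv]] at s2
  rw [g z _ hz h0 h1 rfl rfl s1,
    g z⁻¹ _ hz' h0' h2 (basisAW_inv _ _ _ _) (basisAW_inv _ _ _ _) s2, e3]
  rw [pow_succ Q k]
  have hK : Q ^ k ≠ 0 := pow_ne_zero _ hQ
  generalize Q ^ k = K at *
  generalize basisAW Q a z k = F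
  have h0'' : z ^ 2 - 1 ≠ 0 := fun h => h0 (by linear_combination -h)
  rw [show 1 - z⁻¹ ^ 2 = -(1 - z ^ 2) * z⁻¹ ^ 2 by field_simp; ring]
  field_simp
  ring

theorem exp_two_mul_I (x : ℂ) : exp (2 * I * x) = exp (I * x) ^ 2 := by
  rw [← exp_nat_mul]
  congr 1
  push_cast
  ring

theorem pot_AW (q : ℝ) (lam : Fin 4 → ℂ) (x : ℂ) : pot (.AW q) lam x
    = (1 - aw q lam 0 * exp (I * x)) * (1 - aw q lam 1 * exp (I * x)) * (1 - aw q lam 2 * exp (I * x))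
        * (1 - aw q lam 3 * exp (I * x)) / ((1 - exp (I * x) ^ 2) * (1 - q * exp (I * x) ^ 2)) := by
  simp only [pot, potNum, potDen, Fin.prod_univ_four, exp_two_mul_I]

theorem exp_I_mul_neg (x : ℂ) : exp (I * -x) = (exp (I * x))⁻¹ := by
  rw [← exp_neg, mul_neg]

theorem potStar_AW (q : ℝ) (lam : Fin 4 → ℂ) (x : ℂ) : potStar (.AW q) lam x
    = (1 - aw q lam 0 * (exp (I * x))⁻¹) * (1 - aw q lam 1 * (exp (I * x))⁻¹)
        * (1 - aw q lam 2 * (exp (I * x))⁻¹) * (1 - aw q lam 3 * (exp (I * x))⁻¹)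
        / ((1 - (exp (I * x))⁻¹ ^ 2) * (1 - q * (exp (I * x))⁻¹ ^ 2)) := by
  rw [potStar, pot_AW, exp_I_mul_neg]

theorem exp_I_mul_sub_gam {q : ℝ} (hq : 0 < q) (x : ℂ) :
    exp (I * (x - I * gam (.AW q))) = q * exp (I * x) := by
  rw [ofReal_eq_exp hq, ← exp_add, gam]
  congr 1
  linear_combination -(Real.log q : ℂ) * I_mul_I

theorem exp_I_mul_add_gam {q : ℝ} (hq : 0 < q) (x : ℂ) :
    exp (I * (x + I * gam (.AW q))) = (q : ℂ)⁻¹ * exp (I * x) := by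
  rw [ofReal_eq_exp hq, ← exp_neg, ← exp_add, gam]
  congr 1
  linear_combination (Real.log q : ℂ) * I_mul_I

/-- The coefficients of the Askey-Wilson polynomials, without the normalisation. -/
noncomputable def coefAW (q : ℝ) (lam : Fin 4 → ℂ) (n k : ℕ) : ℂ :=
  qpoch q ((q : ℂ) ^ (-(n : ℤ))) k
    * qpoch q ((∏ i : Fin 4, aw q lam i) * (q : ℂ) ^ ((n : ℤ) - 1)) k / qpoch q q k
    * (q : ℂ) ^ k * qpoch q (aw q lam 0 * aw q lam 1 * (q : ℂ) ^ k) (n - k)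
    * qpoch q (aw q lam 0 * aw q lam 2 * (q : ℂ) ^ k) (n - k)
    * qpoch q (aw q lam 0 * aw q lam 3 * (q : ℂ) ^ k) (n - k)

theorem basePoly_AW_eval (q : ℝ) (lam : Fin 4 → ℂ) (n : ℕ) (x : ℂ) :
    (basePoly (.AW q) lam n).eval (eta (.AW q) x)
      = (aw q lam 0)⁻¹ ^ n * ∑ k ∈ Finset.range (n + 1),
        coefAW q lam n k * basisAW q (aw q lam 0) (exp (I * x)) k := by
  simp only [basePoly, Polynomial.eval_finsetSum, Polynomial.eval_mul, Polynomial.eval_C,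
    Polynomial.eval_prod, Polynomial.eval_add, Polynomial.eval_sub, Polynomial.eval_one, Polynomial.eval_X,
    eta, basisAW, coefAW]
  congr 1
  refine Finset.sum_congr rfl fun k _ => ?_
  congr 1
  refine Finset.prod_congr rfl fun i _ => ?_
  rw [Complex.cos, mul_comm x I, neg_mul, mul_comm x I, exp_neg]
  have := mul_inv_cancel₀ (exp_ne_zero (I * x))
  linear_combination -aw q lam 0 ^ 2 * (q : ℂ) ^ (2 * i) * this

theorem one_sub_ofReal_pow_ne_zero {q : ℝ} (h0 : 0 < q) (h1 : q < 1) (k : ℕ) : 1 - (q : ℂ) ^ (k + 1) ≠ 0 := by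
  have := pow_lt_one₀ h0.le h1 k.succ_ne_zero
  exact_mod_cast (sub_pos.mpr this).ne'

theorem qpoch_self_ne_zero {q : ℝ} (h0 : 0 < q) (h1 : q < 1) (k : ℕ) : qpoch q q k ≠ 0 :=
  Finset.prod_ne_zero_iff.mpr fun i _ => by
    rw [← pow_succ']
    exact one_sub_ofReal_pow_ne_zero h0 h1 i

theorem energy_AW (q : ℝ) (hq : 0 < q) (lam : Fin 4 → ℂ) (n : ℕ) : energy (.AW q) lam n
    = (((q : ℂ) ^ n)⁻¹ - 1) * (1 - (∏ k : Fin 4, aw q lam k) * ((q : ℂ) ^ n / q)) := by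
  rw [energy, zpow_neg, zpow_natCast, zpow_sub₀ (by exact_mod_cast hq.ne'), zpow_natCast, zpow_one]

theorem basePoly_AW_diffEq {q : ℝ} (hq : 0 < q) (hq1 : q < 1) (lam : Fin 4 → ℂ) (n : ℕ) (x : ℂ)
    (h1 : potDen (.AW q) x ≠ 0) (h2 : potDen (.AW q) (-x) ≠ 0) :
    pot (.AW q) lam x * ((basePoly (.AW q) lam n).eval (eta (.AW q) (x - I * gam (.AW q)))
        - (basePoly (.AW q) lam n).eval (eta (.AW q) x))
      + potStar (.AW q) lam x * ((basePoly (.AW q) lam n).eval (eta (.AW q) (x + I * gam (.AW q)))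
        - (basePoly (.AW q) lam n).eval (eta (.AW q) x))
      = energy (.AW q) lam n * (basePoly (.AW q) lam n).eval (eta (.AW q) x) := by
  have hQ : (q : ℂ) ≠ 0 := by exact_mod_cast hq.ne'
  have hz : exp (I * x) ≠ 0 := exp_ne_zero _
  simp only [potDen, exp_two_mul_I, exp_I_mul_neg] at h1 h2
  have hz1 := left_ne_zero_of_mul h1
  have hz2 := right_ne_zero_of_mul h1
  have hz3 := right_ne_zero_of_mul h2
  simp only [basePoly_AW_eval, pot_AW, potStar_AW, exp_I_mul_sub_gam hq, exp_I_mul_add_gam hq]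
  rw [← mul_sub, ← mul_sub, mul_left_comm, mul_left_comm (_ / _) ((aw q lam 0)⁻¹ ^ n), ← mul_add,
    mul_left_comm (energy (.AW q) lam n)]
  congr 1
  generalize exp (I * x) = z at *
  refine sum_eigen_of_triangular (e := fun k => energy (.AW q) lam k)
    (d := fun k => ((q : ℂ) ^ (k + 1))⁻¹ * (1 - (q : ℂ) ^ (k + 1))
      * ((1 - aw q lam 0 * aw q lam 1 * (q : ℂ) ^ k) * (1 - aw q lam 0 * aw q lam 2 * (q : ℂ) ^ k)
        * (1 - aw q lam 0 * aw q lam 3 * (q : ℂ) ^ k))) ?_ ?_ ?_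
  · simp [basisAW, energy]
  · intro k _
    rw [basisAW_triangular hQ hz _ _ _ _ _ hz1 hz2 hz3, energy_AW q hq, Fin.prod_univ_four,
      pow_succ, mul_div_assoc, div_self hQ, mul_one]
  · intro k hk
    have hk1 := one_sub_ofReal_pow_ne_zero hq hq1 k
    rw [coefAW, coefAW, qpoch_tail q (aw q lam 0 * aw q lam 1) hk, qpoch_tail q (aw q lam 0 * aw q lam 2) hk,
      qpoch_tail q (aw q lam 0 * aw q lam 3) hk,
      qpoch_succ, qpoch_succ, qpoch_succ, energy_AW q hq, energy_AW q hq, zpow_neg, zpow_natCast,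
      zpow_sub₀ hQ, zpow_natCast, zpow_one, ← pow_succ']
    have hk2 := qpoch_self_ne_zero hq hq1 k
    have hk3 := pow_ne_zero k hQ
    have hk4 := pow_ne_zero n hQ
    rw [pow_succ] at hk1 ⊢
    field_simp
    ring

theorem basePoly_diffEq (S : System) (hS : S.Valid) (lam : Fin 4 → ℂ) (n : ℕ) (x : ℂ)
    (h1 : potDen S x ≠ 0) (h2 : potDen S (-x) ≠ 0) :
    pot S lam x * ((basePoly S lam n).eval (eta S (x - I * gam S)) - (basePoly S lam n).eval (eta S x))
      + potStar S lam x * ((basePoly S lam n).eval (eta S (x + I * gam S)) - (basePoly S lam n).eval (eta S x))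
      = energy S lam n * (basePoly S lam n).eval (eta S x) := by
  cases S with
  | cH => exact basePoly_cH_diffEq lam n x
  | W => exact basePoly_W_diffEq lam n x h1 h2
  | AW q => exact basePoly_AW_diffEq hS.1 hS.2 lam n x h1 h2

end MultiIndexed

/-! ### Twisted parameters and the equation of the virtual states -/

namespace MultiIndexed

/-- The other type. -/
def VType.other : VType → VType
  | .I => .II
  | .II => .I

/-- The factor between the potential functions with twisted and with original parameters. -/
noncomputable def twistConst : System → VType → (Fin 4 → ℂ) → ℂ
  | .AW q, .I, lam => aw q lam 0 * aw q lam 1 / q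
  | .AW q, .II, lam => aw q lam 2 * aw q lam 3 / q
  | _, _, _ => 1

theorem aw_ne_zero {q : ℝ} (hq : 0 < q) (lam : Fin 4 → ℂ) (k : Fin 4) : aw q lam k ≠ 0 := by
  rw [aw, ofReal_cpow_eq_exp hq]
  exact exp_ne_zero _

theorem aw_one_sub {q : ℝ} (hq : 0 < q) (lam μ : Fin 4 → ℂ) (j k : Fin 4) (h : μ j = 1 - lam k) :
    aw q μ j = q / aw q lam k := by
  rw [aw, aw, h, cpow_sub _ _ (by exact_mod_cast hq.ne'), cpow_one]

/-- The replacement `λ_k ↦ 1 - λ_k` turns `a + ix` into `1 - a + ix`, a factor of `β` one step away.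
Thus the twist interchanges `α` and `β` of its own type, and does not touch the other type. -/
theorem twistConst_mul_al (S : System) (hS : S.Valid) (T : VType) (lam : Fin 4 → ℂ) (x : ℂ) :
    twistConst S T lam * al S T (twist S T lam) x = be S T lam (x - I * gam S) := by
  cases S with
  | cH =>
    cases T <;> simp only [twistConst, al, be, twist, gam, ofReal_one, Matrix.cons_val] <;>
      linear_combination -I_mul_I
  | W =>
    have h : ∀ k, lam k + I * -(x - I * gam .W) = -(1 - lam k + I * x) := by
      intro k
      simp only [gam, ofReal_one]
      linear_combination I_mul_I
    cases T <;> simp only [twistConst, al, be, twist, h, Matrix.cons_val] <;> ring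
  | AW q =>
    have hQ : (q : ℂ) ≠ 0 := by exact_mod_cast hS.1.ne'
    have h1 := exp_I_mul_sub_gam hS.1 x
    have h2 : exp (I * -(x - I * gam (.AW q))) = (q : ℂ)⁻¹ * (exp (I * x))⁻¹ := by
      rw [exp_I_mul_neg, h1, mul_inv]
    have h3 : exp (-(Real.log q / 2 : ℂ) - I * -(x - I * gam (.AW q)))
        = exp (-(Real.log q / 2 : ℂ)) * (q * exp (I * x)) := by
      rw [← h1, ← exp_add]
      congr 1
      ring
    have h4 : exp (-(Real.log q / 2 : ℂ) - I * x) = exp (-(Real.log q / 2 : ℂ)) * (exp (I * x))⁻¹ := by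
      rw [← exp_neg, ← exp_add, sub_eq_add_neg]
    have hz := exp_ne_zero (I * x)
    cases T
    · have a0 := aw_one_sub hS.1 lam (twist (.AW q) .I lam) 0 0 rfl
      have a1 := aw_one_sub hS.1 lam (twist (.AW q) .I lam) 1 1 rfl
      have n0 := aw_ne_zero hS.1 lam 0
      have n1 := aw_ne_zero hS.1 lam 1
      simp only [al, be, twistConst, a0, a1, h2, h3, h4]
      field_simp
      ring
    · have a0 := aw_one_sub hS.1 lam (twist (.AW q) .II lam) 2 2 rfl
      have a1 := aw_one_sub hS.1 lam (twist (.AW q) .II lam) 3 3 rfl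
      have n0 := aw_ne_zero hS.1 lam 2
      have n1 := aw_ne_zero hS.1 lam 3
      simp only [al, be, twistConst, a0, a1, h2, h3, h4]
      field_simp
      ring

theorem twistConst_mul_be (S : System) (hS : S.Valid) (T : VType) (lam : Fin 4 → ℂ) (x : ℂ) :
    twistConst S T lam * be S T (twist S T lam) x = al S T lam (x + I * gam S) := by
  cases S with
  | cH =>
    cases T <;> simp only [twistConst, al, be, twist, gam, ofReal_one, Matrix.cons_val] <;>
      linear_combination I_mul_I
  | W =>
    have := twistConst_mul_al .W hS T lam (-x)
    simp only [be, this]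
    congr 1
    ring
  | AW q =>
    have := twistConst_mul_al (.AW q) hS T lam (-x)
    simp only [be, this]
    congr 1
    ring

theorem al_other_twist (S : System) (T : VType) (lam : Fin 4 → ℂ) (x : ℂ) :
    al S T.other (twist S T lam) x = al S T.other lam x := by
  cases S <;> cases T <;> rfl

theorem be_other_twist (S : System) (T : VType) (lam : Fin 4 → ℂ) (x : ℂ) :
    be S T.other (twist S T lam) x = be S T.other lam x := by
  cases S <;> cases T <;> rfl

theorem pot_eq_other (S : System) (hS : S.Valid) (T : VType) (lam : Fin 4 → ℂ) (x : ℂ) :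
    pot S lam x = al S T lam x * al S T.other lam x / (kap S * sg S (2 * x) * sg S (2 * x - I * gam S)) := by
  rw [pot_eq S hS]
  cases T
  · rfl
  · rw [mul_comm (al S .I lam x)]; rfl

theorem potStar_eq_other (S : System) (hS : S.Valid) (T : VType) (lam : Fin 4 → ℂ) (x : ℂ) :
    potStar S lam x = be S T lam x * be S T.other lam x
      / (kap S * sg S (2 * x) * sg S (2 * x + I * gam S)) := by
  rw [potStar_eq S hS]
  cases T
  · rfl
  · rw [mul_comm (be S .I lam x)]; rfl

theorem twistConst_mul_pot (S : System) (hS : S.Valid) (T : VType) (lam : Fin 4 → ℂ) (x : ℂ) :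
    twistConst S T lam * pot S (twist S T lam) x = be S T lam (x - I * gam S) * al S T.other lam x
      / (kap S * sg S (2 * x) * sg S (2 * x - I * gam S)) := by
  rw [pot_eq_other S hS T, ← twistConst_mul_al S hS, al_other_twist]
  ring

theorem twistConst_mul_potStar (S : System) (hS : S.Valid) (T : VType) (lam : Fin 4 → ℂ) (x : ℂ) :
    twistConst S T lam * potStar S (twist S T lam) x = al S T lam (x + I * gam S) * be S T.other lam x
      / (kap S * sg S (2 * x) * sg S (2 * x + I * gam S)) := by
  rw [potStar_eq_other S hS T, ← twistConst_mul_be S hS, be_other_twist]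
  ring

/-- The dependence on `v` comes from the eigenvalue of the twisted polynomial. The additive constant
is the one determined in `virtualEnergy_zero_eq`. -/
theorem virtualEnergy_eq (S : System) (hS : S.Valid) (T : VType) (lam : Fin 4 → ℂ) (v : ℕ) :
    virtualEnergy S T lam v = twistConst S T lam * energy S (twist S T lam) v + virtualEnergy S T lam 0 := by
  cases S with
  | cH =>
    cases T <;> simp only [virtualEnergy, twistConst, energy, twist, Fin.sum_univ_four, Matrix.cons_val] <;>
      push_cast <;> ring
  | W =>
    cases T <;> simp only [virtualEnergy, twistConst, energy, twist, Fin.sum_univ_four, Matrix.cons_val] <;>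
      push_cast <;> ring
  | AW q =>
    have hQ : (q : ℂ) ≠ 0 := by exact_mod_cast hS.1.ne'
    have hQv : (q : ℂ) ^ v ≠ 0 := pow_ne_zero _ hQ
    have n0 := aw_ne_zero hS.1 lam
    have hz : (q : ℂ) ^ (-(v : ℤ) - 1) = ((q : ℂ) ^ v)⁻¹ * (q : ℂ)⁻¹ := by
      rw [zpow_sub₀ hQ, zpow_neg, zpow_natCast, zpow_one, div_eq_mul_inv]
    cases T
    · have a0 := aw_one_sub hS.1 lam (twist (.AW q) .I lam) 0 0 rfl
      have a1 := aw_one_sub hS.1 lam (twist (.AW q) .I lam) 1 1 rfl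
      have a2 : aw q (twist (.AW q) .I lam) 2 = aw q lam 2 := rfl
      have a3 : aw q (twist (.AW q) .I lam) 3 = aw q lam 3 := rfl
      rw [energy_AW q hS.1]
      simp only [virtualEnergy, twistConst, Fin.prod_univ_four, a0, a1, a2, a3, hz]
      have m0 := n0 0
      have m1 := n0 1
      simp
      field_simp
      ring
    · have a0 := aw_one_sub hS.1 lam (twist (.AW q) .II lam) 2 2 rfl
      have a1 := aw_one_sub hS.1 lam (twist (.AW q) .II lam) 3 3 rfl
      have a2 : aw q (twist (.AW q) .II lam) 0 = aw q lam 0 := rfl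
      have a3 : aw q (twist (.AW q) .II lam) 1 = aw q lam 1 := rfl
      rw [energy_AW q hS.1]
      simp only [virtualEnergy, twistConst, Fin.prod_univ_four, a0, a1, a2, a3, hz]
      have m0 := n0 2
      have m1 := n0 3
      simp
      field_simp
      ring

/-- Subtracting the potentials before adding the two halves cancels `2 y + 1` and `2 * -y + 1` from
the denominators. -/
theorem virtualEnergy_zero_W_aux (a b c d y : ℂ) (h0 : y ≠ 0) (h1 : 2 * y + 1 ≠ 0) (h2 : 2 * -y + 1 ≠ 0) :
    ((1 - a + y) * (1 - b + y) * (c + y) * (d + y) - (a + y) * (b + y) * (c + y) * (d + y)) / (2 * y * (2 * y + 1))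
      + ((1 - a + -y) * (1 - b + -y) * (c + -y) * (d + -y) - (a + -y) * (b + -y) * (c + -y) * (d + -y))
        / (2 * -y * (2 * -y + 1)) = -(a + b - 1) * (c + d) := by
  have e : ∀ w : ℂ, w ≠ 0 → 2 * w + 1 ≠ 0 →
      ((1 - a + w) * (1 - b + w) * (c + w) * (d + w) - (a + w) * (b + w) * (c + w) * (d + w)) / (2 * w * (2 * w + 1))
      = (1 - a - b) * (c + w) * (d + w) / (2 * w) := by
    intro w hw hw1
    rw [div_eq_div_iff (mul_ne_zero (by simp [hw]) hw1) (by simp [hw])]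
    ring
  rw [e y h0 h1, e (-y) (neg_ne_zero.mpr h0) h2]
  field_simp
  ring

theorem virtualEnergy_zero_AW_aux {Q a b z : ℂ} (c d : ℂ) (hQ : Q ≠ 0) (hz : z ≠ 0) (ha : a ≠ 0) (hb : b ≠ 0)
    (h0 : 1 - z ^ 2 ≠ 0) (h1 : 1 - Q * z ^ 2 ≠ 0) (h2 : 1 - Q * z⁻¹ ^ 2 ≠ 0) :
    (a * b / Q * ((1 - Q / a * z) * (1 - Q / b * z) * (1 - c * z) * (1 - d * z))
        - (1 - a * z) * (1 - b * z) * (1 - c * z) * (1 - d * z)) / ((1 - z ^ 2) * (1 - Q * z ^ 2))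
      + (a * b / Q * ((1 - Q / a * z⁻¹) * (1 - Q / b * z⁻¹) * (1 - c * z⁻¹) * (1 - d * z⁻¹))
        - (1 - a * z⁻¹) * (1 - b * z⁻¹) * (1 - c * z⁻¹) * (1 - d * z⁻¹))
          / ((1 - z⁻¹ ^ 2) * (1 - Q * z⁻¹ ^ 2)) = -(1 - a * b * Q⁻¹) * (1 - c * d) := by
  have hz' := inv_ne_zero hz
  have h0' : 1 - z⁻¹ ^ 2 ≠ 0 := by
    intro h; apply h0; field_simp at h; linear_combination -h
  have e : ∀ w : ℂ, 1 - w ^ 2 ≠ 0 → 1 - Q * w ^ 2 ≠ 0 →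
      (a * b / Q * ((1 - Q / a * w) * (1 - Q / b * w) * (1 - c * w) * (1 - d * w))
        - (1 - a * w) * (1 - b * w) * (1 - c * w) * (1 - d * w)) / ((1 - w ^ 2) * (1 - Q * w ^ 2))
      = -(1 - a * b * Q⁻¹) * (1 - c * w) * (1 - d * w) / (1 - w ^ 2) := by
    intro w hw hw1
    rw [div_eq_div_iff (mul_ne_zero hw hw1) hw]
    field_simp
    ring
  rw [e z h0 h1, e z⁻¹ h0' h2]
  have h0'' : z ^ 2 - 1 ≠ 0 := fun h => h0 (by linear_combination -h)
  rw [show 1 - z⁻¹ ^ 2 = -(1 - z ^ 2) * z⁻¹ ^ 2 by field_simp; ring]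
  field_simp
  ring

/-- The diagonal terms of the rescaled twisted operator and of the original one differ by a
constant. Hence a gauge transformation of the off-diagonal terms suffices to identify the two
operators up to that constant. -/
theorem virtualEnergy_zero_eq (S : System) (hS : S.Valid) (T : VType) (lam : Fin 4 → ℂ) (x : ℂ)
    (h1 : potDen S x ≠ 0) (h2 : potDen S (-x) ≠ 0) :
    twistConst S T lam * (pot S (twist S T lam) x + potStar S (twist S T lam) x)
      - (pot S lam x + potStar S lam x) = virtualEnergy S T lam 0 := by
  cases S with
  | cH =>
    cases T <;> simp only [virtualEnergy, twistConst, pot, potNum, potDen, potStar, twist, Matrix.cons_val,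
      div_one] <;> push_cast <;> ring
  | W =>
    have hy : I * x ≠ 0 := by
      rintro h
      exact h1 (by simp only [potDen]; rw [show 2 * I * x = 2 * (I * x) by ring, h]; simp)
    have hy1 : 2 * (I * x) + 1 ≠ 0 := by
      intro h
      exact h1 (by simp only [potDen]; rw [show 2 * I * x + 1 = 2 * (I * x) + 1 by ring, h]; simp)
    have hy2 : 2 * -(I * x) + 1 ≠ 0 := by
      intro h
      exact h2 (by simp only [potDen]; rw [show 2 * I * -x + 1 = 2 * -(I * x) + 1 by ring, h]; simp)
    cases T
    · have := virtualEnergy_zero_W_aux (lam 0) (lam 1) (lam 2) (lam 3) (I * x) hy hy1 hy2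
      simp only [sub_div] at this
      simp only [virtualEnergy, twistConst, potStar, pot_W, mul_neg I x, twist, Matrix.cons_val]
      push_cast
      linear_combination this
    · have := virtualEnergy_zero_W_aux (lam 2) (lam 3) (lam 0) (lam 1) (I * x) hy hy1 hy2
      simp only [sub_div] at this
      simp only [virtualEnergy, twistConst, potStar, pot_W, mul_neg I x, twist, Matrix.cons_val]
      push_cast
      linear_combination this
  | AW q =>
    have hQ : (q : ℂ) ≠ 0 := by exact_mod_cast hS.1.ne'
    have hz : exp (I * x) ≠ 0 := exp_ne_zero _
    simp only [potDen, exp_two_mul_I, exp_I_mul_neg] at h1 h2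
    have hz1 := left_ne_zero_of_mul h1
    have hz2 := right_ne_zero_of_mul h1
    have hz3 := right_ne_zero_of_mul h2
    have n := aw_ne_zero hS.1 lam
    cases T
    · have a0 := aw_one_sub hS.1 lam (twist (.AW q) .I lam) 0 0 rfl
      have a1 := aw_one_sub hS.1 lam (twist (.AW q) .I lam) 1 1 rfl
      have a2 : aw q (twist (.AW q) .I lam) 2 = aw q lam 2 := rfl
      have a3 : aw q (twist (.AW q) .I lam) 3 = aw q lam 3 := rfl
      have := virtualEnergy_zero_AW_aux (aw q lam 2) (aw q lam 3) hQ hz (n 0) (n 1) hz1 hz2 hz3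
      simp only [sub_div] at this
      simp only [virtualEnergy, twistConst, pot_AW, potStar_AW, a0, a1, a2, a3]
      simp only [CharP.cast_eq_zero, neg_zero, zero_sub, zpow_neg, zpow_one, pow_zero, mul_one]
      linear_combination this
    · have a0 := aw_one_sub hS.1 lam (twist (.AW q) .II lam) 2 2 rfl
      have a1 := aw_one_sub hS.1 lam (twist (.AW q) .II lam) 3 3 rfl
      have a2 : aw q (twist (.AW q) .II lam) 0 = aw q lam 0 := rfl
      have a3 : aw q (twist (.AW q) .II lam) 1 = aw q lam 1 := rfl
      have := virtualEnergy_zero_AW_aux (aw q lam 0) (aw q lam 1) hQ hz (n 2) (n 3) hz1 hz2 hz3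
      simp only [sub_div] at this
      simp only [virtualEnergy, twistConst, pot_AW, potStar_AW, a0, a1, a2, a3]
      simp only [CharP.cast_eq_zero, neg_zero, zero_sub, zpow_neg, zpow_one, pow_zero, mul_one]
      linear_combination this

/-- The virtual states satisfy the difference equation in the gauge of the other type. -/
theorem xiV_diffEq (S : System) (hS : S.Valid) (T : VType) (lam : Fin 4 → ℂ) (v : ℕ) (x : ℂ)
    (h1 : potDen S x ≠ 0) (h2 : potDen S (-x) ≠ 0) :
    be S T lam (x - I * gam S) * al S T.other lam x / (kap S * sg S (2 * x) * sg S (2 * x - I * gam S))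
        * xiV S T lam v (x - I * gam S)
      + al S T lam (x + I * gam S) * be S T.other lam x / (kap S * sg S (2 * x) * sg S (2 * x + I * gam S))
        * xiV S T lam v (x + I * gam S)
      - (pot S lam x + potStar S lam x) * xiV S T lam v x = virtualEnergy S T lam v * xiV S T lam v x := by
  have e1 := basePoly_diffEq S hS (twist S T lam) v x h1 h2
  have e2 := virtualEnergy_zero_eq S hS T lam x h1 h2
  rw [← twistConst_mul_pot S hS, ← twistConst_mul_potStar S hS, virtualEnergy_eq S hS T lam v]
  simp only [xiV]
  linear_combination twistConst S T lam * e1 + (basePoly S (twist S T lam) v).eval (eta S x) * e2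

end MultiIndexed

namespace MultiIndexed

/-! ### Shift relations of the virtual states -/

/-- Reduces a first-order shift relation between two terminating series to the basis elements
together with a termwise relation between the coefficients. -/
theorem sum_shift {K : Type*} [Field K] {n : ℕ} {c c' φp φm φ' s : ℕ → K} {a b Δ r : K}
    (h : ∀ k, a * φp k - b * φm k = s k * Δ * φ' k) (hc : ∀ k ≤ n, c k * s k = r * c' k) :
    a * (∑ k ∈ Finset.range (n + 1), c k * φp k) - b * ∑ k ∈ Finset.range (n + 1), c k * φm k
      = r * Δ * ∑ k ∈ Finset.range (n + 1), c' k * φ' k := by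
  simp only [Finset.mul_sum, ← Finset.sum_sub_distrib]
  refine Finset.sum_congr rfl fun k hk => ?_
  have := hc k (by have := Finset.mem_range.mp hk; omega)
  linear_combination c k * h k + Δ * φ' k * this

/-- The constant in the shift relation for type I. -/
noncomputable def shiftConst : System → (Fin 4 → ℂ) → ℕ → ℂ
  | .cH, lam, v => -I * (v + 1 - lam 0 - lam 2)
  | .W, lam, v => -(v + 1 - lam 0 - lam 1)
  | .AW q, lam, v => (exp (Real.log q / 2))⁻¹ ^ v * (aw q lam 0 * aw q lam 1 / q - (q : ℂ) ^ v)
      * (2 / ((exp (Real.log q / 2))⁻¹ - exp (Real.log q / 2)))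

theorem poch_head (b : ℂ) {k n : ℕ} (hk : k ≤ n) :
    poch (b + 1 + k) (n - k) * (b + k) = (b + n) * poch (b + k) (n - k) := by
  have h1 := poch_succ' (b + k) (n - k)
  rw [poch_succ, Nat.cast_sub hk] at h1
  rw [show b + 1 + k = b + k + 1 by ring]
  linear_combination -h1

theorem qpoch_head (q : ℝ) (b : ℂ) {k n : ℕ} (hk : k ≤ n) :
    qpoch q (b * q * (q : ℂ) ^ k) (n - k) * (1 - b * (q : ℂ) ^ k)
      = (1 - b * (q : ℂ) ^ n) * qpoch q (b * (q : ℂ) ^ k) (n - k) := by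
  have h1 := qpoch_succ' q (b * (q : ℂ) ^ k) (n - k)
  rw [qpoch_succ, mul_assoc b, ← pow_add, Nat.add_sub_cancel' hk] at h1
  rw [show b * q * (q : ℂ) ^ k = b * (q : ℂ) ^ k * q by ring]
  linear_combination -h1

/-- When base parameter and argument both move by a half, one family of factors stays fixed and the
other telescopes. -/
theorem basisW_half_shift (A u : ℂ) (k : ℕ) :
    (A + u) * basisW (A + 1 / 2) (u + 1 / 2) k = (A + k + u) * basisW A u k := by
  induction k with
  | zero => simp [basisW]
  | succ k ih =>
    rw [basisW_succ, basisW_succ, ← mul_assoc, ih]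
    push_cast
    ring

theorem basisAW_half_shift {h z : ℂ} (hh : h ≠ 0) (hz : z ≠ 0) (A : ℂ) (k : ℕ) :
    (1 - A * z) * basisAW (h ^ 2) (h * A) (h * z) k = (1 - A * (h ^ 2) ^ k * z) * basisAW (h ^ 2) A z k := by
  induction k with
  | zero => simp [basisAW]
  | succ k ih =>
    rw [basisAW_succ, basisAW_succ, ← mul_assoc, ih, pow_succ (h ^ 2) k]
    field_simp

/-- The base parameter of the series is `1 - λ₁`, which the twist has affected: the shift by `δ`
lowers it by a half, matching the half steps of the argument. The relation therefore holds term by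
term. -/
theorem shift_W (lam : Fin 4 → ℂ) (v : ℕ) (y : ℂ) :
    al .W .I lam (y + I * gam .W / 2) * xiV .W .I lam v (y + I * gam .W / 2)
      - be .W .I lam (y - I * gam .W / 2) * xiV .W .I lam v (y - I * gam .W / 2)
      = shiftConst .W lam v * (eta .W (y + I * gam .W / 2) - eta .W (y - I * gam .W / 2))
        * xiV .W .I (lam + delta) v y := by
  have ep : I * (y + I * gam .W / 2) = I * y - 1 / 2 := by
    simp only [gam, ofReal_one]; linear_combination I_mul_I / 2
  have em : I * (y - I * gam .W / 2) = I * y + 1 / 2 := by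
    simp only [gam, ofReal_one]; linear_combination -I_mul_I / 2
  have em' : I * -(y - I * gam .W / 2) = -(I * y) - 1 / 2 := by
    linear_combination -em
  have eη : eta .W (y + I * gam .W / 2) - eta .W (y - I * gam .W / 2) = 2 * (I * y) := by
    simp only [eta, gam, ofReal_one]; ring
  rw [eη]
  simp only [xiV, basePoly_W_eval, al, be, ep, em, em']
  generalize I * y = u
  have hA : ∀ w k, (1 / 2 - lam 0 + w) * basisW (1 - lam 0) (w + 1 / 2) k
      = (1 / 2 - lam 0 + k + w) * basisW (1 / 2 - lam 0) w k := fun w k => by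
    have := basisW_half_shift (1 / 2 - lam 0) w k
    rwa [show 1 / 2 - lam 0 + 1 / 2 = 1 - lam 0 by ring] at this
  have hs : ∀ (n : ℕ), -(poch (1 - lam 0 + (1 - lam 1) + n) (v - n)) * (1 - lam 0 - lam 1 + n) =
      -(1 - lam 0 - lam 1 + v) * poch (1 - lam 0 - lam 1 + n) (v - n) ∨ v < n := fun n => by
    by_cases hn : n ≤ v
    · have := poch_head (1 - lam 0 - lam 1) hn
      rw [show 1 - lam 0 + (1 - lam 1) + (n : ℂ) = 1 - lam 0 - lam 1 + 1 + n by ring]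
      left
      linear_combination -this
    · right; omega
  refine sum_shift (s := fun k => -(1 - lam 0 - lam 1 + k)) ?_ ?_
  · intro k
    have h1 := hA u k
    have h2 := hA (-u) k
    rw [show -u + 1 / 2 = -(u - 1 / 2) by ring, basisW_neg, basisW_neg] at h2
    simp only [twist, delta, Matrix.cons_val, Pi.add_apply]
    rw [show 1 - (lam 0 + 1 / 2) = 1 / 2 - lam 0 by ring]
    linear_combination -(lam 1 + (u - 1 / 2)) * h2 + (lam 1 + (-u - 1 / 2)) * h1
  · intro k hk
    have h1 := (hs k).resolve_right (by omega)
    simp only [twist, delta, shiftConst, Fin.sum_univ_four, Matrix.cons_val, Pi.add_apply]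
    rw [show 1 - (lam 0 + 1 / 2) + (1 - (lam 1 + 1 / 2)) = 1 - lam 0 - lam 1 by ring,
      show 1 - (lam 0 + 1 / 2) + (lam 2 + 1 / 2) = 1 - lam 0 + lam 2 by ring,
      show 1 - (lam 0 + 1 / 2) + (lam 3 + 1 / 2) = 1 - lam 0 + lam 3 by ring,
      show (v : ℂ) + (1 - lam 0 - lam 1 + (lam 2 + 1 / 2) + (lam 3 + 1 / 2)) - 1
        = v + (1 - lam 0 + (1 - lam 1) + lam 2 + lam 3) - 1 by ring]
    linear_combination (poch (-(v : ℂ)) k * poch (v + (1 - lam 0 + (1 - lam 1) + lam 2 + lam 3) - 1) k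
      / (k.factorial : ℂ)) * poch (1 - lam 0 + lam 2 + k) (v - k) * poch (1 - lam 0 + lam 3 + k) (v - k) * h1

theorem shift_cH (lam : Fin 4 → ℂ) (v : ℕ) (y : ℂ) :
    al .cH .I lam (y + I * gam .cH / 2) * xiV .cH .I lam v (y + I * gam .cH / 2)
      - be .cH .I lam (y - I * gam .cH / 2) * xiV .cH .I lam v (y - I * gam .cH / 2)
      = shiftConst .cH lam v * (eta .cH (y + I * gam .cH / 2) - eta .cH (y - I * gam .cH / 2))
        * xiV .cH .I (lam + delta) v y := by
  have ep : I * (y + I * gam .cH / 2) = I * y - 1 / 2 := by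
    simp only [gam, ofReal_one]; linear_combination I_mul_I / 2
  have em : I * (y - I * gam .cH / 2) = I * y + 1 / 2 := by
    simp only [gam, ofReal_one]; linear_combination -I_mul_I / 2
  have eη : eta .cH (y + I * gam .cH / 2) - eta .cH (y - I * gam .cH / 2) = I := by
    simp only [eta, gam, ofReal_one]; ring
  have eC : shiftConst .cH lam v * I = v + 1 - lam 0 - lam 2 := by
    simp only [shiftConst]; linear_combination -(v + 1 - lam 0 - lam 2) * I_mul_I
  rw [eη, eC]
  simp only [xiV, basePoly_cH_eval, al, be, ep, em]
  rw [mul_left_comm, mul_left_comm (_ - _) (I ^ v / (v.factorial : ℂ)), ← mul_sub,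
    mul_left_comm _ (I ^ v / (v.factorial : ℂ))]
  congr 1
  generalize I * y = u
  rw [← mul_one ((v : ℂ) + 1 - lam 0 - lam 2)]
  refine sum_shift (s := fun k => 1 - lam 0 - lam 2 + k) ?_ ?_
  · intro k
    have h1 := poch_succ' (1 / 2 - lam 2 + u) k
    rw [poch_succ] at h1
    simp only [twist, delta, Matrix.cons_val, Pi.add_apply]
    rw [show 1 - lam 2 + (u - 1 / 2) = 1 / 2 - lam 2 + u by ring,
      show 1 - lam 2 + (u + 1 / 2) = 1 / 2 - lam 2 + u + 1 by ring,
      show 1 - (lam 2 + 1 / 2) + u = 1 / 2 - lam 2 + u by ring]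
    linear_combination -h1
  · intro k hk
    have h1 := poch_head (1 - lam 0 - lam 2) hk
    simp only [twist, delta, Fin.sum_univ_four, Matrix.cons_val, Pi.add_apply]
    rw [show 1 - (lam 2 + 1 / 2) + (1 - (lam 0 + 1 / 2)) = 1 - lam 0 - lam 2 by ring,
      show 1 - (lam 2 + 1 / 2) + (lam 3 + 1 / 2) = 1 - lam 2 + lam 3 by ring,
      show 1 - lam 2 + (1 - lam 0) + (k : ℂ) = 1 - lam 0 - lam 2 + 1 + k by ring,
      show (v : ℂ) + (1 - (lam 2 + 1 / 2) + (lam 1 + 1 / 2) + (1 - (lam 0 + 1 / 2)) + (lam 3 + 1 / 2)) - 1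
        = v + (1 - lam 2 + lam 1 + (1 - lam 0) + lam 3) - 1 by ring]
    linear_combination (poch (-(v : ℂ)) k * poch (v + (1 - lam 2 + lam 1 + (1 - lam 0) + lam 3) - 1) k
      / (k.factorial : ℂ)) * poch (1 - lam 2 + lam 3 + k) (v - k) * h1

theorem exp_half_sq {q : ℝ} (hq : 0 < q) : exp (Real.log q / 2 : ℂ) ^ 2 = q := by
  rw [← exp_nat_mul, ofReal_eq_exp hq]
  congr 1
  push_cast
  ring

theorem exp_half_ne {q : ℝ} (hq : 0 < q) (hq1 : q < 1) :
    (exp (Real.log q / 2 : ℂ))⁻¹ - exp (Real.log q / 2 : ℂ) ≠ 0 := by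
  intro h
  have h1 := exp_ne_zero (Real.log q / 2 : ℂ)
  have h2 := exp_half_sq hq
  field_simp at h
  rw [h2] at h
  exact one_sub_ofReal_pow_ne_zero hq hq1 0 (by simpa using h)

/-- To be read with `h = q^{1/2}`, `A = h / a₁`, `B = h / a₂`: then `h A` is the twisted base
parameter at `λ` and `A` is the one at `λ + δ`. -/
theorem shift_AW_aux {h z A B : ℂ} (hh : h ≠ 0) (hz : z ≠ 0) (hA : A ≠ 0) (hB : B ≠ 0) (k : ℕ) :
    z⁻¹ * ((1 - A⁻¹ * z) * (1 - B⁻¹ * z)) * basisAW (h ^ 2) (h * A) (h⁻¹ * z) k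
      - z * ((1 - A⁻¹ * z⁻¹) * (1 - B⁻¹ * z⁻¹)) * basisAW (h ^ 2) (h * A) (h * z) k
      = (A * B)⁻¹ * (1 - A * B * (h ^ 2) ^ k) * (z - z⁻¹) * basisAW (h ^ 2) A z k := by
  have h1 := basisAW_half_shift hh hz A k
  have h2 := basisAW_half_shift hh (inv_ne_zero hz) A k
  rw [basisAW_inv, show h * z⁻¹ = (h⁻¹ * z)⁻¹ by rw [mul_inv, inv_inv], basisAW_inv] at h2
  have e1 : z * z⁻¹ = 1 := mul_inv_cancel₀ hz
  have e2 : A * A⁻¹ = 1 := mul_inv_cancel₀ hA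
  have e3 : B * B⁻¹ = 1 := mul_inv_cancel₀ hB
  have g1 : z⁻¹ * (1 - A⁻¹ * z) = -A⁻¹ * (1 - A * z⁻¹) := by
    linear_combination -A⁻¹ * e1 - z⁻¹ * e2
  have g2 : z * (1 - A⁻¹ * z⁻¹) = -A⁻¹ * (1 - A * z) := by
    linear_combination -A⁻¹ * e1 - z * e2
  rw [← mul_assoc, ← mul_assoc z, g1, g2, mul_inv]
  linear_combination (-A⁻¹ * (1 - B⁻¹ * z)) * h2 + A⁻¹ * (1 - B⁻¹ * z⁻¹) * h1
    + A⁻¹ * (h ^ 2) ^ k * basisAW (h ^ 2) A z k * (A * (z - z⁻¹)) * e3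

theorem shift_AW {q : ℝ} (hq : 0 < q) (hq1 : q < 1) (lam : Fin 4 → ℂ) (v : ℕ) (y : ℂ) :
    al (.AW q) .I lam (y + I * gam (.AW q) / 2) * xiV (.AW q) .I lam v (y + I * gam (.AW q) / 2)
      - be (.AW q) .I lam (y - I * gam (.AW q) / 2) * xiV (.AW q) .I lam v (y - I * gam (.AW q) / 2)
      = shiftConst (.AW q) lam v
        * (eta (.AW q) (y + I * gam (.AW q) / 2) - eta (.AW q) (y - I * gam (.AW q) / 2))
        * xiV (.AW q) .I (lam + delta) v y := by
  have hh2 := exp_half_sq hq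
  have hh3 := exp_half_ne hq hq1
  have hh0 := exp_ne_zero (Real.log q / 2 : ℂ)
  have hL : exp (-(Real.log q / 2) : ℂ) = (exp (Real.log q / 2 : ℂ))⁻¹ := exp_neg _
  have ep : exp (I * (y + I * gam (.AW q) / 2)) = (exp (Real.log q / 2 : ℂ))⁻¹ * exp (I * y) := by
    rw [← exp_neg, ← exp_add, gam]; congr 1; linear_combination (Real.log q / 2 : ℂ) * I_mul_I
  have em : exp (I * (y - I * gam (.AW q) / 2)) = exp (Real.log q / 2 : ℂ) * exp (I * y) := by
    rw [← exp_add, gam]; congr 1; linear_combination -(Real.log q / 2 : ℂ) * I_mul_I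
  have hd : ∀ k, aw q delta k = exp (Real.log q / 2) := fun k => by
    rw [aw, ofReal_cpow_eq_exp hq, delta]; congr 1; ring
  have m0 := aw_one_sub hq lam (twist (.AW q) .I lam) 0 0 rfl
  have m1 := aw_one_sub hq lam (twist (.AW q) .I lam) 1 1 rfl
  have m2 : aw q (twist (.AW q) .I lam) 2 = aw q lam 2 := rfl
  have m3 : aw q (twist (.AW q) .I lam) 3 = aw q lam 3 := rfl
  have hde : ∀ k, aw q (lam + delta) k = aw q lam k * exp (Real.log q / 2) := fun k => by
    rw [aw_add hq, delta]; congr 2; ring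
  have d0 := aw_one_sub hq (lam + delta) (twist (.AW q) .I (lam + delta)) 0 0 rfl
  have d1 := aw_one_sub hq (lam + delta) (twist (.AW q) .I (lam + delta)) 1 1 rfl
  have d2 : aw q (twist (.AW q) .I (lam + delta)) 2 = aw q (lam + delta) 2 := rfl
  have d3 : aw q (twist (.AW q) .I (lam + delta)) 3 = aw q (lam + delta) 3 := rfl
  rw [hde] at d0 d1 d2 d3
  have n0 := aw_ne_zero hq lam 0
  have n1 := aw_ne_zero hq lam 1
  have eη : eta (.AW q) (y + I * gam (.AW q) / 2) - eta (.AW q) (y - I * gam (.AW q) / 2)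
      = (exp (I * y) - (exp (I * y))⁻¹) * (((exp (Real.log q / 2))⁻¹ - exp (Real.log q / 2)) / 2) := by
    have : ∀ w : ℂ, cos w = (exp (I * w) + (exp (I * w))⁻¹) / 2 := fun w => by
      rw [Complex.cos, ← exp_neg, mul_comm w I, neg_mul, mul_comm w I]
    simp only [eta, this, ep, em, mul_inv, inv_inv]
    ring
  have eal : al (.AW q) .I lam (y + I * gam (.AW q) / 2) = (exp (I * y))⁻¹
      * ((1 - (exp (Real.log q / 2) / aw q lam 0)⁻¹ * exp (I * y))
        * (1 - (exp (Real.log q / 2) / aw q lam 1)⁻¹ * exp (I * y))) := by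
    simp only [al, sub_eq_add_neg (-(Real.log q / 2 : ℂ)), exp_add, exp_neg (I * _), ep, hL]
    field_simp
  have ebe : be (.AW q) .I lam (y - I * gam (.AW q) / 2) = exp (I * y)
      * ((1 - (exp (Real.log q / 2) / aw q lam 0)⁻¹ * (exp (I * y))⁻¹)
        * (1 - (exp (Real.log q / 2) / aw q lam 1)⁻¹ * (exp (I * y))⁻¹)) := by
    simp only [be, al, sub_eq_add_neg (-(Real.log q / 2 : ℂ)), exp_add, exp_neg (I * _), exp_I_mul_neg, em, hL,
      inv_inv]
    field_simp
  rw [eη, eal, ebe]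
  simp only [xiV, basePoly_AW_eval, ep, em, shiftConst, m0, d0]
  have hz := exp_ne_zero (I * y)
  generalize exp (I * y) = z at *
  have key := sum_shift (n := v) (c := coefAW q (twist (.AW q) .I lam) v)
    (c' := coefAW q (twist (.AW q) .I (lam + delta)) v)
    (s := fun k => (exp (Real.log q / 2) / aw q lam 0 * (exp (Real.log q / 2) / aw q lam 1))⁻¹
      * (1 - exp (Real.log q / 2) / aw q lam 0 * (exp (Real.log q / 2) / aw q lam 1) * (q : ℂ) ^ k))
    (r := aw q lam 0 * aw q lam 1 / q - (q : ℂ) ^ v)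
    (fun k => by
      have := shift_AW_aux hh0 hz (div_ne_zero hh0 n0) (div_ne_zero hh0 n1) k
      rw [hh2] at this
      exact this)
    (fun k hk => by
      have hp := qpoch_head q (exp (Real.log q / 2) / aw q lam 0 * (exp (Real.log q / 2) / aw q lam 1)) hk
      have hQ : (q : ℂ) ≠ 0 := by exact_mod_cast hq.ne'
      generalize exp (Real.log q / 2 : ℂ) = h at *
      have p1 : (q : ℂ) / aw q lam 0 * (q / aw q lam 1) = h / aw q lam 0 * (h / aw q lam 1) * q := by
        rw [← hh2]; field_simp
      have p2 : (q : ℂ) / (aw q lam 0 * h) * (q / (aw q lam 1 * h)) = h / aw q lam 0 * (h / aw q lam 1) := by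
        rw [← hh2]; field_simp
      have p3 : ∀ X : ℂ, (q : ℂ) / (aw q lam 0 * h) * (X * h) = q / aw q lam 0 * X := fun X => by
        field_simp
      have p4 : h / aw q lam 0 * (h / aw q lam 1) * (aw q lam 2 * h) * (aw q lam 3 * h)
          = h / aw q lam 0 * (h / aw q lam 1) * q * aw q lam 2 * aw q lam 3 := by
        rw [← hh2]; ring
      have p5 : aw q lam 0 * aw q lam 1 / q - (q : ℂ) ^ v = (h / aw q lam 0 * (h / aw q lam 1))⁻¹
          * (1 - h / aw q lam 0 * (h / aw q lam 1) * (q : ℂ) ^ v) := by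
        rw [mul_sub, mul_one, ← mul_assoc, inv_mul_cancel₀ (mul_ne_zero (div_ne_zero hh0 n0) (div_ne_zero hh0 n1)),
          one_mul, ← hh2]
        field_simp
      simp only [coefAW, Fin.prod_univ_four, m0, m1, m2, m3, d0, d1, d2, d3, p3, p1, p2, p4]
      rw [p5]
      linear_combination (h / aw q lam 0 * (h / aw q lam 1))⁻¹
        * (qpoch q ((q : ℂ) ^ (-(v : ℤ))) k
          * qpoch q ((h / aw q lam 0 * (h / aw q lam 1) * q * aw q lam 2 * aw q lam 3) * (q : ℂ) ^ ((v : ℤ) - 1)) k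
          / qpoch q q k * (q : ℂ) ^ k) * qpoch q (q / aw q lam 0 * aw q lam 2 * (q : ℂ) ^ k) (v - k)
        * qpoch q (q / aw q lam 0 * aw q lam 3 * (q : ℂ) ^ k) (v - k) * hp)
  have e1 : exp (Real.log q / 2 : ℂ) * (exp (Real.log q / 2) / aw q lam 0) = q / aw q lam 0 := by
    rw [← hh2]; ring
  have e2 : (q : ℂ) / (aw q lam 0 * exp (Real.log q / 2)) = exp (Real.log q / 2) / aw q lam 0 := by
    rw [← hh2]; field_simp
  rw [e1] at key
  have e3 : ((exp (Real.log q / 2 : ℂ))⁻¹ ^ v) * (exp (Real.log q / 2) / aw q lam 0)⁻¹ ^ v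
      = ((q : ℂ) / aw q lam 0)⁻¹ ^ v := by
    rw [← mul_pow, ← mul_inv, e1]
  rw [e2]
  rw [← e3]
  have e4 : ((exp (Real.log q / 2 : ℂ))⁻¹ - exp (Real.log q / 2)) / 2
      * (2 / ((exp (Real.log q / 2 : ℂ))⁻¹ - exp (Real.log q / 2))) = 1 := by
    rw [div_mul_div_comm, mul_comm _ (2 : ℂ), div_self (mul_ne_zero two_ne_zero hh3)]
  linear_combination ((exp (Real.log q / 2 : ℂ))⁻¹ ^ v * (exp (Real.log q / 2) / aw q lam 0)⁻¹ ^ v) * key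
    - ((exp (Real.log q / 2 : ℂ))⁻¹ ^ v * (exp (Real.log q / 2) / aw q lam 0)⁻¹ ^ v)
      * ((aw q lam 0 * aw q lam 1 / q - (q : ℂ) ^ v) * (z - z⁻¹))
      * (∑ k ∈ Finset.range (v + 1), coefAW q (twist (.AW q) .I (lam + delta)) v k
        * basisAW q (exp (Real.log q / 2) / aw q lam 0) z k) * e4

theorem shift_I (S : System) (hS : S.Valid) (lam : Fin 4 → ℂ) (v : ℕ) (y : ℂ) :
    al S .I lam (y + I * gam S / 2) * xiV S .I lam v (y + I * gam S / 2)
      - be S .I lam (y - I * gam S / 2) * xiV S .I lam v (y - I * gam S / 2)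
      = shiftConst S lam v * (eta S (y + I * gam S / 2) - eta S (y - I * gam S / 2))
        * xiV S .I (lam + delta) v y := by
  cases S with
  | cH => exact shift_cH lam v y
  | W => exact shift_W lam v y
  | AW q => exact shift_AW hS.1 hS.2 lam v y

end MultiIndexed

/-! ### The shift relation for type II and generic parameters -/

namespace MultiIndexed

/-- The parameters that relate the shift relations of the two types. -/
noncomputable def dualParam : System → (Fin 4 → ℂ) → (Fin 4 → ℂ)
  | .cH, lam => ![1 / 2 - lam 2, 1 / 2 - lam 3, 1 / 2 - lam 0, 1 / 2 - lam 1]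
  | _, lam => fun k => 1 / 2 - lam k

/-- With the companion below: the type I relation at the dual parameters leads from type II
polynomials at `λ + δ` to type II polynomials at `λ`, opposite to the direction wanted for type II.
-/
theorem twist_dualParam (S : System) (lam : Fin 4 → ℂ) :
    twist S .I (dualParam S lam) = twist S .II (lam + delta) := by
  ext k
  cases S <;> fin_cases k <;> simp [twist, dualParam, delta] <;> ring

theorem twist_dualParam_add (S : System) (lam : Fin 4 → ℂ) :
    twist S .I (dualParam S lam + delta) = twist S .II lam := by
  ext k
  cases S <;> fin_cases k <;> simp [twist, dualParam, delta] <;> ring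

/-- The constants in the shift relations. -/
noncomputable def shiftConstV (S : System) : VType → (Fin 4 → ℂ) → ℕ → ℂ
  | .I, lam, v => shiftConst S lam v
  | .II, lam, v => twistConst S .II (lam + delta) * kap S / (cEta S (I * gam S) ^ 2 * deltaConst S)
      * virtualEnergy S .I (dualParam S lam) v / shiftConst S (dualParam S lam) v

/-- The parameters for which the constants in the shift relations do not vanish. -/
def ShiftGeneric (S : System) (lam : Fin 4 → ℂ) (v : ℕ) : Prop :=
  shiftConst S lam v ≠ 0 ∧ shiftConst S (dualParam S lam) v ≠ 0 ∧
    virtualEnergy S .I (dualParam S lam) v ≠ 0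

theorem cEta_I_mul_gam_ne_zero (S : System) (hS : S.Valid) : cEta S (I * gam S) ≠ 0 := by
  simpa using cEta_ne_zero S hS zero_ne_one

theorem twistConst_ne_zero (S : System) (hS : S.Valid) (T : VType) (lam : Fin 4 → ℂ) :
    twistConst S T lam ≠ 0 := by
  cases S with
  | cH => cases T <;> simp [twistConst]
  | W => cases T <;> simp [twistConst]
  | AW q =>
    have hQ : (q : ℂ) ≠ 0 := by exact_mod_cast hS.1.ne'
    cases T <;> simp [twistConst, aw_ne_zero hS.1, hQ]

theorem shiftConstV_ne_zero (S : System) (hS : S.Valid) (T : VType) {lam : Fin 4 → ℂ} {v : ℕ}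
    (h : ShiftGeneric S lam v) : shiftConstV S T lam v ≠ 0 := by
  cases T with
  | I => exact h.1
  | II =>
    exact div_ne_zero (mul_ne_zero (div_ne_zero (mul_ne_zero (twistConst_ne_zero S hS _ _) (kap_ne_zero S))
      (mul_ne_zero (pow_ne_zero _ (cEta_I_mul_gam_ne_zero S hS)) (deltaConst_ne_zero S))) h.2.2) h.2.1

theorem eta_half_sub (S : System) (y : ℂ) : eta S (y + I * gam S / 2) - eta S (y - I * gam S / 2)
    = cEta S (I * gam S) * sg S (2 * y) := by
  rw [eta_sub_eta]
  congr 2 <;> ring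

/-- The base parameter of the type II series is not twisted, so a termwise proof is not available.
Instead the dual type I relation, at `y ± iγ/2`, expresses `ξ(λ)` through `ξ(λ + δ)`. Inserted on
the left it composes to the second-order operator of which `ξ(λ + δ)` is an eigenfunction.
Genericity permits division by the constant of the dual relation. -/
theorem shift_II (S : System) (hS : S.Valid) {lam : Fin 4 → ℂ} {v : ℕ} (h : ShiftGeneric S lam v) (y : ℂ)
    (h1 : potDen S y ≠ 0) (h2 : potDen S (-y) ≠ 0) (h3 : sg S (2 * y) ≠ 0)
    (h4 : sg S (2 * y - I * gam S) ≠ 0) (h5 : sg S (2 * y + I * gam S) ≠ 0) :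
    al S .II lam (y + I * gam S / 2) * xiV S .II lam v (y + I * gam S / 2)
      - be S .II lam (y - I * gam S / 2) * xiV S .II lam v (y - I * gam S / 2)
      = shiftConstV S .II lam v * (eta S (y + I * gam S / 2) - eta S (y - I * gam S / 2))
        * xiV S .II (lam + delta) v y := by
  set ν := dualParam S lam with hν
  have e1 := shift_I S hS ν v (y + I * gam S / 2)
  have e2 := shift_I S hS ν v (y - I * gam S / 2)
  rw [eta_half_sub] at e1 e2 ⊢
  simp only [xiV, hν, twist_dualParam, twist_dualParam_add] at e1 e2 ⊢
  rw [← hν] at e1 e2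
  rw [show y + I * gam S / 2 + I * gam S / 2 = y + I * gam S by ring,
    show y + I * gam S / 2 - I * gam S / 2 = y by ring,
    show 2 * (y + I * gam S / 2) = 2 * y + I * gam S by ring] at e1
  rw [show y - I * gam S / 2 + I * gam S / 2 = y by ring,
    show y - I * gam S / 2 - I * gam S / 2 = y - I * gam S by ring,
    show 2 * (y - I * gam S / 2) = 2 * y - I * gam S by ring] at e2
  have t1 := twistConst_mul_potStar S hS .II (lam + delta) y
  have t2 := twistConst_mul_pot S hS .II (lam + delta) y
  have t3 := twistConst_mul_be S hS .II (lam + delta) y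
  have t4 := twistConst_mul_al S hS .II (lam + delta) y
  have d1 := al_add_delta S hS .II lam (y + 3 * (I * gam S / 2))
  rw [show y + 3 * (I * gam S / 2) - I * gam S / 2 = y + I * gam S by ring,
    show y + 3 * (I * gam S / 2) - I * gam S = y + I * gam S / 2 by ring] at d1
  have d2 := be_add_delta S hS .II lam (y - I * gam S / 2)
  rw [show y - I * gam S / 2 - I * gam S / 2 = y - I * gam S by ring] at d2
  rw [d1] at t3
  rw [d2] at t4
  have s3 := twistConst_mul_be S hS .I ν y
  have s4 := twistConst_mul_al S hS .I ν y
  rw [hν, twist_dualParam] at s3 s4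
  rw [← hν] at s3 s4
  have o1 := al_other_twist S .I ν y
  have o2 := be_other_twist S .I ν y
  rw [hν, twist_dualParam] at o1 o2
  rw [← hν] at o1 o2
  simp only [VType.other] at o1 o2
  have v1 := virtualEnergy_zero_eq S hS .I ν y h1 h2
  have v2 := virtualEnergy_eq S hS .I ν v
  rw [hν, twist_dualParam] at v1 v2
  rw [← hν] at v1 v2
  have de := basePoly_diffEq S hS (twist S .II (lam + delta)) v y h1 h2
  have p1 := pot_eq S hS (twist S .II (lam + delta)) y
  have p2 := potStar_eq S hS (twist S .II (lam + delta)) y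
  have p3 := pot_eq S hS ν y
  have p4 := potStar_eq S hS ν y
  have hc := h.2.1
  have hk := kap_ne_zero S
  have hE := cEta_I_mul_gam_ne_zero S hS
  have hD := deltaConst_ne_zero S
  simp only [shiftConstV]
  rw [← hν] at hc ⊢
  set κ := twist S .II (lam + delta)
  rw [eq_div_iff (mul_ne_zero (mul_ne_zero hk h3) h4)] at p1 p3
  rw [eq_div_iff (mul_ne_zero (mul_ne_zero hk h3) h5)] at p2 p4
  rw [← o1] at p3
  rw [← o2] at p4
  rw [← s3] at e1
  rw [← s4] at e2
  -- both sides multiplied by the nonvanishing constants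
  refine mul_left_cancel₀ (mul_ne_zero (mul_ne_zero hD hc) (mul_ne_zero hE (mul_ne_zero h4 h5))) ?_
  -- `r1` and `r2` identify the two terms on the left with the two halves of that second-order
  -- operator, including their diagonal parts; `r3` normalizes the constant.
  have r1 : deltaConst S * al S .II lam (y + I * gam S / 2) * (shiftConst S ν v
        * (basePoly S (twist S .II lam) v).eval (eta S (y + I * gam S / 2)) * cEta S (I * gam S))
      = twistConst S .II (lam + delta) * (kap S * sg S (2 * y)) * (twistConst S .I ν * potStar S κ y
        * (basePoly S κ v).eval (eta S (y + I * gam S)) - potStar S ν y * (basePoly S κ v).eval (eta S y)) := by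
    refine mul_left_cancel₀ h5 ?_
    linear_combination -deltaConst S * al S .II lam (y + I * gam S / 2) * e1
      - (twistConst S .I ν * be S .I κ y * (basePoly S κ v).eval (eta S (y + I * gam S))
        - be S .I ν y * (basePoly S κ v).eval (eta S y)) * t3
      - twistConst S .II (lam + delta) * twistConst S .I ν * (basePoly S κ v).eval (eta S (y + I * gam S)) * p2
      + twistConst S .II (lam + delta) * (basePoly S κ v).eval (eta S y) * p4
  have r2 : deltaConst S * be S .II lam (y - I * gam S / 2) * (shiftConst S ν v
        * (basePoly S (twist S .II lam) v).eval (eta S (y - I * gam S / 2)) * cEta S (I * gam S))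
      = twistConst S .II (lam + delta) * (kap S * sg S (2 * y)) * (pot S ν y * (basePoly S κ v).eval (eta S y)
        - twistConst S .I ν * pot S κ y * (basePoly S κ v).eval (eta S (y - I * gam S))) := by
    refine mul_left_cancel₀ h4 ?_
    linear_combination -deltaConst S * be S .II lam (y - I * gam S / 2) * e2
      - (al S .I ν y * (basePoly S κ v).eval (eta S y)
        - twistConst S .I ν * al S .I κ y * (basePoly S κ v).eval (eta S (y - I * gam S))) * t4
      - twistConst S .II (lam + delta) * (basePoly S κ v).eval (eta S y) * p3
      + twistConst S .II (lam + delta) * twistConst S .I ν * (basePoly S κ v).eval (eta S (y - I * gam S)) * p1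
  have r3 : deltaConst S * shiftConst S ν v * cEta S (I * gam S)
      * (twistConst S .II (lam + delta) * kap S / (cEta S (I * gam S) ^ 2 * deltaConst S)
        * virtualEnergy S .I ν v / shiftConst S ν v * (cEta S (I * gam S) * sg S (2 * y)))
      = twistConst S .II (lam + delta) * (kap S * sg S (2 * y)) * virtualEnergy S .I ν v := by
    field_simp
  linear_combination (sg S (2 * y - I * gam S) * sg S (2 * y + I * gam S)) * (r1 - r2
    - (basePoly S κ v).eval (eta S y) * r3 + twistConst S .II (lam + delta) * (kap S * sg S (2 * y))
      * (twistConst S .I ν * de + (basePoly S κ v).eval (eta S y) * (v1 - v2)))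

theorem shift_relation (S : System) (hS : S.Valid) (T : VType) {lam : Fin 4 → ℂ} {v : ℕ}
    (h : ShiftGeneric S lam v) (y : ℂ)
    (h1 : potDen S y ≠ 0) (h2 : potDen S (-y) ≠ 0) (h3 : sg S (2 * y) ≠ 0)
    (h4 : sg S (2 * y - I * gam S) ≠ 0) (h5 : sg S (2 * y + I * gam S) ≠ 0) :
    al S T lam (y + I * gam S / 2) * xiV S T lam v (y + I * gam S / 2)
      - be S T lam (y - I * gam S / 2) * xiV S T lam v (y - I * gam S / 2)
      = shiftConstV S T lam v * (eta S (y + I * gam S / 2) - eta S (y - I * gam S / 2))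
        * xiV S T (lam + delta) v y := by
  cases T with
  | I => exact shift_I S hS lam v y
  | II => exact shift_II S hS h y h1 h2 h3 h4 h5

theorem eventually_affine_ne (a b c : ℂ) (hb : b ≠ 0) : ∀ᶠ t in 𝓝[≠] (0 : ℂ), a + b * t ≠ c := by
  refine HasDerivAt.eventually_ne (f' := b) ?_ hb
  simpa using ((hasDerivAt_id (0 : ℂ)).const_mul b).const_add a

theorem eventually_exp_ne {L : ℂ} (hL : L ≠ 0) (a b c : ℂ) (hb : b ≠ 0) :
    ∀ᶠ t in 𝓝[≠] (0 : ℂ), exp (L * (a + b * t)) ≠ c := by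
  refine HasDerivAt.eventually_ne (f' := exp (L * (a + b * 0)) * (L * b)) ?_
    (mul_ne_zero (exp_ne_zero _) (mul_ne_zero hL hb))
  have h : HasDerivAt (fun t : ℂ => L * (a + b * t)) (L * b) 0 := by
    simpa using (((hasDerivAt_id (0 : ℂ)).const_mul b).const_add a).const_mul L
  exact h.cexp

/-- The line of parameters along which a limit to given parameters is taken. -/
def lamLine (lam : Fin 4 → ℂ) (t : ℂ) : Fin 4 → ℂ := fun k => lam k + t

theorem eventually_shiftConst_ne (S : System) (hS : S.Valid) (μ : ℂ → Fin 4 → ℂ) (lam : Fin 4 → ℂ) (b : ℂ)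
    (hb : b ≠ 0) (hμ : ∀ t k, μ t k = lam k + b * t) (v : ℕ) :
    ∀ᶠ t in 𝓝[≠] (0 : ℂ), shiftConst S (μ t) v ≠ 0 := by
  have hb2 : 2 * b ≠ 0 := mul_ne_zero two_ne_zero hb
  cases S with
  | cH =>
    filter_upwards [eventually_affine_ne (lam 0 + lam 2) (2 * b) (v + 1) hb2] with t ht
    simp only [shiftConst, hμ]
    refine mul_ne_zero (neg_ne_zero.mpr I_ne_zero) fun h => ht ?_
    linear_combination -h
  | W =>
    filter_upwards [eventually_affine_ne (lam 0 + lam 1) (2 * b) (v + 1) hb2] with t ht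
    simp only [shiftConst, hμ]
    refine neg_ne_zero.mpr fun h => ht ?_
    linear_combination -h
  | AW q =>
    have hQ : (q : ℂ) ≠ 0 := by exact_mod_cast hS.1.ne'
    filter_upwards [eventually_exp_ne (gam_ne_zero (.AW q) hS) (lam 0 + lam 1) (2 * b) ((q : ℂ) ^ v * q) hb2]
      with t ht
    simp only [shiftConst]
    refine mul_ne_zero (mul_ne_zero (pow_ne_zero _ (inv_ne_zero (exp_ne_zero _))) ?_)
      (div_ne_zero two_ne_zero (exp_half_ne hS.1 hS.2))
    intro h
    apply ht
    rw [← (div_eq_iff hQ).mp (sub_eq_zero.mp h), aw, aw, ofReal_cpow_eq_exp hS.1,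
      ofReal_cpow_eq_exp hS.1, ← exp_add, hμ, hμ, gam]
    congr 1
    ring

theorem eventually_virtualEnergy_ne (S : System) (hS : S.Valid) (μ : ℂ → Fin 4 → ℂ) (lam : Fin 4 → ℂ) (b : ℂ)
    (hb : b ≠ 0) (hμ : ∀ t k, μ t k = lam k + b * t) (v : ℕ) :
    ∀ᶠ t in 𝓝[≠] (0 : ℂ), virtualEnergy S .I (μ t) v ≠ 0 := by
  have hb2 : 2 * b ≠ 0 := mul_ne_zero two_ne_zero hb
  cases S with
  | cH =>
    filter_upwards [eventually_affine_ne (lam 0 + lam 2) (2 * b) (v + 1) hb2,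
      eventually_affine_ne (lam 1 + lam 3) (2 * b) (-v) hb2] with t ht ht'
    simp only [virtualEnergy, hμ]
    exact mul_ne_zero (neg_ne_zero.mpr fun h => ht (by linear_combination h))
      fun h => ht' (by linear_combination h)
  | W =>
    filter_upwards [eventually_affine_ne (lam 0 + lam 1) (2 * b) (v + 1) hb2,
      eventually_affine_ne (lam 2 + lam 3) (2 * b) (-v) hb2] with t ht ht'
    simp only [virtualEnergy, hμ]
    exact mul_ne_zero (neg_ne_zero.mpr fun h => ht (by linear_combination h))
      fun h => ht' (by linear_combination h)
  | AW q =>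
    have hQ : (q : ℂ) ≠ 0 := by exact_mod_cast hS.1.ne'
    have haw : ∀ t i j, aw q (μ t) i * aw q (μ t) j = exp (gam (.AW q) * (lam i + lam j + 2 * b * t)) := by
      intro t i j
      rw [aw, aw, ofReal_cpow_eq_exp hS.1, ofReal_cpow_eq_exp hS.1, ← exp_add, hμ, hμ, gam]
      congr 1
      ring
    filter_upwards [eventually_exp_ne (gam_ne_zero (.AW q) hS) (lam 0 + lam 1) (2 * b)
        ((q : ℂ) ^ (-(v : ℤ) - 1))⁻¹ hb2,
      eventually_exp_ne (gam_ne_zero (.AW q) hS) (lam 2 + lam 3) (2 * b) ((q : ℂ) ^ v)⁻¹ hb2] with t ht ht'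
    simp only [virtualEnergy, haw]
    exact mul_ne_zero (neg_ne_zero.mpr fun h => ht (eq_inv_of_mul_eq_one_left (sub_eq_zero.mp h).symm))
      fun h => ht' (eq_inv_of_mul_eq_one_left (sub_eq_zero.mp h).symm)

/-- Along the diagonal line every relevant factor is a nonconstant affine or exponential function of
`t`, so it takes an exceptional value only at isolated points. The dual parameters move in the
opposite direction. -/
theorem eventually_shiftGeneric (S : System) (hS : S.Valid) (lam : Fin 4 → ℂ) (v : ℕ) :
    ∀ᶠ t in 𝓝[≠] (0 : ℂ), ShiftGeneric S (lamLine lam t) v := by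
  have hd : ∀ t k, dualParam S (lamLine lam t) k = dualParam S lam k + -1 * t := by
    intro t k
    cases S <;> fin_cases k <;> simp [dualParam, lamLine] <;> ring
  exact (eventually_shiftConst_ne S hS _ lam 1 one_ne_zero (fun t k => by simp [lamLine]) v).and
    ((eventually_shiftConst_ne S hS _ _ (-1) (by norm_num) hd v).and
      (eventually_virtualEnergy_ne S hS _ _ (-1) (by norm_num) hd v))

end MultiIndexed

namespace MultiIndexed

/-! ### Functions whose zeros are isolated -/

/-- The zeros of the function are isolated. -/
def ZerosIsolated (f : ℂ → ℂ) : Prop := ∀ z, ∀ᶠ x in 𝓝[≠] z, f x ≠ 0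

theorem ZerosIsolated.of_differentiable {f : ℂ → ℂ} (hf : Differentiable ℂ f) {y : ℂ} (hy : f y ≠ 0) :
    ZerosIsolated f := by
  have ha : AnalyticOnNhd ℂ f Set.univ := fun z _ => hf.analyticAt z
  intro z
  rcases (hf.analyticAt z).eventually_eq_zero_or_eventually_ne_zero with h | h
  · exact absurd (ha.eqOn_zero_of_preconnected_of_eventuallyEq_zero isPreconnected_univ (Set.mem_univ z) h
      (Set.mem_univ y)) hy
  · exact h

theorem ZerosIsolated.mul {f g : ℂ → ℂ} (hf : ZerosIsolated f) (hg : ZerosIsolated g) :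
    ZerosIsolated fun x => f x * g x := fun z => by
  filter_upwards [hf z, hg z] with x h1 h2 using mul_ne_zero h1 h2

theorem ZerosIsolated.const {c : ℂ} (hc : c ≠ 0) : ZerosIsolated fun _ => c :=
  fun _ => Eventually.of_forall fun _ => hc

theorem ZerosIsolated.prod {ι : Type*} (s : Finset ι) {f : ι → ℂ → ℂ} (hf : ∀ i ∈ s, ZerosIsolated (f i)) :
    ZerosIsolated fun x => ∏ i ∈ s, f i x := fun z => by
  filter_upwards [(Filter.eventually_all_finset s).mpr fun i hi => hf i hi z] with x h
  exact Finset.prod_ne_zero_iff.mpr h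

theorem zerosIsolated_affine (a b : ℂ) (ha : a ≠ 0) : ZerosIsolated fun x => a * x + b :=
  .of_differentiable (by fun_prop) (y := (1 - b) / a) (by field_simp; simp)

theorem zerosIsolated_one_sub_exp (a b c : ℂ) (hb : b ≠ 0) : ZerosIsolated fun x => 1 - a * exp (b * x + c) := by
  by_cases h : 1 - a * exp c = 0
  -- The test point is half a period away from 0, where the exponential has the opposite sign; `1 -
  -- a e^c` and `1 + a e^c` cannot both vanish.
  · refine .of_differentiable (by fun_prop) (y := Real.pi * I / b) ?_
    rw [mul_div_cancel₀ _ hb, exp_add, exp_pi_mul_I]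
    intro h'
    exact two_ne_zero (α := ℂ) (by linear_combination h + h')
  · exact .of_differentiable (by fun_prop) (y := 0) (by simpa using h)

theorem zerosIsolated_al (S : System) (T : VType) (lam : Fin 4 → ℂ) (c : ℂ) :
    ZerosIsolated fun x => al S T lam (x + c) := by
  cases S with
  | cH =>
    have h : ∀ k, ZerosIsolated fun x => -(lam k + I * (x + c)) := fun k => by
      convert zerosIsolated_affine (-I) (-lam k - I * c) (neg_ne_zero.mpr I_ne_zero) using 2
      ring
    cases T
    · exact h 0
    · exact h 1
  | W =>
    have h : ∀ k, ZerosIsolated fun x => lam k + I * (x + c) := fun k => by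
      convert zerosIsolated_affine I (lam k + I * c) I_ne_zero using 2
      ring
    cases T
    · exact (h 0).mul (h 1)
    · exact (h 2).mul (h 3)
  | AW q =>
    have h : ∀ k, ZerosIsolated fun x => 1 - aw q lam k * exp (I * (x + c)) := fun k => by
      convert zerosIsolated_one_sub_exp (aw q lam k) I (I * c) I_ne_zero using 5
      ring
    have h0 : ZerosIsolated fun x => exp (-(Real.log q / 2) - I * (x + c)) :=
      fun _ => Eventually.of_forall fun _ => exp_ne_zero _
    cases T
    · exact h0.mul ((h 0).mul (h 1))
    · exact h0.mul ((h 2).mul (h 3))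

theorem ZerosIsolated.comp_neg {f : ℂ → ℂ} (hf : ZerosIsolated f) : ZerosIsolated fun x => f (-x) := by
  intro z
  have h : Tendsto (fun x : ℂ => -x) (𝓝[≠] z) (𝓝[≠] (-z)) :=
    tendsto_nhdsWithin_iff.mpr ⟨(continuous_neg.tendsto z).mono_left nhdsWithin_le_nhds, by
      filter_upwards [self_mem_nhdsWithin] with x hx
      simpa using hx⟩
  exact h.eventually (hf (-z))

theorem zerosIsolated_be (S : System) (T : VType) (lam : Fin 4 → ℂ) (c : ℂ) :
    ZerosIsolated fun x => be S T lam (x + c) := by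
  cases S with
  | cH =>
    have h : ∀ k, ZerosIsolated fun x => lam k - I * (x + c) := fun k => by
      convert zerosIsolated_affine (-I) (lam k - I * c) (neg_ne_zero.mpr I_ne_zero) using 2
      ring
    cases T
    · exact h 2
    · exact h 3
  | W =>
    convert (zerosIsolated_al .W T lam (-c)).comp_neg using 2
    simp only [be, neg_add]
  | AW q =>
    convert (zerosIsolated_al (.AW q) T lam (-c)).comp_neg using 2
    simp only [be, neg_add]

theorem zerosIsolated_sg (S : System) (c : ℂ) : ZerosIsolated fun x => sg S (2 * x + c) := by
  cases S with
  | cH => exact .const one_ne_zero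
  | W => exact zerosIsolated_affine 2 c two_ne_zero
  | AW q =>
    refine .of_differentiable (by simp only [sg]; fun_prop) (y := (Real.pi - c) / 2) ?_
    simp only [sg]
    rw [show (2 * (((Real.pi : ℂ) - c) / 2) + c) / 2 = Real.pi / 2 by ring, sin_pi_div_two]
    exact one_ne_zero

theorem zerosIsolated_potDen (S : System) (hS : S.Valid) (c : ℂ) : ZerosIsolated fun x => potDen S (x + c) := by
  cases S with
  | cH => exact .const one_ne_zero
  | W =>
    have h2 : 2 * I ≠ 0 := mul_ne_zero two_ne_zero I_ne_zero
    convert (zerosIsolated_affine (2 * I) (2 * I * c) h2).mul (zerosIsolated_affine (2 * I) (2 * I * c + 1) h2) using 2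
    simp only [potDen]
    ring
  | AW q =>
    have h2 : 2 * I ≠ 0 := mul_ne_zero two_ne_zero I_ne_zero
    convert (zerosIsolated_one_sub_exp 1 (2 * I) (2 * I * c) h2).mul
      (zerosIsolated_one_sub_exp q (2 * I) (2 * I * c) h2) using 2
    simp only [potDen, mul_add, one_mul]

theorem eta_surjective (S : System) : Function.Surjective (eta S) := by
  cases S with
  | cH => exact fun y => ⟨y, rfl⟩
  | W => exact fun y => ⟨y ^ (1 / 2 : ℂ), by simp [eta, ← cpow_nat_mul]⟩
  | AW q => exact Complex.cos_surjective

theorem differentiable_eta (S : System) : Differentiable ℂ (eta S) := by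
  cases S with
  | cH => exact differentiable_id
  | W => exact differentiable_pow 2
  | AW q => exact differentiable_cos

theorem zerosIsolated_eval (S : System) {p : Polynomial ℂ} (hp : p ≠ 0) (c : ℂ) :
    ZerosIsolated fun x => p.eval (eta S (x + c)) := by
  obtain ⟨w, hw⟩ : ∃ w, p.eval w ≠ 0 := by
    by_contra! h
    exact hp (Polynomial.funext fun r => by simp [h])
  obtain ⟨y, hy⟩ := eta_surjective S w
  refine .of_differentiable ?_ (y := y - c) (by simpa [hy] using hw)
  exact p.differentiable.comp ((differentiable_eta S).comp (by fun_prop))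

theorem zerosIsolated_detDen (S : System) (hS : S.Valid) (lam : Fin 4 → ℂ) {n m₁ m₂ : ℕ} (h₁ : m₁ ≤ n + 1)
    (h₂ : m₂ ≤ n + 1) : ZerosIsolated (detDen S lam n m₁ m₂) := by
  have h : ∀ T m, ZerosIsolated fun x =>
      denProd (fun i => al S T lam (nodeN S n x i)) (fun i => be S T lam (nodeN S n x i)) n m := by
    intro T m
    exact .prod _ fun i _ => .prod _ fun j _ => (zerosIsolated_al S T lam _).mul (zerosIsolated_be S T lam _)
  have hs : ZerosIsolated fun x => ∏ i : Fin n, ∏ j ∈ Finset.Ioi i, sg S (nodeN S n x i + nodeN S n x j) := by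
    simp only [nodeN_add_nodeN]
    exact .prod _ fun i _ => .prod _ fun j _ => zerosIsolated_sg S _
  rw [funext (detDen_eq S hS lam h₁ h₂)]
  exact (ZerosIsolated.const (detDenConst_ne_zero S hS n m₁ m₂)).mul ((hs.mul (h .II m₁)).mul (h .I m₂))

/-! ### The polynomials attached to a family of columns -/

/-- `p` is the polynomial part of the determinant of the given columns. -/
def IsColPoly (S : System) (lam : Fin 4 → ℂ) {n : ℕ} (c : Fin n → Col) (p : Polynomial ℂ) : Prop :=
  ∀ x, (colMat S lam c x).det = detDen S lam n (usesCard .II c) (usesCard .I c) x * p.eval (eta S x)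

/-- Away from the isolated zeros of the denominator the values of the polynomial are determined, and
the zeros of a nonzero polynomial in `η` are isolated too. -/
theorem IsColPoly.unique {S : System} (hS : S.Valid) {lam : Fin 4 → ℂ} {n : ℕ} {c : Fin n → Col}
    {p p' : Polynomial ℂ} (h : IsColPoly S lam c p) (h' : IsColPoly S lam c p') : p = p' := by
  by_contra hne
  have h1 := zerosIsolated_detDen S hS lam ((usesCard_le .II c).trans n.le_succ)
    ((usesCard_le .I c).trans n.le_succ) 0
  have h2 := zerosIsolated_eval S (sub_ne_zero.mpr hne) 0 0
  obtain ⟨x, hx1, hx2⟩ := (h1.and h2).exists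
  refine hx2 ?_
  simp only [add_zero]
  rw [Polynomial.eval_sub, sub_eq_zero]
  exact mul_left_cancel₀ hx1 ((h x).symm.trans (h' x))

theorem existsUnique_isColPoly (S : System) (hS : S.Valid) (lam : Fin 4 → ℂ) {n : ℕ} (c : Fin n → Col) :
    ∃! p, IsColPoly S lam c p := by
  obtain ⟨p, hp⟩ := exists_poly_det_colMat S hS lam c
  exact ⟨p, hp, fun p' hp' => IsColPoly.unique hS hp' hp⟩

/-- The polynomial part of the determinant of the given columns. -/
noncomputable def colPoly (S : System) (lam : Fin 4 → ℂ) {n : ℕ} (c : Fin n → Col) : Polynomial ℂ :=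
  Classical.epsilon (IsColPoly S lam c)

theorem colPoly_spec (S : System) (hS : S.Valid) (lam : Fin 4 → ℂ) {n : ℕ} (c : Fin n → Col) :
    IsColPoly S lam c (colPoly S lam c) :=
  Classical.epsilon_spec (existsUnique_isColPoly S hS lam c).exists

/-- The polynomial part of the determinant of the given columns, as a function of `x`. -/
noncomputable def colFun (S : System) (lam : Fin 4 → ℂ) {n : ℕ} (c : Fin n → Col) (x : ℂ) : ℂ :=
  (colPoly S lam c).eval (eta S x)

theorem usesCard_comp_perm (T : VType) {n : ℕ} (c : Fin n → Col) (σ : Equiv.Perm (Fin n)) :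
    usesCard T (c ∘ σ) = usesCard T c :=
  Finset.card_bij (fun i _ => σ i) (by simp) (by simp) (fun i hi => ⟨σ.symm i, by simpa using hi⟩)

theorem colPoly_comp_perm (S : System) (hS : S.Valid) (lam : Fin 4 → ℂ) {n : ℕ} (c : Fin n → Col)
    (σ : Equiv.Perm (Fin n)) :
    colPoly S lam (c ∘ σ) = Polynomial.C ((σ.sign : ℤ) : ℂ) * colPoly S lam c := by
  refine IsColPoly.unique hS (colPoly_spec S hS lam _) fun x => ?_
  have h : colMat S lam (c ∘ σ) x = (colMat S lam c x).submatrix id σ := rfl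
  rw [h, Matrix.det_permute', colPoly_spec S hS lam c x, usesCard_comp_perm, usesCard_comp_perm,
    Polynomial.eval_mul, Polynomial.eval_C]
  ring

/-- Reordering the columns multiplies the polynomial by the sign of a permutation. The same sign
serves all `λ`, in particular `λ` and `λ + δ`, which both occur in the Hamiltonian. -/
theorem exists_sign_colPoly_eq {S : System} (hS : S.Valid) {n n' : ℕ} {c : Fin n → Col} {c' : Fin n' → Col}
    (hc : Function.Injective c) (hc' : Function.Injective c') (h : Set.range c = Set.range c') :
    ∃ ε : ℂ, ε ≠ 0 ∧ (∀ T, usesCard T c' = usesCard T c) ∧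
      ∀ lam, colPoly S lam c' = Polynomial.C ε * colPoly S lam c := by
  let e : Fin n' ≃ Fin n := (Equiv.ofInjective c' hc').trans
    ((Equiv.setCongr h.symm).trans (Equiv.ofInjective c hc).symm)
  have he : ∀ i, c (e i) = c' i := fun i => by
    simp only [e, Equiv.trans_apply, Equiv.apply_ofInjective_symm hc]
    rfl
  clear_value e
  obtain rfl : n' = n := by simpa using Fintype.card_congr e
  obtain rfl : c ∘ e = c' := funext he
  exact ⟨((Equiv.Perm.sign e : ℤ) : ℂ), by exact_mod_cast Units.ne_zero _, fun T => usesCard_comp_perm T c e,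
    fun lam => colPoly_comp_perm S hS lam c e⟩

/-- The columns of the determinant that defines the denominator polynomial. -/
noncomputable def xiCols (D₁ D₂ : Finset ℕ) : Fin (D₁.card + D₂.card) → Col :=
  Fin.addCases (fun a => .X (D₁.orderEmbOfFin rfl a)) fun b => .Y (D₂.orderEmbOfFin rfl b)

/-- The set of labels of the columns of the denominator polynomial. -/
def colSet (D₁ D₂ : Finset ℕ) : Set Col := Col.X '' D₁ ∪ Col.Y '' D₂

theorem range_xiCols (D₁ D₂ : Finset ℕ) : Set.range (xiCols D₁ D₂) = colSet D₁ D₂ := by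
  have h1 : Set.range (fun a => Col.X (D₁.orderEmbOfFin rfl a)) = Col.X '' D₁ := by
    rw [← Finset.range_orderEmbOfFin D₁ rfl, ← Set.range_comp]; rfl
  have h2 : Set.range (fun a => Col.Y (D₂.orderEmbOfFin rfl a)) = Col.Y '' D₂ := by
    rw [← Finset.range_orderEmbOfFin D₂ rfl, ← Set.range_comp]; rfl
  rw [colSet, ← h1, ← h2]
  ext z
  simp only [Set.mem_range, Set.mem_union, xiCols]
  constructor
  · rintro ⟨i, rfl⟩
    refine Fin.addCases (fun a => ?_) (fun b => ?_) i
    · exact Or.inl ⟨a, by simp⟩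
    · exact Or.inr ⟨b, by simp⟩
  · rintro (⟨a, rfl⟩ | ⟨b, rfl⟩)
    · exact ⟨Fin.castAdd _ a, by simp⟩
    · exact ⟨Fin.natAdd _ b, by simp⟩

theorem xiCols_injective (D₁ D₂ : Finset ℕ) : Function.Injective (xiCols D₁ D₂) := by
  intro i j
  refine Fin.addCases (fun a => ?_) (fun b => ?_) i <;> refine Fin.addCases (fun a' => ?_) (fun b' => ?_) j <;>
    simp [xiCols]

theorem usesCard_sn (T : VType) {n : ℕ} (c : Fin n → Col) (u : Col) :
    usesCard T (sn c u) = usesCard T c + if u.uses T then 1 else 0 := by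
  simp only [usesCard, Finset.card_filter, Fin.sum_univ_castSucc, Fin.snoc_castSucc, Fin.snoc_last]

theorem usesCard_xiCols (D₁ D₂ : Finset ℕ) :
    usesCard .I (xiCols D₁ D₂) = D₂.card ∧ usesCard .II (xiCols D₁ D₂) = D₁.card := by
  simp only [usesCard, Finset.card_filter, Fin.sum_univ_add]
  simp [xiCols, Col.uses]

theorem isDenominatorPoly_iff (S : System) (lam : Fin 4 → ℂ) (D₁ D₂ : Finset ℕ) (p : Polynomial ℂ) :
    IsDenominatorPoly S lam D₁ D₂ p ↔ IsColPoly S lam (xiCols D₁ D₂) p := by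
  rw [IsDenominatorPoly, IsColPoly, (usesCard_xiCols D₁ D₂).1, (usesCard_xiCols D₁ D₂).2]
  refine forall_congr' fun x => ?_
  congr! 2
  ext j k
  refine Fin.addCases (fun a => ?_) (fun b => ?_) k
  · simp [xiMat, colMat, xiCols, Col.uses, Col.poly, colI, xiV]
  · simp [xiMat, colMat, xiCols, Col.uses, Col.poly, colII, xiV]

theorem isMultiIndexedPoly_iff (S : System) (lam : Fin 4 → ℂ) (D₁ D₂ : Finset ℕ) (m : ℕ) (p : Polynomial ℂ) :
    IsMultiIndexedPoly S lam D₁ D₂ m p ↔ IsColPoly S lam (sn (xiCols D₁ D₂) (.Z m)) p := by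
  rw [IsMultiIndexedPoly, IsColPoly, usesCard_sn, usesCard_sn, (usesCard_xiCols D₁ D₂).1, (usesCard_xiCols D₁ D₂).2]
  refine forall_congr' fun x => ?_
  congr! 2
  ext j k
  refine Fin.lastCases ?_ (fun k' => ?_) k
  · simp only [polyMat, colMat, Matrix.of_apply, Fin.lastCases_last, Fin.snoc_last, Col.uses, Col.poly, colZ,
      if_true]
    ring
  · simp only [polyMat, colMat, Matrix.of_apply, Fin.lastCases_castSucc, Fin.snoc_castSucc]
    refine Fin.addCases (fun a => ?_) (fun b => ?_) k'
    · simp [xiCols, Col.uses, Col.poly, colI, xiV]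
    · simp [xiCols, Col.uses, Col.poly, colII, xiV]

/-- Both sides are choices made from equivalent predicates, hence the same choice. -/
theorem Xi_eq_colPoly (S : System) (lam : Fin 4 → ℂ) (D₁ D₂ : Finset ℕ) :
    Xi S lam D₁ D₂ = colPoly S lam (xiCols D₁ D₂) := by
  rw [Xi, colPoly, funext fun p => propext (isDenominatorPoly_iff S lam D₁ D₂ p)]

theorem MIPoly_eq_colPoly (S : System) (lam : Fin 4 → ℂ) (D₁ D₂ : Finset ℕ) (m : ℕ) :
    MIPoly S lam D₁ D₂ m = colPoly S lam (sn (xiCols D₁ D₂) (.Z m)) := by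
  rw [MIPoly, colPoly, funext fun p => propext (isMultiIndexedPoly_iff S lam D₁ D₂ m p)]

theorem existsUnique_polys (S : System) (hS : S.Valid) (lam : Fin 4 → ℂ) (D₁ D₂ : Finset ℕ) :
    (∃! p : Polynomial ℂ, IsDenominatorPoly S lam D₁ D₂ p) ∧
      ∀ m : ℕ, ∃! p : Polynomial ℂ, IsMultiIndexedPoly S lam D₁ D₂ m p := by
  simp only [isDenominatorPoly_iff, isMultiIndexedPoly_iff]
  exact ⟨existsUnique_isColPoly S hS lam _, fun m => existsUnique_isColPoly S hS lam _⟩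

end MultiIndexed

namespace MultiIndexed

/-! ### The gauge factors -/

section gauge

variable {K : Type*} [Field K]

/-- The gauge function of a pair of sequences of site functions. -/
def gaugeG (a e : ℕ → K) (k : ℕ) : K := ∏ i ∈ Finset.range k, a i / e (i + 1)

/-- The gauge factor of a window of `s + r` sites, `s` of the columns having row factors. -/
def gaugePhi (a e : ℕ → K) (p r s : ℕ) : K :=
  (∏ j ∈ Finset.range r, gaugeG a e (p + j)) * ∏ s' ∈ Finset.range s, ∏ i ∈ Finset.range r, a (p + s' + i)

/-- The factor that relates the row factors of a window to the gauge function. -/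
def gaugeK (a e : ℕ → K) (p n : ℕ) : K := (∏ i ∈ Finset.range (n - 1), e (p + 1 + i)) / gaugeG a e p

/-- The factors that depend on the sums of two sites. -/
def siteVand (t : ℕ → K) (p n : ℕ) : K := ∏ k ∈ Finset.range n, ∏ i ∈ Finset.range k, t (2 * p + (i + k))

variable {a e : ℕ → K} {N : ℕ}

theorem gaugeG_succ (k : ℕ) : gaugeG a e (k + 1) = gaugeG a e k * (a k / e (k + 1)) := Finset.prod_range_succ _ _

theorem gaugeG_ne_zero (ha : ∀ k ≤ N, a k ≠ 0) (he : ∀ k ≤ N, e k ≠ 0) {k : ℕ} (hk : k ≤ N) :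
    gaugeG a e k ≠ 0 :=
  Finset.prod_ne_zero_iff.mpr fun i hi => by
    have := Finset.mem_range.mp hi
    exact div_ne_zero (ha i (by omega)) (he _ (by omega))

theorem gaugeG_add (he : ∀ k ≤ N, e k ≠ 0) (p : ℕ) {n : ℕ} (hn : p + n ≤ N) :
    gaugeG a e (p + n) * ∏ i ∈ Finset.range n, e (p + 1 + i)
      = gaugeG a e p * ∏ i ∈ Finset.range n, a (p + i) := by
  induction n with
  | zero => simp
  | succ n ih =>
    have h := he (p + n + 1) (by omega)
    rw [← add_assoc, gaugeG_succ, Finset.prod_range_succ, Finset.prod_range_succ,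
      show p + 1 + n = p + n + 1 by ring, ← mul_assoc (gaugeG a e p), ← ih (by omega)]
    field_simp

theorem gaugePhi_succ (p r s : ℕ) :
    gaugePhi a e p r (s + 1) = gaugePhi a e p r s * ∏ i ∈ Finset.range r, a (p + s + i) := by
  rw [gaugePhi, gaugePhi, Finset.prod_range_succ, mul_assoc]

theorem gaugePhi_ne_zero (ha : ∀ k ≤ N, a k ≠ 0) (he : ∀ k ≤ N, e k ≠ 0) {p r s : ℕ} (h : p + s + r ≤ N) :
    gaugePhi a e p r s ≠ 0 := by
  refine mul_ne_zero (Finset.prod_ne_zero_iff.mpr fun i hi => ?_)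
    (Finset.prod_ne_zero_iff.mpr fun s' hs => Finset.prod_ne_zero_iff.mpr fun i hi => ?_)
  · have := Finset.mem_range.mp hi
    exact gaugeG_ne_zero ha he (by omega)
  · have := Finset.mem_range.mp hi
    have := Finset.mem_range.mp hs
    exact ha _ (by omega)

/-- Moving the window by one site multiplies each gauge function by `a / e` and replaces the first
`a` of each product by the next one. -/
theorem gaugePhi_step (he : ∀ k ≤ N, e k ≠ 0) (p r s : ℕ) (h : p + r ≤ N) :
    gaugePhi a e (p + 1) r s * ∏ i ∈ Finset.range r, e (p + 1 + i)
      = gaugePhi a e p r s * ∏ i ∈ Finset.range r, a (p + s + i) := by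
  induction s with
  | zero =>
    simp only [gaugePhi, Finset.range_zero, Finset.prod_empty, mul_one, ← Finset.prod_mul_distrib, add_zero]
    refine Finset.prod_congr rfl fun i hi => ?_
    have := Finset.mem_range.mp hi
    have h := he (p + i + 1) (by omega)
    rw [show p + 1 + i = p + i + 1 by ring, gaugeG_succ]
    field_simp
  | succ s ih =>
    rw [gaugePhi_succ, gaugePhi_succ, mul_right_comm, ih, show p + 1 + s = p + (s + 1) by ring]

theorem denProd_succ (f g : ℕ → K) (n s : ℕ) : denProd f g (n + 1) (s + 1)
    = denProd f g n s * ((∏ j ∈ Finset.range s, f j) * g n ^ s) := by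
  have hg : g n ^ s = ∏ _j ∈ Finset.range s, g n := by simp
  rw [denProd, Finset.prod_range_succ', Finset.range_zero, Finset.prod_empty, mul_one, denProd, hg,
    ← Finset.prod_mul_distrib, ← Finset.prod_mul_distrib]
  refine Finset.prod_congr rfl fun j _ => ?_
  rw [Finset.prod_mul_distrib, Finset.prod_range_succ, Finset.prod_range_succ', Finset.prod_mul_distrib]
  simp only [Nat.add_sub_cancel, Nat.sub_zero, Nat.sub_sub, add_comm 1]
  ring

/-- `gaugePhi` is what is left of the gauge functions of all sites and the window constants once the
divisor `denProd` is taken out. The induction adds a site and a column with row factors, so the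
number `r` of the other columns stays fixed. -/
theorem denProd_mul_gaugePhi (ha : ∀ k ≤ N, a k ≠ 0) (he : ∀ k ≤ N, e k ≠ 0) (p r s : ℕ) (h : p + s + r ≤ N) :
    denProd (fun i => a (p + i)) (fun i => e (p + i)) (s + r) s * gaugePhi a e p r s
      = (∏ j ∈ Finset.range (s + r), gaugeG a e (p + j)) * gaugeK a e p (s + r) ^ s := by
  induction s with
  | zero => simp [denProd, gaugePhi]
  | succ s ih =>
    have hG := gaugeG_add (a := a) he p (n := s + r) (by omega)
    have hG0 := gaugeG_ne_zero ha he (k := p) (by omega)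
    have hK : gaugeK a e p (s + 1 + r) * gaugeG a e (p + (s + r)) = ∏ i ∈ Finset.range (s + r), a (p + i) := by
      rw [gaugeK, show s + 1 + r - 1 = s + r by omega]
      field_simp
      rw [mul_comm, hG]
    have hs : gaugeK a e p (s + r) ^ s * e (p + (s + r)) ^ s = gaugeK a e p (s + 1 + r) ^ s := by
      -- For `s = 0` both sides are empty powers; this avoids the truncated subtraction in `s + r -
      -- 1` when `s = r = 0`.
      cases s with
      | zero => simp
      | succ s =>
        rw [← mul_pow, gaugeK, gaugeK, show s + 1 + 1 + r - 1 = s + 1 + r - 1 + 1 by omega,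
          Finset.prod_range_succ, show p + 1 + (s + 1 + r - 1) = p + (s + 1 + r) by omega]
        ring
    rw [show s + 1 + r = s + r + 1 by ring, denProd_succ, gaugePhi_succ,
      Finset.prod_range_succ, show s + r + 1 = s + 1 + r by ring, pow_succ, ← hs]
    rw [Finset.prod_range_add] at hK
    simp only [← add_assoc] at hK ih hs ⊢
    linear_combination ((∏ j ∈ Finset.range s, a (p + j)) * e (p + s + r) ^ s
      * ∏ i ∈ Finset.range r, a (p + s + i)) * ih (by omega)
      - (∏ j ∈ Finset.range (s + r), gaugeG a e (p + j)) * gaugeK a e p (s + r) ^ s * e (p + s + r) ^ s * hK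

/-- Within a window the row factor is the gauge function at the site times a constant of the window.
Multiplying a column by row factors thus compensates, up to that constant, division by the gauge
function. -/
theorem rowProd_eq_gauge (ha : ∀ k ≤ N, a k ≠ 0) (he : ∀ k ≤ N, e k ≠ 0) (p : ℕ) {n j : ℕ} (hj : j < n)
    (h : p + n ≤ N) : rowProd (fun i => a (p + i)) (fun i => e (p + i)) n j
      = gaugeK a e p n * gaugeG a e (p + j) := by
  have h1 := gaugeG_add (a := a) he p (n := j) (by omega)
  have h0 := gaugeG_ne_zero ha he (k := p) (by omega)
  have h2 : ∏ i ∈ Finset.range (n - 1), e (p + 1 + i)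
      = (∏ i ∈ Finset.range j, e (p + 1 + i)) * ∏ i ∈ Finset.Ico (j + 1) n, e (p + i) := by
    obtain ⟨r, rfl⟩ : ∃ r, n = j + 1 + r := ⟨n - (j + 1), by omega⟩
    rw [show j + 1 + r - 1 = j + r by omega, Finset.prod_range_add, Finset.prod_Ico_eq_prod_range,
      Nat.add_sub_cancel_left]
    congr 1
    refine Finset.prod_congr rfl fun i _ => ?_
    congr 1
    ring
  rw [rowProd, gaugeK, h2, div_mul_eq_mul_div, eq_div_iff h0]
  linear_combination -(∏ i ∈ Finset.Ico (j + 1) n, e (p + i)) * h1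

theorem siteVand_succ (t : ℕ → K) (p n : ℕ) :
    siteVand t p (n + 1) = siteVand t p n * ∏ i ∈ Finset.range n, t (2 * p + (i + n)) :=
  Finset.prod_range_succ _ _

theorem siteVand_succ' (t : ℕ → K) (p n : ℕ) :
    siteVand t p (n + 1) = siteVand t (p + 1) n * ∏ j ∈ Finset.range n, t (2 * p + (j + 1)) := by
  induction n with
  | zero => simp [siteVand]
  | succ n ih =>
    rw [siteVand_succ, ih, siteVand_succ, Finset.prod_range_succ', Finset.prod_range_succ _ n]
    have : ∀ i, 2 * p + (i + 1 + (n + 1)) = 2 * (p + 1) + (i + n) := fun i => by ring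
    simp only [this, zero_add]
    ring

theorem siteVand_ne_zero {t : ℕ → K} (ht : ∀ k ≤ N, t k ≠ 0) {p n : ℕ} (h : 2 * p + 2 * n ≤ N) :
    siteVand t p n ≠ 0 :=
  Finset.prod_ne_zero_iff.mpr fun k hk => Finset.prod_ne_zero_iff.mpr fun i hi => by
    have := Finset.mem_range.mp hk
    have := Finset.mem_range.mp hi
    exact ht _ (by omega)

theorem prod_Ioi_eq_prod_range (f : ℕ → ℕ → K) (n : ℕ) : ∏ i : Fin n, ∏ j ∈ Finset.Ioi i, f i j
    = ∏ k ∈ Finset.range n, ∏ i ∈ Finset.range k, f i k := by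
  have h1 : ∀ i : Fin n, ∏ j ∈ Finset.Ioi i, f i j = ∏ j : Fin n, if i < j then f i j else 1 := fun i => by
    rw [← Finset.prod_filter]
    congr 1
    ext j
    simp
  simp only [h1]
  rw [Finset.prod_comm, Finset.prod_range]
  refine Finset.prod_congr rfl fun j _ => ?_
  simp only [Fin.lt_def]
  rw [Finset.prod_range fun i => f i j]
  have h2 := Fin.prod_univ_eq_prod_range (fun i => if i < (j : ℕ) then f i j else 1) n
  rw [h2, ← Finset.prod_range fun i => f i j, ← Finset.prod_filter]
  congr 1
  ext i
  simp
  omega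

end gauge

end MultiIndexed

/-! ### The lattice and the Casorati determinants of its solutions -/

namespace MultiIndexed

/-- The lattice of sites on which the difference equations are considered. -/
noncomputable def site (S : System) (b : ℂ) (k : ℕ) : ℂ := b - I * k * gam S

/-- The site functions `al` on the lattice. -/
noncomputable def alSite (S : System) (lam : Fin 4 → ℂ) (b : ℂ) (T : VType) (k : ℕ) : ℂ := al S T lam (site S b k)

/-- The site functions `be` on the lattice. -/
noncomputable def beSite (S : System) (lam : Fin 4 → ℂ) (b : ℂ) (T : VType) (k : ℕ) : ℂ := be S T lam (site S b k)

/-- The factor `sg` of a sum of two sites. -/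
noncomputable def sgSite (S : System) (b : ℂ) (k : ℕ) : ℂ := sg S (2 * b - I * k * gam S)

/-- The gauge function of the given type. -/
noncomputable def gaugeSite (S : System) (lam : Fin 4 → ℂ) (b : ℂ) (T : VType) (k : ℕ) : ℂ :=
  gaugeG (alSite S lam b T) (beSite S lam b T) k

/-- The solutions of the difference equation on the lattice. -/
noncomputable def psi (S : System) (lam : Fin 4 → ℂ) (b : ℂ) (c : Col) (k : ℕ) : ℂ :=
  (c.poly S lam).eval (eta S (site S b k)) / ((if c.uses .I then 1 else gaugeSite S lam b .I k)
    * if c.uses .II then 1 else gaugeSite S lam b .II k)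

/-- None of the denominators that occur at the first sites of the lattice vanishes. -/
structure GoodSites (S : System) (lam : Fin 4 → ℂ) (b : ℂ) (N : ℕ) : Prop where
  al : ∀ T, ∀ k ≤ N, alSite S lam b T k ≠ 0
  be : ∀ T, ∀ k ≤ N, beSite S lam b T k ≠ 0
  sg : ∀ k ≤ 2 * N + 2, sgSite S b k ≠ 0
  den : ∀ k ≤ N, potDen S (site S b k) ≠ 0 ∧ potDen S (-site S b k) ≠ 0
  den_half : ∀ k ≤ N, potDen S (site S b k - I * gam S / 2) ≠ 0 ∧ potDen S (-(site S b k - I * gam S / 2)) ≠ 0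

theorem eventually_goodSites (S : System) (hS : S.Valid) (lam : Fin 4 → ℂ) (c z : ℂ) (N : ℕ) :
    ∀ᶠ x in 𝓝[≠] z, GoodSites S lam (x + c) N := by
  have h1 : ∀ᶠ x in 𝓝[≠] z, ∀ k ∈ Finset.range (N + 1), (∀ T, alSite S lam (x + c) T k ≠ 0) ∧
      (∀ T, beSite S lam (x + c) T k ≠ 0) ∧
      (potDen S (site S (x + c) k) ≠ 0 ∧ potDen S (-site S (x + c) k) ≠ 0) ∧
      (potDen S (site S (x + c) k - I * gam S / 2) ≠ 0 ∧ potDen S (-(site S (x + c) k - I * gam S / 2)) ≠ 0) := by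
    refine (Filter.eventually_all_finset _).mpr fun k _ => ?_
    have a := fun T => zerosIsolated_al S T lam (c - I * k * gam S) z
    have b := fun T => zerosIsolated_be S T lam (c - I * k * gam S) z
    have d1 := zerosIsolated_potDen S hS (c - I * k * gam S) z
    have d2 := (zerosIsolated_potDen S hS (-(c - I * k * gam S))).comp_neg z
    have d3 := zerosIsolated_potDen S hS (c - I * k * gam S - I * gam S / 2) z
    have d4 := (zerosIsolated_potDen S hS (-(c - I * k * gam S - I * gam S / 2))).comp_neg z
    filter_upwards [a .I, a .II, b .I, b .II, d1, d2, d3, d4] with x a1 a2 b1 b2 d1 d2 d3 d4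
    simp only [← add_sub_assoc, ← neg_add] at a1 a2 b1 b2 d1 d2 d3 d4
    refine ⟨fun T => ?_, fun T => ?_, ⟨d1, d2⟩, ⟨d3, d4⟩⟩
    · cases T
      · exact a1
      · exact a2
    · cases T
      · exact b1
      · exact b2
  have h2 : ∀ᶠ x in 𝓝[≠] z, ∀ k ∈ Finset.range (2 * N + 3), sgSite S (x + c) k ≠ 0 := by
    refine (Filter.eventually_all_finset _).mpr fun k _ => ?_
    filter_upwards [zerosIsolated_sg S (2 * c - I * k * gam S) z] with x hx
    rwa [sgSite, mul_add, add_sub_assoc]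
  filter_upwards [h1, h2] with x h1 h2
  have hm : ∀ k ≤ N, k ∈ Finset.range (N + 1) := fun k hk => Finset.mem_range.mpr (by omega)
  exact ⟨fun T k hk => (h1 k (hm k hk)).1 T, fun T k hk => (h1 k (hm k hk)).2.1 T,
    fun k hk => h2 k (Finset.mem_range.mpr (by omega)), fun k hk => (h1 k (hm k hk)).2.2.1,
    fun k hk => (h1 k (hm k hk)).2.2.2⟩

/-- The argument is the centre of the window, so the nodes around it are the sites `p, …, p + n -
1`. -/
theorem nodeN_eq_site (S : System) (b : ℂ) (p n i : ℕ) :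
    nodeN S n (b - I * (p + ((n : ℂ) - 1) / 2) * gam S) i = site S b (p + i) := by
  simp only [nodeN, site]
  push_cast
  ring

/-- The factor between the Casorati determinants on the lattice and the polynomials. -/
noncomputable def gaugePsi (S : System) (lam : Fin 4 → ℂ) (b : ℂ) (n m₁ m₂ p : ℕ) : ℂ :=
  detDenConst S n m₂ m₁ * siteVand (sgSite S b) p n
    / (gaugePhi (alSite S lam b .I) (beSite S lam b .I) p (n - m₁) m₁
      * gaugePhi (alSite S lam b .II) (beSite S lam b .II) p (n - m₂) m₂)

theorem GoodSites.gaugePhi_ne_zero {S : System} {lam : Fin 4 → ℂ} {b : ℂ} {N : ℕ} (h : GoodSites S lam b N)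
    (T : VType) {p r s : ℕ} (hN : p + s + r ≤ N) :
    gaugePhi (alSite S lam b T) (beSite S lam b T) p r s ≠ 0 :=
  MultiIndexed.gaugePhi_ne_zero (h.al T) (h.be T) hN

theorem GoodSites.gaugeSite_ne_zero {S : System} {lam : Fin 4 → ℂ} {b : ℂ} {N : ℕ} (h : GoodSites S lam b N)
    (T : VType) {k : ℕ} (hk : k ≤ N) : gaugeSite S lam b T k ≠ 0 :=
  gaugeG_ne_zero (h.al T) (h.be T) hk

theorem gaugePsi_ne_zero {S : System} (hS : S.Valid) {lam : Fin 4 → ℂ} {b : ℂ} {N : ℕ} (h : GoodSites S lam b N)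
    {n m₁ m₂ p : ℕ} (h₁ : m₁ ≤ n) (h₂ : m₂ ≤ n) (hN : p + n ≤ N) : gaugePsi S lam b n m₁ m₂ p ≠ 0 :=
  div_ne_zero (mul_ne_zero (detDenConst_ne_zero S hS _ _ _) (siteVand_ne_zero h.sg (by omega)))
    (mul_ne_zero (h.gaugePhi_ne_zero .I (by omega)) (h.gaugePhi_ne_zero .II (by omega)))

theorem GoodSites.gaugeSite_prod_ne_zero {S : System} {lam : Fin 4 → ℂ} {b : ℂ} {N : ℕ} (h : GoodSites S lam b N)
    (T : VType) (p n : ℕ) (hN : p + n ≤ N) (m : ℕ) : (∏ j ∈ Finset.range n, gaugeSite S lam b T (p + j))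
      * gaugeK (alSite S lam b T) (beSite S lam b T) p n ^ m ≠ 0 := by
  refine mul_ne_zero (Finset.prod_ne_zero_iff.mpr fun j hj => h.gaugeSite_ne_zero T ?_) (pow_ne_zero _ (div_ne_zero
    (Finset.prod_ne_zero_iff.mpr fun i hi => h.be T _ ?_) (h.gaugeSite_ne_zero T (by omega))))
  · have := Finset.mem_range.mp hj
    omega
  · have := Finset.mem_range.mp hi
    omega

/-- The bridge between the recurrence and the polynomials. Scaling the rows by the gauge functions
of both types and the columns by window constants carries the Casorati matrix into `colMat`.
Dividing by the explicit denominator leaves the polynomial at the centre of the window. -/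
theorem cas_psi {S : System} (hS : S.Valid) {lam : Fin 4 → ℂ} {b : ℂ} {N : ℕ} (h : GoodSites S lam b N) {n : ℕ}
    (c : Fin n → Col) (p : ℕ) (hN : p + n ≤ N) :
    cas (psi S lam b) c (win p n) = gaugePsi S lam b n (usesCard .I c) (usesCard .II c) p
      * colFun S lam c (b - I * (p + ((n : ℂ) - 1) / 2) * gam S) := by
  set x := b - I * (p + ((n : ℂ) - 1) / 2) * gam S with hx
  have hnode : ∀ i, nodeN S n x i = site S b (p + i) := nodeN_eq_site S b p n
  have hrow : ∀ T (j : Fin n), rowFac S T lam n x j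
      = gaugeK (alSite S lam b T) (beSite S lam b T) p n * gaugeSite S lam b T (p + j) := fun T j => by
    rw [rowFac_eq_rowProd S hS]
    simp only [hnode]
    exact rowProd_eq_gauge (h.al T) (h.be T) p j.2 hN
  set G := gaugeSite S lam b with hG
  set κ := fun T => gaugeK (alSite S lam b T) (beSite S lam b T) p n with hκ
  have hdet : (colMat S lam c x).det
      = (((∏ j ∈ Finset.range n, G .I (p + j)) * κ .I ^ usesCard .I c)
        * ((∏ j ∈ Finset.range n, G .II (p + j)) * κ .II ^ usesCard .II c)) * cas (psi S lam b) c (win p n) := by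
    -- A column without row factors of a type is divided by its gauge function, which the row
    -- scaling undoes; a column with row factors instead receives the window constant `κ`.
    have hmat : colMat S lam c x = Matrix.of fun (j k : Fin n) => (G .I (p + j) * G .II (p + j))
        * (Matrix.of fun (j k : Fin n) => ((if (c k).uses .I then κ .I else 1) * (if (c k).uses .II then κ .II else 1))
          * (Matrix.of fun (i k : Fin n) => psi S lam b (c k) (win p n i)) j k) j k := by
      ext j k
      have g1 : G .I (p + j) ≠ 0 := h.gaugeSite_ne_zero .I (by omega)
      have g2 : G .II (p + j) ≠ 0 := h.gaugeSite_ne_zero .II (by omega)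
      simp only [colMat, Matrix.of_apply, psi, win, node_eq_nodeN, hnode, hrow]
      rw [← hG]
      cases (c k).uses .I <;> cases (c k).uses .II <;>
        simp only [if_true, Bool.false_eq_true, if_false, mul_one, one_mul, div_one, hκ] <;> field_simp
    rw [hmat, Matrix.det_mul_column, Matrix.det_mul_row, cas, Finset.prod_mul_distrib, Finset.prod_mul_distrib]
    simp only [Finset.prod_ite, Finset.prod_const, one_pow, mul_one]
    rw [Finset.prod_range (fun j => G .I (p + j)), Finset.prod_range (fun j => G .II (p + j)), usesCard, usesCard]
    ring
  have hΦ : ∀ T, denProd (fun i => alSite S lam b T (p + i)) (fun i => beSite S lam b T (p + i)) n (usesCard T c)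
      * gaugePhi (alSite S lam b T) (beSite S lam b T) p (n - usesCard T c) (usesCard T c)
      = (∏ j ∈ Finset.range n, G T (p + j)) * κ T ^ usesCard T c := fun T => by
    have hle := usesCard_le T c
    have := denProd_mul_gaugePhi (h.al T) (h.be T) p (n - usesCard T c) (usesCard T c) (by omega)
    rwa [Nat.add_sub_cancel' hle] at this
  have hV : ∏ i : Fin n, ∏ j ∈ Finset.Ioi i, sg S (nodeN S n x i + nodeN S n x j) = siteVand (sgSite S b) p n := by
    rw [siteVand, ← prod_Ioi_eq_prod_range fun i k => sgSite S b (2 * p + (i + k))]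
    refine Finset.prod_congr rfl fun i _ => Finset.prod_congr rfl fun j _ => ?_
    rw [hnode, hnode, sgSite, site, site]
    congr 1
    push_cast
    ring
  have hle1 := usesCard_le .I c
  have hle2 := usesCard_le .II c
  have e1 := h.gaugePhi_ne_zero .I (p := p) (r := n - usesCard .I c) (s := usesCard .I c) (by omega)
  have e2 := h.gaugePhi_ne_zero .II (p := p) (r := n - usesCard .II c) (s := usesCard .II c) (by omega)
  have hspec := colPoly_spec S hS lam c x
  rw [detDen_eq S hS lam (hle2.trans n.le_succ) (hle1.trans n.le_succ), hV, hdet] at hspec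
  simp only [hnode] at hspec
  rw [← hΦ .I, ← hΦ .II] at hspec
  have f1 := mul_ne_zero (h.gaugeSite_prod_ne_zero .I p n (by omega) (usesCard .I c))
    (h.gaugeSite_prod_ne_zero .II p n (by omega) (usesCard .II c))
  rw [← hG, ← hΦ .I, ← hΦ .II] at f1
  rw [gaugePsi, colFun, div_mul_eq_mul_div, eq_div_iff (mul_ne_zero e1 e2)]
  refine mul_left_cancel₀ (left_ne_zero_of_mul (left_ne_zero_of_mul f1)) ?_
  refine mul_left_cancel₀ (left_ne_zero_of_mul (right_ne_zero_of_mul f1)) ?_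
  simp only [alSite, beSite] at hspec ⊢
  linear_combination hspec

end MultiIndexed

/-! ### Relations between gauge factors of neighbouring windows -/

namespace MultiIndexed

section gauge

variable {K : Type*} [Field K]

theorem prod_range_shift (f : ℕ → K) (c n : ℕ) :
    (∏ i ∈ Finset.range n, f (c + i)) * f (c + n) = f c * ∏ i ∈ Finset.range n, f (c + 1 + i) := by
  rw [← Finset.prod_range_succ, Finset.prod_range_succ', mul_comm]
  simp only [add_zero, add_assoc, add_comm 1]

theorem prod_range_shift_two (f : ℕ → K) (c n : ℕ) : (∏ i ∈ Finset.range n, f (c + i)) * (f (c + n) * f (c + n + 1))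
    = f c * f (c + 1) * ∏ i ∈ Finset.range n, f (c + 2 + i) := by
  have h1 := prod_range_shift f c n
  have h2 := prod_range_shift f (c + 1) n
  rw [show c + 1 + n = c + n + 1 by ring, show c + 1 + 1 = c + 2 by ring] at h2
  linear_combination f (c + n + 1) * h1 + f c * h2

theorem prod_range_ne_zero {f : ℕ → K} {N : ℕ} (hf : ∀ k ≤ N, f k ≠ 0) {c n : ℕ} (h : c + n ≤ N + 1) :
    ∏ i ∈ Finset.range n, f (c + i) ≠ 0 :=
  Finset.prod_ne_zero_iff.mpr fun i hi => hf _ (by have := Finset.mem_range.mp hi; omega)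

variable {a e t : ℕ → K} {N : ℕ}

theorem gaugePhi_next (he : ∀ k ≤ N, e k ≠ 0) (p r s : ℕ) (h : p + r ≤ N) :
    gaugePhi a e (p + 1) r s * ∏ i ∈ Finset.range r, e (p + 1 + i) = gaugePhi a e p r (s + 1) :=
  (gaugePhi_step he p r s h).trans (gaugePhi_succ p r s).symm

/-- Adding the eigenstate adds a column with row factors of both types, so `s` grows by one and `r`
stays. In the relations named after removal, the denominator has one more column without row
factors; those named after the error concern the correction term. -/
theorem gaugePhi_up_down (a e : ℕ → K) (p r s : ℕ) :
    gaugePhi a e (p + 1) r s * gaugePhi a e p r (s + 1) * a (p + s + r)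
      = gaugePhi a e p r s * gaugePhi a e (p + 1) r (s + 1) * a (p + s) := by
  have h := prod_range_shift a (p + s) r
  rw [gaugePhi_succ, gaugePhi_succ, show p + 1 + s = p + s + 1 by ring]
  linear_combination gaugePhi a e (p + 1) r s * gaugePhi a e p r s * h

theorem gaugePhi_down_down (he : ∀ k ≤ N, e k ≠ 0) (p r s : ℕ) (h : p + 1 + r ≤ N) :
    gaugePhi a e (p + 1) r s * gaugePhi a e (p + 1) r (s + 1) * e (p + 1)
      = gaugePhi a e (p + 2) r s * gaugePhi a e p r (s + 1) * e (p + 1 + r) := by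
  have h := prod_range_shift e (p + 1) r
  rw [← gaugePhi_next he p r s (by omega), ← gaugePhi_next he (p + 1) r s (by omega)]
  linear_combination -gaugePhi a e (p + 1) r s * gaugePhi a e (p + 2) r s * h

theorem gaugePhi_remove_up (ha : ∀ k ≤ N, a k ≠ 0) (he : ∀ k ≤ N, e k ≠ 0) (p r s : ℕ) (h : p + 1 + s + r ≤ N) :
    gaugePhi a e (p + 1) (r + 1) s * gaugePhi a e (p + 1) r s * e (p + 1)
      = gaugePhi a e p (r + 1) s * gaugePhi a e (p + 2) r s * a (p + s) := by
  have h1 := gaugePhi_step (a := a) he p (r + 1) s (by omega)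
  have h2 := gaugePhi_step (a := a) he (p + 1) r s (by omega)
  have e1 := prod_range_shift e (p + 1) r
  have e2 := prod_range_shift a (p + s) r
  rw [Finset.prod_range_succ, Finset.prod_range_succ, e1, e2] at h1
  rw [show p + 1 + s = p + s + 1 by ring] at h2
  refine mul_right_cancel₀ (mul_ne_zero (prod_range_ne_zero he (c := p + 1 + 1) (n := r) (by omega))
    (prod_range_ne_zero ha (c := p + s + 1) (n := r) (by omega))) ?_
  linear_combination (gaugePhi a e (p + 1) r s * ∏ i ∈ Finset.range r, a (p + s + 1 + i)) * h1
    - gaugePhi a e p (r + 1) s * a (p + s) * (∏ i ∈ Finset.range r, a (p + s + 1 + i)) * h2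

theorem gaugePhi_remove_down (ha : ∀ k ≤ N, a k ≠ 0) (he : ∀ k ≤ N, e k ≠ 0) (p r s : ℕ) (h : p + 1 + s + r ≤ N) :
    gaugePhi a e p (r + 1) s * gaugePhi a e (p + 1) r s * a (p + s + r)
      = gaugePhi a e (p + 1) (r + 1) s * gaugePhi a e p r s * e (p + 1 + r) := by
  have h1 := gaugePhi_step (a := a) he p (r + 1) s (by omega)
  have h2 := gaugePhi_step (a := a) he p r s (by omega)
  rw [Finset.prod_range_succ, Finset.prod_range_succ] at h1
  refine mul_right_cancel₀ (mul_ne_zero (prod_range_ne_zero he (c := p + 1) (n := r) (by omega))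
    (prod_range_ne_zero ha (c := p + s) (n := r) (by omega))) ?_
  linear_combination -(gaugePhi a e p r s * ∏ i ∈ Finset.range r, a (p + s + i)) * h1
    + gaugePhi a e p (r + 1) s * a (p + s + r) * (∏ i ∈ Finset.range r, a (p + s + i)) * h2

theorem gaugePhi_error_up (a e : ℕ → K) (p r s : ℕ) :
    gaugePhi a e p (r + 1) (s + 1) * gaugePhi a e (p + 1) r (s + 1) * a (p + s + 1 + r)
      = gaugePhi a e (p + 1) r s * gaugePhi a e p (r + 1) (s + 2) := by
  rw [gaugePhi_succ (s := s + 1), gaugePhi_succ (p := p + 1), Finset.prod_range_succ,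
    show p + 1 + s = p + s + 1 by ring, ← add_assoc p s 1]
  ring

theorem gaugePhi_error_down (he : ∀ k ≤ N, e k ≠ 0) (p r s : ℕ) (h : p + 1 + r ≤ N) :
    gaugePhi a e (p + 1) (r + 1) (s + 1) * gaugePhi a e (p + 1) r (s + 1) * e (p + 1)
      = gaugePhi a e (p + 2) r s * gaugePhi a e p (r + 1) (s + 2) := by
  rw [← gaugePhi_next he p (r + 1) (s + 1) (by omega), ← gaugePhi_next he (p + 1) r s (by omega),
    Finset.prod_range_succ, prod_range_shift]
  ring

/-- Adjacent windows share all but a run of factors, and the two runs differ by a shift of two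
places, which exchanges two factors at each end. -/
theorem siteVand_up_down (t : ℕ → K) (p n : ℕ) :
    siteVand t p n * siteVand t (p + 1) (n + 1) * (t (2 * p + n) * t (2 * p + n + 1))
      = siteVand t (p + 1) n * siteVand t p (n + 1) * (t (2 * p + 2 * n) * t (2 * p + 2 * n + 1)) := by
  have h := prod_range_shift_two t (2 * p + n) n
  have h1 : ∏ i ∈ Finset.range n, t (2 * p + (i + n)) = ∏ i ∈ Finset.range n, t (2 * p + n + i) :=
    Finset.prod_congr rfl fun i _ => congrArg t (by ring)
  have h2 : ∏ i ∈ Finset.range n, t (2 * (p + 1) + (i + n)) = ∏ i ∈ Finset.range n, t (2 * p + n + 2 + i) :=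
    Finset.prod_congr rfl fun i _ => congrArg t (by ring)
  rw [siteVand_succ, siteVand_succ, h1, h2]
  rw [show 2 * p + n + n = 2 * p + 2 * n by ring] at h
  linear_combination -siteVand t p n * siteVand t (p + 1) n * h

theorem siteVand_down_down (t : ℕ → K) (p n : ℕ) :
    siteVand t (p + 2) n * siteVand t p (n + 1) * (t (2 * p + 1 + n) * t (2 * p + 1 + n + 1))
      = siteVand t (p + 1) n * siteVand t (p + 1) (n + 1) * (t (2 * p + 1) * t (2 * p + 1 + 1)) := by
  have h := prod_range_shift_two t (2 * p + 1) n
  have h1 : ∏ i ∈ Finset.range n, t (2 * p + (i + 1)) = ∏ i ∈ Finset.range n, t (2 * p + 1 + i) :=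
    Finset.prod_congr rfl fun i _ => congrArg t (by ring)
  have h2 : ∏ i ∈ Finset.range n, t (2 * (p + 1) + (i + 1)) = ∏ i ∈ Finset.range n, t (2 * p + 1 + 2 + i) :=
    Finset.prod_congr rfl fun i _ => congrArg t (by ring)
  rw [siteVand_succ', siteVand_succ', h1, h2]
  linear_combination siteVand t (p + 1) n * siteVand t (p + 2) n * h

theorem siteVand_error_up (t : ℕ → K) (p n : ℕ) :
    siteVand t (p + 1) n * siteVand t p (n + 3)
      = siteVand t p (n + 2) * siteVand t (p + 1) (n + 1) * (t (2 * p + 2 * n + 2) * t (2 * p + 2 * n + 3)) := by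
  have h1 : ∏ i ∈ Finset.range n, t (2 * (p + 1) + (i + n)) = ∏ i ∈ Finset.range n, t (2 * p + (i + (n + 2))) :=
    Finset.prod_congr rfl fun i _ => congrArg t (by ring)
  rw [siteVand_succ t p, siteVand_succ t (p + 1), Finset.prod_range_succ, Finset.prod_range_succ, h1]
  rw [show 2 * p + (n + (n + 2)) = 2 * p + 2 * n + 2 by ring,
    show 2 * p + (n + 1 + (n + 2)) = 2 * p + 2 * n + 3 by ring]
  ring

theorem siteVand_error_down (t : ℕ → K) (p n : ℕ) :
    siteVand t (p + 2) n * siteVand t p (n + 3)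
      = siteVand t (p + 1) (n + 2) * siteVand t (p + 1) (n + 1) * (t (2 * p + 1) * t (2 * p + 2)) := by
  have h1 : ∏ i ∈ Finset.range n, t (2 * (p + 1) + (i + 1)) = ∏ i ∈ Finset.range n, t (2 * p + (i + 1 + 1 + 1)) :=
    Finset.prod_congr rfl fun i _ => congrArg t (by ring)
  rw [siteVand_succ' t p, siteVand_succ' t (p + 1) n, Finset.prod_range_succ', Finset.prod_range_succ', h1]
  rw [show 2 * p + (0 + 1 + 1) = 2 * p + 2 by ring, show 2 * p + (0 + 1) = 2 * p + 1 by ring]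
  ring

end gauge

end MultiIndexed

namespace MultiIndexed

/-! ### The difference equations on the lattice -/

theorem site_succ (S : System) (b : ℂ) (k : ℕ) : site S b (k + 1) = site S b k - I * gam S := by
  simp only [site]
  push_cast
  ring

/-- The coefficient of the backward shift. -/
noncomputable def siteA (S : System) (lam : Fin 4 → ℂ) (b : ℂ) (k : ℕ) : ℂ := pot S lam (site S b k)

/-- The coefficient of the forward shift. -/
noncomputable def siteC (S : System) (lam : Fin 4 → ℂ) (b : ℂ) (k : ℕ) : ℂ := potStar S lam (site S b k)

/-- The diagonal coefficient. -/
noncomputable def siteB (S : System) (lam : Fin 4 → ℂ) (b : ℂ) (k : ℕ) : ℂ := -(siteA S lam b k + siteC S lam b k)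

/-- The energies of the columns. -/
noncomputable def colEnergy (S : System) (lam : Fin 4 → ℂ) : Col → ℂ
  | .X v => virtualEnergy S .I lam v
  | .Y v => virtualEnergy S .II lam v
  | .Z n => energy S lam n

theorem siteA_eq {S : System} (hS : S.Valid) (lam : Fin 4 → ℂ) (b : ℂ) (k : ℕ) : siteA S lam b k
    = alSite S lam b .I k * alSite S lam b .II k / (kap S * (sgSite S b (2 * k) * sgSite S b (2 * k + 1))) := by
  have h1 : 2 * b - I * ((2 * k : ℕ) : ℂ) * gam S = 2 * site S b k := by simp only [site]; push_cast; ring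
  have h2 : 2 * b - I * ((2 * k + 1 : ℕ) : ℂ) * gam S = 2 * site S b k - I * gam S := by
    simp only [site]; push_cast; ring
  rw [siteA, pot_eq S hS, mul_assoc (kap S), sgSite, sgSite, h1, h2, alSite, alSite]

theorem siteC_succ {S : System} (hS : S.Valid) (lam : Fin 4 → ℂ) (b : ℂ) (k : ℕ) : siteC S lam b (k + 1)
    = beSite S lam b .I (k + 1) * beSite S lam b .II (k + 1)
      / (kap S * (sgSite S b (2 * k + 1) * sgSite S b (2 * k + 2))) := by
  have h1 : 2 * b - I * ((2 * k + 2 : ℕ) : ℂ) * gam S = 2 * site S b (k + 1) := by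
    simp only [site]; push_cast; ring
  have h2 : 2 * b - I * ((2 * k + 1 : ℕ) : ℂ) * gam S = 2 * site S b (k + 1) + I * gam S := by
    simp only [site]; push_cast; ring
  rw [siteC, potStar_eq S hS, sgSite, sgSite, h1, h2, beSite, beSite]
  ring

/-- The quotient of consecutive gauge functions is `α_k / β_{k+1}`. It converts the off-diagonal
coefficients of the virtual state equation into `V` and `V^*`; the diagonal coefficient is already
the right one. -/
theorem virtual_eigenAt {S : System} (hS : S.Valid) {lam : Fin 4 → ℂ} {b : ℂ} {N : ℕ} (h : GoodSites S lam b N)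
    (T : VType) (v k : ℕ) (hk : k + 2 ≤ N) :
    EigenAt (siteA S lam b) (siteB S lam b) (siteC S lam b) (virtualEnergy S T lam v)
      (fun k => xiV S T lam v (site S b k) / gaugeSite S lam b T k) k := by
  have e := xiV_diffEq S hS T lam v (site S b (k + 1)) (h.den _ (by omega)).1 (h.den _ (by omega)).2
  have e1 : site S b (k + 1) + I * gam S = site S b k := by rw [site_succ]; ring
  rw [← site_succ, e1] at e
  have g1 := h.gaugeSite_ne_zero T (k := k) (by omega)
  have a0 := h.al T k (by omega)
  have a1 := h.al T (k + 1) (by omega)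
  have b1 := h.be T (k + 1) (by omega)
  have b2 := h.be T (k + 2) (by omega)
  have G1 : gaugeSite S lam b T (k + 1) = gaugeSite S lam b T k * (alSite S lam b T k / beSite S lam b T (k + 1)) :=
    gaugeG_succ k
  have G2 : gaugeSite S lam b T (k + 2)
      = gaugeSite S lam b T (k + 1) * (alSite S lam b T (k + 1) / beSite S lam b T (k + 2)) := gaugeG_succ (k + 1)
  have f1 : siteA S lam b (k + 1) / gaugeSite S lam b T (k + 2)
      = be S T lam (site S b (k + 1 + 1)) * al S T.other lam (site S b (k + 1))
      / (kap S * sg S (2 * site S b (k + 1)) * sg S (2 * site S b (k + 1) - I * gam S))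
        / gaugeSite S lam b T (k + 1) := by
    rw [siteA, pot_eq_other S hS T, G2]
    have hG := h.gaugeSite_ne_zero T (k := k + 1) (by omega)
    simp only [alSite, beSite] at a1 b2 ⊢
    generalize gaugeSite S lam b T (k + 1) = G at hG ⊢
    generalize kap S * sg S (2 * site S b (k + 1)) * sg S (2 * site S b (k + 1) - I * gam S) = Q
    field_simp
  have f2 : siteC S lam b (k + 1) / gaugeSite S lam b T k
      = al S T lam (site S b k) * be S T.other lam (site S b (k + 1))
      / (kap S * sg S (2 * site S b (k + 1)) * sg S (2 * site S b (k + 1) + I * gam S))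
        / gaugeSite S lam b T (k + 1) := by
    rw [siteC, potStar_eq_other S hS T, G1]
    simp only [alSite, beSite] at a0 b1 ⊢
    generalize gaugeSite S lam b T k = G at g1 ⊢
    generalize kap S * sg S (2 * site S b (k + 1)) * sg S (2 * site S b (k + 1) + I * gam S) = Q
    field_simp
  have f3 : siteB S lam b (k + 1) = -(pot S lam (site S b (k + 1)) + potStar S lam (site S b (k + 1))) := rfl
  rw [EigenAt]
  simp only [mul_div_left_comm _ (xiV S T lam v _), f1, f2, f3]
  linear_combination e / gaugeSite S lam b T (k + 1)

theorem psi_eigenAt {S : System} (hS : S.Valid) {lam : Fin 4 → ℂ} {b : ℂ} {N : ℕ} (h : GoodSites S lam b N)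
    (c : Col) (k : ℕ) (hk : k + 2 ≤ N) :
    EigenAt (siteA S lam b) (siteB S lam b) (siteC S lam b) (colEnergy S lam c) (psi S lam b c) k := by
  cases c with
  | X v =>
    have f : psi S lam b (.X v) = fun j => xiV S .I lam v (site S b j) / gaugeSite S lam b .I j := by
      funext j
      simp [psi, Col.uses, Col.poly, xiV]
    rw [f]
    exact virtual_eigenAt hS h .I v k hk
  | Y v =>
    have f : psi S lam b (.Y v) = fun j => xiV S .II lam v (site S b j) / gaugeSite S lam b .II j := by
      funext j
      simp [psi, Col.uses, Col.poly, xiV]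
    rw [f]
    exact virtual_eigenAt hS h .II v k hk
  | Z n =>
    have e := basePoly_diffEq S hS lam n (site S b (k + 1)) (h.den _ (by omega)).1 (h.den _ (by omega)).2
    have e1 : site S b (k + 1) + I * gam S = site S b k := by rw [site_succ]; ring
    rw [← site_succ, e1] at e
    have f : ∀ j, psi S lam b (.Z n) j = (basePoly S lam n).eval (eta S (site S b j)) := fun j => by
      simp [psi, Col.uses, Col.poly]
    simp only [EigenAt, f, siteB, siteA, siteC, colEnergy]
    linear_combination e

end MultiIndexed

namespace MultiIndexed

/-! ### Ratios of the gauge factors -/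

/-- The points midway between sites. -/
noncomputable def midSite (S : System) (b : ℂ) (j : ℕ) : ℂ := b - I * ((j : ℂ) / 2) * gam S

theorem midSite_add_two (S : System) (b : ℂ) (j : ℕ) : midSite S b (j + 2) = midSite S b j - I * gam S := by
  simp only [midSite]
  push_cast
  ring

theorem midSite_succ (S : System) (b : ℂ) (j : ℕ) : midSite S b (j + 1) = midSite S b j - I * gam S / 2 := by
  simp only [midSite]
  push_cast
  ring

/-- In half steps, the centre of a window of `n` sites from `p` has the index `2 p + n - 1`. -/
theorem cas_psi_midSite {S : System} (hS : S.Valid) {lam : Fin 4 → ℂ} {b : ℂ} {N : ℕ} (h : GoodSites S lam b N)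
    {n : ℕ} (c : Fin n → Col) (p j : ℕ) (hN : p + n ≤ N) (hj : j + 1 = 2 * p + n) :
    cas (psi S lam b) c (win p n) = gaugePsi S lam b n (usesCard .I c) (usesCard .II c) p
      * colFun S lam c (midSite S b j) := by
  have hj' : (j : ℂ) + 1 = 2 * p + n := by exact_mod_cast hj
  rw [cas_psi hS h c p hN, midSite, show (j : ℂ) / 2 = p + ((n : ℂ) - 1) / 2 by linear_combination hj' / 2]

/-- `m₁` counts columns with type I row factors, which for virtual states are the type II states.
This is why the arguments of `lamD` appear in reversed order. -/
theorem pot_lamD_midSite {S : System} (hS : S.Valid) (lam : Fin 4 → ℂ) (b : ℂ) (m₁ m₂ : ℕ) :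
    pot S (lamD S lam m₂ m₁) (midSite S b (m₁ + m₂ + 2)) = alSite S lam b .I (1 + m₁) * alSite S lam b .II (1 + m₂)
      / (kap S * (sgSite S b (m₁ + m₂ + 2) * sgSite S b (m₁ + m₂ + 3))) := by
  rw [pot_lamD S hS, mul_assoc (kap S)]
  simp only [alSite, sgSite, site, midSite]
  congr! 3
  · push_cast; ring
  · push_cast; ring
  · congr 1
    push_cast; ring
  · congr 1
    push_cast; ring

theorem potStar_lamD_midSite {S : System} (hS : S.Valid) (lam : Fin 4 → ℂ) (b : ℂ) (m₁ m₂ : ℕ) :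
    potStar S (lamD S lam m₂ m₁) (midSite S b (m₁ + m₂ + 2))
      = beSite S lam b .I (1 + m₂) * beSite S lam b .II (1 + m₁)
      / (kap S * (sgSite S b (m₁ + m₂ + 1) * sgSite S b (m₁ + m₂ + 2))) := by
  rw [potStar_lamD S hS, mul_assoc (kap S), mul_comm (sgSite S b _)]
  simp only [beSite, sgSite, site, midSite]
  congr! 3
  · push_cast; ring
  · push_cast; ring
  · congr 1
    push_cast; ring
  · congr 1
    push_cast; ring

theorem ratio_aux {a₁ a₂ a₁' a₂' k s u c c' v₁ v₂ v₃ v₄ f₁ f₂ f₃ f₄ g₁ g₂ g₃ g₄ : ℂ} (hk : k ≠ 0) (hs : s ≠ 0)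
    (hu : u ≠ 0) (hf₁ : f₁ ≠ 0) (hf₂ : f₂ ≠ 0) (hf₃ : f₃ ≠ 0) (hf₄ : f₄ ≠ 0) (hg₁ : g₁ ≠ 0) (hg₂ : g₂ ≠ 0)
    (hg₃ : g₃ ≠ 0) (hg₄ : g₄ ≠ 0) (hv : v₁ * v₂ * s = v₃ * v₄ * u) (hf : f₃ * f₄ * a₁ = f₁ * f₂ * a₁')
    (hg : g₃ * g₄ * a₂ = g₁ * g₂ * a₂') :
    a₁ * a₂ / (k * u) * (c * v₁ / (f₁ * g₁)) * (c' * v₂ / (f₂ * g₂))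
      = a₁' * a₂' / (k * s) * ((c * v₃ / (f₃ * g₃)) * (c' * v₄ / (f₄ * g₄))) := by
  field_simp
  linear_combination c * c' * (f₁ * f₂ * a₁' * (g₁ * g₂ * a₂') * hv + v₁ * v₂ * s * (g₃ * g₄ * a₂) * hf
    + v₁ * v₂ * s * (f₁ * f₂ * a₁') * hg)

theorem error_aux {a₁ a₂ k u c c' c'' c''' v₁ v₂ v₃ v₄ f₁ f₂ f₃ f₄ g₁ g₂ g₃ g₄ : ℂ} (hk : k ≠ 0)
    (hu : u ≠ 0) (hf₁ : f₁ ≠ 0) (hf₂ : f₂ ≠ 0) (hf₃ : f₃ ≠ 0) (hf₄ : f₄ ≠ 0) (hg₁ : g₁ ≠ 0) (hg₂ : g₂ ≠ 0)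
    (hg₃ : g₃ ≠ 0) (hg₄ : g₄ ≠ 0) (hc : c'' ≠ 0) (hc' : c''' ≠ 0) (hv : v₁ * v₂ = v₃ * v₄ * u)
    (hf : f₃ * f₄ * a₁ = f₁ * f₂) (hg : g₃ * g₄ * a₂ = g₁ * g₂) :
    a₁ * a₂ / (k * u) * (c * v₁ / (f₁ * g₁)) * (c' * v₂ / (f₂ * g₂))
      = c * c' / (c'' * c''' * k) * ((c'' * v₃ / (f₃ * g₃)) * (c''' * v₄ / (f₄ * g₄))) := by
  field_simp
  linear_combination c * c' * (f₁ * f₂ * (g₁ * g₂) * hv + v₁ * v₂ * (g₃ * g₄ * a₂) * hf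
    + v₁ * v₂ * (f₁ * f₂) * hg)

/-- The gauge factors of the windows of the denominator and of the function combine so that the
coefficient at `λ` becomes the potential at `λ_D`, at the common midpoint. The Vandermonde part and
the two types contribute independently. -/
theorem gaugePsi_up {S : System} (hS : S.Valid) {lam : Fin 4 → ℂ} {b : ℂ} {N : ℕ}
    (h : GoodSites S lam b N) (m₁ m₂ : ℕ) (hN : m₁ + m₂ + 3 ≤ N) :
    siteA S lam b (m₁ + m₂ + 1) * gaugePsi S lam b (m₁ + m₂) m₁ m₂ 1
        * gaugePsi S lam b (m₁ + m₂ + 1) (m₁ + 1) (m₂ + 1) 2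
      = pot S (lamD S lam m₂ m₁) (midSite S b (m₁ + m₂ + 2)) * (gaugePsi S lam b (m₁ + m₂) m₁ m₂ 2
        * gaugePsi S lam b (m₁ + m₂ + 1) (m₁ + 1) (m₂ + 1) 1) := by
  have t := h.sg
  have f := fun T p r s (hp : p + s + r ≤ N) => h.gaugePhi_ne_zero T hp
  rw [siteA_eq hS, pot_lamD_midSite hS]
  simp only [gaugePsi, show m₁ + m₂ - m₁ = m₂ by omega, show m₁ + m₂ - m₂ = m₁ by omega,
    show m₁ + m₂ + 1 - (m₁ + 1) = m₂ by omega, show m₁ + m₂ + 1 - (m₂ + 1) = m₁ by omega]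
  refine ratio_aux (kap_ne_zero S) (mul_ne_zero (t _ (by omega)) (t _ (by omega)))
    (mul_ne_zero (t _ (by omega)) (t _ (by omega))) (f _ _ _ _ (by omega)) (f _ _ _ _ (by omega))
    (f _ _ _ _ (by omega)) (f _ _ _ _ (by omega)) (f _ _ _ _ (by omega)) (f _ _ _ _ (by omega))
    (f _ _ _ _ (by omega)) (f _ _ _ _ (by omega)) ?_ ?_ ?_
  · have := siteVand_up_down (sgSite S b) 1 (m₁ + m₂)
    convert this using 4 <;> ring
  · have := gaugePhi_up_down (alSite S lam b .I) (beSite S lam b .I) 1 m₂ m₁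
    convert this using 3; ring
  · have := gaugePhi_up_down (alSite S lam b .II) (beSite S lam b .II) 1 m₁ m₂
    convert this using 3; ring

theorem gaugePsi_down {S : System} (hS : S.Valid) {lam : Fin 4 → ℂ} {b : ℂ} {N : ℕ}
    (h : GoodSites S lam b N) (m₁ m₂ : ℕ) (hN : m₁ + m₂ + 3 ≤ N) :
    siteC S lam b 1 * gaugePsi S lam b (m₁ + m₂) m₁ m₂ 2
        * gaugePsi S lam b (m₁ + m₂ + 1) (m₁ + 1) (m₂ + 1) 0
      = potStar S (lamD S lam m₂ m₁) (midSite S b (m₁ + m₂ + 2)) * (gaugePsi S lam b (m₁ + m₂) m₁ m₂ 1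
        * gaugePsi S lam b (m₁ + m₂ + 1) (m₁ + 1) (m₂ + 1) 1) := by
  have t := h.sg
  have f := fun T p r s (hp : p + s + r ≤ N) => h.gaugePhi_ne_zero T hp
  rw [siteC_succ hS, potStar_lamD_midSite hS]
  simp only [gaugePsi, show m₁ + m₂ - m₁ = m₂ by omega, show m₁ + m₂ - m₂ = m₁ by omega,
    show m₁ + m₂ + 1 - (m₁ + 1) = m₂ by omega, show m₁ + m₂ + 1 - (m₂ + 1) = m₁ by omega]
  refine ratio_aux (kap_ne_zero S) (mul_ne_zero (t _ (by omega)) (t _ (by omega)))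
    (mul_ne_zero (t _ (by omega)) (t _ (by omega))) (f _ _ _ _ (by omega)) (f _ _ _ _ (by omega))
    (f _ _ _ _ (by omega)) (f _ _ _ _ (by omega)) (f _ _ _ _ (by omega)) (f _ _ _ _ (by omega))
    (f _ _ _ _ (by omega)) (f _ _ _ _ (by omega)) ?_ ?_ ?_
  · have := siteVand_down_down (sgSite S b) 0 (m₁ + m₂)
    convert this using 4 <;> ring
  · exact gaugePhi_down_down (a := alSite S lam b .I) (h.be .I) 0 m₂ m₁ (by omega)
  · exact gaugePhi_down_down (a := alSite S lam b .II) (h.be .II) 0 m₁ m₂ (by omega)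

/-- The function has one column fewer than the denominator, and it is the coefficient `C` of the
recurrence that becomes the potential `V` at `λ_D`. -/
theorem gaugePsi_remove_up {S : System} (hS : S.Valid) {lam : Fin 4 → ℂ} {b : ℂ} {N : ℕ}
    (h : GoodSites S lam b N) (m₁ m₂ : ℕ) (hN : m₁ + m₂ + 5 ≤ N) :
    siteC S lam b 2 * gaugePsi S lam b (m₁ + m₂ + 2) (m₁ + 1) (m₂ + 1) 1
        * gaugePsi S lam b (m₁ + m₂ + 1) (m₁ + 1) (m₂ + 1) 3
      = pot S (lamD S lam (m₂ + 1) (m₁ + 1)) (midSite S b (m₁ + m₂ + 4))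
        * (gaugePsi S lam b (m₁ + m₂ + 2) (m₁ + 1) (m₂ + 1) 2
        * gaugePsi S lam b (m₁ + m₂ + 1) (m₁ + 1) (m₂ + 1) 2) := by
  have t := h.sg
  have f := fun T p r s (hp : p + s + r ≤ N) => h.gaugePhi_ne_zero T hp
  rw [siteC_succ hS, show m₁ + m₂ + 4 = m₁ + 1 + (m₂ + 1) + 2 by ring, pot_lamD_midSite hS]
  simp only [gaugePsi, show m₁ + m₂ + 2 - (m₁ + 1) = m₂ + 1 by omega, show m₁ + m₂ + 2 - (m₂ + 1) = m₁ + 1 by omega,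
    show m₁ + m₂ + 1 - (m₁ + 1) = m₂ by omega, show m₁ + m₂ + 1 - (m₂ + 1) = m₁ by omega]
  refine ratio_aux (kap_ne_zero S) (mul_ne_zero (t _ (by omega)) (t _ (by omega)))
    (mul_ne_zero (t _ (by omega)) (t _ (by omega))) (f _ _ _ _ (by omega)) (f _ _ _ _ (by omega))
    (f _ _ _ _ (by omega)) (f _ _ _ _ (by omega)) (f _ _ _ _ (by omega)) (f _ _ _ _ (by omega))
    (f _ _ _ _ (by omega)) (f _ _ _ _ (by omega)) ?_ ?_ ?_
  · have := siteVand_down_down (sgSite S b) 1 (m₁ + m₂ + 1)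
    rw [mul_comm (siteVand _ _ _), show m₁ + 1 + (m₂ + 1) + 2 = 2 * 1 + 1 + (m₁ + m₂ + 1) by ring,
      show m₁ + 1 + (m₂ + 1) + 3 = 2 * 1 + 1 + (m₁ + m₂ + 1) + 1 by ring, this]
    ring
  · exact gaugePhi_remove_up (h.al .I) (h.be .I) 1 m₂ (m₁ + 1) (by omega)
  · exact gaugePhi_remove_up (h.al .II) (h.be .II) 1 m₁ (m₂ + 1) (by omega)

theorem gaugePsi_remove_down {S : System} (hS : S.Valid) {lam : Fin 4 → ℂ} {b : ℂ} {N : ℕ}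
    (h : GoodSites S lam b N) (m₁ m₂ : ℕ) (hN : m₁ + m₂ + 5 ≤ N) :
    siteA S lam b (m₁ + m₂ + 2) * gaugePsi S lam b (m₁ + m₂ + 2) (m₁ + 1) (m₂ + 1) 2
        * gaugePsi S lam b (m₁ + m₂ + 1) (m₁ + 1) (m₂ + 1) 1
      = potStar S (lamD S lam (m₂ + 1) (m₁ + 1)) (midSite S b (m₁ + m₂ + 4))
        * (gaugePsi S lam b (m₁ + m₂ + 2) (m₁ + 1) (m₂ + 1) 1
        * gaugePsi S lam b (m₁ + m₂ + 1) (m₁ + 1) (m₂ + 1) 2) := by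
  have t := h.sg
  have f := fun T p r s (hp : p + s + r ≤ N) => h.gaugePhi_ne_zero T hp
  rw [siteA_eq hS, show m₁ + m₂ + 4 = m₁ + 1 + (m₂ + 1) + 2 by ring, potStar_lamD_midSite hS]
  simp only [gaugePsi, show m₁ + m₂ + 2 - (m₁ + 1) = m₂ + 1 by omega, show m₁ + m₂ + 2 - (m₂ + 1) = m₁ + 1 by omega,
    show m₁ + m₂ + 1 - (m₁ + 1) = m₂ by omega, show m₁ + m₂ + 1 - (m₂ + 1) = m₁ by omega]
  refine ratio_aux (kap_ne_zero S) (mul_ne_zero (t _ (by omega)) (t _ (by omega)))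
    (mul_ne_zero (t _ (by omega)) (t _ (by omega))) (f _ _ _ _ (by omega)) (f _ _ _ _ (by omega))
    (f _ _ _ _ (by omega)) (f _ _ _ _ (by omega)) (f _ _ _ _ (by omega)) (f _ _ _ _ (by omega))
    (f _ _ _ _ (by omega)) (f _ _ _ _ (by omega)) ?_ ?_ ?_
  · have := siteVand_up_down (sgSite S b) 1 (m₁ + m₂ + 1)
    rw [show 2 * (m₁ + m₂ + 2) = 2 * 1 + 2 * (m₁ + m₂ + 1) by ring,
      show m₁ + 1 + (m₂ + 1) + 1 = 2 * 1 + (m₁ + m₂ + 1) by ring,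
      show m₁ + 1 + (m₂ + 1) + 2 = 2 * 1 + (m₁ + m₂ + 1) + 1 by ring]
    linear_combination this
  · have := gaugePhi_remove_down (h.al .I) (h.be .I) 1 m₂ (m₁ + 1) (by omega)
    convert this using 3
    · ring
    · ring
  · have := gaugePhi_remove_down (h.al .II) (h.be .II) 1 m₁ (m₂ + 1) (by omega)
    convert this using 3
    · ring
    · ring

/-- The constant in the error terms. -/
noncomputable def errorConst (S : System) (m₁ m₂ : ℕ) : ℂ :=
  detDenConst S (m₁ + m₂) m₂ m₁ * detDenConst S (m₁ + m₂ + 3) (m₂ + 2) (m₁ + 2)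
    / (detDenConst S (m₁ + m₂ + 2) (m₂ + 1) (m₁ + 1) * detDenConst S (m₁ + m₂ + 1) (m₂ + 1) (m₁ + 1) * kap S)

/-- In the correction term all dependence on the lattice and on `λ` cancels, leaving `errorConst`.
Its regularity at a zero is therefore decided by the polynomials alone. -/
theorem gaugePsi_error_up {S : System} (hS : S.Valid) {lam : Fin 4 → ℂ} {b : ℂ} {N : ℕ}
    (h : GoodSites S lam b N) (m₁ m₂ : ℕ) (hN : m₁ + m₂ + 5 ≤ N) :
    siteA S lam b (m₁ + m₂ + 2) * gaugePsi S lam b (m₁ + m₂) m₁ m₂ 2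
        * gaugePsi S lam b (m₁ + m₂ + 3) (m₁ + 2) (m₂ + 2) 1
      = errorConst S m₁ m₂ * (gaugePsi S lam b (m₁ + m₂ + 2) (m₁ + 1) (m₂ + 1) 1
        * gaugePsi S lam b (m₁ + m₂ + 1) (m₁ + 1) (m₂ + 1) 2) := by
  have t := h.sg
  have f := fun T p r s (hp : p + s + r ≤ N) => h.gaugePhi_ne_zero T hp
  rw [siteA_eq hS]
  simp only [gaugePsi, errorConst, show m₁ + m₂ - m₁ = m₂ by omega, show m₁ + m₂ - m₂ = m₁ by omega,
    show m₁ + m₂ + 2 - (m₁ + 1) = m₂ + 1 by omega, show m₁ + m₂ + 2 - (m₂ + 1) = m₁ + 1 by omega,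
    show m₁ + m₂ + 3 - (m₁ + 2) = m₂ + 1 by omega, show m₁ + m₂ + 3 - (m₂ + 2) = m₁ + 1 by omega,
    show m₁ + m₂ + 1 - (m₁ + 1) = m₂ by omega, show m₁ + m₂ + 1 - (m₂ + 1) = m₁ by omega]
  refine error_aux (kap_ne_zero S)
    (mul_ne_zero (t _ (by omega)) (t _ (by omega))) (f _ _ _ _ (by omega)) (f _ _ _ _ (by omega))
    (f _ _ _ _ (by omega)) (f _ _ _ _ (by omega)) (f _ _ _ _ (by omega)) (f _ _ _ _ (by omega))
    (f _ _ _ _ (by omega)) (f _ _ _ _ (by omega)) (detDenConst_ne_zero S hS _ _ _)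
    (detDenConst_ne_zero S hS _ _ _) ?_ ?_ ?_
  · have := siteVand_error_up (sgSite S b) 1 (m₁ + m₂)
    convert this using 4 <;> ring
  · have := gaugePhi_error_up (alSite S lam b .I) (beSite S lam b .I) 1 m₂ m₁
    convert this using 3; ring
  · have := gaugePhi_error_up (alSite S lam b .II) (beSite S lam b .II) 1 m₁ m₂
    convert this using 3; ring

theorem gaugePsi_error_down {S : System} (hS : S.Valid) {lam : Fin 4 → ℂ} {b : ℂ} {N : ℕ}
    (h : GoodSites S lam b N) (m₁ m₂ : ℕ) (hN : m₁ + m₂ + 5 ≤ N) :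
    siteC S lam b 2 * gaugePsi S lam b (m₁ + m₂) m₁ m₂ 3
        * gaugePsi S lam b (m₁ + m₂ + 3) (m₁ + 2) (m₂ + 2) 1
      = errorConst S m₁ m₂ * (gaugePsi S lam b (m₁ + m₂ + 2) (m₁ + 1) (m₂ + 1) 2
        * gaugePsi S lam b (m₁ + m₂ + 1) (m₁ + 1) (m₂ + 1) 2) := by
  have t := h.sg
  have f := fun T p r s (hp : p + s + r ≤ N) => h.gaugePhi_ne_zero T hp
  rw [siteC_succ hS]
  simp only [gaugePsi, errorConst, show m₁ + m₂ - m₁ = m₂ by omega, show m₁ + m₂ - m₂ = m₁ by omega,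
    show m₁ + m₂ + 2 - (m₁ + 1) = m₂ + 1 by omega, show m₁ + m₂ + 2 - (m₂ + 1) = m₁ + 1 by omega,
    show m₁ + m₂ + 3 - (m₁ + 2) = m₂ + 1 by omega, show m₁ + m₂ + 3 - (m₂ + 2) = m₁ + 1 by omega,
    show m₁ + m₂ + 1 - (m₁ + 1) = m₂ by omega, show m₁ + m₂ + 1 - (m₂ + 1) = m₁ by omega]
  refine error_aux (kap_ne_zero S)
    (mul_ne_zero (t _ (by omega)) (t _ (by omega))) (f _ _ _ _ (by omega)) (f _ _ _ _ (by omega))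
    (f _ _ _ _ (by omega)) (f _ _ _ _ (by omega)) (f _ _ _ _ (by omega)) (f _ _ _ _ (by omega))
    (f _ _ _ _ (by omega)) (f _ _ _ _ (by omega)) (detDenConst_ne_zero S hS _ _ _)
    (detDenConst_ne_zero S hS _ _ _) ?_ ?_ ?_
  · exact siteVand_error_down (sgSite S b) 1 (m₁ + m₂)
  · exact gaugePhi_error_down (h.be .I) 1 m₂ m₁ (by omega)
  · exact gaugePhi_error_down (h.be .II) 1 m₁ m₂ (by omega)

end MultiIndexed

namespace MultiIndexed

/-! ### The shift of the parameters -/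

/-- The label of a virtual state is not that of an eigenstate. -/
def Col.IsVirtual : Col → Prop
  | .Z _ => False
  | _ => True

theorem usesCard_add_usesCard {n : ℕ} {c : Fin n → Col} (hc : ∀ k, (c k).IsVirtual) :
    usesCard .I c + usesCard .II c = n := by
  simp only [usesCard, Finset.card_filter, ← Finset.sum_add_distrib]
  rw [Finset.sum_congr rfl fun k _ => show _ = 1 from ?_]
  · simp
  · have := hc k
    revert this
    cases c k <;> simp [Col.IsVirtual, Col.uses]

theorem prod_ite_uses (T : VType) {n : ℕ} (c : Fin n → Col) (a : ℂ) :
    ∏ k, (if (c k).uses T then 1 else a) = a ^ (n - usesCard T c) := by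
  rw [Finset.prod_ite, Finset.prod_const_one, one_mul, Finset.prod_const, usesCard]
  congr 1
  have := Finset.card_filter_add_card_filter_not (s := (Finset.univ : Finset (Fin n))) fun k => (c k).uses T = true
  rw [Finset.card_univ, Fintype.card_fin] at this
  omega

theorem basePoly_zero (S : System) (lam : Fin 4 → ℂ) : basePoly S lam 0 = 1 := by
  cases S <;> simp [basePoly, poch, qpoch]

/-- The constants in the shift relations of the columns. -/
noncomputable def colShiftConst (S : System) (lam : Fin 4 → ℂ) : Col → ℂ
  | .X v => shiftConstV S .I lam v
  | .Y v => shiftConstV S .II lam v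
  | .Z _ => 1

/-- The parameters for which the constant in the shift relation of a column does not vanish. -/
def ColGeneric (S : System) (lam : Fin 4 → ℂ) : Col → Prop
  | .X v => ShiftGeneric S lam v
  | .Y v => ShiftGeneric S lam v
  | .Z _ => True

theorem colShiftConst_ne_zero {S : System} (hS : S.Valid) {lam : Fin 4 → ℂ} {c : Col} (h : ColGeneric S lam c) :
    colShiftConst S lam c ≠ 0 := by
  cases c with
  | X v => exact shiftConstV_ne_zero S hS .I h
  | Y v => exact shiftConstV_ne_zero S hS .II h
  | Z n => exact one_ne_zero

theorem site_sub_half (S : System) (b : ℂ) (k : ℕ) : site S (b - I * gam S / 2) k = site S b k - I * gam S / 2 := by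
  simp only [site]
  ring

theorem alSite_add_delta {S : System} (hS : S.Valid) (lam : Fin 4 → ℂ) (b : ℂ) (T : VType) (k : ℕ) :
    alSite S (lam + delta) (b - I * gam S / 2) T k = deltaConst S * alSite S lam b T (k + 1) := by
  rw [alSite, alSite, site_sub_half, al_add_delta S hS, site_succ]

theorem beSite_add_delta {S : System} (hS : S.Valid) (lam : Fin 4 → ℂ) (b : ℂ) (T : VType) (k : ℕ) :
    beSite S (lam + delta) (b - I * gam S / 2) T k = deltaConst S * beSite S lam b T k := by
  rw [beSite, beSite, site_sub_half, be_add_delta S hS]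

theorem sgSite_sub_half (S : System) (b : ℂ) (k : ℕ) : sgSite S (b - I * gam S / 2) k = sgSite S b (k + 1) := by
  simp only [sgSite]
  congr 1
  push_cast
  ring

/-- Under the shift by `δ` and a half step, `α` moves by a whole site and `β` stays, with a common
constant that cancels. The product of quotients telescopes to a factor `α_k / α_0`. -/
theorem gaugeSite_add_delta {S : System} (hS : S.Valid) (lam : Fin 4 → ℂ) (b : ℂ) (T : VType) (k : ℕ) :
    alSite S lam b T 0 * gaugeSite S (lam + delta) (b - I * gam S / 2) T k
      = gaugeSite S lam b T k * alSite S lam b T k := by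
  have hd := deltaConst_ne_zero S
  simp only [gaugeSite]
  induction k with
  | zero => simp [gaugeG]
  | succ k ih =>
    rw [gaugeG_succ, gaugeG_succ, ← mul_assoc, ih, alSite_add_delta hS, beSite_add_delta hS,
      mul_div_mul_left _ _ hd]
    ring

/-- The shift relation at the point midway between two sites, divided by the gauge function,
computes the difference of consecutive values of the gauged virtual state. -/
theorem virtual_sub_succ {S : System} (hS : S.Valid) {lam : Fin 4 → ℂ} {b : ℂ} {N : ℕ} (h : GoodSites S lam b N)
    (h' : GoodSites S (lam + delta) (b - I * gam S / 2) N) (T : VType) {v : ℕ} (hv : ShiftGeneric S lam v) (k : ℕ)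
    (hk : k + 1 ≤ N) :
    xiV S T lam v (site S b (k + 1)) / gaugeSite S lam b T (k + 1) - xiV S T lam v (site S b k) / gaugeSite S lam b T k
      = -(shiftConstV S T lam v / alSite S lam b T 0) * (cEta S (I * gam S) * sgSite S b (2 * k + 1))
        * (xiV S T (lam + delta) v (site S (b - I * gam S / 2) k)
          / gaugeSite S (lam + delta) (b - I * gam S / 2) T k) := by
  have s0 : 2 * (site S b k - I * gam S / 2) = 2 * b - I * ((2 * k + 1 : ℕ) : ℂ) * gam S := by
    simp only [site]; push_cast; ring
  have s1 : 2 * (site S b k - I * gam S / 2) - I * gam S = 2 * b - I * ((2 * k + 2 : ℕ) : ℂ) * gam S := by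
    simp only [site]; push_cast; ring
  have s2 : 2 * (site S b k - I * gam S / 2) + I * gam S = 2 * b - I * ((2 * k : ℕ) : ℂ) * gam S := by
    simp only [site]; push_cast; ring
  have t0 := h.sg (2 * k + 1) (by omega)
  have t1 := h.sg (2 * k + 2) (by omega)
  have t2 := h.sg (2 * k) (by omega)
  simp only [sgSite] at t0 t1 t2
  rw [← s0] at t0
  rw [← s1] at t1
  rw [← s2] at t2
  have r := shift_relation S hS T hv (site S b k - I * gam S / 2) (h.den_half k (by omega)).1
    (h.den_half k (by omega)).2 t0 t1 t2
  have G1 : gaugeSite S lam b T (k + 1) = gaugeSite S lam b T k * (alSite S lam b T k / beSite S lam b T (k + 1)) :=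
    gaugeG_succ k
  have G2 := gaugeSite_add_delta hS lam b T k
  rw [eta_half_sub, s0, sub_add_cancel, sub_sub, add_halves, ← site_succ, ← site_sub_half] at r
  rw [sgSite, G1]
  have g := h.gaugeSite_ne_zero T (k := k) (by omega)
  have g' := h'.gaugeSite_ne_zero T (k := k) (by omega)
  have a0 := h.al T 0 (by omega)
  have ak := h.al T k (by omega)
  have bk := h.be T (k + 1) (by omega)
  have e : ∀ z, z / (gaugeSite S (lam + delta) (b - I * gam S / 2) T k)
      = alSite S lam b T 0 * (z / (gaugeSite S lam b T k * alSite S lam b T k)) := fun z => by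
    rw [← G2]
    field_simp
  rw [e]
  simp only [alSite, beSite] at r a0 ak bk ⊢
  clear t0 t1 t2 s0 s1 s2 e G1 G2
  generalize sg S (2 * b - I * ((2 * k + 1 : ℕ) : ℂ) * gam S) = t at r ⊢
  generalize xiV S T (lam + delta) v (site S (b - I * gam S / 2) k) = z at r ⊢
  field_simp
  linear_combination -r

theorem psi_sub_succ {S : System} (hS : S.Valid) {lam : Fin 4 → ℂ} {b : ℂ} {N : ℕ} (h : GoodSites S lam b N)
    (h' : GoodSites S (lam + delta) (b - I * gam S / 2) N) {c : Col} (hc : c.IsVirtual) (hg : ColGeneric S lam c)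
    (k : ℕ) (hk : k + 1 ≤ N) :
    psi S lam b c (k + 1) - psi S lam b c k
      = (cEta S (I * gam S) * sgSite S b (2 * k + 1))
        * (-(colShiftConst S lam c / ((if c.uses .I then 1 else alSite S lam b .I 0)
          * if c.uses .II then 1 else alSite S lam b .II 0)) * psi S (lam + delta) (b - I * gam S / 2) c k) := by
  cases c with
  | X v =>
    have := virtual_sub_succ hS h h' .I hg k hk
    simp [psi, Col.uses, Col.poly, colShiftConst, xiV] at this ⊢
    rw [this]
    ring
  | Y v =>
    have := virtual_sub_succ hS h h' .II hg k hk
    simp [psi, Col.uses, Col.poly, colShiftConst, xiV] at this ⊢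
    rw [this]
    ring
  | Z n => exact hc.elim

/-- Subtracting from each row the preceding one turns the constant last column into `(1, 0, …, 0)`;
expansion along it gives the sign and the determinant of differences. -/
theorem cas_sn_one {ι : Type*} (ψ : ι → ℕ → ℂ) {n : ℕ} (c : Fin n → ι) (u : ι) (hu : ∀ k, ψ u k = 1) (p : ℕ) :
    cas ψ (sn c u) (win p (n + 1))
      = (-1) ^ n * (Matrix.of fun i k : Fin n => ψ (c k) (p + i + 1) - ψ (c k) (p + i)).det := by
  set M : Matrix (Fin (n + 1)) (Fin (n + 1)) ℂ := Matrix.of fun i k => ψ (sn c u k) (win p (n + 1) i) with hM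
  set M' : Matrix (Fin (n + 1)) (Fin (n + 1)) ℂ :=
    Matrix.of (Fin.cons (M 0) fun i : Fin n => M i.succ - M i.castSucc) with hM'
  have h1 : M.det = M'.det := by
    refine Matrix.det_eq_of_forall_row_eq_smul_add_pred (fun _ => 1) (fun j => rfl) fun i j => ?_
    simp [hM']
  have h2 : ∀ i : Fin n, M' i.succ (Fin.last n) = 0 := fun i => by simp [hM', hM, hu]
  have h3 : M' 0 (Fin.last n) = 1 := by simp [hM', hM, hu]
  rw [cas, h1, Matrix.det_succ_column M' (Fin.last n), Fin.sum_univ_succ, h3]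
  simp only [h2, mul_zero, zero_mul, Finset.sum_const_zero, add_zero, Fin.val_zero, Fin.val_last, zero_add, mul_one]
  congr 2
  ext i k
  simp [hM', hM, win, add_assoc]

/-- The pairs of neighbouring sites split off. Their factors are the row factors that the
differences of the solutions carry. -/
theorem siteVand_shift {K : Type*} [Field K] (t : ℕ → K) (n : ℕ) :
    siteVand t 0 (n + 1) = (∏ i ∈ Finset.range n, t (2 * i + 1)) * siteVand (fun k => t (k + 1)) 0 n := by
  rw [siteVand, Finset.prod_range_succ', Finset.range_zero, Finset.prod_empty, mul_one, siteVand,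
    ← Finset.prod_mul_distrib]
  refine Finset.prod_congr rfl fun k _ => ?_
  rw [Finset.prod_range_succ, mul_comm]
  congr 1
  exact congrArg t (by ring)

theorem gaugePhi_shift {S : System} (hS : S.Valid) (lam : Fin 4 → ℂ) (b : ℂ) (T : VType) (r s : ℕ) :
    alSite S lam b T 0 ^ r * gaugePhi (alSite S (lam + delta) (b - I * gam S / 2) T)
        (beSite S (lam + delta) (b - I * gam S / 2) T) 0 r s
      = deltaConst S ^ (s * r) * gaugePhi (alSite S lam b T) (beSite S lam b T) 0 r (s + 1) := by
  have h1 : alSite S lam b T 0 ^ r * ∏ j ∈ Finset.range r, gaugeSite S (lam + delta) (b - I * gam S / 2) T (0 + j)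
      = ∏ j ∈ Finset.range r, gaugeSite S lam b T (0 + j) * alSite S lam b T (0 + j) := by
    rw [← Finset.card_range r, ← Finset.prod_const, Finset.card_range, ← Finset.prod_mul_distrib]
    exact Finset.prod_congr rfl fun j _ => gaugeSite_add_delta hS lam b T _
  simp only [gaugePhi]
  simp only [gaugeSite] at h1
  rw [← mul_assoc, h1, Finset.prod_mul_distrib, Finset.prod_range_succ' _ s]
  simp only [alSite_add_delta hS, Finset.prod_mul_distrib, Finset.prod_const, Finset.card_range, ← pow_mul]
  rw [mul_comm r s]
  have e : ∀ i j, 0 + i + j + 1 = 0 + (i + 1) + j := fun i j => by ring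
  simp only [e]
  ring

/-- The constant in the shift relation of the determinants. -/
noncomputable def detShiftConst (S : System) (lam : Fin 4 → ℂ) {n : ℕ} (c : Fin n → Col) : ℂ :=
  (-1) ^ n * cEta S (I * gam S) ^ n * (∏ k, -colShiftConst S lam (c k))
    * detDenConst S n (usesCard .II c) (usesCard .I c)
    / (detDenConst S (n + 1) (usesCard .II c + 1) (usesCard .I c + 1)
      * (deltaConst S ^ (usesCard .I c * (n - usesCard .I c)) * deltaConst S ^ (usesCard .II c * (n - usesCard .II c))))

theorem detShiftConst_ne_zero {S : System} (hS : S.Valid) {lam : Fin 4 → ℂ} {n : ℕ} {c : Fin n → Col}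
    (hg : ∀ k, ColGeneric S lam (c k)) : detShiftConst S lam c ≠ 0 := by
  refine div_ne_zero (mul_ne_zero (mul_ne_zero (mul_ne_zero (pow_ne_zero _ (by simp))
    (pow_ne_zero _ (cEta_I_mul_gam_ne_zero S hS))) (Finset.prod_ne_zero_iff.mpr fun k _ =>
      neg_ne_zero.mpr (colShiftConst_ne_zero hS (hg k)))) (detDenConst_ne_zero S hS _ _ _))
    (mul_ne_zero (detDenConst_ne_zero S hS _ _ _) (mul_ne_zero ?_ ?_)) <;>
  exact pow_ne_zero _ (deltaConst_ne_zero S)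

theorem shift_aux {s w t A₁ A₂ C D D' V V' f₁ f₂ f₃ f₄ h₁ h₂ P X : ℂ} (hD : D ≠ 0) (hV0 : V ≠ 0) (hf₁ : f₁ ≠ 0)
    (hf₂ : f₂ ≠ 0) (hA₁ : A₁ ≠ 0) (hA₂ : A₂ ≠ 0) (hf₃ : f₃ ≠ 0) (hf₄ : f₄ ≠ 0) (hh₁ : h₁ ≠ 0) (hh₂ : h₂ ≠ 0)
    (e : s * ((w * t) * (C / (A₁ * A₂) * (D' * V' / (f₃ * f₄) * X))) = D * V / (f₁ * f₂) * P)
    (hV : V = t * V') (F₁ : A₁ * f₃ = h₁ * f₁) (F₂ : A₂ * f₄ = h₂ * f₂) :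
    P = s * w * C * D' / (D * (h₁ * h₂)) * X := by
  have e' : s * w * C * D' * X * V / (A₁ * f₃ * (A₂ * f₄)) = D * V / (f₁ * f₂) * P := by
    rw [← e, hV]
    field_simp
  rw [F₁, F₂] at e'
  field_simp at e' ⊢
  linear_combination -e'

/-- Here `P_0 = 1` provides the constant column. All differences are virtual states for `λ + δ` on
the lattice moved by half a step, with factors depending on the row or on the column only, so these
come out of the determinant. -/
theorem colFun_zero_eq {S : System} (hS : S.Valid) {lam : Fin 4 → ℂ} {b : ℂ} {N : ℕ} (h : GoodSites S lam b N)
    (h' : GoodSites S (lam + delta) (b - I * gam S / 2) N) {n : ℕ} (c : Fin n → Col) (hc : ∀ k, (c k).IsVirtual)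
    (hg : ∀ k, ColGeneric S lam (c k)) (hN : n + 1 ≤ N) :
    colFun S lam (sn c (.Z 0)) (midSite S b n)
      = detShiftConst S lam c * colFun S (lam + delta) c (midSite S b n) := by
  have e1 := cas_psi_midSite hS h (sn c (.Z 0)) 0 n (by omega) (by omega)
  have e2 : cas (psi S (lam + delta) (b - I * gam S / 2)) c (win 0 n)
      = gaugePsi S (lam + delta) (b - I * gam S / 2) n (usesCard .I c) (usesCard .II c) 0
        * colFun S (lam + delta) c (midSite S b n) := by
    rw [cas_psi hS h' c 0 (by omega), midSite]
    congr 2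
    push_cast
    ring
  rw [cas_sn_one _ _ _ (fun k => by simp [psi, Col.uses, Col.poly, basePoly_zero])] at e1
  set Q := fun c : Col => -(colShiftConst S lam c / ((if c.uses .I then 1 else alSite S lam b .I 0)
          * if c.uses .II then 1 else alSite S lam b .II 0)) with hQ
  have hmat : (Matrix.of fun i k : Fin n => psi S lam b (c k) (0 + i + 1) - psi S lam b (c k) (0 + i))
      = Matrix.of fun i k : Fin n => (cEta S (I * gam S) * sgSite S b (2 * i + 1))
        * (Matrix.of fun i k : Fin n => Q (c k)
          * (Matrix.of fun i k : Fin n => psi S (lam + delta) (b - I * gam S / 2) (c k) (win 0 n i)) i k) i k := by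
    ext i k
    simp only [Matrix.of_apply, zero_add, win]
    rw [psi_sub_succ hS h h' (hc k) (hg k) _ (by omega)]
  rw [hmat, Matrix.det_mul_column, Matrix.det_mul_row] at e1
  rw [cas] at e2
  rw [e2, Finset.prod_mul_distrib, Finset.prod_const, Finset.card_univ, Fintype.card_fin, usesCard_sn, usesCard_sn] at e1
  simp only [hQ, neg_div', Finset.prod_div_distrib, Finset.prod_mul_distrib, prod_ite_uses,
    show (Col.Z 0).uses .I = true from rfl, show (Col.Z 0).uses .II = true from rfl, if_true, gaugePsi] at e1
  have V := siteVand_shift (sgSite S b) n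
  have Vs : (fun k => sgSite S b (k + 1)) = sgSite S (b - I * gam S / 2) :=
    funext fun k => (sgSite_sub_half S b k).symm
  rw [Vs, Finset.prod_range] at V
  have F1 := gaugePhi_shift hS lam b .I (n - usesCard .I c) (usesCard .I c)
  have F2 := gaugePhi_shift hS lam b .II (n - usesCard .II c) (usesCard .II c)
  have V0 : siteVand (sgSite S b) 0 (n + 1) ≠ 0 := siteVand_ne_zero h.sg (by omega)
  have l1 := usesCard_le .I c
  have l2 := usesCard_le .II c
  have f1 := h.gaugePhi_ne_zero .I (p := 0) (r := n - usesCard .I c) (s := usesCard .I c + 1) (by omega)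
  have f2 := h.gaugePhi_ne_zero .II (p := 0) (r := n - usesCard .II c) (s := usesCard .II c + 1) (by omega)
  have f3 := h'.gaugePhi_ne_zero .I (p := 0) (r := n - usesCard .I c) (s := usesCard .I c) (by omega)
  have f4 := h'.gaugePhi_ne_zero .II (p := 0) (r := n - usesCard .II c) (s := usesCard .II c) (by omega)
  have a1 := pow_ne_zero (n - usesCard .I c) (h.al .I 0 (by omega))
  have a2 := pow_ne_zero (n - usesCard .II c) (h.al .II 0 (by omega))
  have d := detDenConst_ne_zero S hS (n + 1) (usesCard .II c + 1) (usesCard .I c + 1)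
  have hd1 := pow_ne_zero (usesCard .I c * (n - usesCard .I c)) (deltaConst_ne_zero S)
  have hd2 := pow_ne_zero (usesCard .II c * (n - usesCard .II c)) (deltaConst_ne_zero S)
  rw [detShiftConst]
  simp only [show n + 1 - (usesCard .I c + 1) = n - usesCard .I c by omega,
    show n + 1 - (usesCard .II c + 1) = n - usesCard .II c by omega] at e1
  exact shift_aux d V0 f1 f2 a1 a2 f3 f4 hd1 hd2 e1 V F1 F2

end MultiIndexed

namespace MultiIndexed

/-! ### Continuity in the parameters -/

theorem continuous_poch (n : ℕ) : Continuous fun a => poch a n := by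
  unfold poch
  fun_prop

theorem continuous_qpoch (q : ℝ) (n : ℕ) : Continuous fun a => qpoch q a n := by
  unfold qpoch
  fun_prop

theorem continuous_aw {q : ℝ} (hq : 0 < q) (k : Fin 4) : Continuous fun lam => aw q lam k := by
  simp only [aw, ofReal_cpow_eq_exp hq]
  fun_prop

theorem continuous_pi_four {f : (Fin 4 → ℂ) → Fin 4 → ℂ} (h0 : Continuous fun lam => f lam 0)
    (h1 : Continuous fun lam => f lam 1) (h2 : Continuous fun lam => f lam 2) (h3 : Continuous fun lam => f lam 3) :
    Continuous f :=
  continuous_pi fun k => by fin_cases k <;> assumption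

theorem continuous_twist (S : System) (T : VType) : Continuous (twist S T) := by
  cases S <;> cases T <;>
    refine continuous_pi_four ?_ ?_ ?_ ?_ <;> simp only [twist, Matrix.cons_val] <;> fun_prop

theorem continuous_eval_basePoly (S : System) (hS : S.Valid) (n : ℕ) (y : ℂ) :
    Continuous fun lam => (basePoly S lam n).eval y := by
  cases S with
  | cH =>
    simp only [basePoly, Polynomial.eval_mul, Polynomial.eval_C, Polynomial.eval_finsetSum, Polynomial.eval_prod,
      Polynomial.eval_add, Polynomial.eval_X]
    have h := continuous_poch
    fun_prop
  | W =>
    simp only [basePoly, Polynomial.eval_mul, Polynomial.eval_C, Polynomial.eval_finsetSum, Polynomial.eval_prod,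
      Polynomial.eval_add, Polynomial.eval_X]
    have h := continuous_poch
    fun_prop
  | AW q =>
    have h0 : ∀ lam : Fin 4 → ℂ, aw q lam 0 ≠ 0 := fun lam => by
      rw [aw, ofReal_cpow_eq_exp hS.1]
      exact exp_ne_zero _
    simp only [basePoly, Polynomial.eval_mul, Polynomial.eval_C, Polynomial.eval_finsetSum, Polynomial.eval_prod,
      Polynomial.eval_add, Polynomial.eval_sub, Polynomial.eval_one, Polynomial.eval_X]
    have h := continuous_qpoch q
    have h1 := fun k => continuous_aw hS.1 k
    refine Continuous.mul (((h1 0).inv₀ h0).pow n) ?_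
    fun_prop

theorem continuous_al (S : System) (hS : S.Valid) (T : VType) (x : ℂ) : Continuous fun lam => al S T lam x := by
  cases S with
  | cH => cases T <;> simp only [al] <;> fun_prop
  | W => cases T <;> simp only [al] <;> fun_prop
  | AW q =>
    have h1 := fun k => continuous_aw hS.1 k
    cases T <;> simp only [al] <;> fun_prop

theorem continuous_be (S : System) (hS : S.Valid) (T : VType) (x : ℂ) : Continuous fun lam => be S T lam x := by
  cases S with
  | cH => cases T <;> simp only [be] <;> fun_prop
  | W => exact continuous_al .W hS T (-x)
  | AW q => exact continuous_al (.AW q) hS T (-x)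

theorem continuous_pot (S : System) (hS : S.Valid) (x : ℂ) : Continuous fun lam => pot S lam x := by
  have h := fun T => continuous_al S hS T x
  simp only [pot_eq S hS, div_eq_mul_inv]
  fun_prop

theorem continuous_potStar (S : System) (hS : S.Valid) (x : ℂ) : Continuous fun lam => potStar S lam x := by
  have h := fun T => continuous_be S hS T x
  simp only [potStar_eq S hS, div_eq_mul_inv]
  fun_prop

theorem continuous_lamD (S : System) (m₁ m₂ : ℕ) : Continuous fun lam => lamD S lam m₁ m₂ := by
  unfold lamD
  fun_prop

theorem continuous_energy (S : System) (hS : S.Valid) (n : ℕ) : Continuous fun lam => energy S lam n := by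
  cases S with
  | cH => simp only [energy]; fun_prop
  | W => simp only [energy]; fun_prop
  | AW q =>
    have h1 := fun k => continuous_aw hS.1 k
    simp only [energy]
    fun_prop

theorem continuous_virtualEnergy (S : System) (hS : S.Valid) (T : VType) (v : ℕ) :
    Continuous fun lam => virtualEnergy S T lam v := by
  cases S with
  | cH => cases T <;> simp only [virtualEnergy] <;> fun_prop
  | W => cases T <;> simp only [virtualEnergy] <;> fun_prop
  | AW q =>
    have h1 := fun k => continuous_aw hS.1 k
    cases T <;> simp only [virtualEnergy] <;> fun_prop

theorem continuous_colEnergy (S : System) (hS : S.Valid) (c : Col) : Continuous fun lam => colEnergy S lam c := by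
  cases c with
  | X v => exact continuous_virtualEnergy S hS .I v
  | Y v => exact continuous_virtualEnergy S hS .II v
  | Z n => exact continuous_energy S hS n

theorem continuous_eval_colPoly (S : System) (hS : S.Valid) (c : Col) (y : ℂ) :
    Continuous fun lam => (c.poly S lam).eval y := by
  cases c with
  | X v => exact (continuous_eval_basePoly S hS v y).comp (continuous_twist S .I)
  | Y v => exact (continuous_eval_basePoly S hS v y).comp (continuous_twist S .II)
  | Z n => exact continuous_eval_basePoly S hS n y

theorem continuous_fac (S : System) (hS : S.Valid) (x : ℂ) (m : ℕ) : Continuous fun μ => fac S μ x m := by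
  cases S with
  | cH => exact (continuous_poch m).comp (by fun_prop)
  | W => exact (continuous_poch m).comp (by fun_prop)
  | AW q =>
    simp only [fac, ofReal_cpow_eq_exp hS.1]
    exact (continuous_qpoch q m).comp (by fun_prop)

theorem continuous_facProd (S : System) (hS : S.Valid) (T : VType) (n s t : ℕ) (x : ℂ) :
    Continuous fun lam => facProd S T lam n s t x := by
  have h := continuous_fac S hS
  unfold facProd
  fun_prop

theorem continuous_detDen (S : System) (hS : S.Valid) (n m₁ m₂ : ℕ) (x : ℂ) :
    Continuous fun lam => detDen S lam n m₁ m₂ x := by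
  have h := continuous_facProd S hS
  unfold detDen
  fun_prop

theorem continuous_det_colMat (S : System) (hS : S.Valid) {n : ℕ} (c : Fin n → Col) (x : ℂ) :
    Continuous fun lam => (colMat S lam c x).det := by
  have h := continuous_facProd S hS
  have h2 := continuous_eval_colPoly S hS
  refine Continuous.matrix_det (continuous_matrix fun i k => ?_)
  simp only [colMat, Matrix.of_apply, rowFac]
  refine Continuous.mul (Continuous.mul ?_ ?_) (h2 _ _)
  · split
    · fun_prop
    · exact continuous_const
  · split
    · fun_prop
    · exact continuous_const

/-- The polynomial is defined by a choice, so continuity in `λ` is read off from its value: a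
quotient of two continuous functions wherever the denominator is nonzero. -/
theorem continuousAt_colFun {S : System} (hS : S.Valid) {lam : Fin 4 → ℂ} {n : ℕ} {c : Fin n → Col} {x : ℂ}
    (h : detDen S lam n (usesCard .II c) (usesCard .I c) x ≠ 0) : ContinuousAt (fun μ => colFun S μ c x) lam := by
  have hd := (continuous_detDen S hS n (usesCard .II c) (usesCard .I c) x).continuousAt (x := lam)
  refine ((continuous_det_colMat S hS c x).continuousAt.div hd h).congr ?_
  filter_upwards [hd.eventually_ne h] with μ hμ
  rw [Pi.div_apply, colPoly_spec S hS μ c x, mul_div_cancel_left₀ _ hμ, colFun]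

section sites

variable {S : System} {lam : Fin 4 → ℂ} {b : ℂ} {N : ℕ}

theorem continuousAt_gaugeSite (hS : S.Valid) (h : GoodSites S lam b N) (T : VType) {k : ℕ} (hk : k ≤ N) :
    ContinuousAt (fun μ => gaugeSite S μ b T k) lam := by
  simp only [gaugeSite, gaugeG]
  refine tendsto_finsetProd _ fun i hi => ?_
  have hi := Finset.mem_range.mp hi
  exact ((continuous_al S hS T _).continuousAt.div (continuous_be S hS T _).continuousAt (h.be T _ (by omega)))

theorem continuousAt_psi (hS : S.Valid) (h : GoodSites S lam b N) (c : Col) {k : ℕ} (hk : k ≤ N) :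
    ContinuousAt (fun μ => psi S μ b c k) lam := by
  simp only [psi]
  refine (continuous_eval_colPoly S hS c _).continuousAt.div (ContinuousAt.mul ?_ ?_) (mul_ne_zero ?_ ?_) <;> split
  exacts [continuousAt_const, continuousAt_gaugeSite hS h _ hk, continuousAt_const, continuousAt_gaugeSite hS h _ hk,
    one_ne_zero, h.gaugeSite_ne_zero _ hk, one_ne_zero, h.gaugeSite_ne_zero _ hk]

theorem continuousAt_cas_psi (hS : S.Valid) (h : GoodSites S lam b N) {n : ℕ} (c : Fin n → Col) (r : Fin n → ℕ)
    (hr : ∀ i, r i ≤ N) : ContinuousAt (fun μ => cas (psi S μ b) c r) lam := by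
  simp only [cas, Matrix.det_apply', Matrix.of_apply]
  exact tendsto_finsetSum _ fun σ _ => tendsto_const_nhds.mul
    (tendsto_finsetProd _ fun i _ => continuousAt_psi hS h _ (hr _))

theorem GoodSites.eventually_nhds (hS : S.Valid) (h : GoodSites S lam b N) : ∀ᶠ μ in 𝓝 lam, GoodSites S μ b N := by
  have h1 : ∀ᶠ μ in 𝓝 lam, ∀ k ∈ Finset.range (N + 1), (∀ T, alSite S μ b T k ≠ 0) ∧ ∀ T, beSite S μ b T k ≠ 0 := by
    refine (Filter.eventually_all_finset _).mpr fun k hk => ?_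
    have hk := Finset.mem_range.mp hk
    have a := fun T => (continuous_al S hS T (site S b k)).continuousAt.eventually_ne (h.al T k (by omega))
    have e := fun T => (continuous_be S hS T (site S b k)).continuousAt.eventually_ne (h.be T k (by omega))
    filter_upwards [a .I, a .II, e .I, e .II] with μ a1 a2 e1 e2
    refine ⟨fun T => ?_, fun T => ?_⟩
    · cases T
      · exact a1
      · exact a2
    · cases T
      · exact e1
      · exact e2
  filter_upwards [h1] with μ h1
  exact ⟨fun T k hk => (h1 k (Finset.mem_range.mpr (by omega))).1 T,
    fun T k hk => (h1 k (Finset.mem_range.mpr (by omega))).2 T, h.sg, h.den, h.den_half⟩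

/-- The common constant of the Darboux transformed operator on the lattice. -/
noncomputable def siteBeta (S : System) (lam : Fin 4 → ℂ) (b : ℂ) {m : ℕ} (c : Fin (m + 1) → Col) : ℂ :=
  betaTerm (psi S lam b) (siteA S lam b) (siteB S lam b) (siteC S lam b) (colEnergy S lam) c

theorem continuousAt_siteBeta (hS : S.Valid) {m : ℕ} (c : Fin (m + 1) → Col) (h : GoodSites S lam b (m + 4))
    (h1 : cas (psi S lam b) c (win 1 (m + 1)) ≠ 0) (h2 : cas (psi S lam b) c (win 2 (m + 1)) ≠ 0) :
    ContinuousAt (fun μ => siteBeta S μ b c) lam := by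
  have hA : ∀ k, Continuous fun μ => siteA S μ b k := fun k => continuous_pot S hS _
  have hC : ∀ k, Continuous fun μ => siteC S μ b k := fun k => continuous_potStar S hS _
  have hB : ∀ k, Continuous fun μ => siteB S μ b k := fun k => ((hA k).add (hC k)).neg
  have hE := continuous_colEnergy S hS
  simp only [siteBeta, betaTerm]
  refine (((Continuous.continuousAt (by fun_prop)).sub (Continuous.continuousAt (by fun_prop))).sub
    ((hA _).continuousAt.mul (ContinuousAt.div ?_ ?_ h2))).sub ((hC _).continuousAt.mul (ContinuousAt.div ?_ ?_ h1)) <;>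
  refine continuousAt_cas_psi hS h _ _ fun i => ?_
  · refine Fin.lastCases ?_ (fun i => ?_) i
    · simp
    · simp only [Fin.snoc_castSucc, win]; omega
  · simp only [win]; omega
  · refine Fin.cases ?_ (fun i => ?_) i
    · simp
    · simp only [Fin.cons_succ, win]; omega
  · simp only [win]; omega

end sites

end MultiIndexed

namespace MultiIndexed

/-! ### The deformed operator -/

/-- The shift part of the deformed Hamiltonian. -/
noncomputable def deformedOp (S : System) (lam : Fin 4 → ℂ) {n : ℕ} (c : Fin n → Col) (f : ℂ → ℂ) (x : ℂ) : ℂ :=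
  pot S (lamD S lam (usesCard .II c) (usesCard .I c)) x
      * (colFun S lam c (x + I * gam S / 2) / colFun S lam c (x - I * gam S / 2)) * f (x - I * gam S)
    + potStar S (lamD S lam (usesCard .II c) (usesCard .I c)) x
      * (colFun S lam c (x - I * gam S / 2) / colFun S lam c (x + I * gam S / 2)) * f (x + I * gam S)

/-- Strips a Darboux identity of its gauge factors: `P₁`, `P₂` belong to the two windows of the
denominator and `Q₀`, `Q₁`, `Q₂` to the three windows of the function. -/
theorem deformedOp_aux {A C P₁ P₂ Q₀ Q₁ Q₂ V W f₁ f₂ g₀ g₂ R : ℂ} (hP₁ : P₁ ≠ 0) (hP₂ : P₂ ≠ 0) (hQ₁ : Q₁ ≠ 0)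
    (hA : A * P₁ * Q₂ = V * (P₂ * Q₁)) (hC : C * P₂ * Q₀ = W * (P₁ * Q₁))
    (h : A * (P₁ * f₁ / (P₂ * f₂)) * (Q₂ * g₂) + C * (P₂ * f₂ / (P₁ * f₁)) * (Q₀ * g₀) = R * Q₁) :
    V * (f₁ / f₂) * g₂ + W * (f₂ / f₁) * g₀ = R := by
  refine mul_right_cancel₀ hQ₁ ?_
  rw [← h, mul_div_mul_comm, mul_div_mul_comm]
  generalize f₁ / f₂ = u
  generalize f₂ / f₁ = w
  field_simp
  linear_combination -P₁ * u * g₂ * hA - P₂ * w * g₀ * hC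

theorem midSite_zero_add (S : System) (b : ℂ) (j : ℕ) : midSite S b (j + 1) + I * gam S / 2 = midSite S b j := by
  rw [midSite_succ, sub_add_cancel]

theorem midSite_add_gam (S : System) (b : ℂ) (j : ℕ) : midSite S b (j + 2) + I * gam S = midSite S b j := by
  rw [midSite_add_two, sub_add_cancel]

theorem sn_forall {α : Type*} {p : α → Prop} {n : ℕ} {c : Fin n → α} {u : α} (hc : ∀ k, p (c k)) (hu : p u) (k : Fin (n + 1)) :
    p (sn c u k) := by
  refine Fin.lastCases ?_ (fun k => ?_) k
  · simpa using hu
  · simpa using hc k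

section

variable {S : System} {lam : Fin 4 → ℂ} {b : ℂ}

theorem deformedOp_replace (hS : S.Valid) {m : ℕ} (h : GoodSites S lam b (m + 4)) (F : Fin m → Col) (d e : Col) (n : ℕ)
    (hF : ∀ k, (F k).IsVirtual) (hd : d.IsVirtual) (hde : ∀ T, d.uses T = e.uses T)
    (h1 : colFun S lam (sn F d) (midSite S b (m + 2)) ≠ 0) (h2 : colFun S lam (sn F d) (midSite S b (m + 4)) ≠ 0) :
    deformedOp S lam (sn F d) (colFun S lam (sn (sn F e) (.Z n))) (midSite S b (m + 3))
      = (colEnergy S lam d + colEnergy S lam e - energy S lam n + siteBeta S lam b (sn F d))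
          * colFun S lam (sn (sn F e) (.Z n)) (midSite S b (m + 3))
        + (energy S lam n - colEnergy S lam e)
          * (colFun S lam (sn F e) (midSite S b (m + 2)) / colFun S lam (sn F d) (midSite S b (m + 2))
            + colFun S lam (sn F e) (midSite S b (m + 4)) / colFun S lam (sn F d) (midSite S b (m + 4)))
          * colFun S lam (sn (sn F d) (.Z n)) (midSite S b (m + 3)) := by
  have hn : usesCard .I (sn F d) + usesCard .II (sn F d) = m + 1 := usesCard_add_usesCard (sn_forall hF hd)
  have ue : ∀ T, usesCard T (sn F e) = usesCard T (sn F d) := fun T => by rw [usesCard_sn, usesCard_sn, hde]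
  have l1 := usesCard_le .I (sn F d)
  have l2 := usesCard_le .II (sn F d)
  have P1 := gaugePsi_ne_zero hS h (p := 1) l1 l2 (by omega)
  have P2 := gaugePsi_ne_zero hS h (p := 2) l1 l2 (by omega)
  have Q1 := gaugePsi_ne_zero hS h (p := 1) (Nat.succ_le_succ l1) (Nat.succ_le_succ l2) (by omega)
  have U := gaugePsi_up hS h (usesCard .I (sn F d)) (usesCard .II (sn F d)) (by omega)
  have D := gaugePsi_down hS h (usesCard .I (sn F d)) (usesCard .II (sn F d)) (by omega)
  rw [hn] at U D
  have ev : ∀ c : Col, ∀ i ≤ m + 1,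
      EigenAt (siteA S lam b) (siteB S lam b) (siteC S lam b) (colEnergy S lam c) (psi S lam b c) i :=
    fun c i hi => psi_eigenAt hS h c i (by omega)
  have c1 : ∀ g, cas (psi S lam b) (sn F g) (win 1 (m + 1)) = gaugePsi S lam b (m + 1) (usesCard .I (sn F g))
      (usesCard .II (sn F g)) 1 * colFun S lam (sn F g) (midSite S b (m + 2)) := fun g =>
    cas_psi_midSite hS h _ 1 (m + 2) (by omega) (by omega)
  have c2 : ∀ g, cas (psi S lam b) (sn F g) (win 2 (m + 1)) = gaugePsi S lam b (m + 1) (usesCard .I (sn F g))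
      (usesCard .II (sn F g)) 2 * colFun S lam (sn F g) (midSite S b (m + 4)) := fun g =>
    cas_psi_midSite hS h _ 2 (m + 4) (by omega) (by omega)
  have c3 : ∀ g p j, p + (m + 2) ≤ m + 4 → j + 1 = 2 * p + (m + 2) →
      cas (psi S lam b) (sn (sn F g) (.Z n)) (win p (m + 2))
      = gaugePsi S lam b (m + 2) (usesCard .I (sn F g) + 1) (usesCard .II (sn F g) + 1) p
        * colFun S lam (sn (sn F g) (.Z n)) (midSite S b j) := fun g p j hp hj => by
    rw [cas_psi_midSite hS h _ p j hp hj, usesCard_sn, usesCard_sn (c := sn F g)]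
    rfl
  have key := cas_darboux_replace (psi S lam b) (siteA S lam b) (siteB S lam b) (siteC S lam b) (colEnergy S lam) F d e
    (.Z n) (fun k => ev _) (ev _) (ev _) (ev _) (by rw [c1]; exact mul_ne_zero P1 h1)
    (by rw [c2]; exact mul_ne_zero P2 h2)
  rw [c1, c1, c2, c2, c3 e 2 (m + 5) (by omega) (by omega), c3 e 1 (m + 3) (by omega) (by omega),
    c3 e 0 (m + 1) (by omega) (by omega), c3 d 1 (m + 3) (by omega) (by omega), ue, ue, mul_div_mul_left _ _ P1,
    mul_div_mul_left _ _ P2] at key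
  rw [deformedOp, midSite_add_gam S b (m + 1), midSite_zero_add S b (m + 2), ← midSite_succ, ← midSite_add_two]
  refine deformedOp_aux P1 P2 Q1 U D ?_
  refine key.trans ?_
  simp only [siteBeta, colEnergy]
  ring

/-- The replacement identity with `e = d`: both ratios in the correction equal 1, and `2 E_d - E_n +
2 (E_n - E_d) = E_n`. -/
theorem deformedOp_eigen (hS : S.Valid) {m : ℕ} (h : GoodSites S lam b (m + 4)) (c : Fin (m + 1) → Col) (n : ℕ)
    (hc : ∀ k, (c k).IsVirtual)
    (h1 : colFun S lam c (midSite S b (m + 2)) ≠ 0) (h2 : colFun S lam c (midSite S b (m + 4)) ≠ 0) :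
    deformedOp S lam c (colFun S lam (sn c (.Z n))) (midSite S b (m + 3))
      = (energy S lam n + siteBeta S lam b c) * colFun S lam (sn c (.Z n)) (midSite S b (m + 3)) := by
  obtain ⟨F, d, rfl⟩ : ∃ (F : Fin m → Col) (d : Col), c = sn F d :=
    ⟨fun i => c i.castSucc, c (Fin.last m), (Fin.snoc_init_self c).symm⟩
  rw [deformedOp_replace hS h F d d n (fun k => by simpa using hc k.castSucc) (by simpa using hc (Fin.last m))
    (fun _ => rfl) h1 h2, div_self h1, div_self h2]
  ring

theorem deformedOp_remove (hS : S.Valid) {m : ℕ} (h : GoodSites S lam b (m + 5)) (F : Fin m → Col) (d d' : ℕ) (n : ℕ)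
    (hF : ∀ k, (F k).IsVirtual)
    (h1 : colFun S lam (sn (sn F (.X d)) (.Y d')) (midSite S b (m + 3)) ≠ 0)
    (h2 : colFun S lam (sn (sn F (.X d)) (.Y d')) (midSite S b (m + 5)) ≠ 0) :
    deformedOp S lam (sn (sn F (.X d)) (.Y d')) (colFun S lam (sn F (.Z n))) (midSite S b (m + 4))
      = (virtualEnergy S .I lam d + virtualEnergy S .II lam d' - energy S lam n
            + siteBeta S lam b (sn (sn F (.X d)) (.Y d'))) * colFun S lam (sn F (.Z n)) (midSite S b (m + 4))
        + errorConst S (usesCard .I F) (usesCard .II F)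
          * (colFun S lam F (midSite S b (m + 3)) / colFun S lam (sn (sn F (.X d)) (.Y d')) (midSite S b (m + 3))
            + colFun S lam F (midSite S b (m + 5)) / colFun S lam (sn (sn F (.X d)) (.Y d')) (midSite S b (m + 5)))
          * colFun S lam (sn (sn (sn F (.X d)) (.Y d')) (.Z n)) (midSite S b (m + 4)) := by
  have hn : usesCard .I F + usesCard .II F = m := usesCard_add_usesCard hF
  have u1 : ∀ T, usesCard T (sn (sn F (.X d)) (.Y d')) = usesCard T F + 1 := fun T => by
    rw [usesCard_sn, usesCard_sn]
    cases T <;> simp [Col.uses]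
  have u2 : ∀ T, usesCard T (sn F (.Z n)) = usesCard T F + 1 := fun T => by
    rw [usesCard_sn]
    cases T <;> simp [Col.uses]
  have u3 : ∀ T, usesCard T (sn (sn (sn F (.X d)) (.Y d')) (.Z n)) = usesCard T F + 2 := fun T => by
    rw [usesCard_sn, u1]
    cases T <;> simp [Col.uses]
  set m₁ := usesCard .I F
  set m₂ := usesCard .II F
  have P1 := gaugePsi_ne_zero hS h (n := m + 2) (m₁ := m₁ + 1) (m₂ := m₂ + 1) (p := 1) (by omega) (by omega) (by omega)
  have P2 := gaugePsi_ne_zero hS h (n := m + 2) (m₁ := m₁ + 1) (m₂ := m₂ + 1) (p := 2) (by omega) (by omega) (by omega)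
  have Q2 := gaugePsi_ne_zero hS h (n := m + 1) (m₁ := m₁ + 1) (m₂ := m₂ + 1) (p := 2) (by omega) (by omega) (by omega)
  have U := gaugePsi_remove_up hS h m₁ m₂ (by omega)
  have D := gaugePsi_remove_down hS h m₁ m₂ (by omega)
  have EU := gaugePsi_error_up hS h m₁ m₂ (by omega)
  have ED := gaugePsi_error_down hS h m₁ m₂ (by omega)
  rw [hn] at U D EU ED
  have ev : ∀ c : Col, ∀ i ≤ m + 2,
      EigenAt (siteA S lam b) (siteB S lam b) (siteC S lam b) (colEnergy S lam c) (psi S lam b c) i :=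
    fun c i hi => psi_eigenAt hS h c i (by omega)
  have c1 : cas (psi S lam b) (sn (sn F (.X d)) (.Y d')) (win 1 (m + 2)) = gaugePsi S lam b (m + 2) (m₁ + 1) (m₂ + 1) 1
      * colFun S lam (sn (sn F (.X d)) (.Y d')) (midSite S b (m + 3)) := by
    rw [cas_psi_midSite hS h _ 1 (m + 3) (by omega) (by omega), u1, u1]
  have c2 : cas (psi S lam b) (sn (sn F (.X d)) (.Y d')) (win 2 (m + 2)) = gaugePsi S lam b (m + 2) (m₁ + 1) (m₂ + 1) 2
      * colFun S lam (sn (sn F (.X d)) (.Y d')) (midSite S b (m + 5)) := by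
    rw [cas_psi_midSite hS h _ 2 (m + 5) (by omega) (by omega), u1, u1]
  have c3 : ∀ p j, p + (m + 1) ≤ m + 5 → j + 1 = 2 * p + (m + 1) →
      cas (psi S lam b) (sn F (.Z n)) (win p (m + 1)) = gaugePsi S lam b (m + 1) (m₁ + 1) (m₂ + 1) p
        * colFun S lam (sn F (.Z n)) (midSite S b j) := fun p j hp hj => by
    rw [cas_psi_midSite hS h _ p j hp hj, u2, u2]
  have c4 : ∀ p j, p + m ≤ m + 5 → j + 1 = 2 * p + m →
      cas (psi S lam b) F (win p m) = gaugePsi S lam b m m₁ m₂ p * colFun S lam F (midSite S b j) := fun p j hp hj => by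
    rw [cas_psi_midSite hS h _ p j hp hj]
  have c5 : cas (psi S lam b) (sn (sn (sn F (.X d)) (.Y d')) (.Z n)) (win 1 (m + 3))
      = gaugePsi S lam b (m + 3) (m₁ + 2) (m₂ + 2) 1
        * colFun S lam (sn (sn (sn F (.X d)) (.Y d')) (.Z n)) (midSite S b (m + 4)) := by
    rw [cas_psi_midSite hS h _ 1 (m + 4) (by omega) (by omega), u3, u3]
  have key := cas_darboux_remove (psi S lam b) (siteA S lam b) (siteB S lam b) (siteC S lam b) (colEnergy S lam) F
    (.X d) (.Y d') (.Z n) (fun k => ev _) (ev _) (ev _) (ev _) (by rw [c1]; exact mul_ne_zero P1 h1)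
    (by rw [c2]; exact mul_ne_zero P2 h2)
  rw [c1, c2, c3 3 (m + 6) (by omega) (by omega), c3 2 (m + 4) (by omega) (by omega),
    c3 1 (m + 2) (by omega) (by omega), c4 2 (m + 3) (by omega) (by omega), c4 3 (m + 5) (by omega) (by omega), c5] at key
  rw [deformedOp, midSite_add_gam S b (m + 2), midSite_zero_add S b (m + 3), ← midSite_succ, ← midSite_add_two, u1, u1]
  refine deformedOp_aux P1 P2 Q2 U D ?_
  refine key.trans ?_
  have f1 : ∀ u v w z : ℂ, siteA S lam b (m + 2) * (gaugePsi S lam b m m₁ m₂ 2 * u / (gaugePsi S lam b (m + 2) (m₁ + 1) (m₂ + 1) 1 * v))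
      * (gaugePsi S lam b (m + 3) (m₁ + 2) (m₂ + 2) 1 * w) = errorConst S m₁ m₂ * (u / v) * w * gaugePsi S lam b (m + 1) (m₁ + 1) (m₂ + 1) 2 := by
    intro u v w _
    rw [mul_div_mul_comm]
    field_simp
    linear_combination (u / v * w) * EU
  have f2 : ∀ u v w z : ℂ, siteC S lam b 2 * (gaugePsi S lam b m m₁ m₂ 3 * u / (gaugePsi S lam b (m + 2) (m₁ + 1) (m₂ + 1) 2 * v))
      * (gaugePsi S lam b (m + 3) (m₁ + 2) (m₂ + 2) 1 * w) = errorConst S m₁ m₂ * (u / v) * w * gaugePsi S lam b (m + 1) (m₁ + 1) (m₂ + 1) 2 := by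
    intro u v w _
    rw [mul_div_mul_comm]
    field_simp
    linear_combination (u / v * w) * ED
  rw [add_mul (siteA S lam b (m + 2) * _), f1 _ _ _ 0, f2 _ _ _ 0]
  simp only [siteBeta, colEnergy]
  ring

end

end MultiIndexed

namespace MultiIndexed

/-! ### The deformed Hamiltonian -/

theorem polynomial_eq_of_eventually {S : System} {p r : Polynomial ℂ} {z : ℂ}
    (h : ∀ᶠ x in 𝓝[≠] z, p.eval (eta S x) = r.eval (eta S x)) : p = r := by
  by_contra hne
  obtain ⟨x, hx1, hx2⟩ := (h.and (zerosIsolated_eval S (sub_ne_zero.mpr hne) 0 z)).exists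
  refine hx2 ?_
  simp only [add_zero]
  rw [Polynomial.eval_sub, hx1, sub_self]

theorem midSite_add (S : System) (x : ℂ) (j : ℕ) : midSite S (x + I * ((j : ℂ) / 2) * gam S) j = x :=
  add_sub_cancel_right _ _

/-- The equality of values holds at all points near 0 whose lattices avoid every denominator, which
forces equality of the polynomials. -/
theorem colPoly_sn_zero {S : System} (hS : S.Valid) {lam : Fin 4 → ℂ} {n : ℕ} {c : Fin n → Col}
    (hc : ∀ k, (c k).IsVirtual) (hg : ∀ k, ColGeneric S lam (c k)) :
    colPoly S lam (sn c (.Z 0)) = Polynomial.C (detShiftConst S lam c) * colPoly S (lam + delta) c := by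
  refine polynomial_eq_of_eventually (S := S) (z := 0) ?_
  filter_upwards [eventually_goodSites S hS lam (I * ((n : ℂ) / 2) * gam S) 0 (n + 1),
    eventually_goodSites S hS (lam + delta) (I * ((n : ℂ) / 2) * gam S - I * gam S / 2) 0 (n + 1)] with x h h'
  rw [← add_sub_assoc] at h'
  have := colFun_zero_eq hS h h' c hc hg le_rfl
  rw [midSite_add, colFun, colFun] at this
  rw [this, Polynomial.eval_mul, Polynomial.eval_C]

theorem energy_zero (S : System) (lam : Fin 4 → ℂ) : energy S lam 0 = 0 := by
  cases S <;> simp [energy]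

theorem deformedOp_const_mul (S : System) (lam : Fin 4 → ℂ) {n : ℕ} (c : Fin n → Col) (k : ℂ) (f : ℂ → ℂ) (x : ℂ) :
    deformedOp S lam c (fun y => k * f y) x = k * deformedOp S lam c f x := by
  simp only [deformedOp]
  ring

/-- Apply the eigenvalue equation to the state with `n = 0` and energy zero. The nonzero constant
relating it to the polynomial at `λ + δ` cancels. -/
theorem deformedOp_shift_of_generic {S : System} (hS : S.Valid) {lam : Fin 4 → ℂ} {b : ℂ} {m : ℕ}
    (h : GoodSites S lam b (m + 4)) {c : Fin (m + 1) → Col} (hc : ∀ k, (c k).IsVirtual)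
    (hg : ∀ k, ColGeneric S lam (c k))
    (h1 : colFun S lam c (midSite S b (m + 2)) ≠ 0) (h2 : colFun S lam c (midSite S b (m + 4)) ≠ 0) :
    deformedOp S lam c (colFun S (lam + delta) c) (midSite S b (m + 3))
      = siteBeta S lam b c * colFun S (lam + delta) c (midSite S b (m + 3)) := by
  have e := deformedOp_eigen hS h c 0 hc h1 h2
  have f : colFun S lam (sn c (.Z 0)) = fun y => detShiftConst S lam c * colFun S (lam + delta) c y := by
    funext y
    rw [colFun, colPoly_sn_zero hS hc hg, Polynomial.eval_mul, Polynomial.eval_C, colFun]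
  rw [f, deformedOp_const_mul, energy_zero, zero_add, mul_left_comm] at e
  exact mul_left_cancel₀ (detShiftConst_ne_zero hS hg) e

theorem continuous_lamLine (lam : Fin 4 → ℂ) : Continuous (lamLine lam) := by
  unfold lamLine
  fun_prop

theorem lamLine_zero (lam : Fin 4 → ℂ) : lamLine lam 0 = lam := by
  funext k
  simp [lamLine]

theorem eventually_colGeneric (S : System) (hS : S.Valid) (lam : Fin 4 → ℂ) {n : ℕ} (c : Fin n → Col) :
    ∀ᶠ t in 𝓝[≠] (0 : ℂ), ∀ k, ColGeneric S (lamLine lam t) (c k) := by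
  refine eventually_all.mpr fun k => ?_
  cases c k with
  | X v => exact eventually_shiftGeneric S hS lam v
  | Y v => exact eventually_shiftGeneric S hS lam v
  | Z n => exact Eventually.of_forall fun _ => trivial

/-- The determinants in the denominators of the polynomials of the given columns do not vanish. -/
def ColRegular (S : System) (lam : Fin 4 → ℂ) {n : ℕ} (c : Fin n → Col) (x : ℂ) : Prop :=
  detDen S lam n (usesCard .II c) (usesCard .I c) x ≠ 0

/-- The equation no longer contains the constant that required generic parameters. Both sides are
continuous at `λ`, and they agree for the nearby generic parameters on the line `lamLine lam`. -/
theorem deformedOp_shift {S : System} (hS : S.Valid) {lam : Fin 4 → ℂ} {b : ℂ} {m : ℕ}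
    (h : GoodSites S lam b (m + 4)) {c : Fin (m + 1) → Col} (hc : ∀ k, (c k).IsVirtual)
    (h1 : colFun S lam c (midSite S b (m + 2)) ≠ 0) (h2 : colFun S lam c (midSite S b (m + 4)) ≠ 0)
    (r1 : ColRegular S lam c (midSite S b (m + 2))) (r2 : ColRegular S lam c (midSite S b (m + 4)))
    (r3 : ColRegular S (lam + delta) c (midSite S b (m + 1))) (r4 : ColRegular S (lam + delta) c (midSite S b (m + 3)))
    (r5 : ColRegular S (lam + delta) c (midSite S b (m + 5))) :
    deformedOp S lam c (colFun S (lam + delta) c) (midSite S b (m + 3))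
      = siteBeta S lam b c * colFun S (lam + delta) c (midSite S b (m + 3)) := by
  set F : (Fin 4 → ℂ) → ℂ := fun μ => deformedOp S μ c (colFun S (μ + delta) c) (midSite S b (m + 3))
      - siteBeta S μ b c * colFun S (μ + delta) c (midSite S b (m + 3)) with hF
  have l1 := usesCard_le .I c
  have l2 := usesCard_le .II c
  have k1 : ContinuousAt (fun μ => colFun S μ c (midSite S b (m + 2))) lam := continuousAt_colFun hS r1
  have k2 : ContinuousAt (fun μ => colFun S μ c (midSite S b (m + 4))) lam := continuousAt_colFun hS r2
  have kd : ∀ {x}, ColRegular S (lam + delta) c x → ContinuousAt (fun μ => colFun S (μ + delta) c x) lam :=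
    fun {x} r => (continuousAt_colFun hS r).comp (f := fun μ => μ + delta)
      (continuous_add_const delta).continuousAt
  have w1 : cas (psi S lam b) c (win 1 (m + 1)) ≠ 0 := by
    rw [cas_psi_midSite hS h c 1 (m + 2) (by omega) (by omega)]
    exact mul_ne_zero (gaugePsi_ne_zero hS h l1 l2 (by omega)) h1
  have w2 : cas (psi S lam b) c (win 2 (m + 1)) ≠ 0 := by
    rw [cas_psi_midSite hS h c 2 (m + 4) (by omega) (by omega)]
    exact mul_ne_zero (gaugePsi_ne_zero hS h l1 l2 (by omega)) h2
  have hpot := ((continuous_pot S hS (midSite S b (m + 3))).comp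
    (continuous_lamD S (usesCard .II c) (usesCard .I c))).continuousAt (x := lam)
  have hpotStar := ((continuous_potStar S hS (midSite S b (m + 3))).comp
    (continuous_lamD S (usesCard .II c) (usesCard .I c))).continuousAt (x := lam)
  have hcont : ContinuousAt F lam := by
    simp only [hF, deformedOp, midSite_add_gam S b (m + 1), midSite_zero_add S b (m + 2), ← midSite_succ,
      ← midSite_add_two]
    exact ((((hpot.mul (k1.div k2 h2)).mul (kd r5)).add ((hpotStar.mul (k2.div k1 h1)).mul (kd r3))).sub
      ((continuousAt_siteBeta hS c h w1 w2).mul (kd r4)))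
  have hline : Tendsto (lamLine lam) (𝓝[≠] 0) (𝓝 lam) := by
    have := (continuous_lamLine lam).tendsto 0
    rw [lamLine_zero] at this
    exact this.mono_left nhdsWithin_le_nhds
  have hev : ∀ᶠ t in 𝓝[≠] (0 : ℂ), F (lamLine lam t) = 0 := by
    filter_upwards [eventually_colGeneric S hS lam c, hline.eventually (h.eventually_nhds hS),
      hline.eventually (k1.eventually_ne h1), hline.eventually (k2.eventually_ne h2)] with t hg ht ht1 ht2
    exact sub_eq_zero.mpr (deformedOp_shift_of_generic hS ht hc hg ht1 ht2)
  have h0 : F lam = 0 := tendsto_nhds_unique (hcont.tendsto.comp hline)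
    (tendsto_const_nhds.congr' (hev.mono fun _ ht => ht.symm))
  exact sub_eq_zero.mp h0

/-- The deformed Hamiltonian of a family of columns. -/
noncomputable def colHam (S : System) (lam : Fin 4 → ℂ) {n : ℕ} (c : Fin n → Col) (f : ℂ → ℂ) (x : ℂ) : ℂ :=
  pot S (lamD S lam (usesCard .II c) (usesCard .I c)) x
      * (colFun S lam c (x + I * gam S / 2) / colFun S lam c (x - I * gam S / 2))
      * (f (x - I * gam S) - colFun S (lam + delta) c (x - I * gam S) / colFun S (lam + delta) c x * f x)
    + potStar S (lamD S lam (usesCard .II c) (usesCard .I c)) x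
      * (colFun S lam c (x - I * gam S / 2) / colFun S lam c (x + I * gam S / 2))
      * (f (x + I * gam S) - colFun S (lam + delta) c (x + I * gam S) / colFun S (lam + delta) c x * f x)

/-- The diagonal term of the Hamiltonian is the shift part applied to the denominator at `λ + δ`,
divided by that denominator; by the hypothesis this quotient is `β`. -/
theorem colHam_eq (S : System) (lam : Fin 4 → ℂ) {n : ℕ} (c : Fin n → Col) (f : ℂ → ℂ) {x β : ℂ}
    (h : deformedOp S lam c (colFun S (lam + delta) c) x = β * colFun S (lam + delta) c x)
    (h0 : colFun S (lam + delta) c x ≠ 0) : colHam S lam c f x = deformedOp S lam c f x - β * f x := by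
  have e : β = deformedOp S lam c (colFun S (lam + delta) c) x / colFun S (lam + delta) c x := by
    rw [h, mul_div_cancel_right₀ _ h0]
  rw [e]
  simp only [colHam, deformedOp]
  ring

theorem zerosIsolated_colFun {S : System} {lam : Fin 4 → ℂ} {n : ℕ} {c : Fin n → Col} (h : colPoly S lam c ≠ 0)
    (a : ℂ) : ZerosIsolated fun x => colFun S lam c (x + a) :=
  zerosIsolated_eval S h a

theorem zerosIsolated_detDen_add (S : System) (hS : S.Valid) (lam : Fin 4 → ℂ) {n : ℕ} (c : Fin n → Col) (a z : ℂ) :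
    ∀ᶠ x in 𝓝[≠] z, ColRegular S lam c (x + a) := by
  have h := zerosIsolated_detDen S hS lam ((usesCard_le .II c).trans n.le_succ) ((usesCard_le .I c).trans n.le_succ)
  have ht : Tendsto (fun x : ℂ => x + a) (𝓝[≠] z) (𝓝[≠] (z + a)) :=
    tendsto_nhdsWithin_iff.mpr ⟨((continuous_add_const a).tendsto z).mono_left nhdsWithin_le_nhds, by
      filter_upwards [self_mem_nhdsWithin] with x hx
      simpa using hx⟩
  exact ht.eventually (h (z + a))

/-- The lattice is placed so that `x` is its midpoint number `m + 3`, i.e. `b = x + i γ (m + 3) /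
2`. The conditions on `x` are finitely many and each fails only at isolated points. -/
theorem eventually_colHam {S : System} (hS : S.Valid) {lam : Fin 4 → ℂ} {m : ℕ} {c : Fin (m + 1) → Col}
    (hc : ∀ k, (c k).IsVirtual) (h0 : colPoly S lam c ≠ 0) (h0' : colPoly S (lam + delta) c ≠ 0) (z : ℂ) :
    ∀ᶠ x in 𝓝[≠] z, ∃ b, midSite S b (m + 3) = x ∧ GoodSites S lam b (m + 4) ∧
      colFun S lam c (midSite S b (m + 2)) ≠ 0 ∧ colFun S lam c (midSite S b (m + 4)) ≠ 0 ∧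
      ∀ f, colHam S lam c f x = deformedOp S lam c f x - siteBeta S lam b c * f x := by
  have hm : ∀ x : ℂ, ∀ j : ℕ, midSite S (x + I * (((m + 3 : ℕ) : ℂ) / 2) * gam S) j
      = x + I * ((((m + 3 : ℕ) : ℂ) - j) / 2) * gam S := fun x j => by
    simp only [midSite]
    ring
  have r := fun (μ : Fin 4 → ℂ) (j : ℕ) =>
    zerosIsolated_detDen_add S hS μ c (I * ((((m + 3 : ℕ) : ℂ) - j) / 2) * gam S) z
  have s := fun j : ℕ => zerosIsolated_colFun h0 (I * ((((m + 3 : ℕ) : ℂ) - j) / 2) * gam S) z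
  filter_upwards [eventually_goodSites S hS lam (I * (((m + 3 : ℕ) : ℂ) / 2) * gam S) z (m + 4), r lam (m + 2),
    r lam (m + 4), r (lam + delta) (m + 1), r (lam + delta) (m + 3), r (lam + delta) (m + 5), s (m + 2), s (m + 4),
    zerosIsolated_colFun h0' 0 z] with x h r1 r2 r3 r4 r5 s1 s2 s3
  rw [← hm] at r1 r2 r3 r4 r5 s1 s2
  rw [add_zero] at s3
  refine ⟨_, midSite_add S x (m + 3), h, s1, s2, fun f => colHam_eq S lam c f ?_ s3⟩
  have := deformedOp_shift hS h hc s1 s2 r1 r2 r3 r4 r5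
  rwa [midSite_add] at this

end MultiIndexed

namespace MultiIndexed

/-! ### Limits of the deformed Hamiltonian at the zeros -/

theorem continuous_colFun (S : System) (lam : Fin 4 → ℂ) {n : ℕ} (c : Fin n → Col) : Continuous (colFun S lam c) :=
  (colPoly S lam c).continuous.comp (differentiable_eta S).continuous

theorem tendsto_colHam_eigen_succ {S : System} (hS : S.Valid) {lam : Fin 4 → ℂ} {m : ℕ} {c : Fin (m + 1) → Col}
    (hc : ∀ k, (c k).IsVirtual) (h0 : colPoly S lam c ≠ 0) (h0' : colPoly S (lam + delta) c ≠ 0) (n : ℕ) (x₀ : ℂ) :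
    Tendsto (colHam S lam c (colFun S lam (sn c (.Z n)))) (𝓝[≠] x₀)
      (𝓝 (energy S lam n * colFun S lam (sn c (.Z n)) x₀)) := by
  have hcont : Continuous fun x => energy S lam n * colFun S lam (sn c (.Z n)) x :=
    continuous_const.mul (continuous_colFun S lam _)
  refine ((hcont.tendsto x₀).mono_left nhdsWithin_le_nhds).congr' ?_
  filter_upwards [eventually_colHam hS hc h0 h0' x₀] with x hx
  obtain ⟨b, rfl, h, h1, h2, hH⟩ := hx
  rw [hH, deformedOp_eigen hS h c n hc h1 h2]
  ring

/-- The coefficient of `q` is continuous at `x₀` because its denominators are nonzero there, and `q`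
vanishes at `x₀`. This is where the zero of `P_{D,N}` and the condition on `Ξ_D(x₀ ± iγ/2)` enter.
-/
theorem tendsto_error {f g p q : ℂ → ℂ} (hf : Continuous f) (hg : Continuous g) (hp : Continuous p) (hq : Continuous q)
    {x₀ a v k w : ℂ} (h1 : g (x₀ + a) ≠ 0) (h2 : g (x₀ - a) ≠ 0) (h3 : q x₀ = 0) (h4 : p x₀ = w) :
    Tendsto (fun x => v * p x + k * (f (x + a) / g (x + a) + f (x - a) / g (x - a)) * q x) (𝓝[≠] x₀) (𝓝 (v * w)) := by
  have h : ContinuousAt (fun x => v * p x + k * (f (x + a) / g (x + a) + f (x - a) / g (x - a)) * q x) x₀ := by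
    have c1 : ContinuousAt (fun x => f (x + a) / g (x + a)) x₀ :=
      ContinuousAt.div (f := fun x => f (x + a)) (g := fun x => g (x + a)) (by fun_prop) (by fun_prop) h1
    have c2 : ContinuousAt (fun x => f (x - a) / g (x - a)) x₀ :=
      ContinuousAt.div (f := fun x => f (x - a)) (g := fun x => g (x - a)) (by fun_prop) (by fun_prop) h2
    exact (continuousAt_const.mul hp.continuousAt).add ((continuousAt_const.mul (c1.add c2)).mul hq.continuousAt)
  have h' := h.tendsto.mono_left (nhdsWithin_le_nhds (s := {x₀}ᶜ))
  rwa [h3, mul_zero, add_zero, h4] at h'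

theorem tendsto_colHam_replace {S : System} (hS : S.Valid) {lam : Fin 4 → ℂ} {m : ℕ} {F : Fin m → Col} {d e : Col}
    (hF : ∀ k, (F k).IsVirtual) (hd : d.IsVirtual) (hde : ∀ T, d.uses T = e.uses T)
    (h0 : colPoly S lam (sn F d) ≠ 0) (h0' : colPoly S (lam + delta) (sn F d) ≠ 0) (n : ℕ) {x₀ : ℂ}
    (h1 : colFun S lam (sn F d) (x₀ + I * gam S / 2) ≠ 0) (h2 : colFun S lam (sn F d) (x₀ - I * gam S / 2) ≠ 0)
    (h3 : colFun S lam (sn (sn F d) (.Z n)) x₀ = 0) :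
    Tendsto (colHam S lam (sn F d) (colFun S lam (sn (sn F e) (.Z n)))) (𝓝[≠] x₀)
      (𝓝 ((colEnergy S lam d + colEnergy S lam e - energy S lam n) * colFun S lam (sn (sn F e) (.Z n)) x₀)) := by
  refine (tendsto_error (continuous_colFun S lam (sn F e)) (continuous_colFun S lam (sn F d))
    (continuous_colFun S lam (sn (sn F e) (.Z n))) (continuous_colFun S lam (sn (sn F d) (.Z n)))
    (k := energy S lam n - colEnergy S lam e) h1 h2 h3 rfl).congr' ?_
  filter_upwards [eventually_colHam hS (sn_forall hF hd) h0 h0' x₀] with x hx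
  obtain ⟨b, rfl, h, h1, h2, hH⟩ := hx
  rw [hH, deformedOp_replace hS h F d e n hF hd hde h1 h2, midSite_zero_add S b (m + 2), ← midSite_succ]
  ring

theorem tendsto_colHam_remove {S : System} (hS : S.Valid) {lam : Fin 4 → ℂ} {m : ℕ} {F : Fin m → Col} {d d' : ℕ}
    (hF : ∀ k, (F k).IsVirtual)
    (h0 : colPoly S lam (sn (sn F (.X d)) (.Y d')) ≠ 0)
    (h0' : colPoly S (lam + delta) (sn (sn F (.X d)) (.Y d')) ≠ 0) (n : ℕ) {x₀ : ℂ}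
    (h1 : colFun S lam (sn (sn F (.X d)) (.Y d')) (x₀ + I * gam S / 2) ≠ 0)
    (h2 : colFun S lam (sn (sn F (.X d)) (.Y d')) (x₀ - I * gam S / 2) ≠ 0)
    (h3 : colFun S lam (sn (sn (sn F (.X d)) (.Y d')) (.Z n)) x₀ = 0) :
    Tendsto (colHam S lam (sn (sn F (.X d)) (.Y d')) (colFun S lam (sn F (.Z n)))) (𝓝[≠] x₀)
      (𝓝 ((virtualEnergy S .I lam d + virtualEnergy S .II lam d' - energy S lam n)
        * colFun S lam (sn F (.Z n)) x₀)) := by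
  refine (tendsto_error (continuous_colFun S lam F) (continuous_colFun S lam (sn (sn F (.X d)) (.Y d')))
    (continuous_colFun S lam (sn F (.Z n))) (continuous_colFun S lam (sn (sn (sn F (.X d)) (.Y d')) (.Z n)))
    (k := errorConst S (usesCard .I F) (usesCard .II F)) h1 h2 h3 rfl).congr' ?_
  filter_upwards [eventually_colHam hS (sn_forall (sn_forall hF (show (Col.X d).IsVirtual from trivial))
    (show (Col.Y d').IsVirtual from trivial)) h0 h0' x₀] with x hx
  obtain ⟨b, rfl, h, h1, h2, hH⟩ := hx
  rw [hH, deformedOp_remove hS h F d d' n hF h1 h2, midSite_zero_add S b (m + 3), ← midSite_succ]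
  ring

/-! ### The case without virtual states -/

theorem usesCard_elim0 (T : VType) (c : Fin 0 → Col) : usesCard T c = 0 := by
  simp [usesCard]

theorem colPoly_elim0 {S : System} (hS : S.Valid) (lam : Fin 4 → ℂ) (c : Fin 0 → Col) : colPoly S lam c = 1 :=
  IsColPoly.unique hS (colPoly_spec S hS lam c) fun x => by
    simp [usesCard_elim0, detDen]

theorem facProd_zero (S : System) (T : VType) (lam : Fin 4 → ℂ) (n : ℕ) (x : ℂ) : facProd S T lam n 0 0 x = 1 := by
  cases S <;> simp [facProd, fac, poch, qpoch]

theorem rowFac_one (S : System) (T : VType) (lam : Fin 4 → ℂ) (x : ℂ) : rowFac S T lam 1 x 0 = 1 := by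
  rw [rowFac]
  simp only [Fin.val_zero, Nat.sub_self, facProd_zero, mul_one]
  cases S <;> simp [phase]

theorem colPoly_sn_elim0 {S : System} (hS : S.Valid) (lam : Fin 4 → ℂ) (c : Fin 0 → Col) (n : ℕ) :
    colPoly S lam (sn c (.Z n)) = basePoly S lam n :=
  IsColPoly.unique hS (colPoly_spec S hS lam _) fun x => by
    have h : sn c (.Z n) = fun _ => Col.Z n := by
      funext k
      refine Fin.lastCases ?_ (fun i => i.elim0) k
      exact Fin.snoc_last (α := fun _ => Col) _ _
    have hnode : node S 1 x 0 = x := by simp [node]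
    rw [usesCard_sn, usesCard_sn, usesCard_elim0, usesCard_elim0, h]
    simp [detDen, colMat, Col.uses, Col.poly, facProd_zero, rowFac_one, hnode]

/-- The Darboux argument needs at least one virtual state. Without any, the denominators are 1 and
the claim is the original difference equation. -/
theorem tendsto_colHam_eigen {S : System} (hS : S.Valid) {lam : Fin 4 → ℂ} {n : ℕ} {c : Fin n → Col}
    (hc : ∀ k, (c k).IsVirtual) (h0 : colPoly S lam c ≠ 0) (h0' : colPoly S (lam + delta) c ≠ 0) (v : ℕ) (x₀ : ℂ) :
    Tendsto (colHam S lam c (colFun S lam (sn c (.Z v)))) (𝓝[≠] x₀)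
      (𝓝 (energy S lam v * colFun S lam (sn c (.Z v)) x₀)) := by
  cases n with
  | succ m => exact tendsto_colHam_eigen_succ hS hc h0 h0' v x₀
  | zero =>
    have hcont : Continuous fun x => energy S lam v * colFun S lam (sn c (.Z v)) x :=
      continuous_const.mul (continuous_colFun S lam _)
    refine ((hcont.tendsto x₀).mono_left nhdsWithin_le_nhds).congr' ?_
    have p1 := zerosIsolated_potDen S hS 0 x₀
    have p2 := (zerosIsolated_potDen S hS 0).comp_neg x₀
    filter_upwards [p1, p2] with x p1 p2
    rw [add_zero] at p1 p2
    have hl : lamD S lam 0 0 = lam := by simp [lamD]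
    simp only [colHam, usesCard_elim0, hl, colFun, colPoly_elim0 hS, Polynomial.eval_one, colPoly_sn_elim0 hS]
    rw [← basePoly_diffEq S hS lam v x p1 p2]
    ring

end MultiIndexed

namespace MultiIndexed

/-! ### The deformed Hamiltonian of the multi-indexed polynomials -/

/-- The denominators enter only through ratios at equal parameters, so a common factor `ε`
disappears. -/
theorem colHam_congr {S : System} {lam : Fin 4 → ℂ} {n n' : ℕ} {c : Fin n → Col} {c' : Fin n' → Col} {ε : ℂ}
    (hε : ε ≠ 0) (hu : ∀ T, usesCard T c' = usesCard T c)
    (h : ∀ μ, colPoly S μ c' = Polynomial.C ε * colPoly S μ c) (f : ℂ → ℂ) : colHam S lam c' f = colHam S lam c f := by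
  have hf : ∀ μ x, colFun S μ c' x = ε * colFun S μ c x := fun μ x => by
    rw [colFun, h, Polynomial.eval_mul, Polynomial.eval_C, colFun]
  funext x
  simp only [colHam, hu, hf, mul_div_mul_left _ _ hε]

theorem colHam_const_mul (S : System) (lam : Fin 4 → ℂ) {n : ℕ} (c : Fin n → Col) (ε : ℂ) (f : ℂ → ℂ) (x : ℂ) :
    colHam S lam c (fun y => ε * f y) x = ε * colHam S lam c f x := by
  simp only [colHam]
  ring

theorem hamD_eq_colHam (S : System) (lam : Fin 4 → ℂ) (D₁ D₂ : Finset ℕ) (f : ℂ → ℂ) :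
    hamD S lam D₁ D₂ f = colHam S lam (xiCols D₁ D₂) f := by
  funext x
  simp only [hamD, colHam, XiCheck, colFun, Xi_eq_colPoly, (usesCard_xiCols D₁ D₂).1, (usesCard_xiCols D₁ D₂).2]

theorem MICheck_eq_colFun (S : System) (lam : Fin 4 → ℂ) (D₁ D₂ : Finset ℕ) (m : ℕ) :
    MICheck S lam D₁ D₂ m = colFun S lam (sn (xiCols D₁ D₂) (.Z m)) := by
  funext x
  rw [MICheck, MIPoly_eq_colPoly, colFun]

theorem xiCols_isVirtual (D₁ D₂ : Finset ℕ) (k) : (xiCols D₁ D₂ k).IsVirtual := by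
  refine Fin.addCases (fun a => ?_) (fun b => ?_) k <;> simp [xiCols, Col.IsVirtual]

theorem continuousAt_pot {S : System} {lam : Fin 4 → ℂ} {x : ℂ} (h : potDen S x ≠ 0) :
    ContinuousAt (pot S lam) x := by
  have h1 : Continuous (potNum S lam) := by
    cases S <;> (unfold potNum; fun_prop)
  have h2 : Continuous (potDen S) := by
    cases S <;> (unfold potDen; fun_prop)
  exact h1.continuousAt.div h2.continuousAt h

theorem continuousAt_potStar {S : System} {lam : Fin 4 → ℂ} {x : ℂ} (h : potDen S (-x) ≠ 0) :
    ContinuousAt (potStar S lam) x := by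
  have hn : ContinuousAt (fun x => pot S lam (-x)) x :=
    ContinuousAt.comp (g := pot S lam) (continuousAt_pot h) continuous_neg.continuousAt
  cases S with
  | cH => exact Continuous.continuousAt (by unfold potStar; fun_prop)
  | W => exact hn
  | AW q => exact hn

/-- At a regular point all coefficients are continuous, so the limit over the punctured
neighbourhood is the plain value. -/
theorem hamValueAt_of_tendsto {S : System} {lam : Fin 4 → ℂ} {D₁ D₂ : Finset ℕ} {f : ℂ → ℂ} (hf : Continuous f) {x₀ v : ℂ}
    (h : Tendsto (hamD S lam D₁ D₂ f) (𝓝[≠] x₀) (𝓝 v)) : HamValueAt S lam D₁ D₂ f x₀ v := by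
  refine ⟨h, fun hr => ?_⟩
  obtain ⟨p1, p2, ⟨n1, n2⟩, n3⟩ := hr
  have hc : ContinuousAt (hamD S lam D₁ D₂ f) x₀ := by
    have ξc : ∀ μ, Continuous (XiCheck S μ D₁ D₂) := fun μ =>
      (Xi S μ D₁ D₂).continuous.comp (differentiable_eta S).continuous
    have s : ∀ μ a, ContinuousAt (fun x => XiCheck S μ D₁ D₂ (x + a)) x₀ := fun μ a =>
      ((ξc μ).comp (continuous_add_const a)).continuousAt
    have s' : ∀ μ a, ContinuousAt (fun x => XiCheck S μ D₁ D₂ (x - a)) x₀ := fun μ a =>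
      ((ξc μ).comp (continuous_sub_right a)).continuousAt
    have g : ∀ a, ContinuousAt (fun x => f (x + a)) x₀ := fun a => (hf.comp (continuous_add_const a)).continuousAt
    have g' : ∀ a, ContinuousAt (fun x => f (x - a)) x₀ := fun a => (hf.comp (continuous_sub_right a)).continuousAt
    exact (((continuousAt_pot p1).mul ((s _ _).div (s' _ _) n1)).mul
        ((g' _).sub (((s' _ _).div (ξc _).continuousAt n3).mul hf.continuousAt))).add
      (((continuousAt_potStar p2).mul ((s' _ _).div (s _ _) n2)).mul
        ((g _).sub (((s _ _).div (ξc _).continuousAt n3).mul hf.continuousAt)))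
  exact tendsto_nhds_unique (hc.tendsto.mono_left nhdsWithin_le_nhds) h

theorem sn_injective {α : Type*} {n : ℕ} {c : Fin n → α} (hc : Function.Injective c) {u : α} (hu : u ∉ Set.range c) :
    Function.Injective (sn c u) :=
  Fin.snoc_injective_iff.mpr ⟨hc, hu⟩

theorem range_sn {α : Type*} {n : ℕ} (c : Fin n → α) (u : α) : Set.range (sn c u) = insert u (Set.range c) :=
  Fin.range_snoc c u

theorem X_mem_colSet {D₁ D₂ : Finset ℕ} {v : ℕ} : Col.X v ∈ colSet D₁ D₂ ↔ v ∈ D₁ := by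
  simp [colSet]

theorem Y_mem_colSet {D₁ D₂ : Finset ℕ} {v : ℕ} : Col.Y v ∈ colSet D₁ D₂ ↔ v ∈ D₂ := by
  simp [colSet]

theorem Z_notMem_colSet {D₁ D₂ : Finset ℕ} {v : ℕ} : Col.Z v ∉ colSet D₁ D₂ := by
  simp [colSet]

theorem insert_X_colSet (D₁ D₂ : Finset ℕ) (v : ℕ) : insert (Col.X v) (colSet D₁ D₂) = colSet (insert v D₁) D₂ := by
  simp [colSet, Set.image_insert_eq, Set.insert_union]

theorem insert_Y_colSet (D₁ D₂ : Finset ℕ) (v : ℕ) : insert (Col.Y v) (colSet D₁ D₂) = colSet D₁ (insert v D₂) := by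
  simp [colSet, Set.image_insert_eq, Set.union_insert]

/-- Transfer of a limit of the deformed Hamiltonian to columns in the standard order. -/
theorem hamValueAt_of_colHam {S : System} (hS : S.Valid) {lam : Fin 4 → ℂ} {D₁ D₂ D₁' D₂' : Finset ℕ} {n n' m : ℕ}
    {c : Fin n → Col} {c' : Fin n' → Col} (hc : Function.Injective c) (hc' : Function.Injective c')
    (hr : Set.range c = colSet D₁ D₂) (hr' : Set.range c' = colSet D₁' D₂') {x₀ v : ℂ}
    (h : Tendsto (colHam S lam c (colFun S lam (sn c' (.Z m)))) (𝓝[≠] x₀) (𝓝 (v * colFun S lam (sn c' (.Z m)) x₀))) :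
    HamValueAt S lam D₁ D₂ (MICheck S lam D₁' D₂' m) x₀ (v * (MIPoly S lam D₁' D₂' m).eval (eta S x₀)) := by
  obtain ⟨ε, hε, hu, he⟩ := exists_sign_colPoly_eq hS hc (xiCols_injective D₁ D₂)
    (hr.trans (range_xiCols D₁ D₂).symm)
  obtain ⟨ε', -, -, he'⟩ := exists_sign_colPoly_eq hS (sn_injective hc' (u := .Z m) (by rw [hr']; exact Z_notMem_colSet))
    (sn_injective (xiCols_injective D₁' D₂') (u := .Z m) (by rw [range_xiCols]; exact Z_notMem_colSet))
    (by rw [range_sn, range_sn, hr', range_xiCols])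
  have hf : MICheck S lam D₁' D₂' m = fun x => ε' * colFun S lam (sn c' (.Z m)) x := by
    rw [MICheck_eq_colFun]
    funext x
    rw [colFun, he', Polynomial.eval_mul, Polynomial.eval_C, colFun]
  refine hamValueAt_of_tendsto ?_ ?_
  · rw [MICheck_eq_colFun]
    exact continuous_colFun S lam _
  · rw [hamD_eq_colHam, colHam_congr hε hu he, hf, MIPoly_eq_colPoly, he', Polynomial.eval_mul, Polynomial.eval_C,
      ← colFun, mul_left_comm]
    exact (h.const_mul ε').congr fun x => (colHam_const_mul S lam c ε' _ x).symm

/-- Transfer of the hypotheses from columns in the standard order. -/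
theorem colPoly_transfer {S : System} (hS : S.Valid) {lam : Fin 4 → ℂ} {D₁ D₂ : Finset ℕ} {n : ℕ} {c : Fin n → Col}
    (hc : Function.Injective c) (hr : Set.range c = colSet D₁ D₂) :
    (Xi S lam D₁ D₂ ≠ 0 → colPoly S lam c ≠ 0) ∧ (∀ x, XiCheck S lam D₁ D₂ x ≠ 0 → colFun S lam c x ≠ 0) ∧
      ∀ m x, (MIPoly S lam D₁ D₂ m).eval (eta S x) = 0 → colFun S lam (sn c (.Z m)) x = 0 := by
  obtain ⟨ε, hε, -, he⟩ := exists_sign_colPoly_eq hS hc (xiCols_injective D₁ D₂)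
    (hr.trans (range_xiCols D₁ D₂).symm)
  refine ⟨fun h h0 => h ?_, fun x h h0 => h ?_, fun m x h => ?_⟩
  · rw [Xi_eq_colPoly, he, h0, mul_zero]
  · rw [XiCheck, Xi_eq_colPoly, he, Polynomial.eval_mul, Polynomial.eval_C, ← colFun, h0, mul_zero]
  · obtain ⟨ε', hε', -, he'⟩ := exists_sign_colPoly_eq hS (sn_injective hc (u := .Z m) (by rw [hr]; exact Z_notMem_colSet))
      (sn_injective (xiCols_injective D₁ D₂) (u := .Z m) (by rw [range_xiCols]; exact Z_notMem_colSet))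
      (by rw [range_sn, range_sn, hr, range_xiCols])
    rw [MIPoly_eq_colPoly, he', Polynomial.eval_mul, Polynomial.eval_C] at h
    exact (mul_eq_zero.mp h).resolve_left hε'

section values

variable {S : System} {lam : Fin 4 → ℂ} {D₁ D₂ : Finset ℕ}

theorem hamValueAt_eigen (hS : S.Valid) (h0 : Xi S lam D₁ D₂ ≠ 0) (h0' : Xi S (lam + delta) D₁ D₂ ≠ 0) (n : ℕ) (x₀ : ℂ) :
    HamValueAt S lam D₁ D₂ (MICheck S lam D₁ D₂ n) x₀ (energy S lam n * (MIPoly S lam D₁ D₂ n).eval (eta S x₀)) := by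
  rw [Xi_eq_colPoly] at h0 h0'
  exact hamValueAt_of_colHam hS (xiCols_injective D₁ D₂) (xiCols_injective D₁ D₂) (range_xiCols D₁ D₂)
    (range_xiCols D₁ D₂) (tendsto_colHam_eigen hS (xiCols_isVirtual D₁ D₂) h0 h0' n x₀)

/-- `E₁, E₂` index the columns common to both families. The exchanged column is put last, as the
Darboux identity requires, and the standard order is restored at the cost of a sign. -/
theorem hamValueAt_replace (hS : S.Valid) (h0 : Xi S lam D₁ D₂ ≠ 0) (h0' : Xi S (lam + delta) D₁ D₂ ≠ 0) {n : ℕ} {x₀ : ℂ}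
    (hz : (MIPoly S lam D₁ D₂ n).eval (eta S x₀) = 0) (hx : NoCommonZero S lam D₁ D₂ x₀) {E₁ E₂ D₁' D₂' : Finset ℕ}
    {d e : Col} (hd : d.IsVirtual) (hde : ∀ T, d.uses T = e.uses T) (hdE : d ∉ colSet E₁ E₂) (heE : e ∉ colSet E₁ E₂)
    (hD : insert d (colSet E₁ E₂) = colSet D₁ D₂) (hD' : insert e (colSet E₁ E₂) = colSet D₁' D₂') :
    HamValueAt S lam D₁ D₂ (MICheck S lam D₁' D₂' n) x₀ ((colEnergy S lam d + colEnergy S lam e - energy S lam n)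
      * (MIPoly S lam D₁' D₂' n).eval (eta S x₀)) := by
  rw [← range_xiCols E₁ E₂] at hdE heE
  have i1 := sn_injective (xiCols_injective E₁ E₂) hdE
  have i2 := sn_injective (xiCols_injective E₁ E₂) heE
  have r1 : Set.range (sn (xiCols E₁ E₂) d) = colSet D₁ D₂ := by rw [range_sn, range_xiCols, hD]
  have r2 : Set.range (sn (xiCols E₁ E₂) e) = colSet D₁' D₂' := by rw [range_sn, range_xiCols, hD']
  have t := colPoly_transfer hS (lam := lam) i1 r1
  exact hamValueAt_of_colHam hS i1 i2 r1 r2 (tendsto_colHam_replace hS (xiCols_isVirtual E₁ E₂) hd hde (t.1 h0)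
    ((colPoly_transfer hS i1 r1).1 h0') n (t.2.1 _ hx.2) (t.2.1 _ hx.1) (t.2.2 _ _ hz))

theorem hamValueAt_remove (hS : S.Valid) (h0 : Xi S lam D₁ D₂ ≠ 0) (h0' : Xi S (lam + delta) D₁ D₂ ≠ 0) {n : ℕ} {x₀ : ℂ}
    (hz : (MIPoly S lam D₁ D₂ n).eval (eta S x₀) = 0) (hx : NoCommonZero S lam D₁ D₂ x₀) {d d' : ℕ} (hd : d ∈ D₁)
    (hd' : d' ∈ D₂) : HamValueAt S lam D₁ D₂ (MICheck S lam (D₁.erase d) (D₂.erase d') n) x₀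
      ((virtualEnergy S .I lam d + virtualEnergy S .II lam d' - energy S lam n)
        * (MIPoly S lam (D₁.erase d) (D₂.erase d') n).eval (eta S x₀)) := by
  have i0 := xiCols_injective (D₁.erase d) (D₂.erase d')
  have r0 := range_xiCols (D₁.erase d) (D₂.erase d')
  have i1 := sn_injective i0 (u := .X d) (by rw [r0, X_mem_colSet]; simp)
  have r1 : Set.range (sn (xiCols (D₁.erase d) (D₂.erase d')) (.X d)) = colSet D₁ (D₂.erase d') := by
    rw [range_sn, r0, insert_X_colSet, Finset.insert_erase hd]
  have i2 := sn_injective i1 (u := .Y d') (by rw [r1, Y_mem_colSet]; simp)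
  have r2 : Set.range (sn (sn (xiCols (D₁.erase d) (D₂.erase d')) (.X d)) (.Y d')) = colSet D₁ D₂ := by
    rw [range_sn, r1, insert_Y_colSet, Finset.insert_erase hd']
  have t := colPoly_transfer hS (lam := lam) i2 r2
  exact hamValueAt_of_colHam hS i2 i0 r2 r0 (tendsto_colHam_remove hS (xiCols_isVirtual _ _) (t.1 h0)
    ((colPoly_transfer hS i2 r2).1 h0') n (t.2.1 _ hx.2) (t.2.1 _ hx.1) (t.2.2 _ _ hz))

end values

end MultiIndexed
open MultiIndexed in
theorem mainTheorem4 (S : System) (hS : S.Valid) :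
    (∀ (lam : Fin 4 → ℂ) (D₁ D₂ : Finset ℕ),
      (∃! p : Polynomial ℂ, IsDenominatorPoly S lam D₁ D₂ p) ∧
      ∀ m : ℕ, ∃! p : Polynomial ℂ, IsMultiIndexedPoly S lam D₁ D₂ m p) ∧
    ∀ (lam : Fin 4 → ℂ) (D₁ D₂ : Finset ℕ) (N : ℕ),
      Xi S lam D₁ D₂ ≠ 0 → Xi S (lam + delta) D₁ D₂ ≠ 0 →
      ∀ x₀ : ℂ, (MIPoly S lam D₁ D₂ N).eval (eta S x₀) = 0 →
        (∀ n < N, HamValueAt S lam D₁ D₂ (MICheck S lam D₁ D₂ n) x₀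
          (energy S lam n * (MIPoly S lam D₁ D₂ n).eval (eta S x₀))) ∧
        (NoCommonZero S lam D₁ D₂ x₀ →
          (∀ d ∈ D₁, ∀ e, e ∉ D₁ → e < d →
            HamValueAt S lam D₁ D₂ (MICheck S lam (insert e (D₁.erase d)) D₂ N) x₀
              ((virtualEnergy S .I lam d + virtualEnergy S .I lam e - energy S lam N)
                * (MIPoly S lam (insert e (D₁.erase d)) D₂ N).eval (eta S x₀))) ∧
          (∀ d ∈ D₂, ∀ e, e ∉ D₂ → e < d →
            HamValueAt S lam D₁ D₂ (MICheck S lam D₁ (insert e (D₂.erase d)) N) x₀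
              ((virtualEnergy S .II lam d + virtualEnergy S .II lam e - energy S lam N)
                * (MIPoly S lam D₁ (insert e (D₂.erase d)) N).eval (eta S x₀))) ∧
          (∀ d ∈ D₁, ∀ d' ∈ D₂,
            HamValueAt S lam D₁ D₂ (MICheck S lam (D₁.erase d) (D₂.erase d') N) x₀
              ((virtualEnergy S .I lam d + virtualEnergy S .II lam d' - energy S lam N)
                * (MIPoly S lam (D₁.erase d) (D₂.erase d') N).eval (eta S x₀)))) := by
  refine ⟨existsUnique_polys S hS, fun lam D₁ D₂ N h0 h0' x₀ hz => ⟨fun n _ => hamValueAt_eigen hS h0 h0' n x₀,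
    fun hx => ⟨fun d hd e he _ => ?_, fun d hd e he _ => ?_, fun d hd d' hd' =>
      hamValueAt_remove hS h0 h0' hz hx hd hd'⟩⟩⟩
  -- The common columns are those of `D₁.erase d` and `D₂`.
  · exact hamValueAt_replace hS h0 h0' hz hx (d := .X d) (e := .X e) trivial (fun T => by cases T <;> rfl)
      (by simp [X_mem_colSet]) (by simp [X_mem_colSet, he])
      (by rw [insert_X_colSet, Finset.insert_erase hd]) (insert_X_colSet _ _ _)
  · exact hamValueAt_replace hS h0 h0' hz hx (d := .Y d) (e := .Y e) trivial (fun T => by cases T <;> rfl)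
      (by simp [Y_mem_colSet]) (by simp [Y_mem_colSet, he])
      (by rw [insert_Y_colSet, Finset.insert_erase hd]) (insert_Y_colSet _ _ _)
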